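/- Let $n\ge 3$, $\gamma>0$, and let $\nu\in\mathbb{R}^n$ be a unit vector. Write $e^{\pm\gamma|w|}L^2=L^2(\mathbb{R}^n;e^{\mp2\gamma|w|}dw)$, and let $e^{\gamma|w|}H^2$ be the space of $u\in e^{\gamma|w|}L^2$ whose weak derivatives of order at most $2$ lie in $e^{\gamma|w|}L^2$. Identify $\mathrm{Span}\{\nu\}^\perp$ with $\mathbb{R}^{n-1}$ and its complexification with $\mathbb{C}^{n-1}$; let $a\cdot b=\sum_j a_jb_j$ on $\mathbb{C}^n$, let $\Delta=-\sum_j\partial_j^2$, and for $z\in\mathbb{C}\setminus\mathbb{R}$, $\rho_\perp\in\mathbb{R}^{n-1}\setminus\{0\}$ and $\rho=z\nu+\rho_\perp$ let $G_0(\rho)=\mathcal{F}^{-1}(|\xi|^2+2\rho\cdot\xi)^{-1}\mathcal{F}$. Call $(U,\mathcal{G}_0)$ an analytic extension of $G_0$ if $U$ is an open neighbourhood of $\mathbb{R}^{n-1}\setminus\{0\}$ in $\mathbb{C}^{n-1}$ and $\mathcal{G}_0(z,\rho_\perp):e^{-\gamma|w|}L^2\to e^{\gamma|w|}H^2$, $(z,\rho_\perp)\in(\mathbb{C}\setminus\mathbb{R})\times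 U$, is an analytic family of bounded operators that restricts to $G_0(z\nu+\rho_\perp)$ on $(\mathbb{C}\setminus\mathbb{R})\times(\mathbb{R}^{n-1}\setminus\{0\})$. Analytic extensions exist. Moreover, let $(U,\mathcal{G}_0)$ be any analytic extension, let $\gamma_0>2\gamma$, and let $V\in e^{-\gamma_0|w|}L^\infty(\mathbb{R}^n;\mathbb{C})$. Then there is a set $\mathcal{E}\subset(\mathbb{C}\setminus\mathbb{R})\times U$ such that: 1. $\mathcal{E}$ is the zero set of an analytic function on $(\mathbb{C}\setminus\mathbb{R})\times U$, and $\mathcal{E}\cap\big((\mathbb{C}\setminus\mathbb{R})\times(\mathbb{R}^{n-1}\setminus\{0\})\big)$ is bounded. 2. For $(z,\rho_\perp)\in((\mathbb{C}\setminus\mathbb{R})\times U)\setminus\mathcal{E}$ the operator $\mathrm{Id}+V\mathcal{G}_0(z,\rho_\perp)$ on $e^{-\gamma|w|}L^2$ has a bounded inverse. In a neighbourhood of every point of $(\mathbb{C}\setminus\mathbb{R})\times U$ at which this inverse exists, it exists and is analytic in $(z,\rho_\perp)$ as a bounded operator on $e^{-\gamma|w|}L^2$, and $(\mathrm{Id}+V\mathcal{G}_0)^{-1}-\mathrm{Id}$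 is compact. 3. Let $v_{z,\rho_\perp}=-\mathcal{G}_0(z,\rho_\perp)(\mathrm{Id}+V\mathcal{G}_0(z,\rho_\perp))^{-1}V$. On $((\mathbb{C}\setminus\mathbb{R})\times U)\setminus\mathcal{E}$, the function $v_{z,\rho_\perp}$ is analytic in $(z,\rho_\perp)$ with values in $e^{\gamma|w|}L^2$, and $u_{z,\rho_\perp}=e^{i(z\nu+\rho_\perp)\cdot w}(1+v_{z,\rho_\perp})$ is analytic in $(z,\rho_\perp)$ with values in $L^2(B)$ for every ball $B$ centered at the origin. If moreover $\rho_\perp\in\mathbb{R}^{n-1}\setminus\{0\}$, then $u_{z,\rho_\perp}$ solves $(\Delta+V-\rho\cdot\rho)u=0$ in the sense of distributions, where $\rho=z\nu+\rho_\perp$. -/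

import Mathlib

open MeasureTheory
open scoped ENNReal FourierTransform Laplacian ContDiff Topology

noncomputable section

namespace ExpPotential

/-- Euclidean space `ℝⁿ`. -/
abbrev RSpace (n : ℕ) : Type := EuclideanSpace ℝ (Fin n)

/-- The measure `e^{-2γ|w|} dw` on `ℝⁿ`. -/
def expMeasure (n : ℕ) (γ : ℝ) : Measure (RSpace n) :=
  volume.withDensity (fun w => ENNReal.ofReal (Real.exp (-(2 * γ * ‖w‖))))

/-- The weighted space `e^{γ|w|} L²(ℝⁿ) = L²(ℝⁿ; e^{-2γ|w|} dw)`. The weight `|w|` may be replaced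
by `⟨w⟩ = (1+|w|²)^{1/2}`: since `|w| ≤ ⟨w⟩ ≤ |w| + 1`, the space is the same and the norms are
equivalent. -/
abbrev ExpL2 (n : ℕ) (γ : ℝ) : Type := Lp ℂ 2 (expMeasure n γ)

/-- Test functions: the elements of `C_c^∞(ℝⁿ)`. -/
def IsTest {n : ℕ} (φ : RSpace n → ℂ) : Prop :=
  ContDiff ℝ ∞ φ ∧ HasCompactSupport φ

/-- The iterated partial derivative `∂_{a 0} ⋯ ∂_{a (k-1)} φ`. -/
def partialDeriv {n k : ℕ} (a : Fin k → Fin n) (φ : RSpace n → ℂ) (w : RSpace n) : ℂ :=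
  iteratedFDeriv ℝ k φ w (fun i => EuclideanSpace.single (a i) (1 : ℝ))

/-- `g` is the weak (distributional) derivative `∂_{a 0} ⋯ ∂_{a (k-1)} u`. -/
def IsWeakDeriv {n k : ℕ} (a : Fin k → Fin n) (u g : RSpace n → ℂ) : Prop :=
  ∀ φ : RSpace n → ℂ, IsTest φ →
    ∫ w, u w * partialDeriv a φ w = (-1 : ℂ) ^ k * ∫ w, g w * φ w

/-- Finite sequences of at most `m` coordinate directions, indexing the partial derivatives of
order at most `m`. -/
abbrev DerivIndex (n m : ℕ) : Type := Σ k : Fin (m + 1), (Fin (k : ℕ) → Fin n)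

/-- The index of the derivative of order zero. -/
def DerivIndex.zero (n m : ℕ) : DerivIndex n m :=
  ⟨⟨0, Nat.succ_pos m⟩, fun i => i.elim0⟩

/-! ### Helper facts on the weighted spaces -/

theorem continuous_weight (n : ℕ) (γ : ℝ) :
    Continuous (fun w : RSpace n => (Real.exp (-(γ * ‖w‖)) : ℂ)) := by
  fun_prop

theorem measurable_density (n : ℕ) (γ : ℝ) :
    Measurable (fun w : RSpace n => ENNReal.ofReal (Real.exp (-(2 * γ * ‖w‖)))) := by
  fun_prop

theorem expMeasure_ac (n : ℕ) (γ : ℝ) : expMeasure n γ ≪ volume :=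
  withDensity_absolutelyContinuous _ _

theorem ac_expMeasure (n : ℕ) (γ : ℝ) : (volume : Measure (RSpace n)) ≪ expMeasure n γ := by
  refine withDensity_absolutelyContinuous' (measurable_density n γ).aemeasurable ?_
  refine Filter.Eventually.of_forall fun w => ?_
  simp [Real.exp_pos]

theorem eLpNorm_expMeasure (n : ℕ) (γ : ℝ) (f : RSpace n → ℂ) :
    eLpNorm f 2 (expMeasure n γ)
      = eLpNorm (fun w => (Real.exp (-(γ * ‖w‖)) : ℂ) * f w) 2 volume := by
  rw [eLpNorm_eq_lintegral_rpow_enorm_toReal (by norm_num) (by norm_num),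
    eLpNorm_eq_lintegral_rpow_enorm_toReal (by norm_num) (by norm_num), expMeasure,
    lintegral_withDensity_eq_lintegral_mul_non_measurable _ (measurable_density n γ)
      (Filter.Eventually.of_forall fun w => ENNReal.ofReal_lt_top)]
  congr 2
  funext w
  have h : ‖(Real.exp (-(γ * ‖w‖)) : ℂ)‖ₑ = ENNReal.ofReal (Real.exp (-(γ * ‖w‖))) := by
    rw [← ofReal_norm, Complex.norm_real, Real.norm_of_nonneg (Real.exp_pos _).le]
  simp only [Pi.mul_apply, ENNReal.toReal_ofNat, ENNReal.rpow_ofNat]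
  rw [enorm_mul, h, mul_pow, ← ENNReal.ofReal_pow (Real.exp_pos _).le, ← Real.exp_nat_mul]
  congr 4
  push_cast
  ring

theorem memLp_weight {n : ℕ} {γ : ℝ} {f : RSpace n → ℂ} (hf : MemLp f 2 (expMeasure n γ)) :
    MemLp (fun w => (Real.exp (-(γ * ‖w‖)) : ℂ) * f w) 2 volume := by
  refine ⟨?_, ?_⟩
  · exact (continuous_weight n γ).aestronglyMeasurable.mul
      (hf.1.mono_ac (ac_expMeasure n γ))
  · rw [← eLpNorm_expMeasure]
    exact hf.2

theorem memLp_of_weight {n : ℕ} {γ : ℝ} {f : RSpace n → ℂ} (hm : AEStronglyMeasurable f volume)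
    (hf : MemLp (fun w => (Real.exp (-(γ * ‖w‖)) : ℂ) * f w) 2 volume) :
    MemLp f 2 (expMeasure n γ) := by
  refine ⟨hm.mono_ac (expMeasure_ac n γ), ?_⟩
  rw [eLpNorm_expMeasure]
  exact hf.2

theorem locallyIntegrable_coe {n : ℕ} {γ : ℝ} (u : ExpL2 n γ) :
    LocallyIntegrable (fun w => u w) (volume : Measure (RSpace n)) := by
  have h := (memLp_weight (Lp.memLp u)).locallyIntegrable (by norm_num)
  have h2 := (locallyIntegrableOn_univ.2 h).continuousOn_mul
    (continuous_weight n (-γ)).continuousOn isOpen_univ.isLocallyClosed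
  rw [locallyIntegrableOn_univ] at h2
  refine h2.congr (Filter.Eventually.of_forall fun w => ?_)
  simp only
  rw [← mul_assoc, ← Complex.ofReal_mul, ← Real.exp_add]
  simp

theorem integrable_coe_mul {n : ℕ} {γ : ℝ} (u : ExpL2 n γ) {ψ : RSpace n → ℂ}
    (hc : Continuous ψ) (hs : HasCompactSupport ψ) :
    Integrable (fun w => u w * ψ w) volume := by
  have := (locallyIntegrable_coe u).integrable_smul_left_of_hasCompactSupport hc hs
  refine this.congr (Filter.Eventually.of_forall fun w => ?_)
  simp [mul_comm]

theorem IsTest.partialDeriv_continuous {n k : ℕ} {φ : RSpace n → ℂ} (hφ : IsTest φ)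
    (a : Fin k → Fin n) : Continuous (partialDeriv a φ) := by
  have : Continuous (iteratedFDeriv ℝ k φ) := hφ.1.continuous_iteratedFDeriv (by exact_mod_cast le_top)
  exact (ContinuousMultilinearMap.apply ℝ (fun _ : Fin k => RSpace n) ℂ
    (fun i => EuclideanSpace.single (a i) (1 : ℝ))).continuous.comp this

theorem IsTest.partialDeriv_compact {n k : ℕ} {φ : RSpace n → ℂ} (hφ : IsTest φ)
    (a : Fin k → Fin n) : HasCompactSupport (partialDeriv a φ) :=
  (hφ.2.iteratedFDeriv (𝕜 := ℝ) k).comp_left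
    (g := fun T : ContinuousMultilinearMap ℝ (fun _ : Fin k => RSpace n) ℂ =>
      T (fun i => EuclideanSpace.single (a i) (1 : ℝ))) rfl

/-- The weighted Sobolev space `e^{γ|w|} H^m(ℝⁿ)` of all `u ∈ e^{γ|w|}L²` whose weak derivatives of
order at most `m` lie in `e^{γ|w|}L²`. An element is represented by the family `(∂^a u)_{|a| ≤ m}`,
and the norm is the maximum of the norms of the `∂^a u` in `e^{γ|w|}L²`. -/
def ExpSobolev (n : ℕ) (γ : ℝ) (m : ℕ) : Submodule ℂ (DerivIndex n m → ExpL2 n γ) where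
  carrier := {u | ∀ a : DerivIndex n m,
    IsWeakDeriv a.2 (fun w => u (DerivIndex.zero n m) w) (fun w => u a w)}
  zero_mem' := by
    intro a φ hφ
    have h0 : ((0 : ExpL2 n γ) : RSpace n → ℂ) =ᵐ[volume] 0 :=
      (ac_expMeasure n γ).ae_le (Lp.coeFn_zero ℂ 2 (expMeasure n γ))
    have h1 : ∀ ψ : RSpace n → ℂ, ∫ w, (0 : ExpL2 n γ) w * ψ w = 0 := by
      intro ψ
      rw [integral_eq_zero_of_ae]
      filter_upwards [h0] with w hw
      rw [hw, Pi.zero_apply, zero_mul]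
    simp only [Pi.zero_apply]
    rw [h1, h1, mul_zero]
  add_mem' := by
    intro u v hu hv a φ hφ
    have hadd : ∀ (f g : ExpL2 n γ) (ψ : RSpace n → ℂ), Continuous ψ → HasCompactSupport ψ →
        ∫ w, (f + g : ExpL2 n γ) w * ψ w = (∫ w, f w * ψ w) + ∫ w, g w * ψ w := by
      intro f g ψ hc hs
      rw [← integral_add (integrable_coe_mul f hc hs) (integrable_coe_mul g hc hs)]
      refine integral_congr_ae ?_
      filter_upwards [(ac_expMeasure n γ).ae_le (Lp.coeFn_add f g)] with w hw
      rw [hw, Pi.add_apply, add_mul]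
    simp only [Pi.add_apply]
    rw [hadd _ _ _ (hφ.partialDeriv_continuous a.2) (hφ.partialDeriv_compact a.2),
      hadd _ _ _ hφ.1.continuous hφ.2, mul_add]
    exact congrArg₂ (· + ·) (hu a φ hφ) (hv a φ hφ)
  smul_mem' := by
    intro c u hu a φ hφ
    have hsmul : ∀ (f : ExpL2 n γ) (ψ : RSpace n → ℂ),
        ∫ w, (c • f : ExpL2 n γ) w * ψ w = c * ∫ w, f w * ψ w := by
      intro f ψ
      rw [← integral_const_mul]
      refine integral_congr_ae ?_
      filter_upwards [(ac_expMeasure n γ).ae_le (Lp.coeFn_smul c f)] with w hw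
      rw [hw, Pi.smul_apply, smul_eq_mul, mul_assoc]
    simp only [Pi.smul_apply]
    rw [hsmul, hsmul, mul_left_comm]
    exact congrArg (c * ·) (hu a φ hφ)

/-- The inclusion `e^{γ|w|} H^m → e^{γ|w|} L²`. -/
def ExpSobolev.incl (n : ℕ) (γ : ℝ) (m : ℕ) : ExpSobolev n γ m →L[ℂ] ExpL2 n γ :=
  (ContinuousLinearMap.proj (R := ℂ) (φ := fun _ : DerivIndex n m => ExpL2 n γ)
    (DerivIndex.zero n m)).comp (ExpSobolev n γ m).subtypeL

/-! ### Exponentially decaying potentials -/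

/-- `V ∈ e^{-γ₀|w|} L^∞(ℝⁿ)`. -/
def IsExpDecaying {n : ℕ} (γ₀ : ℝ) (V : RSpace n → ℂ) : Prop :=
  MemLp (fun w => (Real.exp (γ₀ * ‖w‖) : ℂ) * V w) ∞ volume

theorem IsExpDecaying.aestronglyMeasurable {n : ℕ} {γ₀ : ℝ} {V : RSpace n → ℂ}
    (hV : IsExpDecaying γ₀ V) : AEStronglyMeasurable V volume := by
  have h := (continuous_weight n γ₀).aestronglyMeasurable (μ := volume) |>.mul hV.1
  refine h.congr (Filter.Eventually.of_forall fun w => ?_)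
  simp only [Pi.mul_apply]
  rw [← mul_assoc, ← Complex.ofReal_mul, ← Real.exp_add]
  simp

/-- The norm of `V` in `e^{-γ₀|w|} L^∞`. -/
def expDecayNorm {n : ℕ} (γ₀ : ℝ) (V : RSpace n → ℂ) : ℝ :=
  (eLpNorm (fun w => (Real.exp (γ₀ * ‖w‖) : ℂ) * V w) ∞ volume).toReal

theorem eLpNorm_mul_le {n : ℕ} {γ γ₀ : ℝ} {V : RSpace n → ℂ} (hV : IsExpDecaying γ₀ V)
    (hγ : 2 * γ ≤ γ₀) (f : RSpace n → ℂ) :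
    eLpNorm (fun w => V w * f w) 2 (expMeasure n (-γ))
      ≤ ENNReal.ofReal (expDecayNorm γ₀ V) * eLpNorm f 2 (expMeasure n γ) := by
  rw [eLpNorm_expMeasure, eLpNorm_expMeasure]
  refine eLpNorm_le_mul_eLpNorm_of_ae_le_mul ?_ 2
  filter_upwards [ae_le_eLpNormEssSup (f := fun w => (Real.exp (γ₀ * ‖w‖) : ℂ) * V w)
    (μ := volume)] with w hw
  have hC : Real.exp (γ₀ * ‖w‖) * ‖V w‖ ≤ expDecayNorm γ₀ V := by
    have h1 : ‖(Real.exp (γ₀ * ‖w‖) : ℂ) * V w‖ₑ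
        ≤ eLpNorm (fun w => (Real.exp (γ₀ * ‖w‖) : ℂ) * V w) ∞ volume := by
      rw [eLpNorm_exponent_top]
      exact hw
    have h2 := ENNReal.toReal_mono hV.2.ne h1
    rw [toReal_enorm, norm_mul, Complex.norm_real, Real.norm_of_nonneg (Real.exp_pos _).le] at h2
    exact h2
  rw [norm_mul, norm_mul, norm_mul, Complex.norm_real, Complex.norm_real,
    Real.norm_of_nonneg (Real.exp_pos _).le, Real.norm_of_nonneg (Real.exp_pos _).le]
  have h3 : Real.exp (-(-γ * ‖w‖)) ≤ Real.exp (γ₀ * ‖w‖) * Real.exp (-(γ * ‖w‖)) := by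
    rw [← Real.exp_add]
    refine Real.exp_le_exp.2 ?_
    nlinarith [norm_nonneg w]
  calc Real.exp (-(-γ * ‖w‖)) * (‖V w‖ * ‖f w‖)
      ≤ (Real.exp (γ₀ * ‖w‖) * Real.exp (-(γ * ‖w‖))) * (‖V w‖ * ‖f w‖) := by gcongr
    _ = (Real.exp (γ₀ * ‖w‖) * ‖V w‖) * (Real.exp (-(γ * ‖w‖)) * ‖f w‖) := by ring
    _ ≤ expDecayNorm γ₀ V * (Real.exp (-(γ * ‖w‖)) * ‖f w‖) := by gcongr

theorem IsExpDecaying.memLp_mul {n : ℕ} {γ γ₀ : ℝ} {V : RSpace n → ℂ} (hV : IsExpDecaying γ₀ V)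
    (hγ : 2 * γ ≤ γ₀) {f : RSpace n → ℂ} (hf : MemLp f 2 (expMeasure n γ)) :
    MemLp (fun w => V w * f w) 2 (expMeasure n (-γ)) := by
  refine ⟨?_, (eLpNorm_mul_le hV hγ f).trans_lt (ENNReal.mul_lt_top ENNReal.ofReal_lt_top hf.2)⟩
  exact (hV.aestronglyMeasurable.mul (hf.1.mono_ac (ac_expMeasure n γ))).mono_ac
    (expMeasure_ac n (-γ))

/-- Multiplication by `V ∈ e^{-γ₀|w|} L^∞` as a bounded operator `e^{γ|w|}L² → e^{-γ|w|}L²`,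
where `2γ ≤ γ₀`. -/
def mulOp {n : ℕ} {γ γ₀ : ℝ} {V : RSpace n → ℂ} (hV : IsExpDecaying γ₀ V) (hγ : 2 * γ ≤ γ₀) :
    ExpL2 n γ →L[ℂ] ExpL2 n (-γ) :=
  LinearMap.mkContinuous
    { toFun := fun u => (hV.memLp_mul hγ (Lp.memLp u)).toLp (fun w => V w * u w)
      map_add' := by
        intro u v
        rw [← MemLp.toLp_add, MemLp.toLp_eq_toLp_iff]
        filter_upwards [((expMeasure_ac n (-γ)).trans (ac_expMeasure n γ)).ae_le
          (Lp.coeFn_add u v)] with w hw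
        rw [hw, Pi.add_apply, Pi.add_apply, mul_add]
      map_smul' := by
        intro c u
        rw [RingHom.id_apply, ← MemLp.toLp_const_smul, MemLp.toLp_eq_toLp_iff]
        filter_upwards [((expMeasure_ac n (-γ)).trans (ac_expMeasure n γ)).ae_le
          (Lp.coeFn_smul c u)] with w hw
        rw [hw, Pi.smul_apply, Pi.smul_apply, smul_eq_mul, smul_eq_mul, mul_left_comm] }
    (expDecayNorm γ₀ V)
    (by
      intro u
      have h := eLpNorm_mul_le hV hγ (fun w => u w)
      have h2 := ENNReal.toReal_mono
        (ENNReal.mul_lt_top ENNReal.ofReal_lt_top (Lp.memLp u).2).ne h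
      rw [ENNReal.toReal_mul, ENNReal.toReal_ofReal (by exact ENNReal.toReal_nonneg)] at h2
      change ‖(hV.memLp_mul hγ (Lp.memLp u)).toLp (fun w => V w * u w)‖ ≤ expDecayNorm γ₀ V * ‖u‖
      rw [Lp.norm_toLp, Lp.norm_def]
      exact h2)

theorem memLp_one {n : ℕ} {γ : ℝ} (hγ : 0 < γ) :
    MemLp (fun _ : RSpace n => (1 : ℂ)) 2 (expMeasure n γ) := by
  have hfin : IsFiniteMeasure (expMeasure n γ) := by
    refine isFiniteMeasure_withDensity_ofReal (f := fun w : RSpace n => Real.exp (-(2 * γ * ‖w‖)))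
      (Integrable.hasFiniteIntegral ?_)
    have hint := integrable_one_add_norm (E := RSpace n) (μ := volume) (r := (n : ℝ) + 1)
      (by simp)
    obtain ⟨C, hC⟩ : ∃ C : ℝ, ∀ t : ℝ, 0 ≤ t →
        Real.exp (-(2 * γ * t)) ≤ C * (1 + t) ^ (-((n : ℝ) + 1)) := by
      have h2 : 0 < 2 * γ := by positivity
      refine ⟨Real.exp (2 * γ) * ((n + 1).factorial : ℝ) / (2 * γ) ^ (n + 1), fun t ht => ?_⟩
      have h1 : 0 < 1 + t := by linarith
      have hexp := Real.pow_div_factorial_le_exp (2 * γ * (1 + t)) (by positivity) (n + 1)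
      rw [div_le_iff₀ (by positivity), mul_pow, mul_add, mul_one, Real.exp_add] at hexp
      have hr : (1 + t) ^ (-((n : ℝ) + 1)) = ((1 + t) ^ (n + 1))⁻¹ := by
        rw [Real.rpow_neg h1.le, ← Real.rpow_natCast]
        push_cast
        rfl
      rw [hr, Real.exp_neg, ← div_eq_mul_inv, div_div, le_div_iff₀ (by positivity),
        inv_mul_le_iff₀ (Real.exp_pos _)]
      linarith
    refine (hint.const_mul C).mono' (by fun_prop) (Filter.Eventually.of_forall fun w => ?_)
    rw [Real.norm_of_nonneg (Real.exp_pos _).le]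
    exact hC _ (norm_nonneg w)
  exact memLp_const 1

/-- The potential `V` itself, as an element of `e^{-γ|w|}L²` (here `0 < γ` and `2γ ≤ γ₀`). -/
def potentialVec {n : ℕ} {γ γ₀ : ℝ} {V : RSpace n → ℂ} (hV : IsExpDecaying γ₀ V)
    (hγ : 2 * γ ≤ γ₀) (hpos : 0 < γ) : ExpL2 n (-γ) :=
  mulOp hV hγ ((memLp_one hpos).toLp (fun _ => (1 : ℂ)))

/-! ### Complex momenta and the free operator -/

/-- `ℂⁿ`. -/
abbrev CSpace (n : ℕ) : Type := EuclideanSpace ℂ (Fin n)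

/-- The bilinear (not Hermitian) dot product `ρ · σ = ∑ ρ_i σ_i` on `ℂⁿ`. -/
def cdot {n : ℕ} (ρ σ : CSpace n) : ℂ := ∑ i, ρ i * σ i

/-- The inclusion `ℝⁿ ⊆ ℂⁿ`. -/
def toC {n : ℕ} (x : RSpace n) : CSpace n := WithLp.toLp 2 (fun i => (x i : ℂ))

/-- The complexification of `Span{ν}^⊥`, a copy of `ℂ^{n-1}`: all `ζ ∈ ℂⁿ` with `ζ · ν = 0`. -/
def PerpC {n : ℕ} (ν : RSpace n) : Submodule ℂ (CSpace n) where
  carrier := {ζ | cdot ζ (toC ν) = 0}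
  zero_mem' := by simp [cdot]
  add_mem' := by
    intro a b ha hb
    simp only [cdot, Set.mem_ofPred_eq, PiLp.add_apply, add_mul, Finset.sum_add_distrib] at *
    rw [ha, hb, add_zero]
  smul_mem' := by
    intro c a ha
    simp only [cdot, Set.mem_ofPred_eq, PiLp.smul_apply, smul_eq_mul, mul_assoc,
      ← Finset.mul_sum] at *
    rw [ha, mul_zero]

/-- The points of `Span{ν}^⊥ ∖ {0}`, a copy of `ℝ^{n-1} ∖ {0}`, inside its complexification. -/
def realPerp {n : ℕ} (ν : RSpace n) : Set (PerpC ν) :=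
  {ζ | (∀ i, ((ζ : CSpace n) i).im = 0) ∧ ζ ≠ 0}

/-- The set `(ℂ ∖ ℝ) × U`. -/
def offReal {n : ℕ} {ν : RSpace n} (U : Set (PerpC ν)) : Set (ℂ × PerpC ν) :=
  {p | p.1.im ≠ 0 ∧ p.2 ∈ U}

/-- The momentum `ρ = zν + ρ_⊥`, for `p = (z, ρ_⊥)`. -/
def momentum {n : ℕ} {ν : RSpace n} (p : ℂ × PerpC ν) : CSpace n :=
  p.1 • toC ν + (p.2 : CSpace n)

/-- The full symbol `|η|² + 2 ρ·η` of `Δ + 2 ρ·D_w` (where `Δ = -∑ ∂_j²` and `D = -i∂`), at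
`η = 2πξ`: Mathlib's Fourier transform has the kernel `e^{-2πi w·ξ}`. -/
def freeSymbol {n : ℕ} (ρ : CSpace n) (ξ : RSpace n) : ℂ :=
  (((2 * Real.pi * ‖ξ‖) ^ 2 : ℝ) : ℂ) + 2 * cdot ρ (toC ((2 * Real.pi) • ξ))

/-- `u = G₀(ρ) f`, where `G₀(ρ) = 𝓕⁻¹ (|η|² + 2ρ·η)⁻¹ 𝓕`. The function `(|η|² + 2ρ·η)⁻¹ 𝓕f` is in
general not integrable at infinity, so that its inverse Fourier transform is taken in the sense of
distributions, `⟨𝓕⁻¹ T, φ⟩ = ⟨T, 𝓕⁻¹ φ⟩`. -/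
def IsFreeSolution {n : ℕ} (ρ : CSpace n) (f u : RSpace n → ℂ) : Prop :=
  ∀ φ : RSpace n → ℂ, IsTest φ →
    Integrable (fun ξ => (freeSymbol ρ ξ)⁻¹ * 𝓕 f ξ * 𝓕⁻ φ ξ) volume ∧
    ∫ w, u w * φ w = ∫ ξ, (freeSymbol ρ ξ)⁻¹ * 𝓕 f ξ * 𝓕⁻ φ ξ

/-- `U` is an open neighbourhood of `ℝ^{n-1} ∖ {0}` in `ℂ^{n-1}`, and `𝒢₀` is an analytic family on
`(ℂ ∖ ℝ) × U` of bounded operators `e^{-γ|w|}L² → e^{γ|w|}H²`, whose restriction to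
`(ℂ ∖ ℝ) × (ℝ^{n-1} ∖ {0})` is `G₀(zν + ρ_⊥)`. -/
structure IsAnalyticExtension {n : ℕ} (γ : ℝ) (ν : RSpace n) (U : Set (PerpC ν))
    (𝒢₀ : ℂ × PerpC ν → (ExpL2 n (-γ) →L[ℂ] ExpSobolev n γ 2)) : Prop where
  isOpen : IsOpen U
  real_subset : realPerp ν ⊆ U
  analytic : AnalyticOnNhd ℂ 𝒢₀ (offReal U)
  restrict : ∀ p ∈ offReal (realPerp ν), ∀ f : ExpL2 n (-γ),
    IsFreeSolution (momentum p) (fun w => f w) (fun w => ExpSobolev.incl n γ 2 (𝒢₀ p f) w)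

section Potential

variable {n : ℕ} {γ γ₀ : ℝ} {V : RSpace n → ℂ} {ν : RSpace n}

/-- The operator `V 𝒢₀(z, ρ_⊥)` on `e^{-γ|w|}L²`. -/
def potentialOp (hV : IsExpDecaying γ₀ V) (hγ : 2 * γ ≤ γ₀)
    (𝒢₀ : ℂ × PerpC ν → (ExpL2 n (-γ) →L[ℂ] ExpSobolev n γ 2)) (p : ℂ × PerpC ν) :
    ExpL2 n (-γ) →L[ℂ] ExpL2 n (-γ) :=
  (mulOp hV hγ).comp ((ExpSobolev.incl n γ 2).comp (𝒢₀ p))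

/-- The inverse `(Id + V 𝒢₀(z, ρ_⊥))⁻¹` on `e^{-γ|w|}L²` (and `0` where it does not exist). -/
def potentialInv (hV : IsExpDecaying γ₀ V) (hγ : 2 * γ ≤ γ₀)
    (𝒢₀ : ℂ × PerpC ν → (ExpL2 n (-γ) →L[ℂ] ExpSobolev n γ 2)) (p : ℂ × PerpC ν) :
    ExpL2 n (-γ) →L[ℂ] ExpL2 n (-γ) :=
  Ring.inverse (1 + potentialOp hV hγ 𝒢₀ p)

/-- `v = -𝒢₀ (Id + V 𝒢₀)⁻¹ V`, as an element of `e^{γ|w|}L²`. -/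
def correction (hV : IsExpDecaying γ₀ V) (hγ : 2 * γ ≤ γ₀) (hpos : 0 < γ)
    (𝒢₀ : ℂ × PerpC ν → (ExpL2 n (-γ) →L[ℂ] ExpSobolev n γ 2)) (p : ℂ × PerpC ν) : ExpL2 n γ :=
  -ExpSobolev.incl n γ 2 (𝒢₀ p (potentialInv hV hγ 𝒢₀ p (potentialVec hV hγ hpos)))

end Potential

/-- The function `e^{iρ·w}(1 + v(w))` with `ρ = zν + ρ_⊥`. -/
def expSolution {n : ℕ} {ν : RSpace n} (p : ℂ × PerpC ν) (v : RSpace n → ℂ) (w : RSpace n) : ℂ :=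
  Complex.exp (Complex.I * cdot (momentum p) (toC w)) * (1 + v w)

/-- `(H - μ) u = 0` in the sense of distributions, where `H = -∑ ∂_j² + V`. -/
def IsEigenfunction {n : ℕ} (V : RSpace n → ℂ) (μ : ℂ) (u : RSpace n → ℂ) : Prop :=
  ∀ φ : RSpace n → ℂ, IsTest φ → ∫ w, u w * (-(Δ φ) w + V w * φ w - μ * φ w) = 0

end ExpPotential

end

open ExpPotential

noncomputable section

namespace ExpPotential

/-! ### Holomorphic functions of several variables -/

section Osgood

open Metric

variable {E : Type*} [NormedAddCommGroup E] [NormedSpace ℂ E]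
variable {F : Type*} [NormedAddCommGroup F] [NormedSpace ℂ F]

/-! Existence of an extension. For real `ρ_⊥` the substitution `x = η + ρ_⊥` turns `|η|² + 2ρ·η`
into `|x|² + 2z(x·ν) - ρ_⊥·ρ_⊥`, which for non-real `z` vanishes exactly where `x·ν = 0` and `|x| =
|ρ_⊥|`. The Fourier transform of an element of `e^{-γ|w|}L²` is holomorphic in a tube around the
real frequencies, so each ray `tθ` with `θ·ν ≠ 0` can be moved to the curve `(1 + iσc/(1+t)) tθ`,
where `σ` is the sign of `(θ·ν) Im z` (`integral_contourCurve_eq`, `integral_shiftedIntegrand_eq`).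
On the new contour the symbol times the conjugate of the scaling factor has an imaginary part of
definite sign, and this persists for `ρ_⊥` slightly complex (`le_norm_contourSymbol`). The inverse
symbol is therefore bounded, and decays quadratically, locally uniformly in the parameters. The
contour depends on `z` only through the sign of `Im z`. The parameters thus enter only through
multiplication operators, namely the inverse symbol in frequency and `e^{±iρ_⊥·w}` in space, and
analyticity is elementary (`exists_contourExtension`, `exists_isAnalyticExtension`).

Decay. The operators on both sides of the multiplier map `L²` to bounded functions of the frequency,
so the norm of the family is controlled by the integral of the multiplier over a ball and its
supremum outside. On the contour the inverse symbol is bounded by a multiple of `(1+|x|)/|x|²`,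
uniformly in the parameters, and for real `ρ_⊥` it tends to zero almost everywhere as they tend to
infinity. In dimension at least three dominated convergence applies (`exists_norm_le_of_large`). Two
extensions agree at real `ρ_⊥`, hence the decay holds for each of them.

The exceptional set. Multiplication by `V` on `e^{γ|w|}H²` is approximated, with error `O(2^{-k})`,
by operators of rank at most exponential in `k`, using averages over small cubes in a large one
(`exists_finiteRank_approx`). Hence a sufficiently high even power of `K = V𝒢₀` is a sum of rank-one
operators that depend analytically on the parameters and whose vectors and functionals have summable
norms. The function `d` is the infinite determinant of `1 - K^{2m}`, analytic by Osgood's lemma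
(`exists_det_of_approximable`). Since `1 - K^{2m} = (1 + K) ∑ (-K)^i` with commuting factors, `1 +
K` is invertible where `d ≠ 0`; and `d ≠ 0` where `‖K‖ < 1`, which by the decay holds far out at
real `ρ_⊥`.

The rest follows from analyticity of inversion in a Banach algebra, from compactness of `K`, and
from the identity `f = V(1 - 𝒢₀f)` for `f = (1 + V𝒢₀)⁻¹V`, which turns the equation of the free
resolvent into the eigenvalue equation (`isEigenfunction_expSolution`). -/

/-- `f` is bounded near every point of `U`. -/
def LocBoundedOn (f : E → F) (U : Set E) : Prop :=
  ∀ x ∈ U, ∃ r > 0, ∃ C : ℝ, ∀ y ∈ ball x r, ‖f y‖ ≤ C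

/-- `f` is holomorphic along every complex line through a point of `U`. -/
def LineHolomorphicOn (f : E → F) (U : Set E) : Prop :=
  ∀ x ∈ U, ∀ v : E, DifferentiableAt ℂ (fun t : ℂ => f (x + t • v)) 0

theorem LineHolomorphicOn.differentiableAt {f : E → F} {U : Set E} (hf : LineHolomorphicOn f U)
    {x v : E} {t : ℂ} (h : x + t • v ∈ U) :
    DifferentiableAt ℂ (fun s : ℂ => f (x + s • v)) t := by
  have h1 := hf _ h v
  have h2 : DifferentiableAt ℂ (fun s : ℂ => s - t) t := by fun_prop
  have h3 : DifferentiableAt ℂ (fun s : ℂ => f (x + t • v + s • v)) ((fun s : ℂ => s - t) t) := by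
    simpa using h1
  have h4 := DifferentiableAt.comp (g := fun s : ℂ => f (x + t • v + s • v))
    (f := fun s : ℂ => s - t) t h3 h2
  refine h4.congr_of_eventuallyEq (Filter.Eventually.of_forall fun s => ?_)
  simp only [Function.comp]
  congr 1
  module

/-- The Schwarz lemma on the complex line through `x` and `y`: the parameter disc has radius `r / ‖y
- x‖` and `y` sits at the parameter `1`. -/
theorem LineHolomorphicOn.dist_le {f : E → F} {U : Set E} (hf : LineHolomorphicOn f U)
    {x y : E} {r C : ℝ} (hr : 0 < r) (hU : ball x r ⊆ U)
    (hC : ∀ w ∈ ball x r, ‖f w‖ ≤ C) (hy : y ∈ ball x r) :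
    dist (f y) (f x) ≤ 2 * C / r * dist y x := by
  rcases eq_or_ne y x with rfl | hne
  · simp
  set v := y - x with hv
  have hv0 : 0 < ‖v‖ := norm_pos_iff.2 (sub_ne_zero.2 hne)
  have hmem : ∀ t ∈ ball (0 : ℂ) (r / ‖v‖), x + t • v ∈ ball x r := by
    intro t ht
    rw [mem_ball_zero_iff, lt_div_iff₀ hv0] at ht
    rw [mem_ball, dist_eq_norm, add_sub_cancel_left, norm_smul]
    exact ht
  have hd : DifferentiableOn ℂ (fun t : ℂ => f (x + t • v)) (ball 0 (r / ‖v‖)) := fun t ht =>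
    (hf.differentiableAt (hU (hmem t ht))).differentiableWithinAt
  have hm : Set.MapsTo (fun t : ℂ => f (x + t • v)) (ball 0 (r / ‖v‖))
      (closedBall (f (x + (0 : ℂ) • v)) (2 * C)) := by
    intro t ht
    rw [mem_closedBall, dist_eq_norm]
    refine (norm_sub_le _ _).trans ?_
    have h1 := hC _ (hmem t ht)
    have h2 := hC _ (hmem 0 (mem_ball_self (by positivity)))
    linarith
  have h1 : (1 : ℂ) ∈ ball (0 : ℂ) (r / ‖v‖) := by
    rw [mem_ball_zero_iff, norm_one, lt_div_iff₀ hv0, one_mul]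
    simpa [dist_eq_norm] using hy
  have := Complex.dist_le_div_mul_dist_of_mapsTo_ball hd hm h1
  simp only [one_smul, zero_smul, add_zero, hv, add_sub_cancel, dist_zero_right, norm_one,
    mul_one] at this
  refine this.trans (le_of_eq ?_)
  rw [dist_eq_norm, ← hv]
  field_simp

/-- A uniform Lipschitz bound near a point of `U`. -/
theorem LineHolomorphicOn.exists_lipschitz {f : E → F} {U : Set E} (hf : LineHolomorphicOn f U)
    {x : E} {r C : ℝ} (hr : 0 < r) (hU : ball x r ⊆ U)
    (hC : ∀ w ∈ ball x r, ‖f w‖ ≤ C) {y z : E} (hy : y ∈ ball x (r / 3)) (hz : z ∈ ball x (r / 3)) :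
    dist (f z) (f y) ≤ 3 * C / r * dist z y := by
  have hsub : ball y (2 * r / 3) ⊆ ball x r := by
    refine ball_subset_ball' ?_
    rw [mem_ball] at hy
    linarith
  have hzy : z ∈ ball y (2 * r / 3) := by
    rw [mem_ball] at *
    have := dist_triangle_right z y x
    linarith
  refine (hf.dist_le (by positivity) (hsub.trans hU) (fun w hw => hC w (hsub hw)) hzy).trans
    (le_of_eq ?_)
  field_simp

theorem LineHolomorphicOn.continuousOn {f : E → F} {U : Set E} (hU : IsOpen U)
    (hf : LineHolomorphicOn f U) (hb : LocBoundedOn f U) : ContinuousOn f U := by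
  intro x hx
  obtain ⟨r, hr, C, hC⟩ := hb x hx
  obtain ⟨s, hs, hsU⟩ := Metric.isOpen_iff.1 hU x hx
  have hm : 0 < min r s := lt_min hr hs
  refine ContinuousAt.continuousWithinAt ?_
  refine continuousAt_of_locally_lipschitz hm (2 * C / min r s) fun y hy => ?_
  exact hf.dist_le hm ((ball_subset_ball (min_le_right _ _)).trans hsU)
    (fun w hw => hC w (ball_subset_ball (min_le_left _ _) hw)) (mem_ball.2 hy)

universe u

/-- The conclusion of Osgood's lemma for functions on `E`. -/
def OsgoodProperty (E : Type*) [NormedAddCommGroup E] [NormedSpace ℂ E] : Prop :=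
  ∀ (F : Type u) [NormedAddCommGroup F] [NormedSpace ℂ F] [CompleteSpace F]
    (f : E → F) (U : Set E), IsOpen U → LocBoundedOn f U → LineHolomorphicOn f U →
    AnalyticOnNhd ℂ f U

omit [NormedSpace ℂ F] in
theorem LocBoundedOn.comp_continuousLinear {E' : Type*} [NormedAddCommGroup E'] [NormedSpace ℂ E']
    {f : E → F} {U : Set E} (hf : LocBoundedOn f U) (L : E' →L[ℂ] E) :
    LocBoundedOn (f ∘ L) (L ⁻¹' U) := by
  intro x hx
  obtain ⟨r, hr, C, hC⟩ := hf (L x) hx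
  obtain ⟨s, hs, h⟩ := Metric.continuousAt_iff.1 L.continuous.continuousAt r hr
  exact ⟨s, hs, C, fun y hy => hC _ (h hy)⟩

theorem LineHolomorphicOn.comp_continuousLinear {E' : Type*} [NormedAddCommGroup E']
    [NormedSpace ℂ E'] {f : E → F} {U : Set E} (hf : LineHolomorphicOn f U) (L : E' →L[ℂ] E) :
    LineHolomorphicOn (f ∘ L) (L ⁻¹' U) := by
  intro x hx v
  have := hf (L x) hx (L v)
  simpa [Function.comp_def, map_add, map_smul] using this

theorem OsgoodProperty.of_equiv {E' : Type*} [NormedAddCommGroup E'] [NormedSpace ℂ E']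
    (h : OsgoodProperty.{u} E) (L : E ≃L[ℂ] E') : OsgoodProperty.{u} E' := by
  intro F _ _ _ f U hU hb hl x hx
  have h1 := h F (f ∘ (L : E →L[ℂ] E')) ((L : E →L[ℂ] E') ⁻¹' U)
    (hU.preimage L.continuous) (hb.comp_continuousLinear _) (hl.comp_continuousLinear _)
    (L.symm x) (by simpa using hx)
  have h2 : AnalyticAt ℂ (L.symm : E' → E) x := L.symm.toContinuousLinearMap.analyticAt x
  have h3 := h1.comp h2
  refine h3.congr (Filter.Eventually.of_forall fun y => ?_)
  simp

theorem OsgoodProperty.of_subsingleton [Subsingleton E] : OsgoodProperty.{u} E := by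
  intro F _ _ _ f U _ _ _ x _
  refine (analyticAt_const (v := f x)).congr (Filter.Eventually.of_forall fun y => ?_)
  rw [Subsingleton.elim y x]

variable [CompleteSpace F]

/-- A continuous function with values in `C(S, F)` is holomorphic if all its values are. -/
theorem differentiableAt_continuousMap {S : Type*} [TopologicalSpace S] [CompactSpace S]
    {g : ℂ → C(S, F)} {δ : ℝ} (hδ : 0 < δ) (hc : ContinuousOn g (closedBall 0 δ))
    (hd : ∀ s, ∀ t ∈ ball (0 : ℂ) δ, DifferentiableAt ℂ (fun t => g t s) t) :
    DifferentiableAt ℂ g 0 := by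
  lift δ to NNReal using hδ.le
  have hci : CircleIntegrable g 0 δ :=
    (hc.mono sphere_subset_closedBall).circleIntegrable δ.2
  -- The Cauchy integral of `g` is holomorphic with no assumption but integrability on the circle.
  -- It equals `g` because evaluation at `s` commutes with the integral and every `g · s` satisfies
  -- Cauchy's formula.
  have h1 := (hasFPowerSeriesOn_cauchy_integral hci hδ).analyticAt.differentiableAt
  refine h1.congr_of_eventuallyEq ?_
  filter_upwards [ball_mem_nhds (0 : ℂ) hδ] with t ht
  ext s
  have hcs : ContinuousOn (fun t => g t s) (closedBall 0 δ) :=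
    (ContinuousMap.evalCLM ℂ s).continuous.comp_continuousOn hc
  have h2 :=
      Complex.two_pi_I_inv_smul_circleIntegral_sub_inv_smul_of_differentiable_on_off_countable
    (s := ∅) Set.countable_empty ht hcs (fun x hx => hd s x hx.1)
  have hint : CircleIntegrable (fun z => (z - t)⁻¹ • g z) 0 δ := by
    refine ContinuousOn.circleIntegrable δ.2 ?_
    refine ContinuousOn.smul (ContinuousOn.inv₀
      (continuousOn_id.sub continuousOn_const) fun z hz h => ?_) (hc.mono sphere_subset_closedBall)
    have h : z = t := sub_eq_zero.1 h
    rw [h, mem_sphere] at hz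
    rw [mem_ball] at ht
    exact ht.ne hz
  have h3 : (∮ z in C(0, δ), (z - t)⁻¹ • g z) s = ∮ z in C(0, δ), (z - t)⁻¹ • g z s := by
    rw [circleIntegral, circleIntegral]
    exact ((ContinuousMap.evalCLM ℂ s).intervalIntegral_comp_comm hint.out).symm
  rw [ContinuousMap.smul_apply, h3, h2]

/-- The Cauchy kernel on a circle, as a continuous function. -/
def cauchyKernel (c : ℂ) (r : ℝ) (z : ℂ) : C(sphere c r, ℂ) :=
  Ring.inverse (⟨Subtype.val, continuous_subtype_val⟩ - algebraMap ℂ C(sphere c r, ℂ) z)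

theorem isUnit_sub_of_mem_ball {c z : ℂ} {r : ℝ} (hz : z ∈ ball c r) :
    IsUnit ((⟨Subtype.val, continuous_subtype_val⟩ : C(sphere c r, ℂ)) -
      algebraMap ℂ C(sphere c r, ℂ) z) := by
  rw [ContinuousMap.isUnit_iff_forall_ne_zero]
  rintro ⟨ζ, hζ⟩ h
  have h' : ζ - z = 0 := by simpa using h
  rw [sub_eq_zero] at h'
  rw [h', mem_sphere] at hζ
  rw [mem_ball] at hz
  exact hz.ne hζ

theorem cauchyKernel_apply {c z : ℂ} {r : ℝ} (hz : z ∈ ball c r) (ζ : sphere c r) :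
    cauchyKernel c r z ζ = ((ζ : ℂ) - z)⁻¹ := by
  have h := congrArg (fun g : C(sphere c r, ℂ) => g ζ)
    (Ring.mul_inverse_cancel _ (isUnit_sub_of_mem_ball hz))
  refine eq_inv_of_mul_eq_one_right ?_
  simpa [cauchyKernel] using h

/-- The kernel is an inverse in the Banach algebra of continuous functions on the circle, and
inversion is analytic at units. -/
theorem analyticAt_cauchyKernel {c z : ℂ} {r : ℝ} (hz : z ∈ ball c r) :
    AnalyticAt ℂ (cauchyKernel c r) z := by
  obtain ⟨u, hu⟩ := isUnit_sub_of_mem_ball hz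
  have h1 := analyticAt_inverse (𝕜 := ℂ) u
  rw [hu] at h1
  refine AnalyticAt.comp (f := fun z => (⟨Subtype.val, continuous_subtype_val⟩ : C(sphere c r, ℂ)) -
      algebraMap ℂ C(sphere c r, ℂ) z) h1 ?_
  refine analyticAt_const.sub ?_
  have h2 : AnalyticAt ℂ (fun z : ℂ => z • (1 : C(sphere c r, ℂ))) z :=
    analyticAt_id.smul analyticAt_const
  exact h2.congr (Filter.Eventually.of_forall fun z => (Algebra.algebraMap_eq_smul_one z).symm)

/-- The pairing `(k, g) ↦ ∮ k g` of continuous functions on a circle. -/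
def circlePairing (F : Type*) [NormedAddCommGroup F] [NormedSpace ℂ F] (c : ℂ) {r : ℝ}
    (hr : 0 ≤ r) : C(sphere c r, ℂ) →L[ℂ] C(sphere c r, F) →L[ℂ] F :=
  LinearMap.mkContinuous₂
    (LinearMap.mk₂ ℂ (fun (k : C(sphere c r, ℂ)) (g : C(sphere c r, F)) =>
      ∫ θ in (0 : ℝ)..2 * Real.pi, deriv (circleMap c r) θ •
        (k ⟨circleMap c r θ, circleMap_mem_sphere c hr θ⟩ •
          g ⟨circleMap c r θ, circleMap_mem_sphere c hr θ⟩))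
      (fun k k' g => by
        rw [← intervalIntegral.integral_add]
        · simp [add_smul]
        all_goals exact Continuous.intervalIntegrable (by simp; fun_prop) _ _)
      (fun a k g => by
        rw [← intervalIntegral.integral_smul]
        congr 1; ext θ
        simp only [ContinuousMap.smul_apply, smul_smul, smul_eq_mul]; congr 1; ring)
      (fun k g g' => by
        rw [← intervalIntegral.integral_add]
        · simp
        all_goals exact Continuous.intervalIntegrable (by simp; fun_prop) _ _)
      (fun a k g => by
        rw [← intervalIntegral.integral_smul]
        congr 1; ext θ
        simp only [ContinuousMap.smul_apply, smul_smul]; congr 1; ring))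
    (2 * Real.pi * r)
    (fun k g => by
      refine (intervalIntegral.norm_integral_le_of_norm_le_const
        (C := r * (‖k‖ * ‖g‖)) fun θ _ => ?_).trans (le_of_eq ?_)
      · rw [norm_smul, norm_smul]
        have h1 : ‖deriv (circleMap c r) θ‖ = r := by simp [abs_of_nonneg hr]
        rw [h1]
        gcongr
        · exact k.norm_coe_le_norm _
        · exact g.norm_coe_le_norm _
      · rw [sub_zero, abs_of_nonneg (by positivity)]; ring)

omit [CompleteSpace F] in
theorem circlePairing_apply {c : ℂ} {r : ℝ} (hr : 0 ≤ r) (k : C(sphere c r, ℂ))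
    (g : C(sphere c r, F)) :
    circlePairing F c hr k g = ∫ θ in (0 : ℝ)..2 * Real.pi, deriv (circleMap c r) θ •
        (k ⟨circleMap c r θ, circleMap_mem_sphere c hr θ⟩ •
          g ⟨circleMap c r θ, circleMap_mem_sphere c hr θ⟩) := rfl

/-- Cauchy's formula in the first variable writes `f (z, w)` as the pairing of the kernel, which is
analytic in `z`, with the restriction of `f (·, w)` to a circle. The latter is a function of `w`
alone with values in a Banach space, to which the hypothesis on `E` applies. -/
theorem OsgoodProperty.prod (h : OsgoodProperty.{u} E) : OsgoodProperty.{u} (ℂ × E) := by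
  intro F _ _ _ f U hU hb hl
  have hcont := hl.continuousOn hU hb
  rintro ⟨z₀, w₀⟩ hx
  obtain ⟨r₁, hr₁, C, hC⟩ := hb _ hx
  obtain ⟨r₂, hr₂, hr₂U⟩ := Metric.isOpen_iff.1 hU _ hx
  set r := min r₁ r₂ / 2 with hr
  have hm : 0 < min r₁ r₂ := lt_min hr₁ hr₂
  have hrpos : 0 < r := by positivity
  have hmem : ∀ z ∈ closedBall z₀ r, ∀ w ∈ ball w₀ r, (z, w) ∈ ball (z₀, w₀) (min r₁ r₂) := by
    intro z hz w hw
    rw [mem_ball, Prod.dist_eq, max_lt_iff]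
    rw [mem_closedBall] at hz
    rw [mem_ball] at hw
    constructor <;> dsimp only <;> linarith
  have hmU : ∀ z ∈ closedBall z₀ r, ∀ w ∈ ball w₀ r, (z, w) ∈ U := fun z hz w hw =>
    hr₂U (ball_subset_ball (min_le_right _ _) (hmem z hz w hw))
  have hmC : ∀ z ∈ closedBall z₀ r, ∀ w ∈ ball w₀ r, ‖f (z, w)‖ ≤ C := fun z hz w hw =>
    hC _ (ball_subset_ball (min_le_left _ _) (hmem z hz w hw))
  have hC0 : 0 ≤ C := (norm_nonneg _).trans
    (hmC z₀ (mem_closedBall_self hrpos.le) w₀ (mem_ball_self hrpos))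
  classical
  let Φ : E → C(sphere z₀ r, F) := fun w =>
    if hw : w ∈ ball w₀ r then
      ⟨fun ζ => f (ζ, w), hcont.comp_continuous (by fun_prop)
        fun ζ => hmU _ (sphere_subset_closedBall ζ.2) _ hw⟩
    else 0
  have hΦ : ∀ w ∈ ball w₀ r, ∀ ζ, Φ w ζ = f (ζ, w) := by
    intro w hw ζ
    simp only [Φ, dif_pos hw]
    rfl
  have hline : ∀ ζ ∈ closedBall z₀ r, LineHolomorphicOn (fun w => f (ζ, w)) (ball w₀ r) := by
    intro ζ hζ w hw v
    have := hl (ζ, w) (hmU ζ hζ w hw) (0, v)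
    simpa using this
  have hΦb : LocBoundedOn Φ (ball w₀ r) := by
    intro w hw
    obtain ⟨s, hs, hsr⟩ := Metric.isOpen_iff.1 isOpen_ball w hw
    refine ⟨s, hs, C, fun y hy => ?_⟩
    refine (ContinuousMap.norm_le _ hC0).2 fun ζ => ?_
    rw [hΦ y (hsr hy)]
    exact hmC _ (sphere_subset_closedBall ζ.2) _ (hsr hy)
  have hΦl : LineHolomorphicOn Φ (ball w₀ r) := by
    intro w hw v
    obtain ⟨s, hs, hsr⟩ := Metric.isOpen_iff.1 isOpen_ball w hw
    obtain ⟨δ, hδ, hδs⟩ : ∃ δ > 0, ∀ t ∈ closedBall (0 : ℂ) δ, w + t • v ∈ ball w (s / 3) := by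
      have : ContinuousAt (fun t : ℂ => w + t • v) 0 := by fun_prop
      obtain ⟨δ, hδ, h⟩ := Metric.continuousAt_iff.1 this (s / 3) (by positivity)
      refine ⟨δ / 2, by positivity, fun t ht => ?_⟩
      have := @h t (by rw [mem_closedBall] at ht; linarith)
      simpa using this
    have hmemw : ∀ t ∈ closedBall (0 : ℂ) δ, w + t • v ∈ ball w₀ r := fun t ht =>
      hsr (ball_subset_ball (by linarith) (hδs t ht))
    refine differentiableAt_continuousMap hδ ?_ ?_
    -- The Lipschitz constant does not depend on `ζ`, which makes `Φ` continuous along the line for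
    -- the supremum norm.
    · have hlip : ∀ a ∈ closedBall (0 : ℂ) δ, ∀ b ∈ closedBall (0 : ℂ) δ,
          dist (Φ (w + a • v)) (Φ (w + b • v)) ≤ (3 * C / s * ‖v‖) * dist a b := by
        intro a ha b hb
        refine (ContinuousMap.dist_le (by positivity)).2 fun ζ => ?_
        rw [hΦ _ (hmemw a ha), hΦ _ (hmemw b hb)]
        have := (hline ζ (sphere_subset_closedBall ζ.2)).exists_lipschitz hs hsr
          (fun y hy => hmC _ (sphere_subset_closedBall ζ.2) _ (hsr hy)) (hδs b hb) (hδs a ha)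
        refine this.trans (le_of_eq ?_)
        rw [dist_eq_norm, add_sub_add_left_eq_sub, ← sub_smul, norm_smul, dist_eq_norm]
        ring
      exact (LipschitzOnWith.of_dist_le_mul (K := (3 * C / s * ‖v‖).toNNReal) fun a ha b hb => by
        rw [Real.coe_toNNReal _ (by positivity)]; exact hlip a ha b hb).continuousOn
    · intro ζ t ht
      have h1 := (hline ζ (sphere_subset_closedBall ζ.2)).differentiableAt
        (hmemw t (ball_subset_closedBall ht))
      refine h1.congr_of_eventuallyEq ?_
      filter_upwards [isOpen_ball.mem_nhds ht] with t' ht'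
      exact hΦ _ (hmemw t' (ball_subset_closedBall ht')) ζ
  -- Here the hypothesis is used for values in `C(sphere z₀ r, F)`; this is why `OsgoodProperty`
  -- quantifies over the target space.
  have hΦa := h _ Φ (ball w₀ r) isOpen_ball hΦb hΦl w₀ (mem_ball_self hrpos)
  have h1 : AnalyticAt ℂ (fun p : ℂ × E => cauchyKernel z₀ r p.1) (z₀, w₀) :=
    AnalyticAt.fun_comp (analyticAt_cauchyKernel (mem_ball_self hrpos)) analyticAt_fst
  have h2 : AnalyticAt ℂ (fun p : ℂ × E => Φ p.2) (z₀, w₀) :=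
    AnalyticAt.fun_comp hΦa analyticAt_snd
  have h3 : AnalyticAt ℂ (fun p : ℂ × E => (2 * Real.pi * Complex.I : ℂ)⁻¹ •
      circlePairing F z₀ hrpos.le (cauchyKernel z₀ r p.1) (Φ p.2)) (z₀, w₀) := by
    exact (((circlePairing F z₀ hrpos.le).analyticAt_bilinear _).comp₂ h1 h2).const_smul
  refine h3.congr ?_
  have hn : ball z₀ r ×ˢ ball w₀ r ∈ 𝓝 (z₀, w₀) :=
    prod_mem_nhds (ball_mem_nhds _ hrpos) (ball_mem_nhds _ hrpos)
  filter_upwards [hn] with p hp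
  have hci :=
      Complex.two_pi_I_inv_smul_circleIntegral_sub_inv_smul_of_differentiable_on_off_countable
    (f := fun ζ => f (ζ, p.2)) (s := ∅) Set.countable_empty hp.1
    (hcont.comp (by fun_prop) fun ζ hζ => hmU ζ hζ _ hp.2) (fun ζ hζ => by
      have := hl.differentiableAt (x := (0, p.2)) (v := (1, 0)) (t := ζ)
        (by simpa using hmU ζ (ball_subset_closedBall hζ.1) _ hp.2)
      simpa using this)
  refine Eq.trans ?_ hci
  congr 1
  rw [circlePairing_apply, circleIntegral]
  refine intervalIntegral.integral_congr fun θ _ => ?_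
  rw [cauchyKernel_apply hp.1, hΦ _ hp.2]

theorem OsgoodProperty.pi (d : ℕ) : OsgoodProperty.{u} (Fin d → ℂ) := by
  induction d with
  | zero => exact OsgoodProperty.of_subsingleton
  | succ d ih => exact ih.prod.of_equiv (Fin.consEquivL ℂ fun _ => ℂ)

/-- **Osgood's lemma**: a locally bounded function of finitely many complex variables which is
holomorphic along all complex lines is analytic. -/
theorem analyticOnNhd_of_lineHolomorphicOn {E : Type*} [NormedAddCommGroup E] [NormedSpace ℂ E]
    [FiniteDimensional ℂ E] {F : Type u} [NormedAddCommGroup F] [NormedSpace ℂ F] [CompleteSpace F]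
    {f : E → F} {U : Set E} (hU : IsOpen U) (hb : LocBoundedOn f U)
    (hl : LineHolomorphicOn f U) : AnalyticOnNhd ℂ f U :=
  (OsgoodProperty.pi (Module.finrank ℂ E)).of_equiv
    (ContinuousLinearEquiv.ofFinrankEq (by simp)) F f U hU hb hl

/-- Locally uniform limits of holomorphic functions of several variables are analytic. -/
theorem analyticOnNhd_of_tendsto {E : Type*} [NormedAddCommGroup E] [NormedSpace ℂ E]
    [FiniteDimensional ℂ E] {F : Type u} [NormedAddCommGroup F] [NormedSpace ℂ F] [CompleteSpace F]
    {f : ℕ → E → F} {g : E → F} {U : Set E} (hU : IsOpen U)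
    (hf : ∀ k, AnalyticOnNhd ℂ (f k) U)
    (hlim : ∀ x ∈ U, ∃ s ∈ 𝓝 x, TendstoUniformlyOn f g Filter.atTop s) :
    AnalyticOnNhd ℂ g U := by
  have hc : ContinuousOn g U := by
    have h : TendstoLocallyUniformlyOn f g Filter.atTop U :=
      fun u hu x hx => by
        obtain ⟨s, hs, h⟩ := hlim x hx
        exact ⟨s, mem_nhdsWithin_of_mem_nhds hs, h u hu⟩
    exact h.continuousOn (Filter.Frequently.of_forall fun k => (hf k).continuousOn)
  refine analyticOnNhd_of_lineHolomorphicOn hU (fun x hx => ?_) (fun x hx v => ?_)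
  · obtain ⟨r, hr, h⟩ := Metric.continuousAt_iff.1 (hc.continuousAt (hU.mem_nhds hx)) 1 one_pos
    refine ⟨r, hr, ‖g x‖ + 1, fun y hy => ?_⟩
    have h1 := h (mem_ball.1 hy)
    rw [dist_eq_norm] at h1
    have h2 := norm_le_norm_add_norm_sub' (g y) (g x)
    linarith
  · obtain ⟨s, hs, h⟩ := hlim x hx
    have hca : ContinuousAt (fun t : ℂ => x + t • v) 0 := by fun_prop
    have hpre : (fun t : ℂ => x + t • v) ⁻¹' (s ∩ U) ∈ 𝓝 (0 : ℂ) :=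
      hca.preimage_mem_nhds (by simpa using Filter.inter_mem hs (hU.mem_nhds hx))
    obtain ⟨δ, hδ, hδs⟩ := Metric.mem_nhds_iff.1 hpre
    have hlu : TendstoLocallyUniformlyOn (fun k (t : ℂ) => f k (x + t • v))
        (fun t => g (x + t • v)) Filter.atTop (ball 0 δ) :=
      ((h.comp fun t : ℂ => x + t • v).mono fun t ht => (hδs ht).1).tendstoLocallyUniformlyOn
    refine (hlu.differentiableOn (Filter.Eventually.of_forall fun k t ht => ?_)
      isOpen_ball).differentiableAt (ball_mem_nhds _ hδ)
    have h1 := (hf k _ (hδs ht).2).differentiableAt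
    exact (h1.comp t (by fun_prop)).differentiableWithinAt

/-- The second order Taylor remainder of a bounded holomorphic function. -/
theorem norm_sub_sub_smul_deriv_le {h : ℂ → ℂ} {δ C : ℝ} (hδ : 0 < δ)
    (hd : DifferentiableOn ℂ h (ball 0 δ)) (hC : ∀ t ∈ ball (0 : ℂ) δ, ‖h t‖ ≤ C)
    {t : ℂ} (ht : t ∈ ball (0 : ℂ) δ) :
    ‖deriv h 0‖ ≤ 2 * C / δ ∧ ‖h t - h 0 - t * deriv h 0‖ ≤ 4 * C / δ ^ 2 * ‖t‖ ^ 2 := by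
  have h0 := mem_ball_self hδ (x := (0 : ℂ))
  have hder : ‖deriv h 0‖ ≤ 2 * C / δ := by
    refine Complex.norm_deriv_le_div_of_mapsTo_ball hd (fun s hs => ?_) hδ
    rw [mem_closedBall, dist_eq_norm]
    linarith [norm_sub_le (h s) (h 0), hC s hs, hC 0 h0]
  refine ⟨hder, ?_⟩
  have hda : DifferentiableAt ℂ h 0 := hd.differentiableAt (ball_mem_nhds _ hδ)
  have hd' : DifferentiableOn ℂ (fun s => h s - s * deriv h 0) (ball 0 δ) :=
    hd.sub (by fun_prop)
  -- Without its linear part the function is `o(s)` after subtraction of its value at `0`, so a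
  -- Schwarz lemma of second order applies. The radius is `4C = C + 2C + C`.
  have hm : Set.MapsTo (fun s => h s - s * deriv h 0) (ball 0 δ)
      (closedBall ((fun s => h s - s * deriv h 0) 0) (4 * C)) := by
    intro s hs
    rw [mem_closedBall, dist_eq_norm]
    simp only [zero_mul, sub_zero]
    have h1 : ‖s * deriv h 0‖ ≤ 2 * C := by
      rw [norm_mul]
      have hs' : ‖s‖ ≤ δ := (mem_ball_zero_iff.1 hs).le
      calc ‖s‖ * ‖deriv h 0‖ ≤ δ * (2 * C / δ) := by gcongr
        _ = 2 * C := by field_simp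
    have h2 := norm_sub_le (h s - s * deriv h 0) (h 0)
    have h3 := norm_sub_le (h s) (s * deriv h 0)
    linarith [hC s hs, hC 0 h0]
  have hn : ((fun s => h s - s * deriv h 0) · - (fun s => h s - s * deriv h 0) 0) =o[𝓝 0]
      (fun w => ‖w - 0‖ ^ 1) := by
    have h1 := hda.hasDerivAt.isLittleO
    have h2 := h1.norm_right
    simp only [sub_zero, pow_one, zero_mul, smul_eq_mul] at h2 ⊢
    refine h2.congr_left fun s => by ring
  have := Complex.dist_le_mul_div_pow_of_mapsTo_ball_of_isLittleO hd' hm hn ht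
  simp only [dist_eq_norm, zero_mul, sub_zero] at this
  calc ‖h t - h 0 - t * deriv h 0‖ = ‖h t - t * deriv h 0 - h 0‖ := by congr 1; ring
    _ ≤ _ := this
    _ = _ := by norm_num [div_pow]; ring

/-- A family of bounded functions which is pointwise holomorphic and locally uniformly bounded is
an analytic family in `L^∞`. -/
theorem exists_analytic_toLp_top {X : Type*} [MeasurableSpace X] {μ : Measure X}
    {E : Type*} [NormedAddCommGroup E] [NormedSpace ℂ E] [FiniteDimensional ℂ E] {U : Set E}
    (hU : IsOpen U) {g : E → X → ℂ} (hm : ∀ p ∈ U, AEStronglyMeasurable (g p) μ)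
    (hb : ∀ p ∈ U, ∃ r > 0, ∃ C : ℝ, ∀ q ∈ ball p r, ∀ x, ‖g q x‖ ≤ C)
    (hl : ∀ x, LineHolomorphicOn (fun p => g p x) U) :
    ∃ G : E → Lp ℂ ∞ μ, AnalyticOnNhd ℂ G U ∧ ∀ p ∈ U, G p =ᵐ[μ] g p := by
  classical
  have hmem : ∀ p ∈ U, MemLp (g p) ∞ μ := by
    intro p hp
    obtain ⟨r, hr, C, hC⟩ := hb p hp
    exact memLp_top_of_bound (hm p hp) C (Filter.Eventually.of_forall (hC p (mem_ball_self hr)))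
  -- The value `0` only makes `G` total; on `U` the first case always holds.
  let G : E → Lp ℂ ∞ μ := fun p => if h : MemLp (g p) ∞ μ then h.toLp else 0
  have hG : ∀ p ∈ U, G p =ᵐ[μ] g p := by
    intro p hp
    simp only [G, dif_pos (hmem p hp)]
    exact MemLp.coeFn_toLp _
  have hnorm : ∀ (f : Lp ℂ ∞ μ) (C : ℝ), 0 ≤ C → (∀ᵐ x ∂μ, ‖f x‖ ≤ C) → ‖f‖ ≤ C := by
    intro f C hC h
    rw [Lp.norm_def]
    refine ENNReal.toReal_le_of_le_ofReal hC ?_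
    rw [eLpNorm_exponent_top]
    exact eLpNormEssSup_le_of_ae_bound h
  refine ⟨G, analyticOnNhd_of_lineHolomorphicOn hU (fun p hp => ?_) (fun p hp v => ?_), hG⟩
  · obtain ⟨r, hr, C, hC⟩ := hb p hp
    obtain ⟨s, hs, hsU⟩ := Metric.isOpen_iff.1 hU p hp
    refine ⟨min r s, lt_min hr hs, max C 0, fun q hq => hnorm _ _ (le_max_right _ _) ?_⟩
    filter_upwards [hG q (hsU (ball_subset_ball (min_le_right _ _) hq))] with x hx
    rw [hx]
    exact (hC q (ball_subset_ball (min_le_left _ _) hq) x).trans (le_max_left _ _)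
  · obtain ⟨r, hr, C, hC⟩ := hb p hp
    have hca : ContinuousAt (fun t : ℂ => p + t • v) 0 := by fun_prop
    have hpre : (fun t : ℂ => p + t • v) ⁻¹' (ball p r ∩ U) ∈ 𝓝 (0 : ℂ) :=
      hca.preimage_mem_nhds
        (by simpa using Filter.inter_mem (ball_mem_nhds p hr) (hU.mem_nhds hp))
    obtain ⟨δ, hδ, hδs⟩ := Metric.mem_nhds_iff.1 hpre
    have hd : ∀ x, DifferentiableOn ℂ (fun t : ℂ => g (p + t • v) x) (ball 0 δ) := fun x t ht =>
      ((hl x).differentiableAt (hδs ht).2).differentiableWithinAt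
    have hCx : ∀ x, ∀ t ∈ ball (0 : ℂ) δ, ‖g (p + t • v) x‖ ≤ C := fun x t ht =>
      hC _ (hδs ht).1 x
    set D : X → ℂ := fun x => deriv (fun t : ℂ => g (p + t • v) x) 0 with hDdef
    -- The pointwise derivative is a limit of difference quotients along a sequence of steps inside
    -- the disc of radius `δ`.
    have hDm : AEStronglyMeasurable D μ := by
      have hlim : Filter.Tendsto (fun k : ℕ => ((δ / 2 : ℝ) : ℂ) * ((k : ℂ) + 1)⁻¹) Filter.atTop
          (𝓝[≠] 0) := by
        refine tendsto_nhdsWithin_iff.2 ⟨?_, Filter.Eventually.of_forall fun k => ?_⟩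
        · have h1 : Filter.Tendsto (fun k : ℕ => ((1 / ((k : ℝ) + 1) : ℝ) : ℂ)) Filter.atTop
              (𝓝 ((0 : ℝ) : ℂ)) :=
            (Complex.continuous_ofReal.tendsto 0).comp tendsto_one_div_add_atTop_nhds_zero_nat
          have h2 := h1.const_mul ((δ / 2 : ℝ) : ℂ)
          simpa using h2
        · have : (k : ℂ) + 1 ≠ 0 := Nat.cast_add_one_ne_zero k
          simp [this, hδ.ne']
      have hin : ∀ k : ℕ, ((δ / 2 : ℝ) : ℂ) * ((k : ℂ) + 1)⁻¹ ∈ ball (0 : ℂ) δ := by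
        intro k
        rw [mem_ball_zero_iff, norm_mul, Complex.norm_real, norm_inv,
          Real.norm_of_nonneg (by positivity)]
        have h1 : ‖(k : ℂ) + 1‖ = (k : ℝ) + 1 := by
          rw [← Nat.cast_add_one, Complex.norm_natCast]; push_cast; ring
        rw [h1]
        have h2 : ((k : ℝ) + 1)⁻¹ ≤ 1 :=
            inv_le_one_of_one_le₀ (by linarith [k.cast_nonneg (α := ℝ)])
        nlinarith
      refine aestronglyMeasurable_of_tendsto_ae Filter.atTop
        (f := fun (k : ℕ) x => (((δ / 2 : ℝ) : ℂ) * ((k : ℂ) + 1)⁻¹)⁻¹ *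
          (g (p + (((δ / 2 : ℝ) : ℂ) * ((k : ℂ) + 1)⁻¹) • v) x - g p x)) (fun k => ?_)
        (Filter.Eventually.of_forall fun x => ?_)
      · exact ((hm _ (hδs (hin k)).2).sub (hm p hp)).const_mul _
      · have h1 := ((hd x).differentiableAt (ball_mem_nhds _ hδ)).hasDerivAt
        have h2 := (hasDerivAt_iff_tendsto_slope.1 h1).comp hlim
        refine h2.congr fun k => ?_
        simp [slope, Function.comp]
    have hDb : ∀ x, ‖D x‖ ≤ 2 * C / δ := fun x =>
      (norm_sub_sub_smul_deriv_le hδ (hd x) (hCx x) (mem_ball_self hδ)).1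
    have hDL : MemLp D ∞ μ := memLp_top_of_bound hDm _ (Filter.Eventually.of_forall hDb)
    refine HasDerivAt.differentiableAt (f' := hDL.toLp) ?_
    rw [hasDerivAt_iff_isLittleO]
    -- The pointwise Taylor remainder is quadratic in `t` with a constant independent of `x`; this
    -- is what turns pointwise derivatives into a derivative in `L^∞`.
    have hO : (fun t : ℂ => G (p + t • v) - G (p + (0 : ℂ) • v) - (t - 0) • hDL.toLp) =O[𝓝 0]
        (fun t : ℂ => t ^ 2) := by
      refine Asymptotics.IsBigO.of_bound (4 * |C| / δ ^ 2) ?_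
      filter_upwards [ball_mem_nhds (0 : ℂ) hδ] with t ht
      refine hnorm _ _ (by positivity) ?_
      filter_upwards [Lp.coeFn_sub (G (p + t • v) - G (p + (0 : ℂ) • v)) ((t - 0) • hDL.toLp),
        Lp.coeFn_sub (G (p + t • v)) (G (p + (0 : ℂ) • v)), Lp.coeFn_smul (t - 0) hDL.toLp,
        hG _ (hδs ht).2, hG _ (hδs (mem_ball_self hδ)).2, hDL.coeFn_toLp] with x h1 h2 h3 h4 h5 h6
      rw [h1, Pi.sub_apply, h2, Pi.sub_apply, h3, Pi.smul_apply, h4, h5, h6, sub_zero, smul_eq_mul]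
      refine (norm_sub_sub_smul_deriv_le hδ (hd x) (hCx x) ht).2.trans ?_
      rw [norm_pow]
      gcongr
      exact le_abs_self C
    refine hO.trans_isLittleO ?_
    simpa using (Asymptotics.isLittleO_pow_id (𝕜 := ℂ) (n := 2) (by norm_num))

end Osgood

/-! ### Infinite determinants -/

section Determinant

/-- A determinant is bounded by the product of the `ℓ¹` norms of the rows. -/
theorem norm_det_le_prod_sum {m : Type*} [Fintype m] [DecidableEq m] (A : Matrix m m ℂ) :
    ‖A.det‖ ≤ ∏ i, ∑ j, ‖A i j‖ := by
  classical
  rw [← Matrix.det_transpose, Matrix.det_apply]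
  calc ‖∑ σ : Equiv.Perm m, Equiv.Perm.sign σ • ∏ i, A.transpose (σ i) i‖
      ≤ ∑ σ : Equiv.Perm m, ∏ i, ‖A i (σ i)‖ := by
        refine (norm_sum_le _ _).trans (Finset.sum_le_sum fun σ _ => ?_)
        rcases Int.units_eq_one_or (Equiv.Perm.sign σ) with h | h <;>
          simp [h, Matrix.transpose_apply, Units.smul_def]
    _ ≤ ∑ f : m → m, ∏ i, ‖A i (f i)‖ := by
        rw [← Finset.sum_image (f := fun f : m → m => ∏ i, ‖A i (f i)‖)
          (g := fun σ : Equiv.Perm m => (σ : m → m)) (fun σ _ τ _ h => DFunLike.coe_injective h)]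
        exact Finset.sum_le_sum_of_subset_of_nonneg (Finset.subset_univ _)
          fun f _ _ => Finset.prod_nonneg fun i _ => norm_nonneg _
    _ = ∏ i, ∑ j, ‖A i j‖ := by
        rw [Finset.prod_univ_sum, Fintype.piFinset_univ]

theorem norm_det_le_exp {m : Type*} [Fintype m] [DecidableEq m] (A : Matrix m m ℂ) (r : m → ℝ)
    (h : ∀ i, ∑ j, ‖A i j‖ ≤ 1 + r i) : ‖A.det‖ ≤ Real.exp (∑ i, r i) := by
  refine (norm_det_le_prod_sum A).trans ?_
  rw [Real.exp_sum]
  refine Finset.prod_le_prod (fun i _ => Finset.sum_nonneg fun j _ => norm_nonneg _) fun i _ => ?_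
  linarith [h i, Real.add_one_le_exp (r i)]

/-- The `N × N` section of an infinite matrix, plus the identity. -/
def sectionMatrix (M : ℕ → ℕ → ℂ) (N : ℕ) : Matrix (Fin N) (Fin N) ℂ :=
  1 + Matrix.of fun i j : Fin N => M i j

/-! ### Determinants of finite sections with entries bounded by `b i * b j`, `b` summable -/

section Bounds

variable {M : ℕ → ℕ → ℂ} {b : ℕ → ℝ}

theorem sum_fin_le_tsum (hb0 : ∀ i, 0 ≤ b i) (hb : Summable b) (N : ℕ) :
    ∑ i : Fin N, b i ≤ ∑' i, b i := by
  rw [Fin.sum_univ_eq_sum_range (fun i => b i)]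
  exact hb.sum_le_tsum _ fun i _ => hb0 i

theorem row_sum_le (hb0 : ∀ i, 0 ≤ b i) (hb : Summable b) (hM : ∀ i j, ‖M i j‖ ≤ b i * b j)
    (N : ℕ) (i : ℕ) : ∑ j : Fin N, ‖M i j‖ ≤ b i * ∑' j, b j := by
  calc ∑ j : Fin N, ‖M i j‖ ≤ ∑ j : Fin N, b i * b j := Finset.sum_le_sum fun j _ => hM i j
    _ = b i * ∑ j : Fin N, b j := by rw [Finset.mul_sum]
    _ ≤ _ := mul_le_mul_of_nonneg_left (sum_fin_le_tsum hb0 hb N) (hb0 i)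

theorem row_sum_one_add_le (hb0 : ∀ i, 0 ≤ b i) (hb : Summable b)
    (hM : ∀ i j, ‖M i j‖ ≤ b i * b j) (N : ℕ) (i : Fin N) :
    ∑ j, ‖sectionMatrix M N i j‖ ≤ 1 + b i * ∑' j, b j := by
  calc ∑ j, ‖sectionMatrix M N i j‖
      ≤ ∑ j : Fin N, (‖(1 : Matrix (Fin N) (Fin N) ℂ) i j‖ + ‖M i j‖) :=
        Finset.sum_le_sum fun j _ => norm_add_le _ _
    _ = 1 + ∑ j : Fin N, ‖M i j‖ := by
        rw [Finset.sum_add_distrib]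
        congr 1
        rw [Finset.sum_eq_single i]
        · simp
        · intro j _ hj; simp [Matrix.one_apply_ne hj.symm]
        · simp
    _ ≤ _ := by gcongr; exact row_sum_le hb0 hb hM N i

theorem sum_row_bound_le (hb0 : ∀ i, 0 ≤ b i) (hb : Summable b) (N : ℕ) :
    ∑ i : Fin N, b i * ∑' j, b j ≤ (∑' j, b j) ^ 2 := by
  rw [← Finset.sum_mul, sq]
  exact mul_le_mul_of_nonneg_right (sum_fin_le_tsum hb0 hb N) (tsum_nonneg hb0)

/-- An entry of the adjugate is a determinant in which one row is replaced by a unit vector, so the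
row-sum estimate still applies. The bound is independent of `N`: inverses of the sections are then
controlled by a lower bound for their determinants. -/
theorem norm_adjugate_sectionMatrix_le (hb0 : ∀ i, 0 ≤ b i) (hb : Summable b)
    (hM : ∀ i j, ‖M i j‖ ≤ b i * b j) (N : ℕ) (i j : Fin N) :
    ‖(sectionMatrix M N).adjugate i j‖ ≤ Real.exp ((∑' j, b j) ^ 2) := by
  rw [Matrix.adjugate_apply]
  refine (norm_det_le_exp _ (fun i : Fin N => b i * ∑' j, b j) fun k => ?_).trans
    (Real.exp_le_exp.2 (sum_row_bound_le hb0 hb N))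
  rcases eq_or_ne k j with rfl | hk
  · simp only [Matrix.updateRow_self]
    rw [Finset.sum_eq_single i]
    · have : 0 ≤ b k * ∑' j, b j := mul_nonneg (hb0 k) (tsum_nonneg hb0)
      simpa using this
    · intro l _ hl; simp [hl]
    · simp
  · simp only [Matrix.updateRow_ne hk]
    exact row_sum_one_add_le hb0 hb hM N k

/-- The last row of the larger section is a unit vector plus a row of `M`. The unit vector alone
gives the smaller section, and what is left is a determinant whose last row has `ℓ¹` norm at most `b
N * ∑' j, b j`, a summable quantity. -/
theorem norm_det_sectionMatrix_succ_sub_le (hb0 : ∀ i, 0 ≤ b i) (hb : Summable b)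
    (hM : ∀ i j, ‖M i j‖ ≤ b i * b j) (N : ℕ) :
    ‖(sectionMatrix M (N + 1)).det - (sectionMatrix M N).det‖
      ≤ Real.exp ((∑' j, b j) ^ 2) * (∑' j, b j) * b N := by
  set A := sectionMatrix M (N + 1) with hA
  set S := ∑' j, b j with hS
  have hS0 : 0 ≤ S := tsum_nonneg hb0
  have h1 : A = A.updateRow (Fin.last N) ((Pi.single (Fin.last N) 1 : Fin (N + 1) → ℂ) +
      fun j : Fin (N + 1) => M N j) := by
    ext i j
    rcases eq_or_ne i (Fin.last N) with rfl | hi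
    · rw [Matrix.updateRow_self, hA, sectionMatrix, Matrix.add_apply, Pi.add_apply,
        Matrix.one_apply, Pi.single_apply]
      simp [eq_comm]
    · rw [Matrix.updateRow_ne hi]
  have h2 : (A.updateRow (Fin.last N) (Pi.single (Fin.last N) 1 : Fin (N + 1) → ℂ)).det
      = (sectionMatrix M N).det := by
    rw [← Matrix.adjugate_apply, Matrix.adjugate_fin_succ_eq_det_submatrix]
    rw [← two_mul, Even.neg_one_pow (even_two_mul _), one_mul]
    congr 1
    ext i j
    simp [hA, sectionMatrix, Matrix.one_apply, Fin.succAbove_last]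
  have h3 : A.det - (sectionMatrix M N).det =
      (A.updateRow (Fin.last N) (fun j => M N j)).det := by
    conv_lhs => rw [h1]
    rw [Matrix.det_updateRow_add, h2]
    ring
  rw [h3]
  refine (norm_det_le_prod_sum _).trans ?_
  rw [Fin.prod_univ_castSucc]
  have h4 : ∑ j, ‖A.updateRow (Fin.last N) (fun j => M N j) (Fin.last N) j‖ ≤ b N * S := by
    simp only [Matrix.updateRow_self]
    exact row_sum_le hb0 hb hM (N + 1) N
  have h5 : ∏ i : Fin N, ∑ j, ‖A.updateRow (Fin.last N) (fun j => M N j) i.castSucc j‖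
      ≤ Real.exp (S ^ 2) := by
    refine le_trans (Finset.prod_le_prod (g := fun i : Fin N => Real.exp (b i * S))
      (fun i _ => Finset.sum_nonneg fun j _ => norm_nonneg _) fun i _ => ?_) ?_
    · rw [Matrix.updateRow_ne (Fin.castSucc_lt_last i).ne]
      refine (row_sum_one_add_le hb0 hb hM (N + 1) i.castSucc).trans ?_
      rw [Fin.val_castSucc]
      linarith [Real.add_one_le_exp (b i * S)]
    · rw [← Real.exp_sum]
      exact Real.exp_le_exp.2 (sum_row_bound_le hb0 hb N)
  calc _ ≤ Real.exp (S ^ 2) * (b N * S) :=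
        mul_le_mul h5 h4 (Finset.sum_nonneg fun j _ => norm_nonneg _) (Real.exp_pos _).le
    _ = _ := by ring

end Bounds

/-- The determinant of `1 + M`, as the limit of the determinants of the finite sections. -/
def infiniteDet (M : ℕ → ℕ → ℂ) : ℂ :=
  1 + ∑' N, ((sectionMatrix M (N + 1)).det - (sectionMatrix M N).det)

theorem one_add_sum_range_det (M : ℕ → ℕ → ℂ) (N : ℕ) :
    1 + ∑ k ∈ Finset.range N, ((sectionMatrix M (k + 1)).det - (sectionMatrix M k).det)
      = (sectionMatrix M N).det := by
  rw [Finset.sum_range_sub (fun k => (sectionMatrix M k).det)]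
  simp

/-- The Weierstrass test for the telescoping series of determinants. Uniformity in `p` is what makes
the limit determinant analytic. -/
theorem tendstoUniformlyOn_det {E : Type*} {M : E → ℕ → ℕ → ℂ} {s : Set E} {b : ℕ → ℝ}
    (hb0 : ∀ i, 0 ≤ b i) (hb : Summable b) (hM : ∀ p ∈ s, ∀ i j, ‖M p i j‖ ≤ b i * b j) :
    TendstoUniformlyOn (fun N p => (sectionMatrix (M p) N).det) (fun p => infiniteDet (M p))
      Filter.atTop s := by
  have h := tendstoUniformlyOn_tsum_nat (s := s)
    (f := fun N p => (sectionMatrix (M p) (N + 1)).det - (sectionMatrix (M p) N).det)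
    (hb.mul_left (Real.exp ((∑' j, b j) ^ 2) * (∑' j, b j)))
    (fun N p hp => norm_det_sectionMatrix_succ_sub_le hb0 hb (hM p hp) N)
  rw [Metric.tendstoUniformlyOn_iff] at h ⊢
  intro ε hε
  filter_upwards [h ε hε] with N hN p hp
  have := hN p hp
  rwa [infiniteDet, ← one_add_sum_range_det, dist_add_left]

variable {H : Type*} [NormedAddCommGroup H] [NormedSpace ℂ H]

/-! ### Inverses of finite-rank perturbations of the identity -/

section FiniteRank

variable {N : ℕ} (x : Fin N → H) (ψ : Fin N → (H →L[ℂ] ℂ))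

/-- The operator `∑ xᵢ ⊗ ψᵢ`. -/
def sumRankOne : H →L[ℂ] H := ∑ i, (ψ i).smulRight (x i)

theorem sumRankOne_apply (h : H) : sumRankOne x ψ h = ∑ i, ψ i h • x i := by
  simp [sumRankOne]

/-- The operator `∑ xᵢ Gᵢⱼ ⊗ ψⱼ`. -/
def sandwich (G : Matrix (Fin N) (Fin N) ℂ) : H →L[ℂ] H :=
  ∑ i, ∑ j, G i j • (ψ j).smulRight (x i)

theorem sandwich_apply (G : Matrix (Fin N) (Fin N) ℂ) (h : H) :
    sandwich x ψ G h = ∑ i, (∑ j, G i j * ψ j h) • x i := by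
  simp [sandwich, smul_smul, Finset.sum_smul]

theorem norm_sandwich_le {G : Matrix (Fin N) (Fin N) ℂ} {g : ℝ} (hG : ∀ i j, ‖G i j‖ ≤ g) :
    ‖sandwich x ψ G‖ ≤ g * (∑ i, ‖x i‖) * ∑ j, ‖ψ j‖ := by
  rw [mul_assoc, Finset.sum_mul_sum, Finset.mul_sum]
  refine (norm_sum_le _ _).trans (Finset.sum_le_sum fun i _ => ?_)
  rw [Finset.mul_sum]
  refine (norm_sum_le _ _).trans (Finset.sum_le_sum fun j _ => ?_)
  rw [norm_smul, ContinuousLinearMap.norm_smulRight_apply]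
  have := hG i j
  rw [mul_comm ‖x i‖]
  gcongr

/-- Woodbury's formula: a perturbation with range in the span of the `x i` is inverted by inverting
the matrix of the `ψ i (x j)`. The other order of the product is verified separately below. -/
theorem one_add_mul_one_sub_sandwich {G : Matrix (Fin N) (Fin N) ℂ}
    (hG : (1 + Matrix.of fun i j => ψ i (x j)) * G = 1) :
    (1 + sumRankOne x ψ) * (1 - sandwich x ψ G) = 1 := by
  have hG' : ∀ i j, G i j + ∑ k, ψ i (x k) * G k j = if i = j then 1 else 0 := by
    intro i j
    have := congrFun (congrFun hG i) j
    rwa [add_mul, one_mul, Matrix.add_apply, Matrix.mul_apply, Matrix.one_apply] at this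
  ext h
  have h1 : ∀ i, ψ i h = (∑ j, G i j * ψ j h) + ∑ k, (∑ j, G k j * ψ j h) * ψ i (x k) := by
    intro i
    have h2 : ψ i h = ∑ j, (if i = j then 1 else 0) * ψ j h := by simp
    rw [h2]
    simp_rw [← hG', add_mul, Finset.sum_add_distrib]
    congr 1
    simp_rw [Finset.sum_mul]
    rw [Finset.sum_comm]
    refine Finset.sum_congr rfl fun k _ => Finset.sum_congr rfl fun j _ => ?_
    ring
  have h3 : sumRankOne x ψ (h - sandwich x ψ G h) = sandwich x ψ G h := by
    rw [sumRankOne_apply, sandwich_apply]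
    refine Finset.sum_congr rfl fun i _ => ?_
    rw [map_sub, h1 i, map_sum]
    simp only [map_smul, smul_eq_mul, add_sub_cancel_right]
  change (h - sandwich x ψ G h) + sumRankOne x ψ (h - sandwich x ψ G h) = h
  rw [h3, sub_add_cancel]

theorem one_sub_sandwich_mul_one_add {G : Matrix (Fin N) (Fin N) ℂ}
    (hG : G * (1 + Matrix.of fun i j => ψ i (x j)) = 1) :
    (1 - sandwich x ψ G) * (1 + sumRankOne x ψ) = 1 := by
  have hG' : ∀ i j, G i j + ∑ k, G i k * ψ k (x j) = if i = j then 1 else 0 := by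
    intro i j
    have := congrFun (congrFun hG i) j
    rwa [mul_add, mul_one, Matrix.add_apply, Matrix.mul_apply, Matrix.one_apply] at this
  ext h
  have h1 : ∀ i, ψ i h = (∑ j, G i j * ψ j h) + ∑ j, G i j * ∑ k, ψ k h * ψ j (x k) := by
    intro i
    have h2 : ψ i h = ∑ j, (if i = j then 1 else 0) * ψ j h := by simp
    rw [h2]
    simp_rw [← hG', add_mul, Finset.sum_add_distrib]
    congr 1
    simp_rw [Finset.sum_mul, Finset.mul_sum]
    rw [Finset.sum_comm]
    refine Finset.sum_congr rfl fun k _ => Finset.sum_congr rfl fun j _ => ?_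
    ring
  have h3 : sandwich x ψ G (h + sumRankOne x ψ h) = sumRankOne x ψ h := by
    rw [sumRankOne_apply, sandwich_apply]
    refine Finset.sum_congr rfl fun i _ => ?_
    rw [h1 i, ← Finset.sum_add_distrib]
    congr 1
    refine Finset.sum_congr rfl fun j _ => ?_
    rw [map_add, map_sum, mul_add]
    simp only [map_smul, smul_eq_mul]
  change (h + sumRankOne x ψ h) - sandwich x ψ G (h + sumRankOne x ψ h) = h
  rw [h3, add_sub_cancel_right]

/-- The matrix of the inverse of `1 + ψ(x)`, from an inverse `Q` of `1 + ∑ xᵢ ⊗ ψᵢ`. -/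
theorem one_add_matrix_mul_eq_one {Q : H →L[ℂ] H} (hQ : (1 + sumRankOne x ψ) * Q = 1) :
    (1 + Matrix.of fun i j => ψ i (x j)) * (1 - Matrix.of fun i j => ψ i (Q (x j))) = 1 := by
  have hQ' : ∀ h, h = Q h + ∑ k, ψ k (Q h) • x k := by
    intro h
    have := congrArg (fun L : H →L[ℂ] H => L h) hQ
    simpa [sumRankOne_apply, add_mul] using this.symm
  ext i j
  rw [add_mul, one_mul, Matrix.add_apply, Matrix.sub_apply, mul_sub, mul_one, Matrix.sub_apply,
    Matrix.mul_apply]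
  simp only [Matrix.of_apply]
  have h1 : ψ i (x j) = ψ i (Q (x j)) + ∑ k, ψ i (x k) * ψ k (Q (x j)) := by
    conv_lhs => rw [hQ' (x j)]
    simp [mul_comm]
  rw [h1]
  ring

end FiniteRank

/-! ### Invertibility of `1 + A` and nonvanishing of the infinite determinant -/

section Limit

variable [CompleteSpace H] {x : ℕ → H} {ψ : ℕ → (H →L[ℂ] ℂ)} {A : H →L[ℂ] H} {c : ℕ → ℝ}

omit [CompleteSpace H] in
theorem norm_pairing_le (hx : ∀ n, ‖x n‖ ≤ c n) (hψ : ∀ n, ‖ψ n‖ ≤ c n) (i j : ℕ) :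
    ‖ψ i (x j)‖ ≤ c i * c j :=
  ((ψ i).le_opNorm _).trans
    (mul_le_mul (hψ i) (hx j) (norm_nonneg _) ((norm_nonneg _).trans (hψ i)))

omit [CompleteSpace H] in
theorem tendsto_sumRankOne (hA : HasSum (fun n => (ψ n).smulRight (x n)) A) :
    Filter.Tendsto (fun N => sumRankOne (fun i : Fin N => x i) (fun i : Fin N => ψ i))
      Filter.atTop (𝓝 A) := by
  refine hA.tendsto_sum_nat.congr fun N => ?_
  rw [sumRankOne, Fin.sum_univ_eq_sum_range (fun i => (ψ i).smulRight (x i))]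

omit [CompleteSpace H] in
theorem tendsto_det (hc : Summable c) (hx : ∀ n, ‖x n‖ ≤ c n) (hψ : ∀ n, ‖ψ n‖ ≤ c n) :
    Filter.Tendsto (fun N => (sectionMatrix (fun i j => ψ i (x j)) N).det) Filter.atTop
      (𝓝 (infiniteDet fun i j => ψ i (x j))) := by
  have hc0 : ∀ i, 0 ≤ c i := fun i => (norm_nonneg _).trans (hx i)
  exact (tendstoUniformlyOn_det (E := Unit) (s := Set.univ) (M := fun _ i j => ψ i (x j)) hc0 hc
    (fun _ _ => norm_pairing_le hx hψ)).tendsto_at (Set.mem_univ ())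

/-- The determinants of the large sections stay away from zero, and the adjugates are bounded, so
the truncations of `1 + A` have uniformly bounded inverses. Since they converge in norm to `1 + A`,
a Neumann series finishes the proof. -/
theorem isUnit_one_add_of_infiniteDet_ne_zero (hc : Summable c) (hx : ∀ n, ‖x n‖ ≤ c n)
    (hψ : ∀ n, ‖ψ n‖ ≤ c n) (hA : HasSum (fun n => (ψ n).smulRight (x n)) A)
    (hd : infiniteDet (fun i j => ψ i (x j)) ≠ 0) : IsUnit (1 + A) := by
  have hc0 : ∀ i, 0 ≤ c i := fun i => (norm_nonneg _).trans (hx i)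
  set M : ℕ → ℕ → ℂ := fun i j => ψ i (x j)
  set S := ∑' j, c j with hS
  set δ := ‖infiniteDet M‖ / 2 with hδ
  have hδ0 : 0 < δ := half_pos (norm_pos_iff.2 hd)
  -- A bound, independent of the truncation, for the inverse `1 - B` of the truncated operator:
  -- adjugate over determinant for the matrix, and one factor `S` each for the vectors and the
  -- functionals.
  set C := 1 + Real.exp (S ^ 2) / δ * S * S with hC
  have hS0 : 0 ≤ S := tsum_nonneg hc0
  have hC0 : 0 < C := by positivity
  have h1 : ∀ᶠ N in Filter.atTop, δ < ‖(sectionMatrix M N).det‖ :=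
    (tendsto_det hc hx hψ).norm.eventually_const_lt (half_lt_self (norm_pos_iff.2 hd))
  have h2 : ∀ᶠ N in Filter.atTop,
      ‖A - sumRankOne (fun i : Fin N => x i) (fun i : Fin N => ψ i)‖ < C⁻¹ := by
    have := (tendsto_sumRankOne hA)
    have h3 := (tendsto_const_nhds (x := A)).sub this
    rw [sub_self] at h3
    have h4 := h3.norm
    rw [norm_zero] at h4
    exact h4.eventually_lt_const (inv_pos.2 hC0)
  obtain ⟨N, hN1, hN2⟩ := (h1.and h2).exists
  set AN := sumRankOne (fun i : Fin N => x i) (fun i : Fin N => ψ i) with hAN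
  have hdet : IsUnit (sectionMatrix M N).det :=
    isUnit_iff_ne_zero.2 (norm_pos_iff.1 (hδ0.trans hN1))
  set G := (sectionMatrix M N)⁻¹ with hG
  have hGb : ∀ i j, ‖G i j‖ ≤ Real.exp (S ^ 2) / δ := by
    intro i j
    rw [hG, Matrix.inv_def, Matrix.smul_apply, norm_smul, Ring.inverse_eq_inv', norm_inv,
      inv_mul_eq_div]
    have := norm_adjugate_sectionMatrix_le hc0 hc (norm_pairing_le hx hψ) N i j
    gcongr
  set B := sandwich (fun i : Fin N => x i) (fun i : Fin N => ψ i) G with hB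
  have hr : (1 + AN) * (1 - B) = 1 :=
    one_add_mul_one_sub_sandwich _ _ (Matrix.mul_nonsing_inv _ hdet)
  have hl : (1 - B) * (1 + AN) = 1 :=
    one_sub_sandwich_mul_one_add _ _ (Matrix.nonsing_inv_mul _ hdet)
  have hBn : ‖1 - B‖ ≤ C := by
    have h3 : ‖B‖ ≤ Real.exp (S ^ 2) / δ * S * S := by
      refine (norm_sandwich_le _ _ hGb).trans ?_
      have h4 : ∑ i : Fin N, ‖x i‖ ≤ S :=
        (Finset.sum_le_sum fun (i : Fin N) _ => hx i).trans (sum_fin_le_tsum hc0 hc N)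
      have h5 : ∑ i : Fin N, ‖ψ i‖ ≤ S :=
        (Finset.sum_le_sum fun (i : Fin N) _ => hψ i).trans (sum_fin_le_tsum hc0 hc N)
      have h6 : 0 ≤ ∑ i : Fin N, ‖ψ i‖ := Finset.sum_nonneg fun i _ => norm_nonneg _
      have h7 : 0 ≤ ∑ i : Fin N, ‖x i‖ := Finset.sum_nonneg fun i _ => norm_nonneg _
      gcongr
    have h4 : ‖(1 : H →L[ℂ] H)‖ ≤ 1 := ContinuousLinearMap.norm_id_le
    exact (norm_sub_le _ _).trans (by rw [hC]; linarith)
  have hu : IsUnit (1 + (1 - B) * (A - AN)) := by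
    have h3 : ‖-((1 - B) * (A - AN))‖ < 1 := by
      rw [norm_neg]
      refine (norm_mul_le _ _).trans_lt ?_
      calc ‖1 - B‖ * ‖A - AN‖ ≤ C * ‖A - AN‖ := by gcongr
        _ < C * C⁻¹ := by gcongr
        _ = 1 := mul_inv_cancel₀ hC0.ne'
    simpa using isUnit_one_sub_of_norm_lt_one h3
  have h3 : 1 + A = (1 + AN) * (1 + (1 - B) * (A - AN)) := by
    rw [mul_add, ← mul_assoc, hr]
    noncomm_ring
  rw [h3]
  exact IsUnit.mul ⟨⟨1 + AN, 1 - B, hr, hl⟩, rfl⟩ hu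

/-- If `1 + A` is invertible, then so are the late truncations, with bounded inverses `Q`. The
inverse of the section is `1 - ψ i (Q (x j))`, whose determinant is bounded by the row-sum estimate;
hence the determinants of the sections are bounded below, and so is their limit. -/
theorem infiniteDet_ne_zero_of_isUnit (hc : Summable c) (hx : ∀ n, ‖x n‖ ≤ c n)
    (hψ : ∀ n, ‖ψ n‖ ≤ c n) (hA : HasSum (fun n => (ψ n).smulRight (x n)) A)
    (hu : IsUnit (1 + A)) : infiniteDet (fun i j => ψ i (x j)) ≠ 0 := by
  have hc0 : ∀ i, 0 ≤ c i := fun i => (norm_nonneg _).trans (hx i)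
  set M : ℕ → ℕ → ℂ := fun i j => ψ i (x j)
  obtain ⟨u, hu⟩ := hu
  have h1 : Filter.Tendsto (fun N => Ring.inverse
      (1 + sumRankOne (fun i : Fin N => x i) (fun i : Fin N => ψ i))) Filter.atTop
      (𝓝 (Ring.inverse (1 + A))) := by
    have h2 := NormedRing.inverse_continuousAt u
    rw [hu] at h2
    exact h2.tendsto.comp ((tendsto_sumRankOne hA).const_add 1)
  set q := ‖Ring.inverse (1 + A)‖ + 1 with hq
  have h2 : ∀ᶠ N in Filter.atTop, ‖Ring.inverse
      (1 + sumRankOne (fun i : Fin N => x i) (fun i : Fin N => ψ i))‖ < q :=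
    h1.norm.eventually_lt_const (by rw [hq]; linarith)
  have h3 : ∀ᶠ N in Filter.atTop,
      IsUnit (1 + sumRankOne (fun i : Fin N => x i) (fun i : Fin N => ψ i)) := by
    have h4 := (tendsto_sumRankOne hA).const_add 1
    exact h4.eventually (Units.isOpen.mem_nhds ⟨u, hu⟩)
  set S := ∑' j, c j with hS
  have hS0 : 0 ≤ S := tsum_nonneg hc0
  have hq0 : 0 < q := by positivity
  have h4 : ∀ᶠ N in Filter.atTop, Real.exp (-(q * S * S)) ≤ ‖(sectionMatrix M N).det‖ := by
    filter_upwards [h2, h3] with N hN2 hN3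
    set Q := Ring.inverse (1 + sumRankOne (fun i : Fin N => x i) (fun i : Fin N => ψ i)) with hQ
    have h5 := one_add_matrix_mul_eq_one (fun i : Fin N => x i) (fun i : Fin N => ψ i) (Q := Q)
      (Ring.mul_inverse_cancel _ hN3)
    have h6 : (sectionMatrix M N).det *
        (1 - Matrix.of fun i j : Fin N => ψ i (Q (x j))).det = 1 := by
      rw [← Matrix.det_mul]
      erw [h5]
      exact Matrix.det_one
    have h7 : ‖(1 - Matrix.of fun i j : Fin N => ψ i (Q (x j))).det‖ ≤ Real.exp (q * S * S) := by
      refine (norm_det_le_exp _ (fun i : Fin N => c i * q * S) fun i => ?_).trans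
        (Real.exp_le_exp.2 ?_)
      · calc ∑ j, ‖(1 - Matrix.of fun i j : Fin N => ψ i (Q (x j))) i j‖
            ≤ ∑ j : Fin N, (‖(1 : Matrix (Fin N) (Fin N) ℂ) i j‖ + ‖ψ i (Q (x j))‖) :=
              Finset.sum_le_sum fun j _ => norm_sub_le _ _
          _ = 1 + ∑ j : Fin N, ‖ψ i (Q (x j))‖ := by
              rw [Finset.sum_add_distrib]
              congr 1
              rw [Finset.sum_eq_single i]
              · simp
              · intro j _ hj; simp [Matrix.one_apply_ne hj.symm]
              · simp
          _ ≤ 1 + ∑ j : Fin N, c i * q * c j := by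
              gcongr with j
              calc ‖ψ i (Q (x j))‖ ≤ ‖ψ i‖ * (‖Q‖ * ‖x j‖) :=
                    ((ψ i).le_opNorm _).trans (by gcongr; exact Q.le_opNorm _)
                _ ≤ c i * (q * c j) := by
                    have := hψ i
                    have := hx j
                    have := hc0 i
                    gcongr
                _ = c i * q * c j := by ring
          _ ≤ 1 + c i * q * S := by
              rw [← Finset.mul_sum]
              have := sum_fin_le_tsum hc0 hc N
              have := hc0 i
              gcongr
      · have h8 : ∑ i : Fin N, c i * q * S = (∑ i : Fin N, c i) * (q * S) := by
          rw [Finset.sum_mul]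
          exact Finset.sum_congr rfl fun i _ => by ring
        rw [h8]
        have := sum_fin_le_tsum hc0 hc N
        calc (∑ i : Fin N, c i) * (q * S) ≤ S * (q * S) := by gcongr
          _ = q * S * S := by ring
    have h9 := congrArg norm h6
    rw [norm_mul, norm_one] at h9
    rw [Real.exp_neg, inv_le_iff_one_le_mul₀ (Real.exp_pos _), ← h9]
    gcongr
  have h5 := le_of_tendsto_of_tendsto tendsto_const_nhds (tendsto_det hc hx hψ).norm h4
  exact norm_pos_iff.1 ((Real.exp_pos _).trans_le h5)

end Limit

/-- The determinant of an analytic family `1 + ∑ xₙ(p) ⊗ ψₙ(p)`. -/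
theorem exists_analytic_det [CompleteSpace H] {E : Type*} [NormedAddCommGroup E] [NormedSpace ℂ E]
    [FiniteDimensional ℂ E] {U : Set E} (hU : IsOpen U) {ι : Type*} [Countable ι]
    {x : ι → E → H} {ψ : ι → E → (H →L[ℂ] ℂ)}
    {A : E → (H →L[ℂ] H)} (hxa : ∀ i, AnalyticOnNhd ℂ (x i) U)
    (hψa : ∀ i, AnalyticOnNhd ℂ (ψ i) U) {c : ι → ℝ} (hc : Summable c)
    (hb : ∀ p ∈ U, ∃ s ∈ 𝓝 p, ∃ C : ℝ, ∀ q ∈ s, ∀ i, ‖x i q‖ ≤ C * c i ∧ ‖ψ i q‖ ≤ C * c i)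
    (hA : ∀ p ∈ U, HasSum (fun i => (ψ i p).smulRight (x i p)) (A p)) :
    ∃ d : E → ℂ, AnalyticOnNhd ℂ d U ∧ ∀ p ∈ U, d p ≠ 0 ↔ IsUnit (1 + A p) := by
  classical
  have := Encodable.ofCountable ι
  -- Natural numbers that encode no index receive zero vectors, functionals and bounds, which
  -- changes neither sums nor estimates.
  let e : ℕ → Option ι := Encodable.decode₂ ι
  let x' : ℕ → E → H := fun n => (e n).elim 0 x
  let ψ' : ℕ → E → (H →L[ℂ] ℂ) := fun n => (e n).elim 0 ψ
  let c' : ℕ → ℝ := fun n => (e n).elim 0 c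
  have hinj : Function.Injective (Encodable.encode : ι → ℕ) := Encodable.encode_injective
  have hnone : ∀ n ∉ Set.range (Encodable.encode : ι → ℕ), e n = none := by
    intro n hn
    by_contra h
    obtain ⟨i, hi⟩ := Option.ne_none_iff_exists'.1 h
    exact hn ⟨i, Encodable.decode₂_eq_some.1 hi⟩
  have hsome : ∀ i, e (Encodable.encode i) = some i := fun i => Encodable.encodek₂ i
  have hc' : Summable c' := by
    refine (hinj.summable_iff fun n hn => by simp [c', hnone n hn]).1 ?_
    refine hc.congr fun i => ?_
    simp [c', hsome]
  have hxa' : ∀ n, AnalyticOnNhd ℂ (x' n) U := by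
    intro n
    rcases h : e n with _ | i
    · simp only [x', h]
      exact fun _ _ => analyticAt_const
    · simpa [x', h] using hxa i
  have hψa' : ∀ n, AnalyticOnNhd ℂ (ψ' n) U := by
    intro n
    rcases h : e n with _ | i
    · simp only [ψ', h]
      exact fun _ _ => analyticAt_const
    · simpa [ψ', h] using hψa i
  have hb' : ∀ p ∈ U, ∃ s ∈ 𝓝 p, ∃ C : ℝ, ∀ q ∈ s, ∀ n,
      ‖x' n q‖ ≤ C * c' n ∧ ‖ψ' n q‖ ≤ C * c' n := by
    intro p hp
    obtain ⟨s, hs, C, hC⟩ := hb p hp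
    refine ⟨s, hs, C, fun q hq n => ?_⟩
    rcases h : e n with _ | i
    · simp [x', ψ', c', h]
    · simpa [x', ψ', c', h] using hC q hq i
  have hA' : ∀ p ∈ U, HasSum (fun n => (ψ' n p).smulRight (x' n p)) (A p) := by
    intro p hp
    refine (hinj.hasSum_iff fun n hn => by simp [x', ψ', hnone n hn]).1 ?_
    refine (hA p hp).congr_fun fun i => ?_
    simp [x', ψ', hsome]
  refine ⟨fun p => infiniteDet fun i j => ψ' i p (x' j p), ?_, fun p hp => ?_⟩
  · refine analyticOnNhd_of_tendsto hU
      (f := fun N p => (sectionMatrix (fun i j => ψ' i p (x' j p)) N).det) (fun N p hp => ?_)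
      fun p hp => ?_
    · have hent : ∀ i j, AnalyticAt ℂ (fun p => ψ' i p (x' j p)) p := fun i j =>
        ((ContinuousLinearMap.id ℂ (H →L[ℂ] ℂ)).analyticAt_bilinear (ψ' i p, x' j p)).comp₂
          (hψa' i p hp) (hxa' j p hp)
      simp only [Matrix.det_apply]
      refine Finset.analyticAt_fun_sum _ fun σ _ => ?_
      have h1 : AnalyticAt ℂ (fun p => ∏ i, sectionMatrix (fun i j => ψ' i p (x' j p)) N (σ i) i)
          p := by
        refine Finset.analyticAt_fun_prod _ fun i _ => ?_
        simp only [sectionMatrix, Matrix.add_apply, Matrix.of_apply]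
        exact analyticAt_const.add (hent _ _)
      rcases Int.units_eq_one_or (Equiv.Perm.sign σ) with h | h
      · simpa [h] using h1
      · refine h1.neg.congr (Filter.Eventually.of_forall fun q => ?_)
        simp [h]
    · obtain ⟨s, hs, C, hC⟩ := hb' p hp
      refine ⟨s, hs, tendstoUniformlyOn_det (b := fun n => |C * c' n|)
        (fun n => abs_nonneg _) (hc'.mul_left C).abs fun q hq i j => ?_⟩
      exact norm_pairing_le (c := fun n => |C * c' n|)
        (fun n => ((hC q hq n).1).trans (le_abs_self _))
        (fun n => ((hC q hq n).2).trans (le_abs_self _)) i j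
  · obtain ⟨s, hs, C, hC⟩ := hb' p hp
    have hps := mem_of_mem_nhds hs
    exact ⟨isUnit_one_add_of_infiniteDet_ne_zero (hc'.mul_left C) (fun n => (hC p hps n).1)
      (fun n => (hC p hps n).2) (hA' p hp),
      infiniteDet_ne_zero_of_isUnit (hc'.mul_left C) (fun n => (hC p hps n).1)
      (fun n => (hC p hps n).2) (hA' p hp)⟩

end Determinant

/-! ### Determinants for operators which are well approximable by operators of finite rank -/

section Approximable

variable {Y : Type*} [NormedAddCommGroup Y] [NormedSpace ℂ Y]
variable {H : Type*} [NormedAddCommGroup H] [InnerProductSpace ℂ H]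

/-- An orthonormal basis of the range decomposes `L` without any loss in norm that depends on the
rank. This is where the Hilbert structure of `H` is used. -/
theorem exists_rankOne_decomposition (L : Y →L[ℂ] H) [hfin : FiniteDimensional ℂ L.range] :
    ∃ (φ : Fin (Module.finrank ℂ L.range) → (Y →L[ℂ] ℂ))
      (y : Fin (Module.finrank ℂ L.range) → H),
      L = ∑ l, (φ l).smulRight (y l) ∧ (∀ l, ‖φ l‖ ≤ ‖L‖) ∧ ∀ l, ‖y l‖ ≤ 1 := by
  let b := stdOrthonormalBasis ℂ L.range
  refine ⟨fun l => (innerSL ℂ (b l : H)).comp L, fun l => b l, ?_, fun l => ?_, fun l => ?_⟩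
  · ext h
    have h1 := b.sum_repr' ⟨L h, LinearMap.mem_range_self _ h⟩
    have h2 := congrArg (Submodule.subtype _) h1
    simp only [map_sum, map_smul, Submodule.subtype_apply, Submodule.coe_inner] at h2
    simpa using h2.symm
  · refine (ContinuousLinearMap.opNorm_comp_le _ _).trans ?_
    rw [innerSL_apply_norm]
    have : ‖(b l : H)‖ = 1 := b.orthonormal.1 l
    rw [this, one_mul]
  · exact (b.orthonormal.1 l).le

theorem sum_pow_mul_sub_mul_pow {A : Type*} [Ring A] (a b : A) (m : ℕ) :
    ∑ i ∈ Finset.range m, a ^ i * (a - b) * b ^ (m - 1 - i) = a ^ m - b ^ m := by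
  have h : ∀ i ∈ Finset.range m, a ^ i * (a - b) * b ^ (m - 1 - i)
      = a ^ (i + 1) * b ^ (m - (i + 1)) - a ^ i * b ^ (m - i) := by
    intro i hi
    rw [Finset.mem_range] at hi
    have h1 : m - i = (m - 1 - i) + 1 := by omega
    have h2 : m - (i + 1) = m - 1 - i := by omega
    rw [h1, h2, pow_succ, pow_succ']
    noncomm_ring
  rw [Finset.sum_congr rfl h, Finset.sum_range_sub (fun i => a ^ i * b ^ (m - i))]
  simp

theorem opNorm_pow_le {R : H →L[ℂ] H} {B : ℝ} (h : ‖R‖ ≤ B) (i : ℕ) : ‖R ^ i‖ ≤ B ^ i := by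
  refine le_trans ?_ (pow_le_pow_left₀ (norm_nonneg _) h i)
  rcases Nat.eq_zero_or_pos i with rfl | hi
  · rw [pow_zero, pow_zero]
    exact ContinuousLinearMap.norm_id_le
  · exact norm_pow_le' _ hi

/-- Each factor `R` and the functional `φ` contribute one power of `2^{-k}`; the additional half in
the bound for `R`, which comes from the index `k + 1`, is given away. -/
theorem norm_comp_comp_pow_le {φ : Y →L[ℂ] ℂ} {S : H →L[ℂ] Y} {R : H →L[ℂ] H} {a s b : ℝ}
    {k j M : ℕ} (ha : 0 ≤ a) (hφ : ‖φ‖ ≤ a * (1 / 2) ^ k) (hS : ‖S‖ ≤ s)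
    (hR : ‖R‖ ≤ b * (1 / 2) ^ (k + 1)) (hb : a * s ≤ b) (hb1 : 1 ≤ b) (hj : j + 1 ≤ M) :
    ‖(φ.comp S).comp (R ^ j)‖ ≤ b ^ M * (1 / 2) ^ (k * (j + 1)) := by
  have hs : 0 ≤ s := (norm_nonneg S).trans hS
  have hR' : ‖R‖ ≤ b * (1 / 2) ^ k := by
    refine hR.trans ?_
    exact mul_le_mul_of_nonneg_left (pow_le_pow_of_le_one (by norm_num) (by norm_num)
      (Nat.le_succ k)) (by linarith)
  have h1 := opNorm_pow_le hR' j
  have h2 : ‖φ.comp S‖ ≤ b * (1 / 2) ^ k := by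
    calc ‖φ.comp S‖ ≤ ‖φ‖ * ‖S‖ := ContinuousLinearMap.opNorm_comp_le _ _
      _ ≤ (a * (1 / 2) ^ k) * s := mul_le_mul hφ hS (norm_nonneg _) (by positivity)
      _ = (a * s) * (1 / 2) ^ k := by ring
      _ ≤ _ := mul_le_mul_of_nonneg_right hb (by positivity)
  calc ‖(φ.comp S).comp (R ^ j)‖ ≤ ‖φ.comp S‖ * ‖R ^ j‖ := ContinuousLinearMap.opNorm_comp_le _ _
    _ ≤ (b * (1 / 2) ^ k) * (b * (1 / 2) ^ k) ^ j :=
        mul_le_mul h2 h1 (norm_nonneg _) (by positivity)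
    _ = b ^ (j + 1) * (1 / 2) ^ (k * (j + 1)) := by
        rw [← pow_succ', mul_pow, ← pow_mul]
    _ ≤ _ := mul_le_mul_of_nonneg_right (pow_le_pow_right₀ hb1 hj) (by positivity)

theorem norm_pow_apply_le {R : H →L[ℂ] H} {y : H} {b : ℝ} {k i M : ℕ}
    (hR : ‖R‖ ≤ b * (1 / 2) ^ k) (hy : ‖y‖ ≤ 1) (hb1 : 1 ≤ b) (hi : i ≤ M) :
    ‖(R ^ i) y‖ ≤ b ^ M * (1 / 2) ^ (k * i) := by
  calc ‖(R ^ i) y‖ ≤ ‖R ^ i‖ * ‖y‖ := (R ^ i).le_opNorm y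
    _ ≤ (b * (1 / 2) ^ k) ^ i * 1 :=
        mul_le_mul (opNorm_pow_le hR i) hy (norm_nonneg _) (by positivity)
    _ = b ^ i * (1 / 2) ^ (k * i) := by rw [mul_one, mul_pow, ← pow_mul]
    _ ≤ _ := mul_le_mul_of_nonneg_right (pow_le_pow_right₀ hb1 hi) (by positivity)

/-- In the `i`-th summand of the telescoped power the vector carries `i` factors `2^{-k}` and the
functional `2m - i`. The scalars here and in the next lemma redistribute them so that each carries
`m`. -/
theorem two_pow_rescale (B : ℝ) (k i m : ℕ) :
    2 ^ (k * i) * (2 ^ (k * m))⁻¹ * (B * (1 / 2) ^ (k * i)) = B * (1 / 2) ^ (k * m) := by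
  rw [one_div_pow, one_div_pow]
  field_simp

theorem two_pow_rescale' (B : ℝ) {k i j m : ℕ} (h : i + j = 2 * m) :
    2 ^ (k * m) * (2 ^ (k * i))⁻¹ * (B * (1 / 2) ^ (k * j)) = B * (1 / 2) ^ (k * m) := by
  have h1 : (2 : ℝ) ^ (k * i) * 2 ^ (k * j) = 2 ^ (k * m) * 2 ^ (k * m) := by
    rw [← pow_add, ← pow_add, ← mul_add, h]
    ring
  rw [one_div_pow, one_div_pow]
  field_simp
  linear_combination (-B) * h1

variable [CompleteSpace H]

/-- The operator `K = T ∘ S p` has approximation numbers decaying only like a power, so `1 + K`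
itself need not have a determinant, but `1 - K^{2m}` does for `m > β`. With remainders `R k` of `K`
after `k` approximations, `K^{2m}` is the telescoping sum of `R k ^ 2m - R (k+1) ^ 2m`. Each
difference expands into products with one factor of finite rank, hence into about `2^{βk}` rank-one
terms of size `2^{-2mk}`. Only `S` depends on the parameter, so a single determinant serves on the
whole of `U`. -/
theorem exists_det_of_approximable {E : Type*} [NormedAddCommGroup E] [NormedSpace ℂ E]
    [FiniteDimensional ℂ E] {U : Set E} (hU : IsOpen U) {T : Y →L[ℂ] H} {S : E → (H →L[ℂ] Y)}
    (hS : AnalyticOnNhd ℂ S U) {C : ℝ} {β D : ℕ} {A : ℕ → (Y →L[ℂ] H)}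
    (hA : ∀ k, ‖T - A k‖ ≤ C * (1 / 2) ^ k)
    (hfin : ∀ k, FiniteDimensional ℂ (A k).range)
    (hrank : ∀ k, Module.finrank ℂ (A k).range ≤ D * 2 ^ (β * k)) :
    ∃ d : E → ℂ, AnalyticOnNhd ℂ d U ∧ ∀ p ∈ U,
      (d p ≠ 0 → IsUnit (1 + T.comp (S p))) ∧ (‖T.comp (S p)‖ < 1 → d p ≠ 0) := by
  -- Remainders, shifted by one so that the remainder of index `0` is `T` itself; consecutive
  -- differences have finite rank.
  set Tt : ℕ → (Y →L[ℂ] H) := fun k => k.casesOn T fun k => T - A k with hTt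
  set L : ℕ → (Y →L[ℂ] H) := fun k => Tt k - Tt (k + 1) with hL
  set r : ℕ → ℕ := fun k => Module.finrank ℂ (L k).range with hr
  have hrange : ∀ k, L (k + 1) = A (k + 1) - A k := fun k => by simp [hL, hTt]
  have hle : ∀ k, (L (k + 1)).range ≤ (A (k + 1)).range ⊔ (A k).range := by
    intro k
    rw [hrange]
    rintro _ ⟨y, rfl⟩
    exact Submodule.sub_mem_sup ⟨y, rfl⟩ ⟨y, rfl⟩
  have hL0 : L 0 = A 0 := by simp [hL, hTt]
  have hLfin : ∀ k, FiniteDimensional ℂ (L k).range := by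
    intro k
    rcases k with _ | k
    · rw [hL0]; exact hfin 0
    · have := hfin k
      have := hfin (k + 1)
      exact Submodule.finiteDimensional_of_le (hle k)
  have hrk : ∀ k, r k ≤ 2 * D * 2 ^ (β * k) := by
    intro k
    rcases k with _ | k
    · have := hrank 0
      have h0 : r 0 = Module.finrank ℂ (A 0).range := by simp only [hr]; rw [hL0]
      rw [h0]
      simp only [mul_zero, pow_zero, mul_one] at this ⊢
      omega
    · have := hfin k
      have := hfin (k + 1)
      have h1 : r (k + 1) ≤ _ := Submodule.finrank_mono (hle k)
      have h2 := Submodule.finrank_add_le_finrank_add_finrank (A (k + 1)).range (A k).range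
      have h3 := hrank k
      have h4 := hrank (k + 1)
      have h5 : 2 ^ (β * k) ≤ 2 ^ (β * (k + 1)) := Nat.pow_le_pow_right two_pos (by gcongr; omega)
      have h6 : D * 2 ^ (β * k) ≤ D * 2 ^ (β * (k + 1)) := Nat.mul_le_mul_left _ h5
      calc r (k + 1) ≤ D * 2 ^ (β * (k + 1)) + D * 2 ^ (β * (k + 1)) := by omega
        _ = _ := by ring
  set C' := max ‖T‖ (2 * C) with hC'
  have hC'0 : 0 ≤ C' := (norm_nonneg T).trans (le_max_left _ _)
  have hTn : ∀ k, ‖Tt k‖ ≤ C' * (1 / 2) ^ k := by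
    intro k
    rcases k with _ | k
    · rw [pow_zero, mul_one]
      exact le_max_left ‖T‖ (2 * C)
    · have h1 : C * (1 / 2) ^ k = 2 * C * (1 / 2) ^ (k + 1) := by ring
      refine ((hA k).trans h1.le).trans ?_
      gcongr
      exact le_max_right _ _
  have hLn : ∀ k, ‖L k‖ ≤ 2 * C' * (1 / 2) ^ k := by
    intro k
    have h1 := hTn (k + 1)
    have h2 : C' * (1 / 2) ^ (k + 1) ≤ C' * (1 / 2) ^ k := by
      rw [pow_succ]
      have : 0 ≤ C' * (1 / 2 : ℝ) ^ k := by positivity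
      linarith
    exact (norm_sub_le _ _).trans (by linarith [hTn k])
  choose φ y hφy hφ hy using fun k => @exists_rankOne_decomposition _ _ _ _ _ _ (L k) (hLfin k)
  set R : ℕ → E → (H →L[ℂ] H) := fun k p => (Tt k).comp (S p) with hR
  have hRa : ∀ k, AnalyticOnNhd ℂ (R k) U := fun k p hp =>
    (((ContinuousLinearMap.compL ℂ H Y H) (Tt k)).analyticAt _).comp (hS p hp)
  have hRpow : ∀ k i, AnalyticOnNhd ℂ (fun p => R k p ^ i) U := fun k i p hp => (hRa k p hp).pow i
  -- With `m' = β + 1` the number `2^{βk}` of terms times their size `2^{-km'}` is at most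
  -- geometric. The exponent `2 * m'` is even, so that the powers of two can be shared equally and
  -- `(-K)^{2m'} = K^{2m'}`.
  set m' := β + 1 with hm'
  let ι := Σ k : ℕ, Fin (2 * m') × Fin (r k)
  let x : ι → E → H := fun α p =>
    -(((2 : ℂ) ^ (α.1 * α.2.1) * ((2 : ℂ) ^ (α.1 * m'))⁻¹) • (R α.1 p ^ (α.2.1 : ℕ)) (y α.1 α.2.2))
  let ψ : ι → E → (H →L[ℂ] ℂ) := fun α p =>
    ((2 : ℂ) ^ (α.1 * m') * ((2 : ℂ) ^ (α.1 * α.2.1))⁻¹) •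
      ((φ α.1 α.2.2).comp (S p)).comp (R (α.1 + 1) p ^ (2 * m' - 1 - α.2.1))
  let c : ι → ℝ := fun α => (1 / 2) ^ (α.1 * m')
  have hprod : ∀ (α : ι) p, (ψ α p).smulRight (x α p) =
      -(R α.1 p ^ (α.2.1 : ℕ) * (((φ α.1 α.2.2).smulRight (y α.1 α.2.2)).comp (S p)) *
        R (α.1 + 1) p ^ (2 * m' - 1 - α.2.1)) := by
    intro α p
    ext h
    simp only [x, ψ, ContinuousLinearMap.smulRight_apply, smul_apply,
        ContinuousLinearMap.comp_apply,
      neg_apply, mul_apply_eq_comp, map_smul, smul_neg, smul_smul, smul_eq_mul]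
    congr 2
    field_simp
  have hfib : ∀ k p, ∑ a : Fin (2 * m') × Fin (r k), (ψ ⟨k, a⟩ p).smulRight (x ⟨k, a⟩ p)
      = -(R k p ^ (2 * m') - R (k + 1) p ^ (2 * m')) := by
    intro k p
    simp only [hprod]
    rw [Finset.sum_neg_distrib, Fintype.sum_prod_type, ← sum_pow_mul_sub_mul_pow,
      Finset.sum_range]
    congr 1
    refine Finset.sum_congr rfl fun i _ => ?_
    have h1 : R k p - R (k + 1) p = ∑ l, ((φ k l).smulRight (y k l)).comp (S p) := by
      simp only [hR]
      rw [← ContinuousLinearMap.sub_comp]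
      refine (congrArg (fun Q => Q.comp (S p)) (hφy k)).trans ?_
      ext h
      simp
    rw [h1, Finset.mul_sum, Finset.sum_mul]
  have hcs : Summable c := by
    refine (summable_sigma_of_nonneg fun α => by positivity).2 ⟨fun k => Summable.of_finite, ?_⟩
    refine Summable.of_nonneg_of_le (fun k => tsum_nonneg fun _ => by positivity) (fun k => ?_)
      ((summable_geometric_of_lt_one (r := (1 / 2 : ℝ)) (by norm_num) (by norm_num)).mul_left
        (2 * m' * (2 * D) : ℝ))
    rw [tsum_fintype]
    simp only [c, Finset.sum_const, Finset.card_univ, Fintype.card_prod, Fintype.card_fin,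
      nsmul_eq_mul]
    have h1 : (r k : ℝ) ≤ 2 * D * 2 ^ (β * k) := by exact_mod_cast hrk k
    push_cast
    calc (2 * m' * r k : ℝ) * (1 / 2) ^ (k * m')
        ≤ (2 * m' * (2 * D * 2 ^ (β * k))) * (1 / 2) ^ (k * m') := by gcongr
      _ = 2 * m' * (2 * D) * (2 ^ (β * k) * (1 / 2) ^ (β * k)) * (1 / 2) ^ k := by
          rw [hm', mul_add, mul_one, pow_add, mul_comm k β]; push_cast; ring
      _ = _ := by rw [← mul_pow]; norm_num
  have hbd : ∀ p ∈ U, ∃ s ∈ 𝓝 p, ∃ B : ℝ, ∀ q ∈ s, (∀ k, ‖R k q‖ ≤ B * (1 / 2) ^ k) ∧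
      ∀ i, ‖x i q‖ ≤ B * c i ∧ ‖ψ i q‖ ≤ B * c i := by
    intro p hp
    have hcS : ContinuousAt S p := (hS p hp).continuousAt
    refine ⟨{q | ‖S q‖ < ‖S p‖ + 1}, hcS.norm.eventually_lt_const (by linarith), ?_⟩
    -- The summand `1` makes all powers of `b` up to the exponent `2 * m'` bounded by the last one.
    set b := 1 + 2 * C' * (‖S p‖ + 1) with hb
    have hb1 : 1 ≤ b := by rw [hb]; linarith [show 0 ≤ 2 * C' * (‖S p‖ + 1) by positivity]
    refine ⟨b ^ (2 * m'), fun q hq => ?_⟩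
    have hq' : ‖S q‖ ≤ ‖S p‖ + 1 := le_of_lt hq
    have hRq : ∀ k, ‖R k q‖ ≤ b * (1 / 2) ^ k := by
      intro k
      calc ‖R k q‖ ≤ ‖Tt k‖ * ‖S q‖ := ContinuousLinearMap.opNorm_comp_le _ _
        _ ≤ (C' * (1 / 2) ^ k) * (‖S p‖ + 1) := by gcongr; exact hTn k
        _ = (C' * (‖S p‖ + 1)) * (1 / 2) ^ k := by ring
        _ ≤ b * (1 / 2) ^ k := by
          gcongr
          rw [hb]; linarith [show 0 ≤ C' * (‖S p‖ + 1) by positivity]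
    refine ⟨fun k => (hRq k).trans ?_, fun α => ⟨?_, ?_⟩⟩
    · gcongr
      exact le_self_pow₀ hb1 (by omega)
    · obtain ⟨k, i, l⟩ := α
      simp only [x, c, norm_neg, norm_smul, norm_mul, norm_pow, norm_inv, Complex.norm_ofNat]
      refine le_trans ?_ (two_pow_rescale (b ^ (2 * m')) k i m').le
      exact mul_le_mul_of_nonneg_left (norm_pow_apply_le (hRq k) (hy k l) hb1 i.2.le)
        (by positivity)
    · obtain ⟨k, i, l⟩ := α
      simp only [ψ, c, norm_smul, norm_mul, norm_pow, norm_inv, Complex.norm_ofNat]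
      have hi : (i : ℕ) + ((2 * m' - 1 - i) + 1) = 2 * m' := by have := i.2; omega
      refine le_trans ?_ (two_pow_rescale' (b ^ (2 * m')) hi).le
      exact mul_le_mul_of_nonneg_left (norm_comp_comp_pow_le (a := 2 * C') (by positivity)
        ((hφ k l).trans (hLn k)) hq' (hRq (k + 1)) (by rw [hb]; linarith) hb1 (by omega))
        (by positivity)
  have hxa : ∀ α, AnalyticOnNhd ℂ (x α) U := by
    intro α p hp
    have h1 : AnalyticAt ℂ (fun p => (R α.1 p ^ (α.2.1 : ℕ)) (y α.1 α.2.2)) p :=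
      ((ContinuousLinearMap.apply ℂ H (y α.1 α.2.2)).analyticAt _).comp (hRpow α.1 α.2.1 p hp)
    exact (h1.const_smul).neg
  have hψa : ∀ α, AnalyticOnNhd ℂ (ψ α) U := by
    intro α p hp
    have h1 : AnalyticAt ℂ (fun p => (φ α.1 α.2.2).comp (S p)) p :=
      (((ContinuousLinearMap.compL ℂ H Y ℂ) (φ α.1 α.2.2)).analyticAt _).comp (hS p hp)
    have h2 : AnalyticAt ℂ (fun p => ((φ α.1 α.2.2).comp (S p)).comp
        (R (α.1 + 1) p ^ (2 * m' - 1 - α.2.1))) p :=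
      ((ContinuousLinearMap.compL ℂ H H ℂ).analyticAt_bilinear _).comp₂ h1
        (hRpow (α.1 + 1) _ p hp)
    have h3 : AnalyticAt ℂ (fun _ : E => (2 : ℂ) ^ (α.1 * m') *
        ((2 : ℂ) ^ (α.1 * (α.2.1 : ℕ)))⁻¹) p := analyticAt_const
    exact h3.smul h2
  have hbd' : ∀ p ∈ U, ∃ s ∈ 𝓝 p, ∃ B : ℝ, ∀ q ∈ s, ∀ i,
      ‖x i q‖ ≤ B * c i ∧ ‖ψ i q‖ ≤ B * c i := by
    intro p hp
    obtain ⟨s, hs, B, hB⟩ := hbd p hp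
    exact ⟨s, hs, B, fun q hq => (hB q hq).2⟩
  have hsumA : ∀ p ∈ U, HasSum (fun i => (ψ i p).smulRight (x i p))
      (-(T.comp (S p)) ^ (2 * m')) := by
    intro p hp
    obtain ⟨s, hs, B, hB⟩ := hbd p hp
    have hps := hB p (mem_of_mem_nhds hs)
    have hB0 : 0 ≤ B := by
      have := (norm_nonneg _).trans (hps.1 0)
      simpa using this
    have hcc : ∀ α, 0 ≤ c α := fun α => by positivity
    have hc1 : ∀ α, c α ≤ 1 := fun α => pow_le_one₀ (by norm_num) (by norm_num)
    have hsum : Summable fun α : ι => (ψ α p).smulRight (x α p) := by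
      refine Summable.of_norm_bounded (hcs.mul_left (B * B)) fun α => ?_
      rw [ContinuousLinearMap.norm_smulRight_apply]
      calc ‖ψ α p‖ * ‖x α p‖ ≤ (B * c α) * (B * 1) :=
            mul_le_mul (hps.2 α).2 ((hps.2 α).1.trans (by gcongr; exact hc1 α)) (norm_nonneg _)
              (mul_nonneg hB0 (hcc α))
        _ = B * B * c α := by ring
    have hsum2 := hsum.sigma
    have hfibsum : ∀ k, HasSum (fun a => (ψ ⟨k, a⟩ p).smulRight (x ⟨k, a⟩ p))
        (-(R k p ^ (2 * m') - R (k + 1) p ^ (2 * m'))) := by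
      intro k
      rw [← hfib k p]
      exact hasSum_fintype _
    refine HasSum.sigma_of_hasSum (g := fun k => -(R k p ^ (2 * m') - R (k + 1) p ^ (2 * m')))
      ?_ hfibsum hsum
    have h1 : Summable fun k => -(R k p ^ (2 * m') - R (k + 1) p ^ (2 * m')) :=
      hsum2.congr fun k => (hfibsum k).tsum_eq
    rw [h1.hasSum_iff_tendsto_nat]
    have h2 : Filter.Tendsto (fun k => R k p) Filter.atTop (𝓝 0) := by
      refine squeeze_zero_norm hps.1 ?_
      have := (tendsto_pow_atTop_nhds_zero_of_lt_one (r := (1 / 2 : ℝ)) (by norm_num)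
        (by norm_num)).const_mul B
      simpa using this
    have h3 := (h2.pow (2 * m'))
    rw [zero_pow (by omega)] at h3
    have h4 := h3.sub_const (R 0 p ^ (2 * m'))
    rw [zero_sub] at h4
    refine h4.congr fun N => ?_
    have := Finset.sum_range_sub (fun k => R k p ^ (2 * m')) N
    rw [← this]
    refine Finset.sum_congr rfl fun k _ => ?_
    rw [neg_sub]
  obtain ⟨d, hd, hdu⟩ := exists_analytic_det hU (A := fun p => -(T.comp (S p)) ^ (2 * m'))
    hxa hψa hcs hbd' hsumA
  refine ⟨d, hd, fun p hp => ⟨fun h => ?_, fun h => ?_⟩⟩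
  · have h1 := (hdu p hp).1 h
    set K := T.comp (S p)
    -- The geometric sum for `-K`. The factors commute, so invertibility of the product gives
    -- invertibility of `1 + K`; the converse can fail, so `d` may also vanish where `1 + K` is
    -- invertible.
    have h2 : 1 + -K ^ (2 * m') = (1 + K) * ∑ i ∈ Finset.range (2 * m'), (-K) ^ i := by
      have := mul_neg_geom_sum (-K) (2 * m')
      rw [sub_neg_eq_add, Even.neg_pow (even_two_mul m')] at this
      rw [this, sub_eq_add_neg]
    have h3 : Commute (1 + K) (∑ i ∈ Finset.range (2 * m'), (-K) ^ i) :=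
      Commute.sum_right _ _ _ fun i _ =>
        ((Commute.one_left _).add_left (Commute.refl K)).neg_right.pow_right i
    rw [h2] at h1
    exact (h3.isUnit_mul_iff.1 h1).1
  · refine (hdu p hp).2 ?_
    have h1 : ‖(T.comp (S p)) ^ (2 * m')‖ < 1 :=
      (norm_pow_le' _ (by omega)).trans_lt (pow_lt_one₀ (norm_nonneg _) h (by omega))
    simpa [sub_eq_add_neg] using isUnit_one_sub_of_norm_lt_one h1

end Approximable

/-! ### The space `L²(ℝⁿ)` -/

section LTwo

variable {n : ℕ}

/-- The unweighted space `L²(ℝⁿ)`. -/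
abbrev L2 (n : ℕ) : Type := Lp ℂ 2 (volume : Measure (RSpace n))

theorem IsTest.toSchwartz_ofReal {g : RSpace n → ℝ} (hg : ContDiff ℝ ∞ g)
    (hc : HasCompactSupport g) :
    ∃ G : SchwartzMap (RSpace n) ℂ, ∀ x, G x = (g x : ℂ) := by
  have h1 : HasCompactSupport (fun x => (g x : ℂ)) :=
    hc.comp_left (g := fun t : ℝ => (t : ℂ)) (by simp)
  have h2 : ContDiff ℝ ∞ (fun x => (g x : ℂ)) := Complex.ofRealCLM.contDiff.comp hg
  exact ⟨h1.toSchwartzMap h2, fun x => rfl⟩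

/-- On `L¹ ∩ L²` the Fourier transform of `L²` is given by the Fourier integral. -/
theorem coeFn_fourier {f : RSpace n → ℂ} (h1 : Integrable f volume) (h2 : MemLp f 2 volume) :
    ((𝓕 (h2.toLp f) : L2 n) : RSpace n → ℂ) =ᵐ[volume] 𝓕 f := by
  have hcont : Continuous (𝓕 f) :=
    VectorFourier.fourierIntegral_continuous Real.continuous_fourierChar continuous_inner h1
  refine ae_eq_of_integral_contDiff_smul_eq
    ((Lp.memLp _).locallyIntegrable (by norm_num)) hcont.locallyIntegrable ?_
  intro g hg hc
  obtain ⟨G, hG⟩ := IsTest.toSchwartz_ofReal hg hc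
  have e1 := congrArg (fun T : TemperedDistribution (RSpace n) ℂ => T G)
    (Lp.fourier_toTemperedDistribution_eq (h2.toLp f))
  simp only [TemperedDistribution.fourier_apply, Lp.toTemperedDistribution_apply] at e1
  have e2 : ∫ x, g x • (𝓕 (h2.toLp f) : L2 n) x = ∫ x, G x • (𝓕 (h2.toLp f) : L2 n) x := by
    congr 1; ext x; rw [hG]; simp
  have e3 : ∫ x, (𝓕 G) x • (h2.toLp f) x = ∫ x, (𝓕 (G : RSpace n → ℂ)) x • f x := by
    refine integral_congr_ae ?_
    filter_upwards [h2.coeFn_toLp] with x hx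
    rw [hx, SchwartzMap.fourier_coe]
  have e4 :=
      VectorFourier.integral_fourierIntegral_smul_eq_flip (μ := (volume : Measure (RSpace n)))
    (ν := (volume : Measure (RSpace n))) (L := innerₗ (RSpace n)) (f := (G : RSpace n → ℂ)) (g := f)
    Real.continuous_fourierChar continuous_inner G.integrable h1
  rw [e2, ← e1, e3]
  refine (Eq.trans e4 ?_)
  rw [flip_innerₗ]
  congr 1; ext x; rw [hG, Complex.real_smul, smul_eq_mul]; rfl

/-- Multiplication by a bounded function, as an operator on `L²(ℝⁿ)`. -/
def mulL (n : ℕ) : Lp ℂ ∞ (volume : Measure (RSpace n)) →L[ℂ] L2 n →L[ℂ] L2 n :=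
  (ContinuousLinearMap.mul ℂ ℂ).holderL volume ∞ 2 2

theorem coeFn_mulL (m : Lp ℂ ∞ (volume : Measure (RSpace n))) (f : L2 n) :
    (mulL n m f : RSpace n → ℂ) =ᵐ[volume] fun x => m x * f x :=
  (ContinuousLinearMap.mul ℂ ℂ).coeFn_holder m f

theorem norm_mulL_le (m : Lp ℂ ∞ (volume : Measure (RSpace n))) : ‖mulL n m‖ ≤ ‖m‖ := by
  have h : ‖mulL n‖ ≤ 1 :=
    ((ContinuousLinearMap.mul ℂ ℂ).norm_holderL_le).trans (ContinuousLinearMap.opNorm_mul_le ℂ ℂ)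
  calc ‖mulL n m‖ ≤ ‖mulL n‖ * ‖m‖ := (mulL n).le_opNorm m
    _ ≤ 1 * ‖m‖ := by gcongr
    _ = ‖m‖ := one_mul _

theorem exp_neg_mul_exp (γ t : ℝ) (a : ℂ) :
    (Real.exp (-(γ * t)) : ℂ) * ((Real.exp (γ * t) : ℂ) * a) = a := by
  rw [← mul_assoc, ← Complex.ofReal_mul, ← Real.exp_add]
  simp

theorem exp_mul_exp_neg (γ t : ℝ) (a : ℂ) :
    (Real.exp (γ * t) : ℂ) * ((Real.exp (-(γ * t)) : ℂ) * a) = a := by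
  rw [← mul_assoc, ← Complex.ofReal_mul, ← Real.exp_add]
  simp

theorem memLp_exp_mul {γ : ℝ} (g : L2 n) :
    MemLp (fun w => (Real.exp (γ * ‖w‖) : ℂ) * g w) 2 (expMeasure n γ) := by
  refine memLp_of_weight ?_ ?_
  · exact (by fun_prop : Continuous fun w : RSpace n =>
      (Real.exp (γ * ‖w‖) : ℂ)).aestronglyMeasurable.mul (Lp.memLp g).1
  · refine (Lp.memLp g).ae_eq (Filter.Eventually.of_forall fun w => ?_)
    exact (exp_neg_mul_exp γ ‖w‖ (g w)).symm

/-- Multiplication by `e^{-γ|w|}` as an isometry `e^{γ|w|}L² → L²`. -/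
def weightEquiv (n : ℕ) (γ : ℝ) : ExpL2 n γ ≃ₗᵢ[ℂ] L2 n where
  toFun u := (memLp_weight (Lp.memLp u)).toLp (fun w => (Real.exp (-(γ * ‖w‖)) : ℂ) * u w)
  map_add' u v := by
    rw [← MemLp.toLp_add, MemLp.toLp_eq_toLp_iff]
    filter_upwards [(ac_expMeasure n γ).ae_le (Lp.coeFn_add u v)] with w hw
    rw [hw, Pi.add_apply, Pi.add_apply, mul_add]
  map_smul' c u := by
    rw [RingHom.id_apply, ← MemLp.toLp_const_smul, MemLp.toLp_eq_toLp_iff]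
    filter_upwards [(ac_expMeasure n γ).ae_le (Lp.coeFn_smul c u)] with w hw
    rw [hw, Pi.smul_apply, Pi.smul_apply, smul_eq_mul, smul_eq_mul, mul_left_comm]
  invFun g := (memLp_exp_mul g).toLp (fun w => (Real.exp (γ * ‖w‖) : ℂ) * g w)
  left_inv u := by
    rw [Lp.ext_iff]
    refine (MemLp.coeFn_toLp _).trans ?_
    filter_upwards [(expMeasure_ac n γ).ae_le (memLp_weight (Lp.memLp u)).coeFn_toLp] with w hw
    rw [hw, exp_mul_exp_neg]
  right_inv g := by
    rw [Lp.ext_iff]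
    refine (MemLp.coeFn_toLp _).trans ?_
    filter_upwards [(ac_expMeasure n γ).ae_le (memLp_exp_mul (γ := γ) g).coeFn_toLp] with w hw
    rw [hw, exp_neg_mul_exp]
  norm_map' u := by
    change ‖(memLp_weight (Lp.memLp u)).toLp _‖ = ‖u‖
    rw [Lp.norm_toLp, Lp.norm_def, eLpNorm_expMeasure]

theorem coeFn_weightEquiv {γ : ℝ} (u : ExpL2 n γ) :
    (weightEquiv n γ u : RSpace n → ℂ) =ᵐ[volume] fun w => (Real.exp (-(γ * ‖w‖)) : ℂ) * u w :=
  (memLp_weight (Lp.memLp u)).coeFn_toLp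

theorem coeFn_weightEquiv_symm {γ : ℝ} (g : L2 n) :
    ((weightEquiv n γ).symm g : RSpace n → ℂ) =ᵐ[volume]
      fun w => (Real.exp (γ * ‖w‖) : ℂ) * g w :=
  (ac_expMeasure n γ).ae_le (memLp_exp_mul g).coeFn_toLp

end LTwo

/-! ### Fourier transforms along complex contours -/

section ContourFourier

variable {n : ℕ}

theorem norm_toLp_top_le {f : RSpace n → ℂ} {C : ℝ} (hC0 : 0 ≤ C)
    (hf : MemLp f ∞ (volume : Measure (RSpace n))) (hC : ∀ x, ‖f x‖ ≤ C) : ‖hf.toLp f‖ ≤ C := by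
  rw [Lp.norm_toLp, eLpNorm_exponent_top]
  refine ENNReal.toReal_le_of_le_ofReal hC0 ?_
  exact eLpNormEssSup_le_of_ae_bound (Filter.Eventually.of_forall hC)

theorem memLp_exp_neg {δ : ℝ} (hδ : 0 < δ) :
    MemLp (fun w : RSpace n => Real.exp (-(δ * ‖w‖))) 2 volume := by
  have h := memLp_weight (memLp_one (n := n) hδ)
  have h2 := h.norm
  refine h2.ae_eq (Filter.Eventually.of_forall fun w => ?_)
  simp only [mul_one, Complex.norm_real]
  exact Real.norm_of_nonneg (Real.exp_pos _).le

theorem integrable_exp_neg_mul {δ : ℝ} (hδ : 0 < δ) (g : L2 n) :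
    Integrable (fun w => Real.exp (-(δ * ‖w‖)) * ‖g w‖) volume :=
  (memLp_exp_neg hδ).integrable_mul (Lp.memLp g).norm

theorem integral_exp_neg_mul_le {δ : ℝ} (hδ : 0 < δ) :
    ∃ C : ℝ, 0 ≤ C ∧ ∀ g : L2 n, ∫ w, Real.exp (-(δ * ‖w‖)) * ‖g w‖ ≤ C * ‖g‖ := by
  let E : Lp ℝ 2 (volume : Measure (RSpace n)) := (memLp_exp_neg hδ).toLp _
  let Λ := (ContinuousLinearMap.mul ℝ ℝ).lpPairing (volume : Measure (RSpace n)) 2 2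
  refine ⟨‖Λ E‖, norm_nonneg _, fun g => ?_⟩
  have h1 := ContinuousLinearMap.lpPairing_eq_integral (μ := (volume : Measure (RSpace n)))
    (p := 2) (q := 2) (ContinuousLinearMap.mul ℝ ℝ) E ((Lp.memLp g).norm.toLp _)
  have h2 : ∫ w, Real.exp (-(δ * ‖w‖)) * ‖g w‖ = Λ E ((Lp.memLp g).norm.toLp _) := by
    rw [h1]
    refine integral_congr_ae ?_
    filter_upwards [(memLp_exp_neg (n := n) hδ).coeFn_toLp, (Lp.memLp g).norm.coeFn_toLp]
      with w hw1 hw2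
    simp only [E, hw1, hw2, ContinuousLinearMap.mul_apply']
  rw [h2]
  refine (le_abs_self _).trans ?_
  refine ((Λ E).le_opNorm _).trans_eq ?_
  congr 1
  rw [Lp.norm_toLp, eLpNorm_norm, Lp.norm_def]

theorem pow_mul_exp_neg_le {δ t : ℝ} (hδ : 0 < δ) (ht : 0 ≤ t) (k : ℕ) :
    t ^ k * Real.exp (-(δ * t)) ≤ k.factorial / δ ^ k := by
  have h := Real.pow_div_factorial_le_exp (δ * t) (by positivity) k
  rw [div_le_iff₀ (by positivity), mul_pow] at h
  rw [Real.exp_neg, ← div_eq_mul_inv, div_le_div_iff₀ (Real.exp_pos _) (by positivity)]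
  linarith

/-- The Fourier transform along the contour `2πξ + i η(ξ)`, of the function `e^{-γ|w|} g(w)`. -/
def contourFourier (γ : ℝ) (η : RSpace n → RSpace n) (g : RSpace n → ℂ) (ξ : RSpace n) : ℂ :=
  ∫ w, Complex.exp ((-2 * Real.pi * inner ℝ w ξ : ℝ) * Complex.I + (inner ℝ (η ξ) w : ℝ)) *
    ((Real.exp (-(γ * ‖w‖)) : ℂ) * g w)

theorem norm_contourKernel_le {γ c : ℝ} {e ξ w : RSpace n} (he : ‖e‖ ≤ c) (a : ℂ) :
    ‖Complex.exp ((-2 * Real.pi * inner ℝ w ξ : ℝ) * Complex.I + (inner ℝ e w : ℝ)) *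
      ((Real.exp (-(γ * ‖w‖)) : ℂ) * a)‖ ≤ Real.exp (-((γ - c) * ‖w‖)) * ‖a‖ := by
  have h1 : inner ℝ e w ≤ c * ‖w‖ := (real_inner_le_norm e w).trans (by gcongr)
  rw [norm_mul, Complex.norm_exp, norm_mul, Complex.norm_real,
    Real.norm_of_nonneg (Real.exp_pos _).le, ← mul_assoc, ← Real.exp_add]
  gcongr
  simp
  linarith

theorem norm_contourFourier_le {γ c : ℝ} (hc : c < γ) :
    ∃ C : ℝ, 0 ≤ C ∧ ∀ η : RSpace n → RSpace n, (∀ ξ, ‖η ξ‖ ≤ c) → ∀ (g : L2 n) (ξ : RSpace n),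
      ‖contourFourier γ η g ξ‖ ≤ C * ‖g‖ := by
  obtain ⟨C, hC0, hC⟩ := integral_exp_neg_mul_le (n := n) (sub_pos.2 hc)
  refine ⟨C, hC0, fun η hη g ξ => le_trans ?_ (hC g)⟩
  exact norm_integral_le_of_norm_le (integrable_exp_neg_mul (sub_pos.2 hc) g)
    (Filter.Eventually.of_forall fun w => norm_contourKernel_le (hη ξ) (g w))

theorem coeFn_Lp_sum {ι : Type*} (s : Finset ι) (f : ι → L2 n) :
    ((∑ i ∈ s, f i : L2 n) : RSpace n → ℂ) =ᵐ[volume] fun x => ∑ i ∈ s, f i x := by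
  classical
  induction s using Finset.induction_on with
  | empty =>
    simp only [Finset.sum_empty]
    exact Lp.coeFn_zero ℂ 2 volume
  | insert a s ha ih =>
    rw [Finset.sum_insert ha]
    filter_upwards [Lp.coeFn_add (f a) (∑ i ∈ s, f i), ih] with x h1 h2
    rw [h1, Pi.add_apply, h2, Finset.sum_insert ha]

theorem exists_coord_le (w : RSpace n) (j : Fin n) : ‖w j‖ ≤ ‖w‖ := PiLp.norm_apply_le w j

theorem memLp_coordWeight {γ : ℝ} (hγ : 0 < γ) {k : ℕ} (J : Fin k → Fin n) :
    MemLp (fun w : RSpace n => ((∏ i, w (J i) : ℝ) : ℂ) * (Real.exp (-(γ * ‖w‖)) : ℂ)) ∞ volume ∧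
    ∀ w : RSpace n, ‖((∏ i, w (J i) : ℝ) : ℂ) * (Real.exp (-(γ * ‖w‖)) : ℂ)‖
      ≤ k.factorial / γ ^ k := by
  have h : ∀ w : RSpace n, ‖((∏ i, w (J i) : ℝ) : ℂ) * (Real.exp (-(γ * ‖w‖)) : ℂ)‖
      ≤ k.factorial / γ ^ k := by
    intro w
    rw [norm_mul, Complex.norm_real, Complex.norm_real, Real.norm_of_nonneg (Real.exp_pos _).le,
      norm_prod]
    refine le_trans ?_ (pow_mul_exp_neg_le hγ (norm_nonneg w) k)
    gcongr
    refine (Finset.prod_le_prod (fun i _ => norm_nonneg _)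
      (fun i _ => exists_coord_le w (J i))).trans_eq ?_
    simp
  refine ⟨memLp_top_of_bound ?_ _ (Filter.Eventually.of_forall h), h⟩
  exact Continuous.aestronglyMeasurable (by fun_prop)

theorem memLp_coordProd {c : ℝ} {η : RSpace n → RSpace n} (hm : Measurable η)
    (hη : ∀ ξ, ‖η ξ‖ ≤ c) {k : ℕ} (J : Fin k → Fin n) :
    MemLp (fun ξ : RSpace n => ((∏ i, η ξ (J i) : ℝ) : ℂ)) ∞ volume ∧
    ∀ ξ : RSpace n, ‖((∏ i, η ξ (J i) : ℝ) : ℂ)‖ ≤ c ^ k := by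
  have h : ∀ ξ : RSpace n, ‖((∏ i, η ξ (J i) : ℝ) : ℂ)‖ ≤ c ^ k := by
    intro ξ
    rw [Complex.norm_real, norm_prod]
    refine (Finset.prod_le_prod (fun i _ => norm_nonneg _)
      (fun i _ => (exists_coord_le (η ξ) (J i)).trans (hη ξ))).trans_eq ?_
    simp
  refine ⟨memLp_top_of_bound ?_ _ (Filter.Eventually.of_forall h), h⟩
  have h1 : ∀ j : Fin n, Measurable fun ξ => η ξ j := fun j =>
    (by fun_prop : Measurable fun w : RSpace n => w j).comp hm
  exact (Complex.measurable_ofReal.comp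
    (Finset.measurable_prod _ fun i _ => h1 (J i))).aestronglyMeasurable

theorem real_inner_eq_sum (x y : RSpace n) : inner ℝ x y = ∑ j, x j * y j := by
  rw [PiLp.inner_apply]
  refine Finset.sum_congr rfl fun j _ => ?_
  simp [mul_comm]

/-- The `k`-th term of the expansion of `contourFourier` into powers of `η`. -/
def contourTerm {γ c : ℝ} (hγ : 0 < γ) {η : RSpace n → RSpace n} (hm : Measurable η)
    (hη : ∀ ξ, ‖η ξ‖ ≤ c) (k : ℕ) : L2 n →L[ℂ] L2 n :=
  (k.factorial : ℂ)⁻¹ • ∑ J : Fin k → Fin n,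
    (mulL n ((memLp_coordProd hm hη J).1.toLp _)).comp
      ((FourierTransform.fourierCLM ℂ (L2 n)).comp
        (mulL n ((memLp_coordWeight hγ J).1.toLp _)))

/-- There are `n^k` choices of `J`, each contributing `c^k` from the powers of `η` and `k!/γ^k` from
the weighted powers of `w`. The Fourier transform is an isometry and the factorials cancel, so the
series is geometric. -/
theorem norm_contourTerm_le {γ c : ℝ} (hγ : 0 < γ) (hc : 0 ≤ c) {η : RSpace n → RSpace n}
    (hm : Measurable η) (hη : ∀ ξ, ‖η ξ‖ ≤ c) (k : ℕ) :
    ‖contourTerm hγ hm hη k‖ ≤ (n * c / γ) ^ k := by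
  have hF : ‖(FourierTransform.fourierCLM ℂ (L2 n) : L2 n →L[ℂ] L2 n)‖ ≤ 1 := by
    refine ContinuousLinearMap.opNorm_le_bound _ zero_le_one fun f => ?_
    rw [one_mul]
    exact (Lp.norm_fourier_eq f).le
  have hJ : ∀ J : Fin k → Fin n, ‖(mulL n ((memLp_coordProd hm hη J).1.toLp _)).comp
      ((FourierTransform.fourierCLM ℂ (L2 n)).comp
        (mulL n ((memLp_coordWeight hγ J).1.toLp _)))‖ ≤ c ^ k * (k.factorial / γ ^ k) := by
    intro J
    refine (ContinuousLinearMap.opNorm_comp_le _ _).trans ?_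
    have h1 := (norm_mulL_le _).trans (norm_toLp_top_le (by positivity)
      (memLp_coordProd hm hη J).1 (memLp_coordProd hm hη J).2)
    have h2 := (norm_mulL_le _).trans (norm_toLp_top_le (by positivity)
      (memLp_coordWeight hγ J).1 (memLp_coordWeight hγ J).2)
    have h3 := (ContinuousLinearMap.opNorm_comp_le (FourierTransform.fourierCLM ℂ (L2 n))
        (mulL n ((memLp_coordWeight hγ J).1.toLp _))).trans
      ((mul_le_mul hF h2 (norm_nonneg _) zero_le_one).trans_eq (one_mul _))
    exact mul_le_mul h1 h3 (norm_nonneg _) (by positivity)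
  rw [contourTerm, norm_smul, norm_inv, Complex.norm_natCast]
  refine (mul_le_mul_of_nonneg_left ((norm_sum_le _ _).trans
    (Finset.sum_le_sum fun J _ => hJ J)) (by positivity)).trans_eq ?_
  simp only [Finset.sum_const, Finset.card_univ, Fintype.card_fun, Fintype.card_fin, nsmul_eq_mul]
  rw [div_pow, mul_pow]
  push_cast
  field_simp

/-- The power `(η(ξ)·w)^k` is expanded into monomials; the factors `η(ξ)` leave the integral, and
what remains is an ordinary Fourier transform. -/
theorem coeFn_contourTerm {γ c : ℝ} (hγ : 0 < γ) {η : RSpace n → RSpace n}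
    (hm : Measurable η) (hη : ∀ ξ, ‖η ξ‖ ≤ c) (k : ℕ) (g : L2 n) :
    (contourTerm hγ hm hη k g : RSpace n → ℂ) =ᵐ[volume] fun ξ =>
      ∫ w, Complex.exp ((-2 * Real.pi * inner ℝ w ξ : ℝ) * Complex.I) *
        (((inner ℝ (η ξ) w : ℝ) : ℂ) ^ k / k.factorial * ((Real.exp (-(γ * ‖w‖)) : ℂ) * g w)) := by
  have hint : ∀ J : Fin k → Fin n, Integrable (fun w =>
      ((∏ i, w (J i) : ℝ) : ℂ) * (Real.exp (-(γ * ‖w‖)) : ℂ) * g w) volume := by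
    intro J
    -- The weight is split in half: one half makes the product with `g` integrable, the other bounds
    -- the monomial.
    have h1 := ((memLp_exp_neg (n := n) (half_pos hγ)).ofReal (K := ℂ)).integrable_mul (Lp.memLp g)
    have h2 := h1.bdd_mul (c := k.factorial / (γ / 2) ^ k)
      ((memLp_coordWeight (half_pos hγ) J).1.1)
      (Filter.Eventually.of_forall (memLp_coordWeight (half_pos hγ) J).2)
    refine h2.congr (Filter.Eventually.of_forall fun w => ?_)
    have : (Real.exp (-(γ * ‖w‖)) : ℂ)
        = (Real.exp (-(γ / 2 * ‖w‖)) : ℂ) * (Real.exp (-(γ / 2 * ‖w‖)) : ℂ) := by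
      rw [← Complex.ofReal_mul, ← Real.exp_add]; congr 2; ring
    simp only [Pi.mul_apply]
    rw [this]
    simp only [RCLike.ofReal_eq_complex_ofReal] 
    ring
  have hJ : ∀ J : Fin k → Fin n, ((mulL n ((memLp_coordProd hm hη J).1.toLp _)).comp
      ((FourierTransform.fourierCLM ℂ (L2 n)).comp
        (mulL n ((memLp_coordWeight hγ J).1.toLp _))) g : RSpace n → ℂ) =ᵐ[volume] fun ξ =>
      ∫ w, Complex.exp ((-2 * Real.pi * inner ℝ w ξ : ℝ) * Complex.I) *
        (((∏ i, η ξ (J i) * w (J i) : ℝ) : ℂ) * ((Real.exp (-(γ * ‖w‖)) : ℂ) * g w)) := by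
    intro J
    have h2 : MemLp (fun w => ((∏ i, w (J i) : ℝ) : ℂ) * (Real.exp (-(γ * ‖w‖)) : ℂ) * g w) 2
        volume := (Lp.memLp g).mul' (memLp_coordWeight hγ J).1
    have e1 : mulL n ((memLp_coordWeight hγ J).1.toLp _) g = h2.toLp _ := by
      rw [Lp.ext_iff]
      filter_upwards [coeFn_mulL ((memLp_coordWeight hγ J).1.toLp _) g,
        (memLp_coordWeight hγ J).1.coeFn_toLp, h2.coeFn_toLp] with w hw1 hw2 hw3
      rw [hw1, hw2, hw3]
    have e2 := coeFn_fourier (hint J) h2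
    have e3 := coeFn_mulL ((memLp_coordProd hm hη J).1.toLp _) (𝓕 (h2.toLp _) : L2 n)
    have e4 := (memLp_coordProd hm hη J).1.coeFn_toLp
    filter_upwards [e2, e3, e4] with ξ h2 h3 h4
    simp only [ContinuousLinearMap.comp_apply, e1]
    refine h3.trans ?_
    rw [h2, h4, Real.fourier_eq', ← integral_const_mul]
    congr 1
    ext w
    rw [Finset.prod_mul_distrib]
    push_cast
    simp only [smul_eq_mul]
    ring
  have hsum : (contourTerm hγ hm hη k g : RSpace n → ℂ) =ᵐ[volume] fun ξ =>
      (k.factorial : ℂ)⁻¹ * ∑ J : Fin k → Fin n,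
        (((mulL n ((memLp_coordProd hm hη J).1.toLp _)).comp
      ((FourierTransform.fourierCLM ℂ (L2 n)).comp
        (mulL n ((memLp_coordWeight hγ J).1.toLp _))) g : L2 n) : RSpace n → ℂ) ξ := by
    rw [contourTerm, _root_.smul_apply, _root_.sum_apply]
    refine (Lp.coeFn_smul _ _).trans ?_
    filter_upwards [coeFn_Lp_sum (Finset.univ : Finset (Fin k → Fin n)) (fun J =>
      ((mulL n ((memLp_coordProd hm hη J).1.toLp _)).comp
      ((FourierTransform.fourierCLM ℂ (L2 n)).comp
        (mulL n ((memLp_coordWeight hγ J).1.toLp _))) g : L2 n))] with ξ hξ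
    rw [Pi.smul_apply, smul_eq_mul, hξ]
  refine hsum.trans ?_
  filter_upwards [ae_all_iff.2 hJ] with ξ hξ
  rw [Finset.sum_congr rfl fun J _ => hξ J, ← integral_finsetSum, ← integral_const_mul]
  · congr 1
    ext w
    rw [← Finset.mul_sum, ← Finset.sum_mul, real_inner_eq_sum (η ξ), ← Complex.ofReal_pow,
      Fintype.sum_pow]
    push_cast
    field_simp
  · intro J _
    have h1 := ((hint J).const_mul ((∏ i, η ξ (J i) : ℝ) : ℂ)).bdd_mul (c := 1)
      (f := fun w : RSpace n => Complex.exp ((-2 * Real.pi * inner ℝ w ξ : ℝ) * Complex.I))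
      (Continuous.aestronglyMeasurable (by fun_prop))
      (Filter.Eventually.of_forall fun w => (Complex.norm_exp_ofReal_mul_I _).le)
    refine h1.congr (Filter.Eventually.of_forall fun w => ?_)
    simp only [Finset.prod_mul_distrib]
    push_cast
    ring

/-- The operator `g ↦ contourFourier γ η g` is bounded on `L²`. -/
theorem exists_contourFourier {γ c : ℝ} (hc : 0 ≤ c) (hγ : 0 < γ) (hcγ : n * c < γ) (hcγ' : c < γ) :
    ∃ C : ℝ, 0 ≤ C ∧ ∀ η : RSpace n → RSpace n, Measurable η → (∀ ξ, ‖η ξ‖ ≤ c) →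
      ∃ T : L2 n →L[ℂ] L2 n, ‖T‖ ≤ C ∧ ∀ g : L2 n, T g =ᵐ[volume] contourFourier γ η g := by
  have hq0 : 0 ≤ n * c / γ := by positivity
  have hq1 : n * c / γ < 1 := (div_lt_one hγ).2 hcγ
  have hgeo := hasSum_geometric_of_lt_one hq0 hq1
  refine ⟨(1 - n * c / γ)⁻¹, inv_nonneg.2 (by linarith), fun η hm hη => ?_⟩
  have hs : Summable (contourTerm hγ hm hη) :=
    Summable.of_norm_bounded hgeo.summable (norm_contourTerm_le hγ hc hm hη)
  refine ⟨∑' k, contourTerm hγ hm hη k,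
    tsum_of_norm_bounded hgeo (norm_contourTerm_le hγ hc hm hη), fun g => ?_⟩
  have h1 : Filter.Tendsto (fun N => ∑ k ∈ Finset.range N, contourTerm hγ hm hη k g) Filter.atTop
      (𝓝 ((∑' k, contourTerm hγ hm hη k) g)) := by
    have := (hs.hasSum.mapL (ContinuousLinearMap.apply ℂ (L2 n) g)).tendsto_sum_nat
    exact this
  -- Convergence in `L²` gives convergence almost everywhere along a subsequence, enough to compare
  -- with the pointwise sum of the series of integrals.
  obtain ⟨ns, hns, hlim⟩ := (tendstoInMeasure_of_tendsto_Lp h1).exists_seq_tendsto_ae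
  have hco := ae_all_iff.2 (fun k => coeFn_contourTerm hγ hm hη k g)
  have hsumco := ae_all_iff.2 (fun N : ℕ => coeFn_Lp_sum (Finset.range N)
    (fun k => contourTerm hγ hm hη k g))
  filter_upwards [hlim, hco, hsumco] with ξ hξ hk hN
  have hI := integrable_exp_neg_mul (sub_pos.2 hcγ') g
  have hexp : ∀ t : ℝ, HasSum (fun k : ℕ => t ^ k / k.factorial) (Real.exp t) := fun t => by
    rw [Real.exp_eq_exp_ℝ]; exact NormedSpace.expSeries_div_hasSum_exp t
  have hexpC : ∀ t : ℂ, HasSum (fun k : ℕ => t ^ k / k.factorial) (Complex.exp t) := fun t => by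
    rw [Complex.exp_eq_exp_ℂ]; exact NormedSpace.expSeries_div_hasSum_exp t
  -- The exponential series is integrated termwise: the absolute values sum to `e^{c|w|} e^{-γ|w|}
  -- |g(w)|`, integrable since `c < γ`.
  have hS := hasSum_integral_of_dominated_convergence (μ := (volume : Measure (RSpace n)))
    (F := fun (k : ℕ) w => Complex.exp ((-2 * Real.pi * inner ℝ w ξ : ℝ) * Complex.I) *
        (((inner ℝ (η ξ) w : ℝ) : ℂ) ^ k / k.factorial * ((Real.exp (-(γ * ‖w‖)) : ℂ) * g w)))
    (f := fun w => Complex.exp ((-2 * Real.pi * inner ℝ w ξ : ℝ) * Complex.I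
        + (inner ℝ (η ξ) w : ℝ)) * ((Real.exp (-(γ * ‖w‖)) : ℂ) * g w))
    (fun k w => (c * ‖w‖) ^ k / k.factorial * (Real.exp (-(γ * ‖w‖)) * ‖g w‖))
    (fun k => by
      refine AEStronglyMeasurable.mul (Continuous.aestronglyMeasurable (by fun_prop)) ?_
      refine AEStronglyMeasurable.mul (Continuous.aestronglyMeasurable (by fun_prop)) ?_
      exact AEStronglyMeasurable.mul (Continuous.aestronglyMeasurable (by fun_prop)) (Lp.memLp g).1)
    (fun k => Filter.Eventually.of_forall fun w => by
      rw [norm_mul, Complex.norm_exp_ofReal_mul_I, one_mul, norm_mul, norm_mul, norm_div, norm_pow,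
        Complex.norm_real, Complex.norm_natCast, Complex.norm_real,
        Real.norm_of_nonneg (Real.exp_pos _).le]
      gcongr
      exact (norm_inner_le_norm _ _).trans (by gcongr; exact hη ξ))
    (Filter.Eventually.of_forall fun w => ((hexp (c * ‖w‖)).mul_right _).summable)
    (by
      refine hI.congr (Filter.Eventually.of_forall fun w => ?_)
      simp only
      rw [((hexp (c * ‖w‖)).mul_right _).tsum_eq, ← mul_assoc, ← Real.exp_add]
      congr 2; ring)
    (Filter.Eventually.of_forall fun w => by
      have := ((hexpC (inner ℝ (η ξ) w : ℝ)).mul_right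
        ((Real.exp (-(γ * ‖w‖)) : ℂ) * g w)).mul_left
        (Complex.exp ((-2 * Real.pi * inner ℝ w ξ : ℝ) * Complex.I))
      rw [Complex.exp_add, mul_assoc (Complex.exp _) (Complex.exp _)]
      exact this)
  have h2 := hS.tendsto_sum_nat.comp hns.tendsto_atTop
  refine tendsto_nhds_unique hξ (h2.congr fun i => ?_)
  simp only [Function.comp_apply]
  rw [hN]
  exact (Finset.sum_congr rfl fun k _ => hk k).symm

end ContourFourier

/-! ### The symbol on the deformed contour -/

section ContourSymbol

variable {n : ℕ} {ν : RSpace n}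

/-- The side to which the contour through `x` is moved. -/
def contourSign (κ : ℝ) (ν x : RSpace n) : ℝ := if 0 ≤ κ * inner ℝ x ν then 1 else -1

/-- The contour consists of the points `contourScale x • x`. -/
def contourScale (c κ : ℝ) (ν x : RSpace n) : ℂ :=
  1 + ((contourSign κ ν x * (c / (1 + ‖x‖)) : ℝ) : ℂ) * Complex.I

/-- The imaginary part of the point `contourScale x • x` of the contour. -/
def contourShift (c κ : ℝ) (ν x : RSpace n) : RSpace n :=
  (contourSign κ ν x * (c / (1 + ‖x‖))) • x

/-- The symbol of the free operator on the contour. -/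
def contourSymbol (c κ : ℝ) (p : ℂ × PerpC ν) (x : RSpace n) : ℂ :=
  ((‖x‖ ^ 2 : ℝ) : ℂ) * contourScale c κ ν x ^ 2
    + 2 * p.1 * ((inner ℝ x ν : ℝ) : ℂ) * contourScale c κ ν x
    - cdot (p.2 : CSpace n) (p.2 : CSpace n)

/-- The Jacobian of the parametrization of the contour. -/
def contourJac (c κ : ℝ) (ν x : RSpace n) : ℂ :=
  contourScale c κ ν x ^ (n - 1) *
    (1 + ((contourSign κ ν x * (c / (1 + ‖x‖) ^ 2) : ℝ) : ℂ) * Complex.I)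

/-- The multiplier on the contour of the derivative `∂^a` of the free resolvent. -/
def contourMult (c κ : ℝ) {k : ℕ} (a : Fin k → Fin n) (p : ℂ × PerpC ν) (x : RSpace n) : ℂ :=
  contourJac c κ ν x / contourSymbol c κ p x *
    ∏ i, (Complex.I * (contourScale c κ ν x * (x (a i) : ℂ) - (p.2 : CSpace n) (a i)))

theorem contourSign_sq (κ : ℝ) (ν x : RSpace n) : contourSign κ ν x ^ 2 = 1 := by
  unfold contourSign; split_ifs <;> norm_num

theorem abs_contourSign (κ : ℝ) (ν x : RSpace n) : |contourSign κ ν x| = 1 := by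
  unfold contourSign; split_ifs <;> norm_num

theorem contourSign_mul (κ : ℝ) (ν x : RSpace n) :
    contourSign κ ν x * (κ * inner ℝ x ν) = |κ * inner ℝ x ν| := by
  unfold contourSign
  split_ifs with h
  · rw [abs_of_nonneg h, one_mul]
  · rw [abs_of_neg (not_le.1 h)]; ring

theorem measurable_contourSign (κ : ℝ) (ν : RSpace n) : Measurable (contourSign κ ν) := by
  unfold contourSign
  exact Measurable.ite (measurableSet_le measurable_const (by fun_prop)) measurable_const
    measurable_const

theorem measurable_contourScale (c κ : ℝ) (ν : RSpace n) : Measurable (contourScale c κ ν) := by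
  have := measurable_contourSign κ ν
  unfold contourScale
  fun_prop

theorem measurable_contourShift (c κ : ℝ) (ν : RSpace n) : Measurable (contourShift c κ ν) := by
  have := measurable_contourSign κ ν
  unfold contourShift
  fun_prop

theorem measurable_contourSymbol (c κ : ℝ) (p : ℂ × PerpC ν) :
    Measurable (contourSymbol c κ p) := by
  have := measurable_contourScale c κ ν
  unfold contourSymbol
  fun_prop

theorem measurable_contourJac (c κ : ℝ) (ν : RSpace n) : Measurable (contourJac c κ ν) := by
  have := measurable_contourScale c κ ν
  have := measurable_contourSign κ ν
  unfold contourJac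
  fun_prop

theorem measurable_contourMult (c κ : ℝ) {k : ℕ} (a : Fin k → Fin n) (p : ℂ × PerpC ν) :
    Measurable (contourMult c κ a p) := by
  have := measurable_contourScale c κ ν
  have := measurable_contourJac c κ ν
  have := measurable_contourSymbol c κ p
  unfold contourMult
  refine Measurable.mul (by fun_prop) (Finset.measurable_prod _ fun i _ => ?_)
  fun_prop

theorem norm_contourShift_le {c : ℝ} (hc : 0 ≤ c) (κ : ℝ) (ν x : RSpace n) :
    ‖contourShift c κ ν x‖ ≤ c := by
  have := norm_nonneg x
  rw [contourShift, norm_smul, norm_mul, Real.norm_eq_abs, abs_contourSign, one_mul,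
    Real.norm_of_nonneg (by positivity), div_mul_eq_mul_div, div_le_iff₀ (by positivity)]
  nlinarith

theorem div_one_add_norm_le {c : ℝ} (hc : 0 ≤ c) (x : RSpace n) : c / (1 + ‖x‖) ≤ c :=
  div_le_self hc (by linarith [norm_nonneg x])

theorem norm_one_add_mul_I_le {b : ℝ} (hb : |b| ≤ 1) : ‖1 + (b : ℂ) * Complex.I‖ ≤ 2 := by
  refine (norm_add_le _ _).trans ?_
  rw [norm_one, norm_mul, Complex.norm_I, mul_one, Complex.norm_real, Real.norm_eq_abs]
  linarith

theorem norm_contourScale_le {c : ℝ} (hc : 0 ≤ c) (hc1 : c ≤ 1) (κ : ℝ) (ν x : RSpace n) :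
    ‖contourScale c κ ν x‖ ≤ 2 := by
  have := norm_nonneg x
  refine norm_one_add_mul_I_le ?_
  rw [abs_mul, abs_contourSign, one_mul, abs_of_nonneg (by positivity)]
  exact (div_one_add_norm_le hc x).trans hc1

theorem norm_contourJac_le {c : ℝ} (hc : 0 ≤ c) (hc1 : c ≤ 1) (κ : ℝ) (ν x : RSpace n) :
    ‖contourJac c κ ν x‖ ≤ 2 ^ (n - 1) * 2 := by
  have := norm_nonneg x
  rw [contourJac, norm_mul, norm_pow]
  gcongr
  · exact norm_contourScale_le hc hc1 κ ν x
  · refine norm_one_add_mul_I_le ?_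
    rw [abs_mul, abs_contourSign, one_mul, abs_of_nonneg (by positivity)]
    exact (div_le_self hc (by nlinarith)).trans hc1

/-- The set of all `ρ_⊥` for which the symbol does not vanish on the contour and `e^{iρ_⊥·w}` grows
slowly. -/
def contourDomain (c δ : ℝ) (ν : RSpace n) : Set (PerpC ν) :=
  {ρ | 0 < (cdot (ρ : CSpace n) (ρ : CSpace n)).re ∧
    |(cdot (ρ : CSpace n) (ρ : CSpace n)).im| <
      c / 4 * min (cdot (ρ : CSpace n) (ρ : CSpace n)).re 1 ∧
    ‖(WithLp.toLp 2 (fun i => ((ρ : CSpace n) i).im) : RSpace n)‖ < δ}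

theorem continuous_cdot_self : Continuous (fun ρ : PerpC ν =>
    cdot (ρ : CSpace n) (ρ : CSpace n)) := by
  unfold cdot
  fun_prop

theorem isOpen_contourDomain (c δ : ℝ) (ν : RSpace n) : IsOpen (contourDomain c δ ν) := by
  have h := continuous_cdot_self (ν := ν)
  have h1 : Continuous fun ρ : PerpC ν => (cdot (ρ : CSpace n) (ρ : CSpace n)).re :=
    Complex.continuous_re.comp h
  have h2 : Continuous fun ρ : PerpC ν => (cdot (ρ : CSpace n) (ρ : CSpace n)).im :=
    Complex.continuous_im.comp h
  have h3 : Continuous fun ρ : PerpC ν =>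
      ‖(WithLp.toLp 2 (fun i => ((ρ : CSpace n) i).im) : RSpace n)‖ := by
    refine continuous_norm.comp ((PiLp.continuous_toLp 2 _).comp (continuous_pi fun i => ?_))
    exact Complex.continuous_im.comp (by fun_prop)
  exact (isOpen_lt continuous_const h1).inter ((isOpen_lt h2.abs
    (continuous_const.mul (h1.min continuous_const))).inter (isOpen_lt h3 continuous_const))

theorem cdot_self_of_real {ρ : PerpC ν} (hρ : ∀ i, ((ρ : CSpace n) i).im = 0) :
    cdot (ρ : CSpace n) (ρ : CSpace n) = ((‖ρ‖ ^ 2 : ℝ) : ℂ) := by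
  have h1 : ‖ρ‖ = ‖(ρ : CSpace n)‖ := rfl
  rw [h1, EuclideanSpace.norm_sq_eq, cdot]
  push_cast
  refine Finset.sum_congr rfl fun i _ => ?_
  have : (ρ : CSpace n) i = ((((ρ : CSpace n) i).re : ℝ) : ℂ) := by
    apply Complex.ext <;> simp [hρ i]
  rw [this, Complex.norm_real, ← Complex.ofReal_mul, ← Complex.ofReal_pow, Real.norm_eq_abs,
    sq_abs, sq]

theorem realPerp_subset_contourDomain {c δ : ℝ} (hc : 0 < c) (hδ : 0 < δ) :
    realPerp ν ⊆ contourDomain c δ ν := by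
  rintro ρ ⟨hρ, h0⟩
  have h2 : 0 < ‖ρ‖ ^ 2 := by
    have := norm_pos_iff.2 h0
    positivity
  have h3 : (WithLp.toLp 2 (fun i => ((ρ : CSpace n) i).im) : RSpace n) = 0 := by
    ext i; simp [hρ i]
  refine ⟨?_, ?_, ?_⟩
  · rw [cdot_self_of_real hρ, Complex.ofReal_re]; exact h2
  · rw [cdot_self_of_real hρ, Complex.ofReal_re, Complex.ofReal_im, abs_zero]
    have : 0 < min (‖ρ‖ ^ 2) 1 := lt_min h2 one_pos
    positivity
  · rw [h3, norm_zero]; exact hδ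

/-- The key lower bound for the symbol on the contour. -/
theorem le_norm_contourSymbol {c δ κ : ℝ} (hc : 0 < c) (hc1 : c ≤ 1) {p : ℂ × PerpC ν}
    (hp : p.2 ∈ contourDomain c δ ν) (hκ : 0 ≤ κ * p.1.im) (hκ1 : |κ| = 1) (x : RSpace n) :
    c / (1 + ‖x‖) * (‖x‖ ^ 2 + (cdot (p.2 : CSpace n) (p.2 : CSpace n)).re) ≤
      4 * ‖contourSymbol c κ p x‖ := by
  obtain ⟨hq0, hq1, -⟩ := hp
  have hr := norm_nonneg x
  set q := cdot (p.2 : CSpace n) (p.2 : CSpace n) with hq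
  set r := ‖x‖
  set σ := contourSign κ ν x with hσ
  set s : ℝ := inner ℝ x ν with hs
  set b := c / (1 + r) with hb
  have hb0 : 0 < b := by positivity
  have hσ2 : σ ^ 2 = 1 := contourSign_sq κ ν x
  have hσs : 0 ≤ σ * (κ * s) := by rw [hσ, contourSign_mul]; exact abs_nonneg _
  have hκ2 : κ ^ 2 = 1 := by rw [← sq_abs, hκ1, one_pow]
  have hys : 0 ≤ σ * s * p.1.im := by
    have : σ * s * p.1.im = (σ * (κ * s)) * (κ * p.1.im) := by
      linear_combination -(σ * s * p.1.im) * hκ2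
    rw [this]; positivity
  have hscale : contourScale c κ ν x = 1 + ((σ * b : ℝ) : ℂ) * Complex.I := rfl
  -- Multiplication by the conjugate of the scale makes each term of the imaginary part explicit.
  -- After multiplication by `σ` the terms with `r²`, `Re q` and `Im z` are nonnegative; only `Im q`
  -- has no sign.
  have him : (contourSymbol c κ p x * (starRingEnd ℂ) (contourScale c κ ν x)).im * σ
      = b * (r ^ 2 * (1 + b ^ 2) + q.re) - σ * q.im + 2 * (σ * s * p.1.im) * (1 + b ^ 2) := by
    rw [contourSymbol, hscale, ← hq]
    have e1 : ((r ^ 2 : ℝ) : ℂ) * (1 + ((σ * b : ℝ) : ℂ) * Complex.I) ^ 2 = 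
       ((r ^ 2 * (1 - (σ * b) ^ 2) : ℝ) : ℂ) + ((r ^ 2 * (2 * (σ * b)) : ℝ) : ℂ) * Complex.I := by
      push_cast
      linear_combination (r ^ 2 * (σ * b) ^ 2 : ℂ) * Complex.I_sq
    rw [e1]
    simp only [Complex.mul_im, Complex.sub_im, Complex.add_im, Complex.sub_re, Complex.add_re,
      Complex.mul_re, Complex.ofReal_re, Complex.ofReal_im, Complex.I_re, Complex.I_im,
      Complex.one_re, Complex.one_im, Complex.conj_re, Complex.conj_im, Complex.re_ofNat,
      Complex.im_ofNat]
    have h4 : σ ^ 4 = 1 := by nlinarith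
    have h3 : σ ^ 3 = σ := by nlinarith
    ring_nf
    simp only [hσ2, h4, h3]
    ring
  have hmain : b * (r ^ 2 + q.re) ≤ 2 * (b * (r ^ 2 * (1 + b ^ 2) + q.re) - σ * q.im) := by
    have h1 : σ * q.im ≤ |q.im| := by
      refine (le_abs_self _).trans_eq ?_
      rw [abs_mul, hσ, abs_contourSign, one_mul]
    -- The condition on `Im q` in `contourDomain` is made for this: the bound by `Re q` is used for
    -- `r ≤ 1`, the bound by `1` for `r ≥ 1`.
    have h2 : 2 * |q.im| ≤ b * (r ^ 2 + q.re) := by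
      rw [hb, div_mul_eq_mul_div, le_div_iff₀ (by positivity)]
      have hm1 : min q.re 1 ≤ q.re := min_le_left _ _
      have hm2 : min q.re 1 ≤ 1 := min_le_right _ _
      rcases le_total r 1 with h | h
      · nlinarith [abs_nonneg q.im]
      · have h6 : |q.im| ≤ c / 4 := by nlinarith
        have h7 : 2 * |q.im| * (1 + r) ≤ c / 2 * (1 + r) := by nlinarith
        have h8 : 1 + r ≤ 2 * r ^ 2 := by nlinarith
        nlinarith [mul_pos hc hq0, mul_le_mul_of_nonneg_left h8 hc.le]
    have h5 : 0 ≤ b * (r ^ 2 * b ^ 2) := by positivity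
    nlinarith
  have hle : (contourSymbol c κ p x * (starRingEnd ℂ) (contourScale c κ ν x)).im * σ
      ≤ 2 * ‖contourSymbol c κ p x‖ := by
    refine (le_abs_self _).trans ?_
    rw [abs_mul, hσ, abs_contourSign, mul_one]
    refine (Complex.abs_im_le_norm _).trans ?_
    rw [norm_mul, RCLike.norm_conj, mul_comm]
    gcongr
    exact norm_contourScale_le hc.le hc1 κ ν x
  have h6 : 0 ≤ 2 * (σ * s * p.1.im) * (1 + b ^ 2) := by positivity
  linarith

theorem contourSymbol_ne_zero {c δ κ : ℝ} (hc : 0 < c) (hc1 : c ≤ 1) {p : ℂ × PerpC ν}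
    (hp : p.2 ∈ contourDomain c δ ν) (hκ : 0 ≤ κ * p.1.im) (hκ1 : |κ| = 1) (x : RSpace n) :
    contourSymbol c κ p x ≠ 0 := by
  intro h
  have h1 := le_norm_contourSymbol hc hc1 hp hκ hκ1 x
  rw [h, norm_zero, mul_zero] at h1
  have h2 := hp.1
  have := norm_nonneg x
  have h3 : 0 < c / (1 + ‖x‖) * (‖x‖ ^ 2 + (cdot (p.2 : CSpace n) (p.2 : CSpace n)).re) := by
    positivity
  linarith

/-- The scale has modulus between `1` and `2`, so the quadratic term dominates for large `x`,
whatever the side of the contour. -/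
theorem le_norm_contourSymbol_of_large {c : ℝ} (hν : ‖ν‖ = 1) (hc : 0 ≤ c) (hc1 : c ≤ 1)
    (κ : ℝ) (p : ℂ × PerpC ν) (x : RSpace n) :
    ‖x‖ ^ 2 - 4 * ‖p.1‖ * ‖x‖ - ‖cdot (p.2 : CSpace n) (p.2 : CSpace n)‖ ≤
      ‖contourSymbol c κ p x‖ := by
  have hl : 1 ≤ ‖contourScale c κ ν x‖ := by
    refine le_trans ?_ (Complex.abs_re_le_norm _)
    have : (contourScale c κ ν x).re = 1 := by
      rw [contourScale, Complex.add_re, Complex.re_ofReal_mul]; simp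
    rw [this, abs_one]
  have hl2 := norm_contourScale_le hc hc1 κ ν x
  have hs : |inner ℝ x ν| ≤ ‖x‖ := by
    have := abs_real_inner_le_norm x ν
    rwa [hν, mul_one] at this
  have h1 := norm_sub_norm_le (((‖x‖ ^ 2 : ℝ) : ℂ) * contourScale c κ ν x ^ 2)
    (-(2 * p.1 * ((inner ℝ x ν : ℝ) : ℂ) * contourScale c κ ν x)
      + cdot (p.2 : CSpace n) (p.2 : CSpace n))
  have h2 : ‖-(2 * p.1 * ((inner ℝ x ν : ℝ) : ℂ) * contourScale c κ ν x)
      + cdot (p.2 : CSpace n) (p.2 : CSpace n)‖ ≤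
      4 * ‖p.1‖ * ‖x‖ + ‖cdot (p.2 : CSpace n) (p.2 : CSpace n)‖ := by
    refine (norm_add_le _ _).trans ?_
    gcongr
    rw [norm_neg, norm_mul, norm_mul, norm_mul, Complex.norm_real, Real.norm_eq_abs,
      Complex.norm_ofNat]
    calc 2 * ‖p.1‖ * |inner ℝ x ν| * ‖contourScale c κ ν x‖
        ≤ 2 * ‖p.1‖ * ‖x‖ * 2 := by gcongr
      _ = 4 * ‖p.1‖ * ‖x‖ := by ring
  have h3 : ‖x‖ ^ 2 ≤ ‖((‖x‖ ^ 2 : ℝ) : ℂ) * contourScale c κ ν x ^ 2‖ := by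
    rw [norm_mul, Complex.norm_real, norm_pow (contourScale c κ ν x),
      Real.norm_of_nonneg (by positivity)]
    exact le_mul_of_one_le_right (by positivity) (one_le_pow₀ hl)
  have h4 : ((‖x‖ ^ 2 : ℝ) : ℂ) * contourScale c κ ν x ^ 2 -
      (-(2 * p.1 * ((inner ℝ x ν : ℝ) : ℂ) * contourScale c κ ν x)
      + cdot (p.2 : CSpace n) (p.2 : CSpace n)) = contourSymbol c κ p x := by
    rw [contourSymbol]; ring
  rw [h4] at h1
  linarith

/-- The inverse of the symbol decays like `|x|⁻²`, locally uniformly in the parameters. -/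
theorem exists_le_norm_contourSymbol {c δ κ : ℝ} (hν : ‖ν‖ = 1) (hc : 0 < c) (hc1 : c ≤ 1)
    (hκ1 : |κ| = 1) {A b : ℝ} (hb : 0 < b) :
    ∃ C : ℝ, 0 < C ∧ ∀ p : ℂ × PerpC ν, p.2 ∈ contourDomain c δ ν → 0 ≤ κ * p.1.im →
      ‖p.1‖ ≤ A → ‖cdot (p.2 : CSpace n) (p.2 : CSpace n)‖ ≤ A →
      b ≤ (cdot (p.2 : CSpace n) (p.2 : CSpace n)).re →
      ∀ x : RSpace n, 1 + ‖x‖ ^ 2 ≤ C * ‖contourSymbol c κ p x‖ := by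
  set A' := max A 0
  have hA' : 0 ≤ A' := le_max_right _ _
  -- Beyond this radius the quadratic term absorbs the others. Inside, the sign argument gives a
  -- positive lower bound that depends only on `b`, `c` and `R`.
  set R := 8 * A' + 8 with hR
  have hR0 : 0 < R := by positivity
  refine ⟨4 + 4 * (1 + R) * (1 + R ^ 2) / (c * b), by positivity, ?_⟩
  intro p hp hκ h1 h2 h3 x
  have h1' := h1.trans (le_max_left A 0)
  have h2' := h2.trans (le_max_left A 0)
  have hx := norm_nonneg x
  rcases le_total ‖x‖ R with h | h
  · have h4 := le_norm_contourSymbol hc hc1 hp hκ hκ1 x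
    have h5 : c / (1 + R) * b ≤ 4 * ‖contourSymbol c κ p x‖ := by
      refine le_trans ?_ h4
      gcongr
      nlinarith
    have h6 : 1 + ‖x‖ ^ 2 ≤ 1 + R ^ 2 := by gcongr
    have h7 : 1 + R ^ 2 ≤ 4 * (1 + R) * (1 + R ^ 2) / (c * b) * ‖contourSymbol c κ p x‖ := by
      rw [div_mul_eq_mul_div, le_div_iff₀ (by positivity)]
      rw [div_mul_eq_mul_div, div_le_iff₀ (by positivity)] at h5
      nlinarith [mul_le_mul_of_nonneg_right h5 (show 0 ≤ 1 + R ^ 2 by positivity)]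
    nlinarith [norm_nonneg (contourSymbol c κ p x)]
  · have h4 := le_norm_contourSymbol_of_large hν hc.le hc1 κ p x
    have h5 : 1 + ‖x‖ ^ 2 ≤ 4 * ‖contourSymbol c κ p x‖ := by nlinarith
    have h6 : 0 ≤ 4 * (1 + R) * (1 + R ^ 2) / (c * b) * ‖contourSymbol c κ p x‖ := by positivity
    linarith

end ContourSymbol

/-! ### The analytic family of operators defined by the contour -/

section ContourFamily

variable {n : ℕ} {ν : RSpace n}

theorem lineHolomorphicOn_of_differentiableAt {E : Type*} [NormedAddCommGroup E] [NormedSpace ℂ E]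
    {f : E → ℂ} {U : Set E} (h : ∀ p ∈ U, DifferentiableAt ℂ f p) : LineHolomorphicOn f U := by
  intro p hp v
  have h1 : DifferentiableAt ℂ f (p + (0 : ℂ) • v) := by simpa using h p hp
  exact h1.comp (0 : ℂ) (by fun_prop : DifferentiableAt ℂ (fun t : ℂ => p + t • v) 0)

theorem differentiableAt_finsetProd {E ι : Type*} [NormedAddCommGroup E] [NormedSpace ℂ E]
    {s : Finset ι} {f : ι → E → ℂ} {p : E} (h : ∀ i ∈ s, DifferentiableAt ℂ (f i) p) :
    DifferentiableAt ℂ (fun q => ∏ i ∈ s, f i q) p := by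
  classical
  induction s using Finset.induction_on with
  | empty => simp
  | insert a s ha ih =>
    simp only [Finset.prod_insert ha]
    exact (h a (Finset.mem_insert_self a s)).fun_mul
      (ih fun i hi => h i (Finset.mem_insert_of_mem hi))

/-- The coordinates of the complexification of `Span{ν}^⊥`. -/
def perpCoord (ν : RSpace n) (j : Fin n) : PerpC ν →L[ℂ] ℂ :=
  (EuclideanSpace.proj j : CSpace n →L[ℂ] ℂ).comp (PerpC ν).subtypeL

theorem perpCoord_apply (j : Fin n) (ρ : PerpC ν) : perpCoord ν j ρ = (ρ : CSpace n) j := rfl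

theorem norm_perpCoord_apply_le (j : Fin n) (ρ : PerpC ν) : ‖(ρ : CSpace n) j‖ ≤ ‖ρ‖ :=
  PiLp.norm_apply_le (ρ : CSpace n) j

theorem differentiable_snd_apply (j : Fin n) :
    Differentiable ℂ (fun p : ℂ × PerpC ν => (p.2 : CSpace n) j) := by
  simp only [← perpCoord_apply]
  exact (perpCoord ν j).differentiable.comp differentiable_snd

theorem differentiable_contourSymbol (c κ : ℝ) (x : RSpace n) :
    Differentiable ℂ (fun p : ℂ × PerpC ν => contourSymbol c κ p x) := by
  have h := differentiable_snd_apply (ν := ν)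
  unfold contourSymbol cdot
  fun_prop

/-- One of the two components of the parameter domain. -/
def contourParam (c δ κ : ℝ) (ν : RSpace n) : Set (ℂ × PerpC ν) :=
  {p | 0 < κ * p.1.im ∧ p.2 ∈ contourDomain c δ ν}

theorem isOpen_contourParam (c δ κ : ℝ) (ν : RSpace n) : IsOpen (contourParam c δ κ ν) := by
  refine IsOpen.inter ?_ ((isOpen_contourDomain c δ ν).preimage continuous_snd)
  exact isOpen_lt continuous_const
    (continuous_const.mul (Complex.continuous_im.comp continuous_fst))

/-- At most two derivatives produce at most quadratic growth, which the inverse symbol compensates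
locally uniformly in `p`. For fixed frequency the multiplier is holomorphic in `p`, since neither
the scale nor the Jacobian involves `p`. -/
theorem exists_analytic_contourMult {c δ κ : ℝ} (hν : ‖ν‖ = 1) (hc : 0 < c) (hc1 : c ≤ 1)
    (hκ1 : |κ| = 1) {k : ℕ} (hk : k ≤ 2) (a : Fin k → Fin n) :
    ∃ G : ℂ × PerpC ν → Lp ℂ ∞ (volume : Measure (RSpace n)),
      AnalyticOnNhd ℂ G (contourParam c δ κ ν) ∧ ∀ p ∈ contourParam c δ κ ν,
        G p =ᵐ[volume] fun ξ => contourMult c κ a p ((2 * Real.pi) • ξ) := by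
  refine exists_analytic_toLp_top (isOpen_contourParam c δ κ ν) (fun p _ => ?_) (fun p hp => ?_)
    (fun ξ => ?_)
  · exact ((measurable_contourMult c κ a p).comp (by fun_prop)).aestronglyMeasurable
  · have hb : 0 < (cdot (p.2 : CSpace n) (p.2 : CSpace n)).re / 2 := half_pos hp.2.1
    obtain ⟨C, hC0, hC⟩ := exists_le_norm_contourSymbol (δ := δ) hν hc hc1 hκ1
      (A := max (‖p.1‖ + 1) (‖cdot (p.2 : CSpace n) (p.2 : CSpace n)‖ + 1)) hb
    have c1 : Continuous fun p : ℂ × PerpC ν => ‖p.1‖ := by fun_prop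
    have c2 : Continuous fun p : ℂ × PerpC ν => cdot (p.2 : CSpace n) (p.2 : CSpace n) :=
      continuous_cdot_self.comp continuous_snd
    have c3 : Continuous fun p : ℂ × PerpC ν => ‖p.2‖ := by fun_prop
    have ev : ∀ᶠ q in 𝓝 p, q ∈ contourParam c δ κ ν ∧ ‖q.1‖ < ‖p.1‖ + 1 ∧
        ‖cdot (q.2 : CSpace n) (q.2 : CSpace n)‖ < ‖cdot (p.2 : CSpace n) (p.2 : CSpace n)‖ + 1 ∧
        (cdot (p.2 : CSpace n) (p.2 : CSpace n)).re / 2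
          < (cdot (q.2 : CSpace n) (q.2 : CSpace n)).re ∧ ‖q.2‖ < ‖p.2‖ + 1 := by
      refine ((isOpen_contourParam c δ κ ν).eventually_mem hp).and ?_
      refine ((c1.tendsto p).eventually_lt_const (lt_add_one _)).and ?_
      refine ((c2.norm.tendsto p).eventually_lt_const (lt_add_one _)).and ?_
      exact (((Complex.continuous_re.comp c2).tendsto p).eventually_const_lt
        (half_lt_self hp.2.1)).and ((c3.tendsto p).eventually_lt_const (lt_add_one _))
    obtain ⟨r, hr, hball⟩ := Metric.eventually_nhds_iff_ball.1 ev
    set B := ‖p.2‖ + 2 with hB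
    have hB0 : 0 ≤ B := by positivity
    refine ⟨r, hr, 2 ^ (n - 1) * 2 * C * (8 * (1 + B ^ 2)), fun q hq ξ => ?_⟩
    obtain ⟨hq0, hq1, hq2, hq3, hq4⟩ := hball q hq
    set x := (2 * Real.pi) • ξ
    have hx := norm_nonneg x
    have hs :=
        hC q hq0.2 hq0.1.le (hq1.le.trans (le_max_left _ _)) (hq2.le.trans (le_max_right _ _))
      hq3.le x
    have hpos : 0 < ‖contourSymbol c κ q x‖ := norm_pos_iff.2
      (contourSymbol_ne_zero hc hc1 hq0.2 hq0.1.le hκ1 x)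
    have hprod : ‖∏ i, (Complex.I * (contourScale c κ ν x * (x (a i) : ℂ)
        - (q.2 : CSpace n) (a i)))‖ ≤ 8 * (1 + B ^ 2) * (1 + ‖x‖ ^ 2) := by
      have h1 : ∀ i, ‖Complex.I * (contourScale c κ ν x * (x (a i) : ℂ)
          - (q.2 : CSpace n) (a i))‖ ≤ 2 * ‖x‖ + B := by
        intro i
        rw [norm_mul, Complex.norm_I, one_mul]
        refine (norm_sub_le _ _).trans ?_
        rw [norm_mul, Complex.norm_real]
        have e1 := norm_contourScale_le hc.le hc1 κ ν x
        have e2 := exists_coord_le x (a i)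
        have e3 := norm_perpCoord_apply_le (a i) q.2
        have := mul_le_mul e1 e2 (norm_nonneg _) zero_le_two
        linarith
      rw [norm_prod]
      refine (Finset.prod_le_prod (fun i _ => norm_nonneg _) (fun i _ => h1 i)).trans ?_
      rw [Finset.prod_const, Finset.card_univ, Fintype.card_fin]
      -- The `2` in `B` serves to raise the exponent from `k` to `2`.
      have hB1 : 1 ≤ 2 * ‖x‖ + B := by
        have := norm_nonneg p.2
        linarith
      refine (pow_le_pow_right₀ hB1 hk).trans ?_
      nlinarith [sq_nonneg (2 * ‖x‖ - B), mul_nonneg (sq_nonneg B) (sq_nonneg ‖x‖)]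
    rw [contourMult, norm_mul, norm_div]
    calc ‖contourJac c κ ν x‖ / ‖contourSymbol c κ q x‖ * _
        ≤ (2 ^ (n - 1) * 2) / ‖contourSymbol c κ q x‖ * (8 * (1 + B ^ 2) * (1 + ‖x‖ ^ 2)) := by
          gcongr
          exact norm_contourJac_le hc.le hc1 κ ν x
      _ ≤ (2 ^ (n - 1) * 2) / ‖contourSymbol c κ q x‖ *
          (8 * (1 + B ^ 2) * (C * ‖contourSymbol c κ q x‖)) := by gcongr
      _ = 2 ^ (n - 1) * 2 * C * (8 * (1 + B ^ 2)) := by field_simp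
  · refine lineHolomorphicOn_of_differentiableAt fun p hp => ?_
    have h0 := contourSymbol_ne_zero hc hc1 hp.2 hp.1.le hκ1 ((2 * Real.pi) • ξ)
    have h1 := (differentiable_contourSymbol (ν := ν) c κ ((2 * Real.pi) • ξ)) p
    have h2 := fun j => (differentiable_snd_apply (ν := ν) j) p
    unfold contourMult
    have h3 : DifferentiableAt ℂ (fun p : ℂ × PerpC ν => contourJac c κ ν ((2 * Real.pi) • ξ) /
        contourSymbol c κ p ((2 * Real.pi) • ξ)) p := by
      simp only [div_eq_mul_inv]
      exact ((differentiableAt_inv h0).comp p h1).const_mul _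
    refine h3.fun_mul ?_
    have h4 : ∀ i ∈ Finset.univ, DifferentiableAt ℂ (fun p : ℂ × PerpC ν => Complex.I *
        (contourScale c κ ν ((2 * Real.pi) • ξ) * (((2 * Real.pi) • ξ) (a i) : ℂ)
          - (p.2 : CSpace n) (a i))) p := fun i _ => ((h2 (a i)).const_sub _).const_mul _
    exact differentiableAt_finsetProd h4

theorem cdot_toC (ζ : CSpace n) (w : RSpace n) : cdot ζ (toC w) = ∑ i, ζ i * (w i : ℂ) := rfl

theorem cdot_add_left (a b x : CSpace n) : cdot (a + b) x = cdot a x + cdot b x := by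
  simp [cdot, add_mul, Finset.sum_add_distrib]

theorem cdot_sub_left (a b x : CSpace n) : cdot (a - b) x = cdot a x - cdot b x := by
  simp [cdot, sub_mul, Finset.sum_sub_distrib]

theorem cdot_smul_left (t : ℂ) (a x : CSpace n) : cdot (t • a) x = t * cdot a x := by
  simp [cdot, mul_assoc, Finset.mul_sum]

theorem cdot_neg_left (a x : CSpace n) : cdot (-a) x = -cdot a x := by
  simp [cdot]

theorem cdot_comm (a b : CSpace n) : cdot a b = cdot b a := by
  simp [cdot, mul_comm]

theorem cdot_toC_toC (x y : RSpace n) : cdot (toC x) (toC y) = ((inner ℝ x y : ℝ) : ℂ) := by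
  rw [cdot_toC, real_inner_eq_sum]
  push_cast
  rfl

theorem continuous_cdot_toC (ζ : CSpace n) : Continuous fun w : RSpace n => cdot ζ (toC w) := by
  simp only [cdot_toC]
  fun_prop

theorem im_cdot_toC (ζ : CSpace n) (w : RSpace n) :
    (cdot ζ (toC w)).im = inner ℝ (WithLp.toLp 2 (fun i => (ζ i).im) : RSpace n) w := by
  rw [cdot_toC, real_inner_eq_sum, Complex.im_sum]
  refine Finset.sum_congr rfl fun i _ => ?_
  simp

theorem norm_exp_I_cdot_le {δ ε : ℝ} (hε : |ε| = 1) {ζ : CSpace n}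
    (h : ‖(WithLp.toLp 2 (fun i => (ζ i).im) : RSpace n)‖ ≤ δ) (w : RSpace n) :
    ‖Complex.exp ((ε : ℂ) * Complex.I * cdot ζ (toC w))‖ ≤ Real.exp (δ * ‖w‖) := by
  rw [Complex.norm_exp]
  refine Real.exp_le_exp.2 ?_
  have h1 : ((ε : ℂ) * Complex.I * cdot ζ (toC w)).re = -(ε * (cdot ζ (toC w)).im) := by
    simp
  rw [h1, im_cdot_toC]
  refine (neg_le_abs _).trans ?_
  rw [abs_mul, hε, one_mul]
  exact (abs_real_inner_le_norm _ _).trans (by gcongr)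

theorem norm_le_of_ae_bound_top {f : Lp ℂ ∞ (volume : Measure (RSpace n))} {C : ℝ} (hC : 0 ≤ C)
    (h : ∀ᵐ x, ‖f x‖ ≤ C) : ‖f‖ ≤ C := by
  rw [Lp.norm_def, eLpNorm_exponent_top]
  exact ENNReal.toReal_le_of_le_ofReal hC (eLpNormEssSup_le_of_ae_bound h)

/-- On the parameter domain the imaginary part of `ρ_⊥` is shorter than `δ`, so a part `e^{-δ|w|}`
of the weight absorbs the growth of `e^{±iρ_⊥·w}`. The rest of the weight is kept for the shift of
the contour. -/
theorem exists_analytic_expWeight {c δ κ ε : ℝ} (hε : |ε| = 1) :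
    ∃ G : ℂ × PerpC ν → Lp ℂ ∞ (volume : Measure (RSpace n)),
      AnalyticOnNhd ℂ G (contourParam c δ κ ν) ∧ (∀ p ∈ contourParam c δ κ ν, ‖G p‖ ≤ 1) ∧
      ∀ p ∈ contourParam c δ κ ν, (G p =ᵐ[volume] fun w => Complex.exp ((ε : ℂ) * Complex.I *
          cdot (p.2 : CSpace n) (toC w)) * (Real.exp (-(δ * ‖w‖)) : ℂ)) := by
  have hb : ∀ q ∈ contourParam c δ κ ν, ∀ w : RSpace n, ‖Complex.exp ((ε : ℂ) * Complex.I *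
          cdot (q.2 : CSpace n) (toC w)) * (Real.exp (-(δ * ‖w‖)) : ℂ)‖ ≤ 1 := by
    intro q hq w
    have h1 := norm_exp_I_cdot_le hε hq.2.2.2.le w
    rw [norm_mul, Complex.norm_real, Real.norm_of_nonneg (Real.exp_pos _).le]
    refine (mul_le_mul_of_nonneg_right h1 (Real.exp_pos _).le).trans_eq ?_
    rw [← Real.exp_add, add_neg_cancel, Real.exp_zero]
  suffices hex : ∃ G : ℂ × PerpC ν → Lp ℂ ∞ (volume : Measure (RSpace n)),
      AnalyticOnNhd ℂ G (contourParam c δ κ ν) ∧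
      ∀ p ∈ contourParam c δ κ ν, (G p =ᵐ[volume] fun w => Complex.exp ((ε : ℂ) * Complex.I *
          cdot (p.2 : CSpace n) (toC w)) * (Real.exp (-(δ * ‖w‖)) : ℂ)) by
    obtain ⟨G, hG, hG'⟩ := hex
    refine ⟨G, hG, fun p hp => norm_le_of_ae_bound_top zero_le_one ?_, hG'⟩
    filter_upwards [hG' p hp] with w hw
    rw [hw]
    exact hb p hp w
  refine exists_analytic_toLp_top (isOpen_contourParam c δ κ ν) (fun p _ => ?_) (fun p hp => ?_)
    (fun w => ?_)
  · have := continuous_cdot_toC (p.2 : CSpace n)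
    exact Continuous.aestronglyMeasurable (by fun_prop)
  · obtain ⟨r, hr, hball⟩ := Metric.isOpen_iff.1 (isOpen_contourParam c δ κ ν) p hp
    exact ⟨r, hr, 1, fun q hq w => hb q (hball hq) w⟩
  · refine lineHolomorphicOn_of_differentiableAt fun p hp => ?_
    have h2 := fun j => (differentiable_snd_apply (ν := ν) j) p
    simp only [cdot_toC]
    fun_prop

/-- The Fourier transform at a complex frequency. -/
def cFourier (f : RSpace n → ℂ) (ζ : CSpace n) : ℂ :=
  ∫ w, Complex.exp (-(Complex.I * cdot ζ (toC w))) * f w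

/-- The point of the contour with parameter `x`, relative to `ρ`. -/
def contourPoint (c κ : ℝ) (p : ℂ × PerpC ν) (x : RSpace n) : CSpace n :=
  contourScale c κ ν x • toC x - (p.2 : CSpace n)

/-- The exponent splits into the ordinary Fourier phase, a real exponential due to the shift, and a
factor in `ρ_⊥` that does not involve the frequency. This separation is what confines the parameters
to multiplication operators. -/
theorem contour_exponent (c κ : ℝ) (p : ℂ × PerpC ν) (ξ w : RSpace n) :
    -(Complex.I * cdot (contourPoint c κ p ((2 * Real.pi) • ξ)) (toC w))
      = ((-2 * Real.pi * inner ℝ w ξ : ℝ) * Complex.I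
        + (inner ℝ (contourShift c κ ν ((2 * Real.pi) • ξ)) w : ℝ))
        + Complex.I * cdot (p.2 : CSpace n) (toC w) := by
  rw [contourPoint, cdot_sub_left, cdot_smul_left, cdot_toC_toC, contourShift, contourScale,
    real_inner_smul_left, real_inner_smul_left, real_inner_smul_left, real_inner_comm ξ w]
  push_cast
  linear_combination (-(contourSign κ ν ((2 * Real.pi) • ξ) : ℂ) *
    (c / (1 + ‖(2 * Real.pi) • ξ‖)) * (2 * Real.pi * (inner ℝ ξ w : ℝ)) : ℂ) * Complex.I_sq

theorem analyticAt_clm_comp {E F G H : Type*} [NormedAddCommGroup E] [NormedSpace ℂ E]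
    [NormedAddCommGroup F] [NormedSpace ℂ F] [NormedAddCommGroup G] [NormedSpace ℂ G]
    [NormedAddCommGroup H] [NormedSpace ℂ H] {f : E → (G →L[ℂ] H)} {g : E → (F →L[ℂ] G)} {p : E}
    (hf : AnalyticAt ℂ f p) (hg : AnalyticAt ℂ g p) :
    AnalyticAt ℂ (fun q => (f q).comp (g q)) p :=
  ((ContinuousLinearMap.compL ℂ F G H).analyticAt_bilinear _).comp₂ hf hg

theorem norm_le_mul_exp_of_contour {γ' δ γ : ℝ} (hγ : γ' + δ = γ) (t : ℝ) (A B : ℂ) :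
    (Real.exp (-(γ' * t)) : ℂ) * (A * (Real.exp (-(δ * t)) : ℂ) * ((Real.exp (γ * t) : ℂ) * B))
      = A * B := by
  have h : Real.exp (-(γ' * t)) * Real.exp (-(δ * t)) * Real.exp (γ * t) = 1 := by
    rw [← Real.exp_add, ← Real.exp_add, ← hγ, Real.exp_eq_one_iff]; ring
  have h2 : (Real.exp (-(γ' * t)) : ℂ) * (Real.exp (-(δ * t)) : ℂ) * (Real.exp (γ * t) : ℂ) =
      1 := by
    exact_mod_cast h
  linear_combination (A * B) * h2

/-- Assumptions on the parameters of the contour. -/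
structure ContourParams (n : ℕ) (γ γ' δ c κ : ℝ) : Prop where
  hc : 0 < c
  hc1 : c ≤ 1
  hγ' : 0 < γ'
  hδ : 0 < δ
  hγ : γ' + δ = γ
  hcn : n * c < γ'
  hcγ : c < γ'
  hκ : |κ| = 1

/-- The operators on `L²` with the multiplier `m` on the contour. -/
theorem exists_contourOperators {γ γ' δ c κ : ℝ} (h : ContourParams n γ γ' δ c κ) :
    ∃ (T₁ T₂ : L2 n →L[ℂ] L2 n) (E₁ E₂ : ℂ × PerpC ν → Lp ℂ ∞ (volume : Measure (RSpace n)))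
      (C : ℝ), 0 ≤ C ∧ ‖T₁‖ ≤ C ∧ ‖T₂‖ ≤ C ∧ (∀ g, ∀ᵐ ξ, ‖T₁ g ξ‖ ≤ C * ‖g‖) ∧
      (∀ g, ∀ᵐ ξ, ‖T₂ g ξ‖ ≤ C * ‖g‖) ∧ (∀ p ∈ contourParam c δ κ ν, ‖E₁ p‖ ≤ 1) ∧
      (∀ p ∈ contourParam c δ κ ν, ‖E₂ p‖ ≤ 1) ∧
      AnalyticOnNhd ℂ E₁ (contourParam c δ κ ν) ∧ AnalyticOnNhd ℂ E₂ (contourParam c δ κ ν) ∧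
      (∀ p ∈ contourParam c δ κ ν, ∀ f : ExpL2 n (-γ),
        T₁ (mulL n (E₁ p) (weightEquiv n (-γ) f)) =ᵐ[volume]
          fun ξ => cFourier f (contourPoint c κ p ((2 * Real.pi) • ξ))) ∧
      (∀ p ∈ contourParam c δ κ ν, ∀ (m : Lp ℂ ∞ (volume : Measure (RSpace n))) (X : L2 n)
        (φ : RSpace n → ℂ), IsTest φ →
        Integrable (fun ξ => m ξ * X ξ *
          cFourier φ (-contourPoint c κ p ((2 * Real.pi) • ξ))) volume ∧
        ∫ w, (weightEquiv n γ).symm (mulL n (E₂ p)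
          (ContinuousLinearMap.adjoint T₂ (mulL n m X))) w * φ w
          = ∫ ξ, m ξ * X ξ * cFourier φ (-contourPoint c κ p ((2 * Real.pi) • ξ))) := by
  obtain ⟨C, hC0, hC⟩ := exists_contourFourier h.hc.le h.hγ' h.hcn h.hcγ
  have hm1 : Measurable fun ξ : RSpace n => contourShift c κ ν ((2 * Real.pi) • ξ) :=
    (measurable_contourShift c κ ν).comp (by fun_prop)
  obtain ⟨C', hC'0, hC'⟩ := norm_contourFourier_le (n := n) h.hcγ
  have hη1 : ∀ ξ : RSpace n, ‖contourShift c κ ν ((2 * Real.pi) • ξ)‖ ≤ c :=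
    fun ξ => norm_contourShift_le h.hc.le κ ν _
  have hη2 : ∀ ξ : RSpace n, ‖(-fun ξ => contourShift c κ ν ((2 * Real.pi) • ξ)) ξ‖ ≤ c :=
    fun ξ => by rw [Pi.neg_apply, norm_neg]; exact hη1 ξ
  -- Neither `T₁` nor `T₂` depends on `p`: the imaginary part of the contour involves only `κ`.
  obtain ⟨T₁, hT₁n, hT₁⟩ := hC _ hm1 hη1
  obtain ⟨T₂, hT₂n, hT₂⟩ := hC _ hm1.neg hη2
  obtain ⟨E₁, hE₁, hE₁n, hE₁'⟩ :=
      exists_analytic_expWeight (ν := ν) (c := c) (δ := δ) (κ := κ) (ε := 1)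
    abs_one
  obtain ⟨E₂, hE₂, hE₂n, hE₂'⟩ := exists_analytic_expWeight (ν := ν) (c := c) (δ := δ) (κ := κ)
    (ε := -1) (by simp)
  have hsup : ∀ (T : L2 n →L[ℂ] L2 n) (η : RSpace n → RSpace n), (∀ ξ, ‖η ξ‖ ≤ c) →
      (∀ g : L2 n, T g =ᵐ[volume] contourFourier γ' η g) →
      ∀ g, ∀ᵐ ξ, ‖T g ξ‖ ≤ (C + C') * ‖g‖ := by
    intro T η hη hT g
    filter_upwards [hT g] with ξ hξ
    rw [hξ]
    exact (hC' η hη g ξ).trans (by gcongr; linarith)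
  refine ⟨T₁, T₂, E₁, E₂, C + C', by positivity, by linarith, by linarith, hsup _ _ hη1 hT₁,
    hsup _ _ hη2 hT₂, hE₁n, hE₂n, hE₁, hE₂, fun p hp f => ?_, fun p hp m X φ hφ => ?_⟩
  · refine (hT₁ _).trans (Filter.Eventually.of_forall fun ξ => ?_)
    beta_reduce
    rw [contourFourier, cFourier]
    refine integral_congr_ae ?_
    filter_upwards [coeFn_mulL (E₁ p) (weightEquiv n (-γ) f), hE₁' p hp, coeFn_weightEquiv f]
      with w h1 h2 h3
    have e : -(-γ * ‖w‖) = γ * ‖w‖ := by ring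
    rw [h1, h2, h3, contour_exponent, Complex.exp_add _ (Complex.I * _), Complex.ofReal_one,
        one_mul,
      e, norm_le_mul_exp_of_contour h.hγ]
    ring
  -- The test function is conjugated and stripped of its weight so that `T₂ Φ` is the conjugate of
  -- the transform of `φ`. The pairing then becomes an inner product, and the adjoint of `T₂` moves
  -- the operator away from `φ`.
  · set Φ : RSpace n → ℂ := fun w => (starRingEnd ℂ) ((Real.exp (γ' * ‖w‖) : ℂ) *
      (Complex.exp (-(Complex.I * cdot (p.2 : CSpace n) (toC w))) * φ w)) with hΦ
    have hcd := continuous_cdot_toC (p.2 : CSpace n)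
    have hΦc : Continuous Φ := by
      have := hφ.1.continuous
      exact Complex.continuous_conj.comp (by fun_prop)
    have hΦs : HasCompactSupport Φ := by
      refine hφ.2.mono fun w hw => ?_
      contrapose! hw
      simp only [Function.mem_support, not_not] at hw ⊢
      simp [hΦ, hw]
    have hΦ2 : MemLp Φ 2 (volume : Measure (RSpace n)) := hΦc.memLp_of_hasCompactSupport hΦs
    have hT : (T₂ (hΦ2.toLp Φ) : RSpace n → ℂ) =ᵐ[volume] fun ξ =>
        (starRingEnd ℂ) (cFourier φ (-contourPoint c κ p ((2 * Real.pi) • ξ))) := by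
      refine (hT₂ _).trans (Filter.Eventually.of_forall fun ξ => ?_)
      simp only
      unfold contourFourier cFourier
      rw [← integral_conj]
      refine integral_congr_ae ?_
      filter_upwards [hΦ2.coeFn_toLp] with w hw
      rw [hw, cdot_neg_left, mul_neg, contour_exponent, hΦ]
      simp only [Pi.neg_apply, inner_neg_left]
      have e0 : (Real.exp (-(γ' * ‖w‖)) : ℂ) * (Real.exp (γ' * ‖w‖) : ℂ) = 1 := by
        rw [← Complex.ofReal_mul, ← Real.exp_add]; simp
      have e1 : Complex.exp (((-2 * Real.pi * inner ℝ w ξ : ℝ) : ℂ) * Complex.I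
          + ((-inner ℝ (contourShift c κ ν ((2 * Real.pi) • ξ)) w : ℝ) : ℂ))
          = (starRingEnd ℂ) (Complex.exp (-(((-2 * Real.pi * inner ℝ w ξ : ℝ) : ℂ) * Complex.I
          + ((inner ℝ (contourShift c κ ν ((2 * Real.pi) • ξ)) w : ℝ) : ℂ)))) := by
        rw [← Complex.exp_conj, map_neg, map_add, map_mul, Complex.conj_I, Complex.conj_ofReal,
          Complex.conj_ofReal]
        congr 1
        push_cast
        ring
      rw [e1, neg_add (_ + _), Complex.exp_add]
      simp only [map_mul, Complex.conj_ofReal]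
      linear_combination ((starRingEnd ℂ) (Complex.exp (-(((-2 * Real.pi * inner ℝ w ξ : ℝ) : ℂ)
        * Complex.I + ((inner ℝ (contourShift c κ ν ((2 * Real.pi) • ξ)) w : ℝ) : ℂ)))) *
        (starRingEnd ℂ) (Complex.exp (-(Complex.I * cdot (p.2 : CSpace n) (toC w)))) *
        (starRingEnd ℂ) (φ w)) * e0
    have hin := L2.inner_def (𝕜 := ℂ) (T₂ (hΦ2.toLp Φ)) (mulL n m X)
    have hI := L2.integrable_inner (𝕜 := ℂ) (T₂ (hΦ2.toLp Φ)) (mulL n m X)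
    have hae : (fun ξ => inner ℂ ((T₂ (hΦ2.toLp Φ) : L2 n) ξ) ((mulL n m X : L2 n) ξ)) =ᵐ[volume]
        fun ξ => m ξ * X ξ * cFourier φ (-contourPoint c κ p ((2 * Real.pi) • ξ)) := by
      filter_upwards [hT, coeFn_mulL m X] with ξ h1 h2
      rw [h1, h2, RCLike.inner_apply, RingHomCompTriple.comp_apply, RingHom.id_apply]
    refine ⟨hI.congr hae, ?_⟩
    rw [← integral_congr_ae hae, ← hin, ← ContinuousLinearMap.adjoint_inner_right, L2.inner_def]
    refine integral_congr_ae ?_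
    filter_upwards [coeFn_weightEquiv_symm (γ := γ) (mulL n (E₂ p)
      (ContinuousLinearMap.adjoint T₂ (mulL n m X))), coeFn_mulL (E₂ p)
      (ContinuousLinearMap.adjoint T₂ (mulL n m X)), hE₂' p hp, hΦ2.coeFn_toLp] with w h1 h2 h3 h4
    rw [h1, h2, h3, h4, RCLike.inner_apply, hΦ]
    simp only [RingHomCompTriple.comp_apply, RingHom.id_apply]
    have e0 : (Real.exp (γ * ‖w‖) : ℂ) * (Real.exp (-(δ * ‖w‖)) : ℂ) =
        (Real.exp (γ' * ‖w‖) : ℂ) := by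
      rw [← Complex.ofReal_mul, ← Real.exp_add, ← h.hγ]; congr 2; ring
    have e1 : ((-1 : ℝ) : ℂ) * Complex.I * cdot (p.2 : CSpace n) (toC w)
        = -(Complex.I * cdot (p.2 : CSpace n) (toC w)) := by push_cast; ring
    rw [e1]
    linear_combination (Complex.exp (-(Complex.I * cdot (p.2 : CSpace n) (toC w))) *
      (ContinuousLinearMap.adjoint T₂ (mulL n m X)) w * φ w) * e0

end ContourFamily

/-! ### Weak derivatives, and the extension of the free resolvent -/

section Extension

variable {n : ℕ} {ν : RSpace n}

theorem IsTest.partialDeriv {k : ℕ} {φ : RSpace n → ℂ} (hφ : IsTest φ) (a : Fin k → Fin n) :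
    IsTest (partialDeriv a φ) := by
  refine ⟨?_, hφ.partialDeriv_compact a⟩
  have h : ContDiff ℝ ∞ (iteratedFDeriv ℝ k φ) := by
    refine hφ.1.iteratedFDeriv_right (m := ∞) ?_
    exact_mod_cast le_top
  exact (ContinuousMultilinearMap.apply ℝ (fun _ : Fin k => RSpace n) ℂ
    (fun i => EuclideanSpace.single (a i) (1 : ℝ))).contDiff.comp h

theorem partialDeriv_succ {k : ℕ} {φ : RSpace n → ℂ} (hφ : IsTest φ) (a : Fin (k + 1) → Fin n)
    (w : RSpace n) :
    ExpPotential.partialDeriv a φ w = fderiv ℝ (ExpPotential.partialDeriv (Fin.tail a) φ) w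
      (EuclideanSpace.single (a 0) (1 : ℝ)) := by
  have hd : DifferentiableAt ℝ (iteratedFDeriv ℝ k φ) w :=
    (hφ.1.differentiable_iteratedFDeriv (by exact_mod_cast ENat.natCast_lt_top k)).differentiableAt
  let L := ContinuousMultilinearMap.apply ℝ (fun _ : Fin k => RSpace n) ℂ
    (fun i => EuclideanSpace.single (Fin.tail a i) (1 : ℝ))
  have h1 : ExpPotential.partialDeriv (Fin.tail a) φ = fun x => L (iteratedFDeriv ℝ k φ x) := rfl
  have h2 : HasFDerivAt (fun x => L (iteratedFDeriv ℝ k φ x))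
      (L.comp (fderiv ℝ (iteratedFDeriv ℝ k φ) w)) w := L.hasFDerivAt.comp w hd.hasFDerivAt
  rw [h1, h2.fderiv, ExpPotential.partialDeriv, iteratedFDeriv_succ_apply_left]
  rfl

theorem hasFDerivAt_cdot_toC (ζ : CSpace n) (w : RSpace n) :
    ∃ L : RSpace n →L[ℝ] ℂ,
      HasFDerivAt (fun w => cdot ζ (toC w)) L w ∧ ∀ v, L v = cdot ζ (toC v) := by
  let L : RSpace n →L[ℝ] ℂ := ∑ i, ζ i • (Complex.ofRealCLM.comp
    (EuclideanSpace.proj i : RSpace n →L[ℝ] ℝ))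
  have h : ∀ v, L v = cdot ζ (toC v) := by
    intro v
    simp [L, cdot_toC, _root_.sum_apply]
  refine ⟨L, ?_, h⟩
  have := L.hasFDerivAt (x := w)
  refine this.congr_of_eventuallyEq (Filter.Eventually.of_forall fun v => (h v).symm)

theorem integrable_exp_mul_test (ζ : CSpace n) {φ : RSpace n → ℂ} (hc : Continuous φ)
    (hs : HasCompactSupport φ) :
    Integrable (fun w => Complex.exp (-(Complex.I * cdot ζ (toC w))) * φ w) volume := by
  have := continuous_cdot_toC ζ
  refine Continuous.integrable_of_hasCompactSupport (by fun_prop) hs.mul_left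

/-- Integration by parts, without boundary terms because `φ` has compact support; the exponential
may grow. -/
theorem cFourier_fderiv {φ : RSpace n → ℂ} (hφ : IsTest φ) (v : RSpace n) (ζ : CSpace n) :
    cFourier (fun w => fderiv ℝ φ w v) ζ = Complex.I * cdot ζ (toC v) * cFourier φ ζ := by
  have hexp : ∀ w, HasFDerivAt (fun w => Complex.exp (-(Complex.I * cdot ζ (toC w))))
      (fderiv ℝ (fun w => Complex.exp (-(Complex.I * cdot ζ (toC w)))) w) w ∧
      fderiv ℝ (fun w => Complex.exp (-(Complex.I * cdot ζ (toC w)))) w v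
        = -(Complex.I * cdot ζ (toC v)) * Complex.exp (-(Complex.I * cdot ζ (toC w))) := by
    intro w
    obtain ⟨L, hL, hLv⟩ := hasFDerivAt_cdot_toC ζ w
    have h1 : HasFDerivAt (fun w => Complex.exp (-(Complex.I * cdot ζ (toC w))))
        (Complex.exp (-(Complex.I * cdot ζ (toC w))) • -(Complex.I • L)) w :=
      ((hL.const_mul Complex.I).fun_neg).cexp
    refine ⟨h1.differentiableAt.hasFDerivAt, ?_⟩
    rw [h1.fderiv]
    simp [hLv]
    ring
  have hφd : Differentiable ℝ φ := hφ.1.differentiable (by simp)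
  have hφ'c : Continuous fun w => fderiv ℝ φ w v :=
    (hφ.1.continuous_fderiv (by simp)).clm_apply continuous_const
  have hφ's : HasCompactSupport fun w => fderiv ℝ φ w v := hφ.2.fderiv_apply (𝕜 := ℝ) v
  have h := integral_mul_fderiv_eq_neg_fderiv_mul_of_integrable (μ := (volume : Measure (RSpace n)))
    (f := fun w => Complex.exp (-(Complex.I * cdot ζ (toC w)))) (g := φ) (v := v)
    (by
      simp only [(hexp _).2]
      have := (integrable_exp_mul_test ζ hφ.1.continuous hφ.2).const_mul
        (-(Complex.I * cdot ζ (toC v)))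
      refine this.congr (Filter.Eventually.of_forall fun w => ?_)
      simp only
      ring)
    (integrable_exp_mul_test ζ hφ'c hφ's)
    (integrable_exp_mul_test ζ hφ.1.continuous hφ.2)
    (fun w _ => (hexp w).1.differentiableAt) (fun w _ => hφd w)
  rw [cFourier, h, cFourier, ← integral_neg, ← integral_const_mul]
  congr 1
  ext w
  rw [(hexp w).2]
  ring

theorem cFourier_partialDeriv {φ : RSpace n → ℂ} (hφ : IsTest φ) :
    ∀ {k : ℕ} (a : Fin k → Fin n) (ζ : CSpace n),
      cFourier (partialDeriv a φ) ζ = (∏ i, (Complex.I * ζ (a i))) * cFourier φ ζ := by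
  intro k
  induction k with
  | zero =>
    intro a ζ
    have : partialDeriv a φ = φ := by
      ext w; rw [partialDeriv, iteratedFDeriv_zero_apply]
    rw [this]; simp
  | succ k ih =>
    intro a ζ
    have h1 : partialDeriv a φ = fun w => fderiv ℝ (partialDeriv (Fin.tail a) φ) w
        (EuclideanSpace.single (a 0) (1 : ℝ)) := by
      ext w; exact partialDeriv_succ hφ a w
    have h2 : cdot ζ (toC (EuclideanSpace.single (a 0) (1 : ℝ))) = ζ (a 0) := by
      rw [cdot_toC, Finset.sum_eq_single (a 0)]
      · simp
      · intro b _ hb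
        simp [hb]
      · simp
    rw [h1, cFourier_fderiv (IsTest.partialDeriv hφ (Fin.tail a)), ih, h2, Fin.prod_univ_succ]
    simp only [Fin.tail]
    ring

/-- The pairing with a continuous function of compact support. -/
theorem exists_testPairing (γ : ℝ) {ψ : RSpace n → ℂ} (hc : Continuous ψ)
    (hs : HasCompactSupport ψ) :
    ∃ Λ : ExpL2 n γ →L[ℂ] ℂ, ∀ u, Λ u = ∫ w, u w * ψ w := by
  have h2 : MemLp (fun w => (Real.exp (γ * ‖w‖) : ℂ) * ψ w) 2 (volume : Measure (RSpace n)) :=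
    Continuous.memLp_of_hasCompactSupport (by fun_prop) hs.mul_left
  refine ⟨((ContinuousLinearMap.mul ℂ ℂ).lpPairing (volume : Measure (RSpace n)) 2 2
    (h2.toLp _)).comp (weightEquiv n γ).toContinuousLinearEquiv.toContinuousLinearMap, fun u => ?_⟩
  have h3 := ContinuousLinearMap.lpPairing_eq_integral (μ := (volume : Measure (RSpace n)))
    (p := 2) (q := 2) (ContinuousLinearMap.mul ℂ ℂ) (h2.toLp _) (weightEquiv n γ u)
  refine h3.trans (integral_congr_ae ?_)
  filter_upwards [h2.coeFn_toLp, coeFn_weightEquiv u] with w h4 h5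
  rw [h4, h5, ContinuousLinearMap.mul_apply']
  have := exp_mul_exp_neg γ ‖w‖ (u w * ψ w)
  linear_combination this

/-- Each condition on a weak derivative is an equality of two bounded functionals. Closedness is
needed for the projection onto the Sobolev space. -/
theorem isClosed_expSobolev (γ : ℝ) (m : ℕ) :
    IsClosed (ExpSobolev n γ m : Set (DerivIndex n m → ExpL2 n γ)) := by
  have : (ExpSobolev n γ m : Set (DerivIndex n m → ExpL2 n γ)) =
      ⋂ (a : DerivIndex n m), ⋂ (φ : RSpace n → ℂ), ⋂ (_ : IsTest φ),
        {u | ∫ w, u (DerivIndex.zero n m) w * partialDeriv a.2 φ w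
          = (-1 : ℂ) ^ (a.1 : ℕ) * ∫ w, u a w * φ w} := by
    ext u
    simp only [Set.mem_iInter, Set.mem_ofPred_eq]
    rfl
  rw [this]
  refine isClosed_iInter fun a => isClosed_iInter fun φ => isClosed_iInter fun hφ => ?_
  obtain ⟨Λ₁, h1⟩ := exists_testPairing γ (hφ.partialDeriv_continuous a.2)
    (hφ.partialDeriv_compact a.2)
  obtain ⟨Λ₂, h2⟩ := exists_testPairing γ hφ.1.continuous hφ.2
  simp only [← h1, ← h2]
  exact isClosed_eq (by fun_prop) (by fun_prop)

/-- The Sobolev space is complemented. -/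
theorem exists_projection (γ : ℝ) (m : ℕ) :
    ∃ π : (DerivIndex n m → ExpL2 n γ) →L[ℂ] ExpSobolev n γ m, ∀ u : ExpSobolev n γ m,
      π (u : DerivIndex n m → ExpL2 n γ) = u := by
  -- With the `ℓ²` norm the finite product is a Hilbert space with the same topology, and an
  -- orthogonal projection exists.
  let e := PiLp.continuousLinearEquiv 2 ℂ (fun _ : DerivIndex n m => ExpL2 n γ)
  let K : Submodule ℂ (PiLp 2 (fun _ : DerivIndex n m => ExpL2 n γ)) :=
    (ExpSobolev n γ m).comap e.toLinearEquiv.toLinearMap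
  have hK : IsClosed (K : Set (PiLp 2 (fun _ : DerivIndex n m => ExpL2 n γ))) :=
    (isClosed_expSobolev γ m).preimage e.continuous
  have : CompleteSpace K := hK.completeSpace_coe
  let π₀ := K.orthogonalProjectionOnto
  let j : K →L[ℂ] ExpSobolev n γ m :=
    (e.toContinuousLinearMap.comp K.subtypeL).codRestrict (ExpSobolev n γ m) (fun u => u.2)
  refine ⟨j.comp (π₀.comp e.symm.toContinuousLinearMap), fun u => ?_⟩
  have hu : e.symm (u : DerivIndex n m → ExpL2 n γ) ∈ K := by
    change e (e.symm (u : DerivIndex n m → ExpL2 n γ)) ∈ ExpSobolev n γ m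
    rw [ContinuousLinearEquiv.apply_symm_apply]
    exact u.2
  have h1 : π₀ (e.symm (u : DerivIndex n m → ExpL2 n γ)) = ⟨_, hu⟩ :=
    K.orthogonalProjectionOnto_mem_subspace_eq_self ⟨_, hu⟩
  apply Subtype.ext
  change e (π₀ (e.symm (u : DerivIndex n m → ExpL2 n γ)) : PiLp 2 _) = u
  rw [h1]
  exact e.apply_symm_apply _

theorem integral_norm_mul_norm_le (f g : L2 n) :
    Integrable (fun ξ => ‖f ξ‖ * ‖g ξ‖) volume ∧ ∫ ξ, ‖f ξ‖ * ‖g ξ‖ ≤ ‖f‖ * ‖g‖ := by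
  have hf := (Lp.memLp f).norm
  have hg := (Lp.memLp g).norm
  refine ⟨hf.integrable_mul hg, ?_⟩
  have h1 := real_inner_le_norm (hf.toLp _) (hg.toLp _)
  rw [Lp.norm_toLp, Lp.norm_toLp, eLpNorm_norm, eLpNorm_norm, ← Lp.norm_def, ← Lp.norm_def,
    L2.inner_def] at h1
  refine le_trans (le_of_eq ?_) h1
  refine integral_congr_ae ?_
  filter_upwards [hf.coeFn_toLp, hg.coeFn_toLp] with ξ h2 h3
  rw [h2, h3]
  simp [mul_comm]

/-- An operator of the form `T₂† m T₁`, where `T₁` and `T₂` map to bounded functions, is small if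
`m` is small in the complement of a set and small in mean on this set. -/
theorem norm_adjoint_mul_le {T₁ T₂ : L2 n →L[ℂ] L2 n} {C : ℝ} (hC : 0 ≤ C) (h1 : ‖T₁‖ ≤ C)
    (h2 : ‖T₂‖ ≤ C) (h1' : ∀ g, ∀ᵐ ξ, ‖T₁ g ξ‖ ≤ C * ‖g‖) (h2' : ∀ g, ∀ᵐ ξ, ‖T₂ g ξ‖ ≤ C * ‖g‖)
    (m : Lp ℂ ∞ (volume : Measure (RSpace n))) {S : Set (RSpace n)} (hS : MeasurableSet S)
    (hm : IntegrableOn (fun ξ => ‖m ξ‖) S volume)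
    {ε : ℝ} (hε : 0 ≤ ε) (hmε : ∀ᵐ ξ, ξ ∉ S → ‖m ξ‖ ≤ ε) :
    ‖(ContinuousLinearMap.adjoint T₂).comp ((mulL n m).comp T₁)‖
      ≤ C ^ 2 * (ε + ∫ ξ in S, ‖m ξ‖) := by
  have hI0 : 0 ≤ ∫ ξ in S, ‖m ξ‖ := integral_nonneg fun ξ => norm_nonneg _
  refine ContinuousLinearMap.opNorm_le_bound _ (by positivity) fun g => ?_
  set y := ((ContinuousLinearMap.adjoint T₂).comp ((mulL n m).comp T₁)) g with hy
  have hyy : ‖y‖ ^ 2 ≤ C ^ 2 * (ε + ∫ ξ in S, ‖m ξ‖) * ‖g‖ * ‖y‖ := by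
    have e1 : inner ℂ y y = inner ℂ (T₂ y) (mulL n m (T₁ g)) := by
      conv_lhs => rhs; rw [hy]
      rw [ContinuousLinearMap.comp_apply, ContinuousLinearMap.adjoint_inner_right]
      rfl
    have e2 : ‖y‖ ^ 2 = ‖inner ℂ y y‖ := by
      rw [inner_self_eq_norm_sq_to_K]; simp
    rw [e2, e1, L2.inner_def]
    obtain ⟨i1, i2⟩ := integral_norm_mul_norm_le (T₂ y) (T₁ g)
    have hmS : Integrable (S.indicator fun ξ => ‖m ξ‖) volume := (integrable_indicator_iff hS).2 hm
    -- Off `S` the multiplier is at most `ε` and the `L²` norms are used; on `S` both functions are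
    -- bounded pointwise and the multiplier is integrated.
    have hdom : ∀ᵐ ξ, ‖inner ℂ (T₂ y ξ) (mulL n m (T₁ g) ξ)‖ ≤
        ε * (‖T₂ y ξ‖ * ‖T₁ g ξ‖) + (C * ‖y‖ * (C * ‖g‖)) * S.indicator (fun ξ => ‖m ξ‖) ξ := by
      filter_upwards [coeFn_mulL m (T₁ g), h1' g, h2' y, hmε] with ξ a1 a2 a3 a4
      rw [a1]
      refine (norm_inner_le_norm _ _).trans ?_
      rw [norm_mul]
      by_cases hξ : ξ ∈ S
      · rw [Set.indicator_of_mem hξ]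
        have : ‖T₂ y ξ‖ * ‖T₁ g ξ‖ ≤ C * ‖y‖ * (C * ‖g‖) :=
          mul_le_mul a3 a2 (norm_nonneg _) (by positivity)
        have h5 : 0 ≤ ε * (‖T₂ y ξ‖ * ‖T₁ g ξ‖) := by positivity
        nlinarith [norm_nonneg (m ξ)]
      · rw [Set.indicator_of_notMem hξ, mul_zero, add_zero]
        have := a4 hξ
        have h5 : 0 ≤ ‖T₂ y ξ‖ * ‖T₁ g ξ‖ := by positivity
        nlinarith
    have h3 := norm_integral_le_of_norm_le ((i1.const_mul ε).add (hmS.const_mul _)) hdom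
    refine h3.trans ?_
    simp only [Pi.add_apply]
    rw [integral_add (i1.const_mul ε) (hmS.const_mul _), integral_const_mul, integral_const_mul,
      integral_indicator hS]
    have h4 : ∫ ξ, ‖T₂ y ξ‖ * ‖T₁ g ξ‖ ≤ (C * ‖y‖) * (C * ‖g‖) :=
      i2.trans (mul_le_mul ((T₂.le_opNorm y).trans (by gcongr))
        ((T₁.le_opNorm g).trans (by gcongr)) (norm_nonneg _) (by positivity))
    nlinarith [mul_le_mul_of_nonneg_left h4 hε]
  rcases (norm_nonneg y).eq_or_lt with h0 | h0
  · rw [← h0]; positivity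
  · nlinarith

/-- The analytic extension of the free resolvent to one component of the parameter domain. -/
theorem exists_contourExtension {γ γ' δ c κ : ℝ} (h : ContourParams n γ γ' δ c κ) (hν : ‖ν‖ = 1) :
    ∃ (𝒢 : ℂ × PerpC ν → (ExpL2 n (-γ) →L[ℂ] ExpSobolev n γ 2)) (C : ℝ), 0 ≤ C ∧
      AnalyticOnNhd ℂ 𝒢 (contourParam c δ κ ν) ∧
      (∀ p ∈ contourParam c δ κ ν, ∀ (f : ExpL2 n (-γ)) (φ : RSpace n → ℂ), IsTest φ →
        Integrable (fun ξ : RSpace n => contourJac c κ ν ((2 * Real.pi) • ξ) /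
          contourSymbol c κ p ((2 * Real.pi) • ξ) *
          cFourier f (contourPoint c κ p ((2 * Real.pi) • ξ)) *
          cFourier φ (-contourPoint c κ p ((2 * Real.pi) • ξ))) volume ∧
        ∫ w, ExpSobolev.incl n γ 2 (𝒢 p f) w * φ w =
          ∫ ξ : RSpace n, contourJac c κ ν ((2 * Real.pi) • ξ) /
          contourSymbol c κ p ((2 * Real.pi) • ξ) *
          cFourier f (contourPoint c κ p ((2 * Real.pi) • ξ)) *
          cFourier φ (-contourPoint c κ p ((2 * Real.pi) • ξ))) ∧
      (∀ p ∈ contourParam c δ κ ν, ∀ (S : Set (RSpace n)) (ε : ℝ), MeasurableSet S → 0 ≤ ε →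
        IntegrableOn (fun ξ : RSpace n => contourJac c κ ν ((2 * Real.pi) • ξ) /
          contourSymbol c κ p ((2 * Real.pi) • ξ)) S volume →
        (∀ ξ, ξ ∉ S → ‖contourJac c κ ν ((2 * Real.pi) • ξ) /
          contourSymbol c κ p ((2 * Real.pi) • ξ)‖ ≤ ε) →
        ‖(ExpSobolev.incl n γ 2).comp (𝒢 p)‖ ≤ C * (ε + ∫ ξ in S,
          ‖contourJac c κ ν ((2 * Real.pi) • ξ) / contourSymbol c κ p ((2 * Real.pi) • ξ)‖)) := by
  classical
  obtain ⟨T₁, T₂, E₁, E₂, C, hC0, hT₁, hT₂, hT₁', hT₂', hE₁n, hE₂n, hE₁, hE₂, hf, hpair⟩ :=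
    exists_contourOperators (ν := ν) h
  have hmult : ∀ a : DerivIndex n 2, ∃ G : ℂ × PerpC ν → Lp ℂ ∞ (volume : Measure (RSpace n)),
      AnalyticOnNhd ℂ G (contourParam c δ κ ν) ∧ ∀ p ∈ contourParam c δ κ ν,
        G p =ᵐ[volume] fun ξ => contourMult c κ a.2 p ((2 * Real.pi) • ξ) := fun a =>
    exists_analytic_contourMult hν h.hc h.hc1 h.hκ (Nat.le_of_lt_succ a.1.2) a.2
  choose G hG hG' using hmult
  let W₁ : ExpL2 n (-γ) →L[ℂ] L2 n := (weightEquiv n (-γ)).toContinuousLinearEquiv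
  let W₂ : L2 n →L[ℂ] ExpL2 n γ := (weightEquiv n γ).symm.toContinuousLinearEquiv
  -- The parameter enters through three multiplications only, each analytic in operator norm.
  let A : DerivIndex n 2 → ℂ × PerpC ν → (ExpL2 n (-γ) →L[ℂ] ExpL2 n γ) := fun a p =>
    W₂.comp ((mulL n (E₂ p)).comp (((ContinuousLinearMap.adjoint T₂).comp
      ((mulL n (G a p)).comp T₁)).comp ((mulL n (E₁ p)).comp W₁)))
  have hA : ∀ a, AnalyticOnNhd ℂ (A a) (contourParam c δ κ ν) := by
    intro a p hp
    have m1 : AnalyticAt ℂ (fun q => mulL n (E₁ q)) p :=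
      (mulL n).comp_analyticOnNhd hE₁ p hp
    have m2 : AnalyticAt ℂ (fun q => mulL n (E₂ q)) p :=
      (mulL n).comp_analyticOnNhd hE₂ p hp
    have m3 : AnalyticAt ℂ (fun q => mulL n (G a q)) p :=
      (mulL n).comp_analyticOnNhd (hG a) p hp
    exact analyticAt_clm_comp analyticAt_const (analyticAt_clm_comp m2
      (analyticAt_clm_comp (analyticAt_clm_comp analyticAt_const
        (analyticAt_clm_comp m3 analyticAt_const)) (analyticAt_clm_comp m1 analyticAt_const)))
  have hApair : ∀ a, ∀ p ∈ contourParam c δ κ ν, ∀ (f : ExpL2 n (-γ)) (φ : RSpace n → ℂ),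
      IsTest φ →
      Integrable (fun ξ : RSpace n => contourMult c κ a.2 p ((2 * Real.pi) • ξ) *
          cFourier f (contourPoint c κ p ((2 * Real.pi) • ξ)) *
          cFourier φ (-contourPoint c κ p ((2 * Real.pi) • ξ))) volume ∧
      ∫ w, A a p f w * φ w = ∫ ξ : RSpace n, contourMult c κ a.2 p ((2 * Real.pi) • ξ) *
          cFourier f (contourPoint c κ p ((2 * Real.pi) • ξ)) *
          cFourier φ (-contourPoint c κ p ((2 * Real.pi) • ξ)) := by
    intro a p hp f φ hφ
    obtain ⟨i1, i2⟩ := hpair p hp (G a p) (T₁ (mulL n (E₁ p) (weightEquiv n (-γ) f))) φ hφ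
    have hae : (fun ξ => G a p ξ * (T₁ (mulL n (E₁ p) (weightEquiv n (-γ) f)) : L2 n) ξ *
          cFourier φ (-contourPoint c κ p ((2 * Real.pi) • ξ))) =ᵐ[volume]
        fun ξ => contourMult c κ a.2 p ((2 * Real.pi) • ξ) *
          cFourier f (contourPoint c κ p ((2 * Real.pi) • ξ)) *
          cFourier φ (-contourPoint c κ p ((2 * Real.pi) • ξ)) := by
      filter_upwards [hG' a p hp, hf p hp f] with ξ h1 h2
      rw [h1, h2]
    refine ⟨i1.congr hae, ?_⟩
    rw [← integral_congr_ae hae]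
    exact i2
  have hzero : ∀ (p : ℂ × PerpC ν) (x : RSpace n), contourMult c κ (DerivIndex.zero n 2).2 p x
      = contourJac c κ ν x / contourSymbol c κ p x := by
    intro p x
    rw [contourMult]
    have : ∏ i : Fin ((DerivIndex.zero n 2).1 : ℕ), (Complex.I * (contourScale c κ ν x *
        (x ((DerivIndex.zero n 2).2 i) : ℂ) - (p.2 : CSpace n) ((DerivIndex.zero n 2).2 i))) = 1 :=
      Finset.prod_eq_one fun i _ => i.elim0
    rw [this, mul_one]
  -- The transform of a derivative of `φ`, taken at minus the contour point, yields the factor of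
  -- `contourMult` up to the sign `(-1)^k`, which is the sign in the definition of a weak
  -- derivative.
  have hmem : ∀ p ∈ contourParam c δ κ ν, ∀ f, (fun a => A a p f) ∈ ExpSobolev n γ 2 := by
    intro p hp f a φ hφ
    refine (hApair (DerivIndex.zero n 2) p hp f _ (IsTest.partialDeriv hφ a.2)).2.trans ?_
    refine Eq.trans ?_ (congrArg (fun t => (-1 : ℂ) ^ (a.1 : ℕ) * t) (hApair a p hp f φ hφ).2.symm)
    rw [← integral_const_mul]
    congr 1
    ext ξ
    rw [cFourier_partialDeriv hφ, hzero, contourMult]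
    have : ∏ i, (Complex.I * (-contourPoint c κ p ((2 * Real.pi) • ξ)) (a.2 i)) =
        (-1 : ℂ) ^ (a.1 : ℕ) * ∏ i, (Complex.I * (contourScale c κ ν ((2 * Real.pi) • ξ) *
          (((2 * Real.pi) • ξ) (a.2 i) : ℂ) - (p.2 : CSpace n) (a.2 i))) := by
      have e : ∀ i, Complex.I * (-contourPoint c κ p ((2 * Real.pi) • ξ)) (a.2 i) =
          (-1 : ℂ) * (Complex.I * (contourScale c κ ν ((2 * Real.pi) • ξ) *
          (((2 * Real.pi) • ξ) (a.2 i) : ℂ) - (p.2 : CSpace n) (a.2 i))) := by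
        intro i
        simp only [contourPoint, toC, PiLp.neg_apply, PiLp.sub_apply, PiLp.smul_apply, smul_eq_mul]
        ring
      rw [Finset.prod_congr rfl fun i _ => e i, Finset.prod_mul_distrib]
      simp
    rw [this]
    ring
  obtain ⟨π, hπ⟩ := exists_projection (n := n) γ 2
  -- The family is analytic into the full product, with values in the closed subspace. Composition
  -- with the projection changes no value and gives analyticity into the subspace.
  let B : ℂ × PerpC ν → (ExpL2 n (-γ) →L[ℂ] (DerivIndex n 2 → ExpL2 n γ)) := fun p =>
    ∑ a, (ContinuousLinearMap.single ℂ (fun _ : DerivIndex n 2 => ExpL2 n γ) a).comp (A a p)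
  have hB : ∀ p f, B p f = fun a => A a p f := by
    intro p f
    simp only [B, _root_.sum_apply, ContinuousLinearMap.comp_apply,
        ContinuousLinearMap.single_apply]
    exact Finset.univ_sum_single (fun a => A a p f)
  have hincl : ∀ p ∈ contourParam c δ κ ν, (ExpSobolev.incl n γ 2).comp (π.comp (B p))
      = A (DerivIndex.zero n 2) p := by
    intro p hp
    ext1 f
    have h1 : π (B p f) = ⟨fun a => A a p f, hmem p hp f⟩ := by
      rw [hB]; exact hπ ⟨_, hmem p hp f⟩
    simp only [ContinuousLinearMap.comp_apply, h1]
    rfl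
  refine ⟨fun p => π.comp (B p), C ^ 2, by positivity, ?_, ?_, ?_⟩
  · intro p hp
    refine analyticAt_clm_comp analyticAt_const ?_
    refine Finset.analyticAt_fun_sum _ fun a _ => ?_
    exact analyticAt_clm_comp analyticAt_const (hA a p hp)
  · intro p hp f φ hφ
    have h1 := hApair (DerivIndex.zero n 2) p hp f φ hφ
    simp only [hzero] at h1
    refine ⟨h1.1, Eq.trans ?_ h1.2⟩
    rw [← hincl p hp]
    rfl
  · intro p hp S ε hS hε hint hle
    have hGm := hG' (DerivIndex.zero n 2) p hp
    simp only [hzero] at hGm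
    have h0 := norm_adjoint_mul_le hC0 hT₁ hT₂ hT₁' hT₂' (G (DerivIndex.zero n 2) p) hS
      (hint.norm.congr (ae_restrict_of_ae (hGm.mono fun ξ hξ => by simp only [hξ]))) hε
      (hGm.mono fun ξ hξ h => by rw [hξ]; exact hle ξ h)
    have h1 : ∫ ξ in S, ‖G (DerivIndex.zero n 2) p ξ‖ = ∫ ξ in S,
          ‖contourJac c κ ν ((2 * Real.pi) • ξ) / contourSymbol c κ p ((2 * Real.pi) • ξ)‖ :=
      integral_congr_ae (ae_restrict_of_ae (hGm.mono fun ξ hξ => by simp only [hξ]))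
    rw [h1] at h0
    rw [hincl p hp]
    refine le_trans ?_ h0
    refine ContinuousLinearMap.opNorm_le_bound _ (norm_nonneg _) fun f => ?_
    set X := (ContinuousLinearMap.adjoint T₂).comp ((mulL n (G (DerivIndex.zero n 2) p)).comp T₁)
    change ‖(weightEquiv n γ).symm (mulL n (E₂ p) (X (mulL n (E₁ p) (weightEquiv n (-γ) f))))‖ ≤ _
    rw [LinearIsometryEquiv.norm_map]
    have b1 : ‖mulL n (E₁ p) (weightEquiv n (-γ) f)‖ ≤ ‖f‖ := by
      refine ((mulL n (E₁ p)).le_opNorm _).trans ?_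
      rw [LinearIsometryEquiv.norm_map]
      exact mul_le_of_le_one_left (norm_nonneg _) ((norm_mulL_le _).trans (hE₁n p hp))
    refine ((mulL n (E₂ p)).le_opNorm _).trans ?_
    refine (mul_le_of_le_one_left (norm_nonneg _) ((norm_mulL_le _).trans (hE₂n p hp))).trans ?_
    exact (X.le_opNorm _).trans (by gcongr)

end Extension

/-! ### Polar coordinates -/

section Polar

open Set

variable {n : ℕ}

theorem integrable_volumeIoiPow_iff (k : ℕ) (g : ℝ → ℂ) :
    Integrable (fun t : Ioi (0 : ℝ) => g t) (Measure.volumeIoiPow k) ↔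
      IntegrableOn (fun t => t ^ k • g t) (Ioi 0) := by
  rw [integrableOn_iff_comap_subtypeVal (by measurability), Measure.volumeIoiPow,
    integrable_withDensity_iff_integrable_smul', integrable_congr]
  · refine .of_forall ?_
    rintro ⟨x, hx : 0 < x⟩
    simp (disch := positivity) [ENNReal.toReal_ofReal]
  · fun_prop
  · simp

theorem integral_volumeIoiPow (k : ℕ) (g : ℝ → ℂ) :
    ∫ t : Ioi (0 : ℝ), g t ∂(Measure.volumeIoiPow k) = ∫ t in Ioi 0, t ^ k • g t := by
  simp only [Measure.volumeIoiPow, ENNReal.ofReal]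
  rw [integral_withDensity_eq_integral_smul,
    integral_subtype_comap measurableSet_Ioi fun a ↦ Real.toNNReal (a ^ k) • g a,
    setIntegral_congr_fun measurableSet_Ioi fun x hx ↦ ?_]
  · rw [NNReal.smul_def, Real.coe_toNNReal _ (pow_nonneg (le_of_lt hx) _)]
  · exact (measurable_subtype_coe.pow_const _).real_toNNReal

variable [NeZero n]

instance nontrivial_rSpace : Nontrivial (RSpace n) := by
  refine ⟨⟨0, EuclideanSpace.single 0 1, fun h => ?_⟩⟩
  have := congrArg (fun v : RSpace n => v 0) h
  simp at this

/-- The surface measure of the unit sphere. -/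
abbrev sphereMeasure (n : ℕ) : Measure (Metric.sphere (0 : RSpace n) 1) :=
  (volume : Measure (RSpace n)).toSphere

theorem integrable_polar_iff (F : RSpace n → ℂ) :
    Integrable F volume ↔ Integrable (fun y : Metric.sphere (0 : RSpace n) 1 × Ioi (0 : ℝ) =>
      F (y.2.1 • y.1.1)) ((sphereMeasure n).prod (Measure.volumeIoiPow (n - 1))) := by
  have h := (volume : Measure (RSpace n)).measurePreserving_homeomorphUnitSphereProd
  rw [finrank_euclideanSpace_fin] at h
  have e1 := h.integrable_comp_emb (g := fun y : Metric.sphere (0 : RSpace n) 1 × Ioi (0 : ℝ) =>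
      F (y.2.1 • y.1.1)) (Homeomorph.measurableEmbedding _)
  have e2 : Integrable F volume ↔ IntegrableOn F ({0}ᶜ : Set (RSpace n)) volume := by
    rw [IntegrableOn, restrict_compl_singleton]
  rw [← e1, e2, integrableOn_iff_comap_subtypeVal (by measurability)]
  refine integrable_congr (Filter.Eventually.of_forall fun x => ?_)
  simp only [Function.comp_apply]
  congr 1
  have h0 : ‖x.1‖ ≠ 0 := norm_ne_zero_iff.2 x.2
  simp [smul_smul, h0]

theorem integral_polar (F : RSpace n → ℂ) :
    ∫ x, F x = ∫ y : Metric.sphere (0 : RSpace n) 1 × Ioi (0 : ℝ), F (y.2.1 • y.1.1)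
      ∂((sphereMeasure n).prod (Measure.volumeIoiPow (n - 1))) := by
  have h := (volume : Measure (RSpace n)).measurePreserving_homeomorphUnitSphereProd
  rw [finrank_euclideanSpace_fin] at h
  have e1 := h.integral_comp (Homeomorph.measurableEmbedding _)
    (fun y : Metric.sphere (0 : RSpace n) 1 × Ioi (0 : ℝ) => F (y.2.1 • y.1.1))
  have e2 : ∫ x, F x = ∫ x in ({0}ᶜ : Set (RSpace n)), F x := by
    rw [restrict_compl_singleton]
  rw [← e1, e2, ← integral_subtype_comap (measurableSet_singleton _).compl]
  refine integral_congr_ae (Filter.Eventually.of_forall fun x => ?_)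
  simp only
  congr 1
  have h0 : ‖x.1‖ ≠ 0 := norm_ne_zero_iff.2 x.2
  simp [smul_smul, h0]

/-- Rays may be compared one by one and only for almost every direction, so directions orthogonal to
`ν`, where the deformation breaks down, can be ignored. -/
theorem integral_eq_of_polar {F G : RSpace n → ℂ} (hF : Integrable F volume)
    (hG : Integrable G volume)
    (h : ∀ᵐ θ ∂(sphereMeasure n), IntegrableOn (fun t : ℝ => t ^ (n - 1) • F (t • θ.1)) (Ioi 0) →
      IntegrableOn (fun t : ℝ => t ^ (n - 1) • G (t • θ.1)) (Ioi 0) →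
      ∫ t in Ioi (0 : ℝ), t ^ (n - 1) • F (t • θ.1)
        = ∫ t in Ioi (0 : ℝ), t ^ (n - 1) • G (t • θ.1)) :
    ∫ x, F x = ∫ x, G x := by
  have hF' := (integrable_polar_iff F).1 hF
  have hG' := (integrable_polar_iff G).1 hG
  rw [integral_polar F, integral_polar G, integral_prod _ hF', integral_prod _ hG']
  refine integral_congr_ae ?_
  filter_upwards [h, hF'.prod_right_ae, hG'.prod_right_ae] with θ h1 h2 h3
  rw [integral_volumeIoiPow (n - 1) (fun t => F (t • θ.1)),
    integral_volumeIoiPow (n - 1) (fun t => G (t • θ.1))]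
  exact h1 ((integrable_volumeIoiPow_iff (n - 1) (fun t => F (t • θ.1))).1 h2)
    ((integrable_volumeIoiPow_iff (n - 1) (fun t => G (t • θ.1))).1 h3)

theorem integrable_of_polar {F : RSpace n → ℂ} (hF : Measurable F)
    {b : Metric.sphere (0 : RSpace n) 1 → ℝ} (hb : Integrable b (sphereMeasure n))
    (h : ∀ᵐ θ ∂(sphereMeasure n), IntegrableOn (fun t : ℝ => t ^ (n - 1) • F (t • θ.1)) (Ioi 0) ∧
      ∫ t in Ioi (0 : ℝ), t ^ (n - 1) * ‖F (t • θ.1)‖ ≤ b θ) :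
    Integrable F volume := by
  have hm : Measurable (fun y : Metric.sphere (0 : RSpace n) 1 × Ioi (0 : ℝ) =>
      F (y.2.1 • y.1.1)) := hF.comp (by fun_prop)
  rw [integrable_polar_iff, integrable_prod_iff hm.aestronglyMeasurable]
  refine ⟨?_, ?_⟩
  · filter_upwards [h] with θ hθ
    exact (integrable_volumeIoiPow_iff (n - 1) (fun t => F (t • θ.1))).2 hθ.1
  · refine hb.mono' hm.aestronglyMeasurable.norm.integral_prod_right' ?_
    filter_upwards [h] with θ hθ
    rw [Real.norm_of_nonneg (integral_nonneg fun _ => norm_nonneg _)]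
    refine le_trans (le_of_eq ?_) hθ.2
    have h1 := integral_volumeIoiPow (n - 1) (fun t => ((‖F (t • θ.1)‖ : ℝ) : ℂ))
    have h2 : ∀ t : ℝ, t ^ (n - 1) • ((‖F (t • θ.1)‖ : ℝ) : ℂ)
        = ((t ^ (n - 1) * ‖F (t • θ.1)‖ : ℝ) : ℂ) := fun t => by
      rw [Complex.real_smul, Complex.ofReal_mul]
    simp only [h2, integral_complex_ofReal] at h1
    exact_mod_cast h1

/-- The function `|t|^{-1/2}` near the origin. -/
def invSqrt (t : ℝ) : ℝ := (Icc (-1) 1).indicator (fun t => |t| ^ (-(1 / 2) : ℝ)) t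

theorem invSqrt_nonneg (t : ℝ) : 0 ≤ invSqrt t :=
  indicator_nonneg (fun _ _ => Real.rpow_nonneg (abs_nonneg _) _) t

theorem integrable_invSqrt : Integrable invSqrt volume := by
  have h1 : IntegrableOn (fun t : ℝ => |t| ^ (-(1 / 2) : ℝ)) (Ioc 0 1) := by
    have := (intervalIntegral.intervalIntegrable_rpow' (a := 0) (b := 1) (r := -(1 / 2))
      (by norm_num)).1
    refine this.congr_fun (fun t ht => ?_) measurableSet_Ioc
    simp only
    rw [abs_of_pos ht.1]
  have h2 : IntegrableOn (fun t : ℝ => |t| ^ (-(1 / 2) : ℝ)) (Ico (-1) 0) := by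
    have h3 := (integrable_indicator_iff measurableSet_Ioc).2 h1
    rw [← integrable_indicator_iff measurableSet_Ico]
    refine h3.comp_neg.congr (Filter.Eventually.of_forall fun t => ?_)
    simp only [indicator, mem_Ioc, mem_Ico, abs_neg]
    congr 1
    refine propext ⟨fun h => ⟨by linarith, by linarith⟩, fun h => ⟨by linarith, by linarith⟩⟩
  have h4 : IntegrableOn (fun t : ℝ => |t| ^ (-(1 / 2) : ℝ)) (Icc (-1) 1) := by
    have h5 : Icc (-1 : ℝ) 1 = Ico (-1) 0 ∪ ({0} ∪ Ioc 0 1) := by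
      ext t
      simp only [mem_Icc, mem_union, mem_Ico, mem_singleton_iff, mem_Ioc]
      constructor
      · rintro ⟨h, h'⟩
        rcases lt_trichotomy t 0 with h0 | h0 | h0
        · exact Or.inl ⟨h, h0⟩
        · exact Or.inr (Or.inl h0)
        · exact Or.inr (Or.inr ⟨h0, h'⟩)
      · rintro (h | h | h)
        · exact ⟨h.1, by linarith⟩
        · rw [h]; norm_num
        · exact ⟨by linarith, h.2⟩
    rw [h5]
    exact h2.union ((integrableOn_singleton (by simp) (by simp)).union h1)
  exact (integrable_indicator_iff measurableSet_Icc).2 h4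

theorem rpow_neg_half_le (t : ℝ) : |t| ^ (-(1 / 2) : ℝ) ≤ invSqrt t + 1 := by
  unfold invSqrt
  by_cases h : t ∈ Icc (-1 : ℝ) 1
  · rw [indicator_of_mem h]; linarith
  · rw [indicator_of_notMem h, zero_add]
    have : 1 ≤ |t| := by
      by_contra! h1
      exact h ⟨by linarith [(abs_lt.1 h1).1], (abs_lt.1 h1).2.le⟩
    exact Real.rpow_le_one_of_one_le_of_nonpos this (by norm_num)

theorem measurable_invSqrt : Measurable invSqrt :=
  Measurable.indicator (by fun_prop) measurableSet_Icc

/-- In an orthonormal basis that starts with `ν` the function is dominated by a product of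
integrable functions of one coordinate. -/
theorem integrable_invSqrt_inner {ν : RSpace n} (hν : ‖ν‖ = 1) :
    Integrable (fun x : RSpace n => (Metric.closedBall (0 : RSpace n) 1).indicator
      (fun x => ((invSqrt (inner ℝ x ν) : ℝ) : ℂ)) x) volume := by
  classical
  let v : Fin n → RSpace n := fun i => if i = 0 then ν else 0
  have hv : Orthonormal ℝ (({0} : Set (Fin n)).domRestrict v) := by
    refine ⟨?_, ?_⟩
    · rintro ⟨i, rfl⟩; have h0 : v 0 = ν := if_pos rfl
      change ‖v 0‖ = 1
      rw [h0, hν]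
    · rintro ⟨i, rfl⟩ ⟨j, rfl⟩ hij; exact absurd rfl hij
  obtain ⟨b, hb⟩ := hv.exists_orthonormalBasis_extension_of_card_eq (by simp)
  have hb0 : b 0 = ν := by rw [hb 0 rfl]; simp [v]
  have hprod : Integrable (fun y : Fin n → ℝ => ∏ i, (if i = 0 then invSqrt (y i) else
      (Icc (-1 : ℝ) 1).indicator (fun _ => 1) (y i))) volume := by
    refine Integrable.fintype_prod (f := fun i : Fin n => fun t : ℝ => if i = 0 then invSqrt t else
      (Icc (-1 : ℝ) 1).indicator (fun _ => 1) t) fun i => ?_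
    by_cases hi : i = 0
    · simp only [hi, if_true]; exact integrable_invSqrt
    · simp only [hi, if_false]
      exact (integrable_indicator_iff measurableSet_Icc).2 (integrableOn_const (by simp))
  have h1 := ((EuclideanSpace.volume_preserving_symm_measurableEquiv_toLp (Fin n))
    ).integrable_comp_emb (MeasurableEquiv.measurableEmbedding _) |>.2 hprod
  have h2 := (b.repr.measurePreserving.integrable_comp_emb
    b.repr.toHomeomorph.measurableEmbedding).2 h1
  refine h2.mono' ?_ (Filter.Eventually.of_forall fun x => ?_)
  · refine (Measurable.indicator ?_ Metric.isClosed_closedBall.measurableSet).aestronglyMeasurable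
    exact Complex.measurable_ofReal.comp (measurable_invSqrt.comp (by fun_prop))
  · simp only [Function.comp_apply]
    have hcoord : ∀ i, b.repr x i = inner ℝ (b i) x := fun i => b.repr_apply_apply x i
    have hnn : ∀ i ∈ (Finset.univ : Finset (Fin n)), 0 ≤ (if i = 0 then invSqrt (b.repr x i) else
        (Icc (-1 : ℝ) 1).indicator (fun _ => 1) (b.repr x i)) := by
      intro i _
      split_ifs
      · exact invSqrt_nonneg _
      · exact indicator_nonneg (fun _ _ => zero_le_one) _
    by_cases hx : x ∈ Metric.closedBall (0 : RSpace n) 1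
    · rw [indicator_of_mem hx, Complex.norm_real, Real.norm_of_nonneg (invSqrt_nonneg _)]
      have hx1 : ‖x‖ ≤ 1 := by simpa using hx
      have : ∏ i, (if i = 0 then invSqrt (b.repr x i) else
          (Icc (-1 : ℝ) 1).indicator (fun _ => 1) (b.repr x i)) = invSqrt (inner ℝ x ν) := by
        rw [Finset.prod_eq_single_of_mem 0 (Finset.mem_univ _)]
        · rw [if_pos rfl, hcoord, hb0, real_inner_comm]
        · intro i _ hi
          rw [if_neg hi, indicator_of_mem]
          have h3 : |b.repr x i| ≤ 1 := by
            rw [hcoord]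
            refine (abs_real_inner_le_norm _ _).trans ?_
            rw [b.norm_eq_one, one_mul]; exact hx1
          exact ⟨by linarith [neg_le_of_abs_le h3], le_of_abs_le h3⟩
      exact this.ge
    · rw [indicator_of_notMem hx, norm_zero]
      exact Finset.prod_nonneg hnn

/-- Integrability over the unit ball gives, by Fubini in polar coordinates, integrability over
almost every sphere of radius below `1`. One such sphere suffices, as the function is homogeneous.
-/
theorem integrable_rpow_inner_sphere {ν : RSpace n} (hν : ‖ν‖ = 1) :
    Integrable (fun θ : Metric.sphere (0 : RSpace n) 1 =>
      |inner ℝ θ.1 ν| ^ (-(1 / 2) : ℝ)) (sphereMeasure n) := by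
  have h := (integrable_polar_iff _).1 (integrable_invSqrt_inner hν)
  have h1 := h.prod_left_ae
  -- Radii below `1` have positive measure, so one of them avoids the exceptional null set.
  have h2 : (Measure.volumeIoiPow (n - 1)) (Iio ⟨1, mem_Ioi.2 one_pos⟩) ≠ 0 := by
    rw [Measure.volumeIoiPow_apply_Iio]
    simp only [ne_eq, ENNReal.ofReal_eq_zero, not_le]
    positivity
  obtain ⟨t, ht1, ht2⟩ : ∃ t : Ioi (0 : ℝ), t ∈ Iio (⟨1, mem_Ioi.2 one_pos⟩ : Ioi (0 : ℝ)) ∧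
      Integrable (fun θ : Metric.sphere (0 : RSpace n) 1 =>
        (Metric.closedBall (0 : RSpace n) 1).indicator
      (fun x => ((invSqrt (inner ℝ x ν) : ℝ) : ℂ)) (t.1 • θ.1)) (sphereMeasure n) := by
    by_contra! hcon
    refine h2 (measure_mono_null ?_ (ae_iff.1 h1))
    intro t ht
    exact hcon t ht
  have ht0 : (0 : ℝ) < t := t.2
  have ht3 : (t : ℝ) < 1 := ht1
  have h3 := ht2.norm.const_mul ((t : ℝ) ^ (1 / 2 : ℝ))
  refine h3.congr (Filter.Eventually.of_forall fun θ => ?_)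
  have hθ : ‖θ.1‖ = 1 := by simp
  have hmem : t.1 • θ.1 ∈ Metric.closedBall (0 : RSpace n) 1 := by
    rw [mem_closedBall_zero_iff, norm_smul, hθ, mul_one, Real.norm_of_nonneg ht0.le]
    exact ht3.le
  have hs : |inner ℝ θ.1 ν| ≤ 1 := by
    have := abs_real_inner_le_norm θ.1 ν
    rwa [hθ, hν, mul_one] at this
  have hmem2 : t.1 * inner ℝ θ.1 ν ∈ Icc (-1 : ℝ) 1 := by
    rw [mem_Icc, ← abs_le, abs_mul, abs_of_pos ht0]
    exact mul_le_one₀ ht3.le (abs_nonneg _) hs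
  simp only
  rw [indicator_of_mem hmem, Complex.norm_real, Real.norm_of_nonneg (invSqrt_nonneg _),
    real_inner_smul_left, invSqrt, indicator_of_mem hmem2, abs_mul, abs_of_pos ht0,
    Real.mul_rpow ht0.le (abs_nonneg _), ← mul_assoc, ← Real.rpow_add ht0]
  norm_num

end Polar

/-! ### The deformation of the contour -/

section Deformation

open Set

variable {n : ℕ}

theorem ae_sphere_inner_ne_zero [NeZero n] {ν : RSpace n} (hν : ‖ν‖ = 1) :
    ∀ᵐ θ ∂(sphereMeasure n), inner ℝ θ.1 ν ≠ 0 := by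
  rw [ae_iff]
  simp only [not_not]
  have hm : MeasurableSet {θ : Metric.sphere (0 : RSpace n) 1 | inner ℝ θ.1 ν = 0} :=
    (measurableSet_singleton (0 : ℝ)).preimage (by fun_prop)
  rw [Measure.toSphere_apply' _ hm]
  refine mul_eq_zero_of_right _ ?_
  let S : Submodule ℝ (RSpace n) := LinearMap.ker (innerₗ (RSpace n) ν)
  have hS : S ≠ ⊤ := by
    intro h
    have h1 : ν ∈ S := h ▸ Submodule.mem_top
    have h2 : inner ℝ ν ν = 0 := h1
    rw [real_inner_self_eq_norm_sq, hν] at h2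
    norm_num at h2
  refine measure_mono_null ?_ (Measure.addHaar_submodule volume S hS)
  rintro x ⟨t, ht, y, ⟨θ, hθ, rfl⟩, rfl⟩
  have h3 : inner ℝ θ.1 ν = 0 := hθ
  change inner ℝ ν (t • θ.1) = 0
  rw [real_inner_smul_right, real_inner_comm, h3, mul_zero]

/-- Combines two lower bounds for the symbol, from its real and its imaginary part, with half the
power each. Both resulting singularities are integrable. -/
theorem rpow_neg_half_mul_le {a b m : ℝ} (ha : 0 < a) (hb : 0 < b) (ham : a ≤ m) (hbm : b ≤ m) :
    m⁻¹ ≤ a ^ (-(1 / 2) : ℝ) * b ^ (-(1 / 2) : ℝ) := by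
  have hm : 0 < m := ha.trans_le ham
  have h1 : m⁻¹ = m ^ (-(1 / 2) : ℝ) * m ^ (-(1 / 2) : ℝ) := by
    rw [← Real.rpow_add hm, ← Real.rpow_neg_one]; norm_num
  rw [h1]
  exact mul_le_mul (Real.rpow_le_rpow_of_nonpos ha ham (by norm_num))
    (Real.rpow_le_rpow_of_nonpos hb hbm (by norm_num)) (Real.rpow_nonneg hm.le _)
    (Real.rpow_nonneg ha.le _)

theorem mul_rpow_neg_half_le {t : ℝ} (ht : 0 < t) : t * t ^ (-(1 / 2) : ℝ) ≤ 1 + t := by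
  rcases le_total 1 t with h | h
  · have := Real.rpow_le_one_of_one_le_of_nonpos h (show (-(1 / 2) : ℝ) ≤ 0 by norm_num)
    nlinarith
  · have h1 : t * t ^ (-(1 / 2) : ℝ) = t ^ (1 / 2 : ℝ) := by
      nth_rewrite 1 [← Real.rpow_one t]
      rw [← Real.rpow_add ht]; norm_num
    rw [h1]
    have := Real.rpow_le_one ht.le h (show (0 : ℝ) ≤ 1 / 2 by norm_num)
    linarith

/-- A quadratic polynomial with roots of opposite sign. -/
theorem exists_root_bound {B q : ℝ} (hB : 0 ≤ B) (hq : 0 < q) :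
    ∃ l : ℝ, 0 < l ∧ ∀ b : ℝ, |b| ≤ B → ∃ τ : ℝ, ∀ t : ℝ, 0 < t →
      l * |t - τ| ≤ |t ^ 2 + 2 * b * t - q| := by
  -- With `D = √(b² + q)` the roots are `D - b > 0` and `-D - b < 0`. For `t > 0` the factor of the
  -- negative root is at least `D - |b| = q / (D + |b|)`, and `D + |b| ≤ 2B + √q`.
  refine ⟨q / (2 * B + Real.sqrt q), by positivity, fun b hb => ?_⟩
  set D := Real.sqrt (b ^ 2 + q) with hD
  have hD2 : D ^ 2 = b ^ 2 + q := Real.sq_sqrt (by positivity)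
  have hD0 : 0 ≤ D := Real.sqrt_nonneg _
  have hDb : |b| < D := by
    rw [← Real.sqrt_sq_eq_abs]
    exact Real.sqrt_lt_sqrt (sq_nonneg b) (by linarith)
  have hDle : D ≤ B + Real.sqrt q := by
    rw [hD]
    refine Real.sqrt_le_iff.2 ⟨by positivity, ?_⟩
    have h1 : b ^ 2 ≤ B ^ 2 := by rw [← sq_abs b]; gcongr
    nlinarith [Real.sq_sqrt hq.le, Real.sqrt_nonneg q]
  refine ⟨D - b, fun t ht => ?_⟩
  have h1 : t ^ 2 + 2 * b * t - q = (t + b + D) * (t - (D - b)) := by nlinarith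
  rw [h1, abs_mul]
  refine mul_le_mul_of_nonneg_right ?_ (abs_nonneg _)
  refine le_trans ?_ (le_abs_self _)
  rw [div_le_iff₀ (by positivity)]
  have h2 := neg_abs_le b
  have h3 : q = (D - |b|) * (D + |b|) := by nlinarith [sq_abs b]
  have h4 : D + |b| ≤ 2 * B + Real.sqrt q := by linarith
  calc q = (D - |b|) * (D + |b|) := h3
    _ ≤ (D - |b|) * (2 * B + Real.sqrt q) := mul_le_mul_of_nonneg_left h4 (by linarith)
    _ ≤ (t + b + D) * (2 * B + Real.sqrt q) := by
        refine mul_le_mul_of_nonneg_right ?_ (by positivity)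
        linarith

/-- The symbol in shifted real coordinates. -/
def shiftedSymbol (z : ℂ) (q : ℝ) (ν x : RSpace n) : ℂ :=
  ((‖x‖ ^ 2 : ℝ) : ℂ) + 2 * z * ((inner ℝ x ν : ℝ) : ℂ) - (q : ℂ)

/-- On a ray the real part of the symbol is bounded below by a multiple of `|t - τ|` and the
imaginary part by one of `t |θ·ν|`. The power `t^{-1/2}` is harmless because `n ≥ 2`, and the decay
of order `n + 1` leaves a factor `(1+t)^{-2}`. -/
theorem norm_inv_shiftedSymbol_mul_le (hn : 2 ≤ n) {ν θ : RSpace n} {z : ℂ} (hz : z.im ≠ 0)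
    {q l τ t C : ℝ} (hl : 0 < l) (hC0 : 0 ≤ C) {Φ : RSpace n → ℂ}
    (hC : ∀ x, (1 + ‖x‖) ^ (n + 1) * ‖Φ x‖ ≤ C) (hθ1 : ‖θ‖ = 1) (hθ : inner ℝ θ ν ≠ 0)
    (ht0 : 0 < t) (htτ : t ≠ τ)
    (hτ : l * |t - τ| ≤ |t ^ 2 + 2 * (z.re * inner ℝ θ ν) * t - q|) :
    t ^ (n - 1) * ‖(shiftedSymbol z q ν (t • θ))⁻¹ * Φ (t • θ)‖ ≤
      C * (2 * |z.im|) ^ (-(1 / 2) : ℝ) * l ^ (-(1 / 2) : ℝ) * |inner ℝ θ ν| ^ (-(1 / 2) : ℝ) *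
        (invSqrt (t - τ) + (1 + t ^ 2)⁻¹) := by
  have hs0 : 0 < |inner ℝ θ ν| := abs_pos.2 hθ
  have hnorm : ‖t • θ‖ = t := by rw [norm_smul, hθ1, mul_one, Real.norm_of_nonneg ht0.le]
  have him : (shiftedSymbol z q ν (t • θ)).im = 2 * z.im * (t * inner ℝ θ ν) := by
    rw [shiftedSymbol, real_inner_smul_left]
    simp [Complex.mul_im, Complex.add_im, -Complex.ofReal_pow]
  have hre : (shiftedSymbol z q ν (t • θ)).re = t ^ 2 + 2 * (z.re * inner ℝ θ ν) * t - q := by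
    rw [shiftedSymbol, real_inner_smul_left, hnorm]
    simp [Complex.mul_re, Complex.add_re, -Complex.ofReal_pow]
    ring
  have h1 : 0 < l * |t - τ| := mul_pos hl (abs_pos.2 (sub_ne_zero.2 htτ))
  have h2 : l * |t - τ| ≤ ‖shiftedSymbol z q ν (t • θ)‖ :=
    hτ.trans (by rw [← hre]; exact Complex.abs_re_le_norm _)
  have h3 : 0 < 2 * |z.im| * (t * |inner ℝ θ ν|) := by
    have := abs_pos.2 hz
    positivity
  have h4 : 2 * |z.im| * (t * |inner ℝ θ ν|) ≤ ‖shiftedSymbol z q ν (t • θ)‖ := by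
    refine le_trans (le_of_eq ?_) (Complex.abs_im_le_norm _)
    rw [him, abs_mul, abs_mul, abs_mul, abs_of_pos ht0, abs_two]
  have h5 := rpow_neg_half_mul_le h3 h1 h4 h2
  have h6 : (2 * |z.im| * (t * |inner ℝ θ ν|)) ^ (-(1 / 2) : ℝ)
      = (2 * |z.im|) ^ (-(1 / 2) : ℝ) * (t ^ (-(1 / 2) : ℝ) * |inner ℝ θ ν| ^ (-(1 / 2) : ℝ)) := by
    rw [Real.mul_rpow (by positivity) (by positivity), Real.mul_rpow ht0.le hs0.le]
  have h7 : (l * |t - τ|) ^ (-(1 / 2) : ℝ)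
      = l ^ (-(1 / 2) : ℝ) * |t - τ| ^ (-(1 / 2) : ℝ) :=
    Real.mul_rpow hl.le (abs_nonneg _)
  have h8 := hC (t • θ)
  rw [hnorm] at h8
  have h9 := mul_rpow_neg_half_le ht0
  have h10 : t ^ (n - 1) * t ^ (-(1 / 2) : ℝ) ≤ (1 + t) ^ (n - 1) := by
    obtain ⟨k, rfl⟩ : ∃ k, n = k + 2 := ⟨n - 2, by omega⟩
    have : k + 2 - 1 = k + 1 := by omega
    rw [this, pow_succ, pow_succ, mul_assoc]
    gcongr
    linarith
  have h11 : ‖Φ (t • θ)‖ ≤ C / (1 + t) ^ (n + 1) := by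
    rw [le_div_iff₀ (by positivity)]; linarith
  have h12 : (1 + t) ^ (n + 1) = (1 + t) ^ (n - 1) * (1 + t) ^ 2 := by
    rw [← pow_add]; congr 1; omega
  have h13 := rpow_neg_half_le (t - τ)
  have h14 := invSqrt_nonneg (t - τ)
  have h15 : 0 ≤ |t - τ| ^ (-(1 / 2) : ℝ) := by positivity
  have h16 : ((1 + t) ^ 2)⁻¹ ≤ (1 + t ^ 2)⁻¹ := by gcongr; nlinarith
  have h17 : ((1 + t) ^ 2)⁻¹ ≤ 1 := inv_le_one_of_one_le₀ (by nlinarith)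
  have h18 : ((1 + t) ^ 2)⁻¹ * |t - τ| ^ (-(1 / 2) : ℝ) ≤ invSqrt (t - τ) + (1 + t ^ 2)⁻¹ := by
    have h0 : 0 ≤ ((1 + t) ^ 2)⁻¹ := by positivity
    calc ((1 + t) ^ 2)⁻¹ * |t - τ| ^ (-(1 / 2) : ℝ) ≤ ((1 + t) ^ 2)⁻¹ * (invSqrt (t - τ) + 1) := by
          gcongr
      _ ≤ invSqrt (t - τ) + (1 + t ^ 2)⁻¹ := by nlinarith
  rw [norm_mul, norm_inv]
  rw [h6, h7] at h5
  calc t ^ (n - 1) * (‖shiftedSymbol z q ν (t • θ)‖⁻¹ * ‖Φ (t • θ)‖)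
      ≤ t ^ (n - 1) * (((2 * |z.im|) ^ (-(1 / 2) : ℝ) * (t ^ (-(1 / 2) : ℝ) *
        |inner ℝ θ ν| ^ (-(1 / 2) : ℝ)) * (l ^ (-(1 / 2) : ℝ) * |t - τ| ^ (-(1 / 2) : ℝ)))
        * (C / (1 + t) ^ (n + 1))) := by gcongr
    _ = C * (2 * |z.im|) ^ (-(1 / 2) : ℝ) * l ^ (-(1 / 2) : ℝ) * 
        |inner ℝ θ ν| ^ (-(1 / 2) : ℝ) * ((t ^ (n - 1) * t ^ (-(1 / 2) : ℝ)) *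
        (|t - τ| ^ (-(1 / 2) : ℝ) / (1 + t) ^ (n + 1))) := by ring
    _ ≤ C * (2 * |z.im|) ^ (-(1 / 2) : ℝ) * l ^ (-(1 / 2) : ℝ) * 
        |inner ℝ θ ν| ^ (-(1 / 2) : ℝ) * ((1 + t) ^ (n - 1) *
        (|t - τ| ^ (-(1 / 2) : ℝ) / (1 + t) ^ (n + 1))) := by gcongr
    _ = C * (2 * |z.im|) ^ (-(1 / 2) : ℝ) * l ^ (-(1 / 2) : ℝ) * 
        |inner ℝ θ ν| ^ (-(1 / 2) : ℝ) * (((1 + t) ^ 2)⁻¹ * |t - τ| ^ (-(1 / 2) : ℝ)) := by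
        rw [h12]; field_simp
    _ ≤ _ := mul_le_mul_of_nonneg_left h18 (by positivity)

/-- The symbol vanishes to first order on a set of codimension two, so its inverse is locally
integrable. In polar coordinates the singularity separates into one in the radius and one in the
direction. -/
theorem integrable_inv_shiftedSymbol_mul (hn : 2 ≤ n) {ν : RSpace n} (hν : ‖ν‖ = 1) {z : ℂ}
    (hz : z.im ≠ 0) {q : ℝ} (hq : 0 < q) {Φ : RSpace n → ℂ} (hm : Measurable Φ) {C : ℝ}
    (hC : ∀ x, (1 + ‖x‖) ^ (n + 1) * ‖Φ x‖ ≤ C) :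
    Integrable (fun x => (shiftedSymbol z q ν x)⁻¹ * Φ x) volume := by
  have : NeZero n := ⟨by omega⟩
  have hC0 : 0 ≤ C := le_trans (by positivity) (hC 0)
  obtain ⟨l, hl, hroot⟩ := exists_root_bound (abs_nonneg z.re) hq
  have hmeas : Measurable (fun x => (shiftedSymbol z q ν x)⁻¹ * Φ x) := by
    unfold shiftedSymbol
    fun_prop
  set K := C * (2 * |z.im|) ^ (-(1 / 2) : ℝ) * l ^ (-(1 / 2) : ℝ) with hK
  have hK0 : 0 ≤ K := by positivity
  set I := (∫ t, invSqrt t) + ∫ t : ℝ, (1 + t ^ 2)⁻¹ with hI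
  refine integrable_of_polar hmeas ((integrable_rpow_inner_sphere hν).const_mul (K * I)) ?_
  filter_upwards [ae_sphere_inner_ne_zero hν] with θ hθ
  have hθ1 : ‖θ.1‖ = 1 := by simp
  have hs1 : |inner ℝ θ.1 ν| ≤ 1 := by
    have := abs_real_inner_le_norm θ.1 ν
    rwa [hθ1, hν, mul_one] at this
  set s : ℝ := inner ℝ θ.1 ν with hs
  obtain ⟨τ, hτ⟩ := hroot (z.re * s) (by
    rw [abs_mul]; exact mul_le_of_le_one_right (abs_nonneg _) hs1)
  have hbound : ∀ t ∈ Ioi (0 : ℝ), t ≠ τ →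
      t ^ (n - 1) * ‖(shiftedSymbol z q ν (t • θ.1))⁻¹ * Φ (t • θ.1)‖ ≤
        K * |s| ^ (-(1 / 2) : ℝ) * (invSqrt (t - τ) + (1 + t ^ 2)⁻¹) := by
    exact fun t ht htτ => norm_inv_shiftedSymbol_mul_le hn hz hl hC0 hC hθ1 hθ ht htτ (hτ t ht)
  have hInt : Integrable (fun t : ℝ => K * |s| ^ (-(1 / 2) : ℝ) *
      (invSqrt (t - τ) + (1 + t ^ 2)⁻¹)) volume :=
    ((integrable_invSqrt.comp_sub_right τ).add integrable_inv_one_add_sq).const_mul _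
  have hae : ∀ᵐ t ∂(volume.restrict (Ioi (0 : ℝ))),
      t ^ (n - 1) * ‖(shiftedSymbol z q ν (t • θ.1))⁻¹ * Φ (t • θ.1)‖ ≤
        K * |s| ^ (-(1 / 2) : ℝ) * (invSqrt (t - τ) + (1 + t ^ 2)⁻¹) := by
    have h1 : ∀ᵐ t : ℝ ∂(volume.restrict (Ioi (0 : ℝ))), t ≠ τ :=
      ae_restrict_of_ae (by simp [ae_iff])
    filter_upwards [h1, ae_restrict_mem measurableSet_Ioi] with t h2 h3
    exact hbound t h3 h2
  have hmt : Measurable fun t : ℝ => t ^ (n - 1) •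
      ((shiftedSymbol z q ν (t • θ.1))⁻¹ * Φ (t • θ.1)) :=
    (by fun_prop : Measurable fun t : ℝ => t ^ (n - 1)).smul (hmeas.comp (by fun_prop))
  have hon : IntegrableOn (fun t : ℝ => t ^ (n - 1) •
      ((shiftedSymbol z q ν (t • θ.1))⁻¹ * Φ (t • θ.1))) (Ioi 0) := by
    refine Integrable.mono' hInt.integrableOn hmt.aestronglyMeasurable ?_
    filter_upwards [hae, ae_restrict_mem measurableSet_Ioi] with t h2 h3
    rw [norm_smul, norm_pow, Real.norm_of_nonneg (le_of_lt h3)]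
    exact h2
  refine ⟨hon, ?_⟩
  have hnn : ∀ t, 0 ≤ K * |s| ^ (-(1 / 2) : ℝ) * (invSqrt (t - τ) + (1 + t ^ 2)⁻¹) := fun t => by
    have := invSqrt_nonneg (t - τ)
    positivity
  calc ∫ t in Ioi (0 : ℝ), t ^ (n - 1) * ‖(shiftedSymbol z q ν (t • θ.1))⁻¹ * Φ (t • θ.1)‖
      ≤ ∫ t in Ioi (0 : ℝ), K * |s| ^ (-(1 / 2) : ℝ) * (invSqrt (t - τ) + (1 + t ^ 2)⁻¹) := by
        refine integral_mono_ae ?_ hInt.integrableOn hae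
        refine hon.norm.congr ?_
        filter_upwards [ae_restrict_mem measurableSet_Ioi] with t h3
        rw [norm_smul, norm_pow, Real.norm_of_nonneg (le_of_lt h3)]
    _ ≤ ∫ t, K * |s| ^ (-(1 / 2) : ℝ) * (invSqrt (t - τ) + (1 + t ^ 2)⁻¹) :=
        setIntegral_le_integral hInt (Filter.Eventually.of_forall hnn)
    _ = K * I * |s| ^ (-(1 / 2) : ℝ) := by
        rw [integral_const_mul, integral_add (integrable_invSqrt.comp_sub_right τ)
          integrable_inv_one_add_sq, integral_sub_right_eq_self invSqrt]
        ring

/-- The curve to which the half line is deformed. -/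
def contourCurve (c σ t : ℝ) : ℂ := (t : ℂ) + ((σ * (c * t / (1 + t)) : ℝ) : ℂ) * Complex.I

/-- The region between the half line and the curve. -/
def contourStrip (c σ : ℝ) : Set ℂ := {v | 0 ≤ v.re ∧ 0 ≤ σ * v.im ∧ σ * v.im ≤ c}

theorem convex_contourStrip (c σ : ℝ) : Convex ℝ (contourStrip c σ) := by
  intro v hv w hw a b ha hb hab
  obtain ⟨v1, v2, v3⟩ := hv
  obtain ⟨w1, w2, w3⟩ := hw
  simp only [contourStrip, mem_ofPred_eq, Complex.add_re, Complex.add_im, Complex.real_smul,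
    Complex.re_ofReal_mul, Complex.im_ofReal_mul]
  refine ⟨by positivity, ?_, ?_⟩
  · have : σ * (a * v.im + b * w.im) = a * (σ * v.im) + b * (σ * w.im) := by ring
    rw [this]; positivity
  · have : σ * (a * v.im + b * w.im) = a * (σ * v.im) + b * (σ * w.im) := by ring
    rw [this]
    calc a * (σ * v.im) + b * (σ * w.im) ≤ a * c + b * c := by gcongr
      _ = c := by rw [← add_mul, hab, one_mul]

theorem contourCurve_mem {c σ t : ℝ} (hc : 0 ≤ c) (hσ : σ ^ 2 = 1) (ht : 0 ≤ t) :
    contourCurve c σ t ∈ contourStrip c σ := by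
  have h1 : (contourCurve c σ t).re = t := by
    rw [contourCurve, Complex.add_re, Complex.re_ofReal_mul]; simp
  have h2 : (contourCurve c σ t).im = σ * (c * t / (1 + t)) := by
    rw [contourCurve, Complex.add_im, Complex.im_ofReal_mul]; simp
  have h3 : σ * (σ * (c * t / (1 + t))) = c * t / (1 + t) := by
    linear_combination (c * t / (1 + t)) * hσ
  refine ⟨by rw [h1]; exact ht, ?_, ?_⟩
  · rw [h2, h3]; positivity
  · rw [h2, h3, div_le_iff₀ (by positivity)]; nlinarith

theorem ofReal_mem_contourStrip {c σ t : ℝ} (hc : 0 ≤ c) (ht : 0 ≤ t) :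
    (t : ℂ) ∈ contourStrip c σ := by
  refine ⟨by simpa using ht, by simp, by simpa using hc⟩

theorem hasDerivAt_contourCurve {c σ t : ℝ} (ht : 0 ≤ t) :
    HasDerivAt (contourCurve c σ) (1 + ((σ * (c / (1 + t) ^ 2) : ℝ) : ℂ) * Complex.I) t := by
  have h0 : (1 + t) ≠ 0 := by positivity
  have h1 : HasDerivAt (fun t : ℝ => σ * (c * t / (1 + t))) (σ * (c / (1 + t) ^ 2)) t := by
    have h2 := (((hasDerivAt_id t).const_mul c).div ((hasDerivAt_id t).const_add 1) h0).const_mul σ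
    refine h2.congr_deriv ?_
    simp only [id]
    field_simp
    ring
  have h3 := (h1.ofReal_comp).mul_const Complex.I
  exact (hasDerivAt_id t).ofReal_comp.add h3 |>.congr_deriv (by simp)

/-- On the convex strip `g` has a primitive. Its difference between the curve and the half line
vanishes at `0`, where both start, and tends to zero at infinity because the vertical segment
joining them has length at most `c` while `g` decays. -/
theorem integral_contourCurve_eq {c σ : ℝ} (hc : 0 ≤ c) (hσ : σ ^ 2 = 1) {g : ℂ → ℂ}
    (hg : DifferentiableOn ℂ g (contourStrip c σ)) {K R : ℝ}
    (hdecay : ∀ v ∈ contourStrip c σ, R ≤ v.re → (1 + v.re) * ‖g v‖ ≤ K)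
    (h0 : IntegrableOn (fun t : ℝ => g t) (Ioi 0))
    (h1 : IntegrableOn (fun t : ℝ => (1 + ((σ * (c / (1 + t) ^ 2) : ℝ) : ℂ) * Complex.I) *
      g (contourCurve c σ t)) (Ioi 0)) :
    ∫ t in Ioi (0 : ℝ), g t = ∫ t in Ioi (0 : ℝ),
      (1 + ((σ * (c / (1 + t) ^ 2) : ℝ) : ℂ) * Complex.I) * g (contourCurve c σ t) := by
  obtain ⟨G, hG⟩ := (convex_contourStrip c σ).exists_forall_hasDerivWithinAt hg
  set H : ℝ → ℂ := fun t => G (contourCurve c σ t) - G t with hH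
  have hder : ∀ t : ℝ, 0 ≤ t → HasDerivWithinAt H
      ((1 + ((σ * (c / (1 + t) ^ 2) : ℝ) : ℂ) * Complex.I) * g (contourCurve c σ t) - g t)
      (Ici 0) t := by
    intro t ht
    have a1 : HasDerivWithinAt (G ∘ contourCurve c σ)
        ((1 + ((σ * (c / (1 + t) ^ 2) : ℝ) : ℂ) * Complex.I) • g (contourCurve c σ t)) (Ici 0) t :=
      (hG _ (contourCurve_mem hc hσ ht)).scomp t (hasDerivAt_contourCurve ht).hasDerivWithinAt
        (fun s hs => contourCurve_mem hc hσ hs)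
    have a2 : HasDerivWithinAt (G ∘ fun t : ℝ => (t : ℂ)) ((1 : ℂ) • g t) (Ici 0) t :=
      (hG _ (ofReal_mem_contourStrip hc ht)).scomp t
        ((hasDerivAt_id t).ofReal_comp.congr_deriv (by simp)).hasDerivWithinAt
        (fun s hs => ofReal_mem_contourStrip hc hs)
    simp only [smul_eq_mul, one_mul] at a1 a2
    exact a1.sub a2
  have hH0 : H 0 = 0 := by simp [hH, contourCurve]
  have hFTC : ∀ T : ℝ, 0 ≤ T → ∫ t in (0 : ℝ)..T,
      ((1 + ((σ * (c / (1 + t) ^ 2) : ℝ) : ℂ) * Complex.I) * g (contourCurve c σ t) - g t)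
      = H T := by
    intro T hT
    rw [intervalIntegral.integral_eq_sub_of_hasDeriv_right_of_le hT
      (fun t ht => ((hder t ht.1).continuousWithinAt).mono Icc_subset_Ici_self)
      (fun t ht => (hder t ht.1.le).mono (fun s hs => (ht.1.trans hs).le)), hH0, sub_zero]
    rw [intervalIntegrable_iff_integrableOn_Ioc_of_le hT]
    exact (h1.sub h0).mono_set Ioc_subset_Ioi_self
  have hlim : Filter.Tendsto H Filter.atTop (𝓝 0) := by
    have hb : ∀ᶠ T : ℝ in Filter.atTop, ‖H T‖ ≤ K * c / (1 + T) := by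
      filter_upwards [Filter.eventually_ge_atTop R, Filter.eventually_ge_atTop 0] with T hTR hT0
      have hconv : Convex ℝ (contourStrip c σ ∩ {v | v.re = T}) := by
        refine (convex_contourStrip c σ).inter ?_
        intro v hv w hw a b ha hb hab
        have h2 : v.re = T := hv
        have h3 : w.re = T := hw
        simp only [mem_ofPred_eq, Complex.add_re, Complex.real_smul, Complex.re_ofReal_mul, h2, h3]
        rw [← add_mul, hab, one_mul]
      have hre : (contourCurve c σ T).re = T := by
        rw [contourCurve, Complex.add_re, Complex.re_ofReal_mul]; simp
      have h4 := hconv.norm_image_sub_le_of_norm_hasDerivWithin_le (f := G) (f' := g)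
        (C := K / (1 + T)) (x := (T : ℂ)) (y := contourCurve c σ T)
        (fun v hv => (hG v hv.1).mono inter_subset_left)
        (fun v hv => by
          have h5 : v.re = T := hv.2
          have h6 := hdecay v hv.1 (by rw [h5]; exact hTR)
          rw [h5] at h6
          rw [le_div_iff₀ (by positivity)]; linarith)
        ⟨ofReal_mem_contourStrip hc hT0, by simp⟩ ⟨contourCurve_mem hc hσ hT0, hre⟩
      refine h4.trans ?_
      have hK : 0 ≤ K / (1 + T) := by
        have h6 := hdecay (T : ℂ) (ofReal_mem_contourStrip hc hT0) (by simpa using hTR)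
        have : 0 ≤ K := le_trans (by simp only [Complex.ofReal_re]; positivity) h6
        positivity
      have h7 : ‖contourCurve c σ T - T‖ ≤ c := by
        rw [contourCurve, add_sub_cancel_left, norm_mul, Complex.norm_I, mul_one,
          Complex.norm_real, norm_mul, Real.norm_eq_abs]
        have h8 : |σ| = 1 := by
          have := sq_abs σ
          rw [hσ] at this
          nlinarith [abs_nonneg σ]
        rw [h8, one_mul, Real.norm_of_nonneg (by positivity), div_le_iff₀ (by positivity)]
        nlinarith
      calc K / (1 + T) * ‖contourCurve c σ T - T‖ ≤ K / (1 + T) * c := by gcongr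
        _ = K * c / (1 + T) := by ring
    refine squeeze_zero_norm' hb ?_
    exact tendsto_const_nhds.div_atTop (Filter.tendsto_atTop_add_const_left _ _ Filter.tendsto_id)
  have hlim2 := intervalIntegral_tendsto_integral_Ioi (0 : ℝ) (h1.sub h0) Filter.tendsto_id
  have hlim3 := hlim2.congr' (f₂ := H) (by
    filter_upwards [Filter.eventually_ge_atTop 0] with T hT
    exact hFTC T hT)
  have h5 := tendsto_nhds_unique hlim3 hlim
  have h6 := integral_sub h1 h0
  simp only [Pi.sub_apply] at h5
  rw [h6] at h5
  exact (sub_eq_zero.1 h5).symm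

end Deformation

/-! ### Fourier transforms at complex frequencies -/

section ComplexFrequencies

variable {n : ℕ}

theorem toC_add (x y : RSpace n) : toC (x + y) = toC x + toC y := by
  ext i; simp [toC]

theorem toC_sub (x y : RSpace n) : toC (x - y) = toC x - toC y := by
  ext i; simp [toC]

theorem toC_neg (x : RSpace n) : toC (-x) = -toC x := by
  ext i; simp [toC]

theorem toC_smul (t : ℝ) (x : RSpace n) : toC (t • x) = (t : ℂ) • toC x := by
  ext i; simp [toC]

theorem norm_toC (x : RSpace n) : ‖toC x‖ = ‖x‖ := by
  rw [EuclideanSpace.norm_eq, EuclideanSpace.norm_eq]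
  simp [toC]

theorem cFourier_toC (f : RSpace n → ℂ) (ξ : RSpace n) :
    cFourier f (toC ((2 * Real.pi) • ξ)) = 𝓕 f ξ := by
  rw [Real.fourier_eq', cFourier]
  refine integral_congr_ae (Filter.Eventually.of_forall fun w => ?_)
  simp only [cdot_toC_toC, real_inner_smul_left, smul_eq_mul]
  congr 2
  rw [real_inner_comm w ξ]
  push_cast
  ring

theorem cFourier_neg_toC (f : RSpace n → ℂ) (ξ : RSpace n) :
    cFourier f (-toC ((2 * Real.pi) • ξ)) = 𝓕⁻ f ξ := by
  rw [Real.fourierInv_eq', cFourier]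
  refine integral_congr_ae (Filter.Eventually.of_forall fun w => ?_)
  simp only [cdot_neg_left, cdot_toC_toC, real_inner_smul_left, smul_eq_mul]
  congr 2
  rw [real_inner_comm w ξ]
  push_cast
  ring

theorem norm_exp_cdot_le {b : ℝ} {ζ : CSpace n}
    (h : ‖(WithLp.toLp 2 (fun i => (ζ i).im) : RSpace n)‖ ≤ b) (w : RSpace n) :
    ‖Complex.exp (-(Complex.I * cdot ζ (toC w)))‖ ≤ Real.exp (b * ‖w‖) := by
  have := norm_exp_I_cdot_le (ε := -1) (by simp) h w
  simpa using this

theorem norm_cFourier_le {b : ℝ} {h : RSpace n → ℂ}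
    (hh : Integrable (fun w => Real.exp (b * ‖w‖) * ‖h w‖) volume) {ζ : CSpace n}
    (hζ : ‖(WithLp.toLp 2 (fun i => (ζ i).im) : RSpace n)‖ ≤ b) :
    ‖cFourier h ζ‖ ≤ ∫ w, Real.exp (b * ‖w‖) * ‖h w‖ := by
  refine norm_integral_le_of_norm_le hh (Filter.Eventually.of_forall fun w => ?_)
  rw [norm_mul]
  gcongr
  exact norm_exp_cdot_le hζ w

theorem im_smul_toC_add (v : ℂ) (θ x : RSpace n) :
    (WithLp.toLp 2 (fun i => ((v • toC θ + toC x) i).im) : RSpace n) = v.im • θ := by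
  ext i
  simp [toC, Complex.mul_im]

theorem differentiableAt_cFourier {b : ℝ} {h : RSpace n → ℂ}
    (hm : AEStronglyMeasurable h volume)
    (hh : Integrable (fun w => Real.exp (b * ‖w‖) * ‖h w‖) volume) {θ : RSpace n} (hθ : ‖θ‖ = 1)
    (x : RSpace n) {v : ℂ} (hv : |v.im| < b) :
    DifferentiableAt ℂ (fun v : ℂ => cFourier h (v • toC θ + toC x)) v := by
  -- The gap between `b'` and `b` absorbs the factor `|w|` that differentiation under the integral
  -- produces.
  obtain ⟨b', hb1, hb2⟩ := exists_between hv
  have hopen : IsOpen {v : ℂ | |v.im| < b'} :=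
    isOpen_lt (continuous_abs.comp Complex.continuous_im) continuous_const
  set F : ℂ → RSpace n → ℂ := fun v w =>
    Complex.exp (-(Complex.I * cdot (v • toC θ + toC x) (toC w))) * h w with hF
  set F' : ℂ → RSpace n → ℂ := fun v w => -(Complex.I * cdot (toC θ) (toC w)) * F v w with hF'
  have hFm : ∀ v, AEStronglyMeasurable (F v) volume := fun v => by
    have := continuous_cdot_toC (v • toC θ + toC x)
    exact (Continuous.aestronglyMeasurable (by fun_prop)).mul hm
  have hexp : ∀ u ∈ {v : ℂ | |v.im| < b'}, ∀ w, ‖F u w‖ ≤ Real.exp (b' * ‖w‖) * ‖h w‖ := by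
    intro u hu w
    rw [hF, norm_mul]
    gcongr
    refine norm_exp_cdot_le ?_ w
    rw [im_smul_toC_add, norm_smul, hθ, mul_one]
    exact le_of_lt hu
  have hd : 0 < b - b' := sub_pos.2 hb2
  refine (hasDerivAt_integral_of_dominated_loc_of_deriv_le (F := F) (F' := F')
    (bound := fun w => (b - b')⁻¹ * (Real.exp (b * ‖w‖) * ‖h w‖)) (hopen.mem_nhds hb1)
    (Filter.Eventually.of_forall hFm) ?_ ?_ ?_ (hh.const_mul _) ?_).2.differentiableAt
  · refine hh.mono' (hFm v) (Filter.Eventually.of_forall fun w => (hexp v hb1 w).trans ?_)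
    gcongr
  · have := continuous_cdot_toC (toC θ)
    exact (Continuous.aestronglyMeasurable (by fun_prop)).mul (hFm v)
  · refine Filter.Eventually.of_forall fun w u hu => ?_
    rw [hF', norm_mul, norm_neg, norm_mul, Complex.norm_I, one_mul, cdot_toC_toC,
      Complex.norm_real]
    have h1 : ‖inner ℝ θ w‖ ≤ ‖w‖ := by
      have := norm_inner_le_norm (𝕜 := ℝ) θ w
      rwa [hθ, one_mul] at this
    have h2 : ‖w‖ ≤ (b - b')⁻¹ * Real.exp ((b - b') * ‖w‖) := by
      rw [← div_eq_inv_mul, le_div_iff₀ hd]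
      have := Real.add_one_le_exp ((b - b') * ‖w‖)
      linarith
    calc ‖inner ℝ θ w‖ * ‖F u w‖
        ≤ ((b - b')⁻¹ * Real.exp ((b - b') * ‖w‖)) * (Real.exp (b' * ‖w‖) * ‖h w‖) := by
          refine mul_le_mul (h1.trans h2) (hexp u hu w) (norm_nonneg _) ?_
          positivity
      _ = (b - b')⁻¹ * ((Real.exp ((b - b') * ‖w‖) * Real.exp (b' * ‖w‖)) * ‖h w‖) := by ring
      _ = (b - b')⁻¹ * (Real.exp (b * ‖w‖) * ‖h w‖) := by
          rw [← Real.exp_add]; congr 4; ring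
  · refine Filter.Eventually.of_forall fun w u hu => ?_
    have h1 : HasDerivAt (fun v : ℂ => -(Complex.I * cdot (v • toC θ + toC x) (toC w)))
        (-(Complex.I * cdot (toC θ) (toC w))) u := by
      have : (fun v : ℂ => -(Complex.I * cdot (v • toC θ + toC x) (toC w))) = fun v =>
          v * (-(Complex.I * cdot (toC θ) (toC w))) + -(Complex.I * cdot (toC x) (toC w)) := by
        funext v
        rw [cdot_add_left, cdot_smul_left]
        ring
      rw [this]
      simpa using ((hasDerivAt_id u).mul_const
        (-(Complex.I * cdot (toC θ) (toC w)))).add_const (-(Complex.I * cdot (toC x) (toC w)))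
    have h2 := h1.cexp.mul_const (h w)
    refine h2.congr_deriv ?_
    simp only [hF', hF]
    ring

theorem norm_le_sum_norm (ζ : CSpace n) : ‖ζ‖ ≤ ∑ i, ‖ζ i‖ := by
  rw [EuclideanSpace.norm_eq]
  refine Real.sqrt_le_iff.2 ⟨Finset.sum_nonneg fun i _ => norm_nonneg _, ?_⟩
  exact Finset.sum_sq_le_sq_sum_of_nonneg fun i _ => norm_nonneg _

theorem IsTest.integrable_exp_mul_norm {φ : RSpace n → ℂ} (hφ : IsTest φ) (b : ℝ) :
    Integrable (fun w => Real.exp (b * ‖w‖) * ‖φ w‖) volume := by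
  have := hφ.1.continuous
  exact Continuous.integrable_of_hasCompactSupport (by fun_prop) hφ.2.norm.mul_left

/-- The Paley–Wiener bound. -/
theorem exists_norm_cFourier_test_le (b : ℝ) (N : ℕ) :
    ∀ {φ : RSpace n → ℂ}, IsTest φ → ∃ C : ℝ, ∀ ζ : CSpace n,
      ‖(WithLp.toLp 2 (fun i => (ζ i).im) : RSpace n)‖ ≤ b →
      (1 + ‖ζ‖) ^ N * ‖cFourier φ ζ‖ ≤ C := by
  induction N with
  | zero =>
    intro φ hφ
    exact ⟨_, fun ζ hζ => by
      rw [pow_zero, one_mul]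
      exact norm_cFourier_le (hφ.integrable_exp_mul_norm b) hζ⟩
  | succ N ih =>
    intro φ hφ
    obtain ⟨C, hC⟩ := ih hφ
    have hj : ∀ j : Fin n, ∃ C : ℝ, ∀ ζ : CSpace n,
        ‖(WithLp.toLp 2 (fun i => (ζ i).im) : RSpace n)‖ ≤ b →
        (1 + ‖ζ‖) ^ N * ‖cFourier (partialDeriv (fun _ : Fin 1 => j) φ) ζ‖ ≤ C :=
      fun j => ih (hφ.partialDeriv _)
    choose D hD using hj
    -- One more power of `1 + ‖ζ‖` is at most `1 + ∑ ‖ζ j‖`, and each factor `ζ j` is traded for a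
    -- derivative of `φ`.
    refine ⟨C + ∑ j, D j, fun ζ hζ => ?_⟩
    have h1 : ∀ j, ‖cFourier (partialDeriv (fun _ : Fin 1 => j) φ) ζ‖ = ‖ζ j‖ * ‖cFourier φ ζ‖ := by
      intro j
      rw [cFourier_partialDeriv hφ]
      simp
    calc (1 + ‖ζ‖) ^ (N + 1) * ‖cFourier φ ζ‖
        ≤ (1 + ‖ζ‖) ^ N * (1 + ∑ j, ‖ζ j‖) * ‖cFourier φ ζ‖ := by
          rw [pow_succ]
          gcongr
          exact norm_le_sum_norm ζ
      _ = (1 + ‖ζ‖) ^ N * ‖cFourier φ ζ‖ + ∑ j, (1 + ‖ζ‖) ^ N * (‖ζ j‖ * ‖cFourier φ ζ‖) := by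
          rw [← Finset.mul_sum, ← Finset.sum_mul]; ring
      _ ≤ C + ∑ j, D j := by
          refine add_le_add (hC ζ hζ) (Finset.sum_le_sum fun j _ => ?_)
          rw [← h1]
          exact hD j ζ hζ

theorem integrable_exp_mul_expL2 {γ b : ℝ} (hb : b < γ) (f : ExpL2 n (-γ)) :
    Integrable (fun w => Real.exp (b * ‖w‖) * ‖f w‖) volume := by
  have h1 := integrable_exp_neg_mul (sub_pos.2 hb) (weightEquiv n (-γ) f)
  refine h1.congr ?_
  filter_upwards [coeFn_weightEquiv f] with w hw
  rw [hw, norm_mul, Complex.norm_real, Real.norm_of_nonneg (Real.exp_pos _).le, ← mul_assoc,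
    ← Real.exp_add]
  congr 2
  ring

theorem continuous_cFourier_toC {f : RSpace n → ℂ} (hf : Integrable f volume) :
    Continuous fun x : RSpace n => cFourier f (toC x) := by
  have h1 : Continuous (𝓕 f) := VectorFourier.fourierIntegral_continuous
    Real.continuous_fourierChar (by exact continuous_inner) hf
  have h2 : (fun x : RSpace n => cFourier f (toC x)) = fun x => 𝓕 f ((2 * Real.pi)⁻¹ • x) := by
    funext x
    rw [← cFourier_toC, smul_smul, mul_inv_cancel₀ (by positivity), one_smul]
  rw [h2]
  exact h1.comp (continuous_const_smul _)

theorem integrable_coe_expL2 {γ : ℝ} (hγ : 0 < γ) (f : ExpL2 n (-γ)) :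
    Integrable (fun w => f w) volume := by
  have h1 := integrable_exp_mul_expL2 hγ f
  simp only [zero_mul, Real.exp_zero, one_mul] at h1
  exact (integrable_norm_iff ((Lp.aestronglyMeasurable f).mono_ac (ac_expMeasure n (-γ)))).1 h1

end ComplexFrequencies

/-! ### The contour integral at real frequencies -/

section RealFrequencies

open Set

variable {n : ℕ} {ν : RSpace n}

/-- The integrand along a ray, as a function of the complex radius. -/
def rayIntegrand (z : ℂ) (q : ℝ) (ν r₀ θ : RSpace n) (f φ : RSpace n → ℂ) (v : ℂ) : ℂ :=
  v ^ (n - 1) * ((v ^ 2 + 2 * z * ((inner ℝ θ ν : ℝ) : ℂ) * v - (q : ℂ))⁻¹ *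
    (cFourier f (v • toC θ + toC (-r₀)) * cFourier φ (v • toC (-θ) + toC r₀)))

/-- If the symbol vanished, the imaginary part of its product with the conjugate of `v`, multiplied
by `σ`, would be a sum of nonnegative terms equal to zero. One of them is a positive multiple of
`|v|²`, so `v = 0`; but there the symbol equals `-q`. -/
theorem raySymbol_ne_zero {z : ℂ} {q σ s c : ℝ} (hq : 0 < q) (hσ : 0 < σ * (s * z.im)) {v : ℂ}
    (hv : v ∈ contourStrip c σ) : v ^ 2 + 2 * z * (s : ℂ) * v - (q : ℂ) ≠ 0 := by
  intro h0
  obtain ⟨-, hv2, -⟩ := hv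
  have h1 := congrArg Complex.im (congrArg (· * (starRingEnd ℂ) v) h0)
  have h2 := congrArg Complex.re h0
  simp only [pow_two, Complex.sub_im, Complex.add_im, Complex.mul_im, Complex.mul_re,
    Complex.ofReal_re, Complex.ofReal_im, Complex.conj_re, Complex.conj_im, Complex.sub_re,
    Complex.add_re, Complex.re_ofNat, Complex.im_ofNat, Complex.zero_re, Complex.zero_im] at h1 h2
  have h3 : (v.re ^ 2 + v.im ^ 2 + q) * (σ * v.im) +
      2 * (σ * (s * z.im)) * (v.re ^ 2 + v.im ^ 2) = 0 := by
    linear_combination σ * h1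
  have h4 : v.re ^ 2 + v.im ^ 2 = 0 := by
    have h5 : 0 ≤ (v.re ^ 2 + v.im ^ 2 + q) * (σ * v.im) := by positivity
    have h6 : 0 ≤ v.re ^ 2 + v.im ^ 2 := by positivity
    nlinarith
  have h5 : v.re = 0 := by nlinarith [sq_nonneg v.re, sq_nonneg v.im]
  have h6 : v.im = 0 := by nlinarith [sq_nonneg v.re, sq_nonneg v.im]
  rw [h5, h6] at h2
  simp at h2
  linarith

theorem abs_im_le_of_mem_contourStrip {c σ : ℝ} (hσ : σ ^ 2 = 1) {v : ℂ}
    (hv : v ∈ contourStrip c σ) : |v.im| ≤ c := by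
  have h1 : |σ| = 1 := by
    have := sq_abs σ
    rw [hσ] at this
    nlinarith [abs_nonneg σ]
  have h2 : |σ * v.im| = |v.im| := by rw [abs_mul, h1, one_mul]
  rw [← h2, abs_of_nonneg hv.2.1]
  exact hv.2.2

theorem differentiableOn_rayIntegrand {z : ℂ} {q σ c b : ℝ} {r₀ θ : RSpace n} (hq : 0 < q)
    (hθ : ‖θ‖ = 1) (hσ1 : σ ^ 2 = 1) (hσ : 0 < σ * (inner ℝ θ ν * z.im)) (hcb : c < b)
    {f φ : RSpace n → ℂ} (hfm : AEStronglyMeasurable f volume)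
    (hf : Integrable (fun w => Real.exp (b * ‖w‖) * ‖f w‖) volume) (hφ : IsTest φ) :
    DifferentiableOn ℂ (rayIntegrand z q ν r₀ θ f φ) (contourStrip c σ) := by
  intro v hv
  have hv1 : |v.im| < b := (abs_im_le_of_mem_contourStrip hσ1 hv).trans_lt hcb
  have h1 := differentiableAt_cFourier hfm hf hθ (-r₀) hv1
  have h2 := differentiableAt_cFourier hφ.1.continuous.aestronglyMeasurable
    (hφ.integrable_exp_mul_norm b) (θ := -θ) (by rw [norm_neg, hθ]) r₀ hv1
  refine DifferentiableAt.differentiableWithinAt ?_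
  have h3 : DifferentiableAt ℂ (fun v : ℂ =>
      v ^ 2 + 2 * z * ((inner ℝ θ ν : ℝ) : ℂ) * v - (q : ℂ)) v := by fun_prop
  unfold rayIntegrand
  exact (differentiableAt_id.pow _).fun_mul
    ((h3.inv (raySymbol_ne_zero hq hσ hv)).fun_mul (h1.fun_mul h2))

/-- The Paley–Wiener bound of order `n` beats the factors `v^(n-1)` and `1 + v.re`; of the inverse
symbol only boundedness by `1` far out is used. -/
theorem exists_rayIntegrand_decay {z : ℂ} {q σ c b : ℝ} {r₀ θ : RSpace n} (hq : 0 < q)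
    (hθ : ‖θ‖ = 1) (hσ1 : σ ^ 2 = 1) (hcb : c < b) {f φ : RSpace n → ℂ}
    (hf : Integrable (fun w => Real.exp (b * ‖w‖) * ‖f w‖) volume) (hφ : IsTest φ) :
    ∃ K R : ℝ, ∀ v ∈ contourStrip c σ, R ≤ v.re →
      (1 + v.re) * ‖rayIntegrand z q ν r₀ θ f φ v‖ ≤ K := by
  obtain ⟨C, hC⟩ := exists_norm_cFourier_test_le b n hφ
  set A := ∫ w, Real.exp (b * ‖w‖) * ‖f w‖ with hA
  have hA0 : 0 ≤ A := integral_nonneg fun w => by positivity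
  set a := ‖2 * z * ((inner ℝ θ ν : ℝ) : ℂ)‖ with ha
  refine ⟨A * ((1 + ‖r₀‖) ^ n * C), a + q + 1, fun v hv hR => ?_⟩
  have hv1 : |v.im| ≤ b := (abs_im_le_of_mem_contourStrip hσ1 hv).trans hcb.le
  have hvn : v.re ≤ ‖v‖ := Complex.re_le_norm v
  have h1 : ‖cFourier f (v • toC θ + toC (-r₀))‖ ≤ A := norm_cFourier_le hf (by
    rw [im_smul_toC_add, norm_smul, hθ, mul_one]; exact hv1)
  have h2 := hC (v • toC (-θ) + toC r₀) (by
    rw [im_smul_toC_add, norm_smul, norm_neg, hθ, mul_one]; exact hv1)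
  have h3 : 1 + ‖v‖ ≤ (1 + ‖r₀‖) * (1 + ‖v • toC (-θ) + toC r₀‖) := by
    have h4 : ‖v‖ ≤ ‖v • toC (-θ) + toC r₀‖ + ‖r₀‖ := by
      have h5 : ‖v • toC (-θ)‖ = ‖v‖ := by rw [norm_smul, norm_toC, norm_neg, hθ, mul_one]
      have h6 := norm_sub_le (v • toC (-θ) + toC r₀) (toC r₀)
      rwa [add_sub_cancel_right, h5, norm_toC] at h6
    nlinarith [norm_nonneg r₀, norm_nonneg (v • toC (-θ) + toC r₀)]
  have h4 : (1 + ‖v‖) ^ n * ‖cFourier φ (v • toC (-θ) + toC r₀)‖ ≤ (1 + ‖r₀‖) ^ n * C := by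
    calc (1 + ‖v‖) ^ n * ‖cFourier φ (v • toC (-θ) + toC r₀)‖
        ≤ ((1 + ‖r₀‖) * (1 + ‖v • toC (-θ) + toC r₀‖)) ^ n *
          ‖cFourier φ (v • toC (-θ) + toC r₀)‖ := by gcongr
      _ = (1 + ‖r₀‖) ^ n * ((1 + ‖v • toC (-θ) + toC r₀‖) ^ n *
          ‖cFourier φ (v • toC (-θ) + toC r₀)‖) := by rw [mul_pow]; ring
      _ ≤ (1 + ‖r₀‖) ^ n * C := by gcongr
  have ha0 : 0 ≤ a := norm_nonneg _
  have h5 : 1 ≤ ‖v ^ 2 + 2 * z * ((inner ℝ θ ν : ℝ) : ℂ) * v - (q : ℂ)‖ := by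
    have h6 := norm_sub_norm_le (v ^ 2) (-(2 * z * ((inner ℝ θ ν : ℝ) : ℂ) * v - (q : ℂ)))
    have h7 := norm_sub_le (2 * z * ((inner ℝ θ ν : ℝ) : ℂ) * v) (q : ℂ)
    rw [norm_mul, ← ha, Complex.norm_real, Real.norm_of_nonneg hq.le] at h7
    rw [norm_neg, norm_pow] at h6
    have h8 : v ^ 2 - -(2 * z * ((inner ℝ θ ν : ℝ) : ℂ) * v - (q : ℂ))
        = v ^ 2 + 2 * z * ((inner ℝ θ ν : ℝ) : ℂ) * v - (q : ℂ) := by ring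
    rw [h8] at h6
    nlinarith
  have h6 := inv_le_one_of_one_le₀ h5
  have h7 : (1 + ‖v‖) * ‖v‖ ^ (n - 1) ≤ (1 + ‖v‖) ^ n := by
    -- In dimension zero there is no unit vector `θ`; this case must go since `n - 1` is truncated.
    rcases Nat.eq_zero_or_pos n with rfl | hn
    · have h8 : ‖θ‖ = 0 := by simp [Subsingleton.elim θ 0]
      rw [hθ] at h8
      norm_num at h8
    · obtain ⟨k, rfl⟩ : ∃ k, n = k + 1 := ⟨n - 1, by omega⟩
      rw [Nat.add_sub_cancel, pow_succ, mul_comm]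
      gcongr
      linarith
  rw [rayIntegrand, norm_mul, norm_mul, norm_mul, norm_inv, norm_pow]
  have hre : 0 ≤ v.re := hv.1
  calc (1 + v.re) * (‖v‖ ^ (n - 1) *
      (‖v ^ 2 + 2 * z * ((inner ℝ θ ν : ℝ) : ℂ) * v - (q : ℂ)‖⁻¹ *
        (‖cFourier f (v • toC θ + toC (-r₀))‖ * ‖cFourier φ (v • toC (-θ) + toC r₀)‖)))
      ≤ (1 + ‖v‖) * (‖v‖ ^ (n - 1) * (1 * (A * ‖cFourier φ (v • toC (-θ) + toC r₀)‖))) := by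
        gcongr
    _ = A * (((1 + ‖v‖) * ‖v‖ ^ (n - 1)) * ‖cFourier φ (v • toC (-θ) + toC r₀)‖) := by ring
    _ ≤ A * ((1 + ‖v‖) ^ n * ‖cFourier φ (v • toC (-θ) + toC r₀)‖) := by gcongr
    _ ≤ A * ((1 + ‖r₀‖) ^ n * C) := by gcongr

/-- The integrand of the free resolvent in shifted real coordinates. -/
def shiftedIntegrand (z : ℂ) (q : ℝ) (ν r₀ : RSpace n) (f φ : RSpace n → ℂ) (x : RSpace n) : ℂ :=
  (shiftedSymbol z q ν x)⁻¹ * (cFourier f (toC (x - r₀)) * cFourier φ (-toC (x - r₀)))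

/-- The integrand of the free resolvent on the contour. -/
def contourIntegrand (c κ : ℝ) (p : ℂ × PerpC ν) (f φ : RSpace n → ℂ) (x : RSpace n) : ℂ :=
  contourJac c κ ν x / contourSymbol c κ p x * cFourier f (contourPoint c κ p x) *
    cFourier φ (-contourPoint c κ p x)

theorem shiftedIntegrand_smul (z : ℂ) (q : ℝ) (r₀ : RSpace n) {θ : RSpace n} (hθ : ‖θ‖ = 1)
    (f φ : RSpace n → ℂ) {t : ℝ} (ht : 0 < t) :
    t ^ (n - 1) • shiftedIntegrand z q ν r₀ f φ (t • θ) = rayIntegrand z q ν r₀ θ f φ (t : ℂ) := by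
  have h1 : toC (t • θ - r₀) = (t : ℂ) • toC θ + toC (-r₀) := by
    rw [sub_eq_add_neg, toC_add, toC_smul]
  have h2 : -toC (t • θ - r₀) = (t : ℂ) • toC (-θ) + toC r₀ := by
    rw [toC_sub, toC_smul, toC_neg, smul_neg]; abel
  have h3 : shiftedSymbol z q ν (t • θ)
      = (t : ℂ) ^ 2 + 2 * z * ((inner ℝ θ ν : ℝ) : ℂ) * t - (q : ℂ) := by
    rw [shiftedSymbol, norm_smul, hθ, mul_one, Real.norm_of_nonneg ht.le, real_inner_smul_left]
    push_cast
    ring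
  rw [shiftedIntegrand, h2, h1, h3, rayIntegrand, Complex.real_smul]
  push_cast
  rfl

/-- The side of the contour depends only on the direction, so along a ray the contour is
`contourCurve`. The Jacobian times `t^(n-1)` is `V^(n-1)` times the derivative of the curve `V`, so
the polar density continues holomorphically. -/
theorem contourIntegrand_smul {c κ : ℝ} {p : ℂ × PerpC ν} {r₀ : RSpace n}
    (hr₀ : toC r₀ = (p.2 : CSpace n)) {θ : RSpace n} (hθ : ‖θ‖ = 1)
    (f φ : RSpace n → ℂ) {t : ℝ} (ht : 0 < t) :
    t ^ (n - 1) • contourIntegrand c κ p f φ (t • θ) =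
      (1 + ((contourSign κ ν θ * (c / (1 + t) ^ 2) : ℝ) : ℂ) * Complex.I) *
        rayIntegrand p.1 (‖r₀‖ ^ 2) ν r₀ θ f φ (contourCurve c (contourSign κ ν θ) t) := by
  have hs : contourSign κ ν (t • θ) = contourSign κ ν θ := by
    rw [contourSign, contourSign, real_inner_smul_left]
    have : 0 ≤ κ * (t * inner ℝ θ ν) ↔ 0 ≤ κ * inner ℝ θ ν := by
      rw [mul_left_comm]
      exact mul_nonneg_iff_of_pos_left ht
    simp only [this]
  have hnorm : ‖t • θ‖ = t := by rw [norm_smul, hθ, mul_one, Real.norm_of_nonneg ht.le]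
  set V := contourCurve c (contourSign κ ν θ) t with hV
  have hsc : (t : ℂ) * contourScale c κ ν (t • θ) = V := by
    rw [contourScale, hs, hnorm, hV, contourCurve]
    push_cast
    ring
  have h1 : contourPoint c κ p (t • θ) = V • toC θ + toC (-r₀) := by
    rw [contourPoint, toC_smul, smul_smul, mul_comm, hsc, toC_neg, hr₀, sub_eq_add_neg]
  have h2 : -contourPoint c κ p (t • θ) = V • toC (-θ) + toC r₀ := by
    rw [h1, toC_neg, toC_neg, smul_neg]; abel
  have hq : cdot (p.2 : CSpace n) (p.2 : CSpace n) = ((‖r₀‖ ^ 2 : ℝ) : ℂ) := by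
    rw [← hr₀, cdot_toC_toC, real_inner_self_eq_norm_sq]
  have h3 : contourSymbol c κ p (t • θ)
      = V ^ 2 + 2 * p.1 * ((inner ℝ θ ν : ℝ) : ℂ) * V - ((‖r₀‖ ^ 2 : ℝ) : ℂ) := by
    rw [contourSymbol, hnorm, hq, real_inner_smul_left, ← hsc]
    push_cast
    ring
  have h4 : (t : ℂ) ^ (n - 1) * contourJac c κ ν (t • θ) = V ^ (n - 1) *
      (1 + ((contourSign κ ν θ * (c / (1 + t) ^ 2) : ℝ) : ℂ) * Complex.I) := by
    rw [contourJac, ← mul_assoc, ← mul_pow, hsc, hs, hnorm]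
  rw [contourIntegrand, h2, h1, h3, rayIntegrand, Complex.real_smul, Complex.ofReal_pow,
    div_eq_mul_inv]
  linear_combination ((V ^ 2 + 2 * p.1 * ((inner ℝ θ ν : ℝ) : ℂ) * V
    - ((‖r₀‖ ^ 2 : ℝ) : ℂ))⁻¹ * cFourier f (V • toC θ + toC (-r₀)) *
    cFourier φ (V • toC (-θ) + toC r₀)) * h4

theorem integrable_shiftedIntegrand {γ : ℝ} (hn : 2 ≤ n) (hγ : 0 < γ) (hν : ‖ν‖ = 1) {z : ℂ}
    (hz : z.im ≠ 0) {q : ℝ} (hq : 0 < q) (r₀ : RSpace n) (f : ExpL2 n (-γ)) {φ : RSpace n → ℂ}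
    (hφ : IsTest φ) : Integrable (shiftedIntegrand z q ν r₀ f φ) volume := by
  have hf := integrable_coe_expL2 hγ f
  have hc1 : Continuous fun x : RSpace n => cFourier f (toC (x - r₀)) :=
    (continuous_cFourier_toC hf).comp (continuous_id.sub continuous_const)
  have hc2 : Continuous fun x : RSpace n => cFourier φ (-toC (x - r₀)) := by
    have h1 := continuous_cFourier_toC (hφ.1.continuous.integrable_of_hasCompactSupport hφ.2
      (μ := volume))
    have h2 := h1.comp (continuous_const.sub continuous_id : Continuous fun x : RSpace n => r₀ - x)
    refine h2.congr fun x => ?_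
    simp only [Function.comp_apply]
    rw [← toC_neg, neg_sub]
    rfl
  obtain ⟨C, hC⟩ := exists_norm_cFourier_test_le 0 (n + 1) hφ
  have hf0 : Integrable (fun w => Real.exp (0 * ‖w‖) * ‖f w‖) volume := by
    simpa using hf.norm
  set A := ∫ w, Real.exp (0 * ‖w‖) * ‖f w‖ with hA
  have hA0 : 0 ≤ A := integral_nonneg fun w => by positivity
  have him : ∀ x : RSpace n, ‖(WithLp.toLp 2 (fun i => ((toC x) i).im) : RSpace n)‖ ≤ 0 := by
    intro x
    have : (WithLp.toLp 2 (fun i => ((toC x) i).im) : RSpace n) = 0 := by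
      ext i; simp [toC]
    rw [this, norm_zero]
  refine integrable_inv_shiftedSymbol_mul hn hν hz hq (hc1.mul hc2).measurable
    (C := A * ((1 + ‖r₀‖) ^ (n + 1) * C)) fun x => ?_
  have h1 : ‖cFourier f (toC (x - r₀))‖ ≤ A := norm_cFourier_le hf0 (him _)
  have h2 := hC (-toC (x - r₀)) (by rw [← toC_neg]; exact him _)
  rw [norm_neg, norm_toC] at h2
  have h3 : 1 + ‖x‖ ≤ (1 + ‖r₀‖) * (1 + ‖x - r₀‖) := by
    have h4 := norm_add_le (x - r₀) r₀
    rw [sub_add_cancel] at h4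
    nlinarith [norm_nonneg r₀, norm_nonneg (x - r₀)]
  have h2' : 0 ≤ ‖cFourier φ (-toC (x - r₀))‖ := norm_nonneg _
  rw [norm_mul]
  calc (1 + ‖x‖) ^ (n + 1) * (‖cFourier f (toC (x - r₀))‖ * ‖cFourier φ (-toC (x - r₀))‖)
      ≤ ((1 + ‖r₀‖) * (1 + ‖x - r₀‖)) ^ (n + 1) * (A * ‖cFourier φ (-toC (x - r₀))‖) := by
        gcongr
    _ = A * ((1 + ‖r₀‖) ^ (n + 1) *
        ((1 + ‖x - r₀‖) ^ (n + 1) * ‖cFourier φ (-toC (x - r₀))‖)) := by rw [mul_pow]; ring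
    _ ≤ A * ((1 + ‖r₀‖) ^ (n + 1) * C) := by gcongr

/-- For almost every direction the ray is deformed within the strip on the side `σ`, where the
symbol has no zero. Integrability of both integrands over `ℝⁿ` provides integrability along almost
every ray. -/
theorem integral_shiftedIntegrand_eq {γ γ' δ c κ : ℝ} (h : ContourParams n γ γ' δ c κ)
    (hn : 2 ≤ n) (hν : ‖ν‖ = 1) {p : ℂ × PerpC ν} (hp : 0 < κ * p.1.im) {r₀ : RSpace n}
    (hr₀ : toC r₀ = (p.2 : CSpace n)) (hr : r₀ ≠ 0) (f : ExpL2 n (-γ)) {φ : RSpace n → ℂ}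
    (hφ : IsTest φ) (hint : Integrable (contourIntegrand c κ p f φ) volume) :
    ∫ x, shiftedIntegrand p.1 (‖r₀‖ ^ 2) ν r₀ f φ x = ∫ x, contourIntegrand c κ p f φ x := by
  have : NeZero n := ⟨by omega⟩
  have hγ : γ' < γ := by have := h.hγ; have := h.hδ; linarith
  have hq : 0 < ‖r₀‖ ^ 2 := by have := norm_pos_iff.2 hr; positivity
  have hz : p.1.im ≠ 0 := fun h0 => by rw [h0, mul_zero] at hp; exact lt_irrefl _ hp
  have hfe := integrable_exp_mul_expL2 hγ f
  refine integral_eq_of_polar (integrable_shiftedIntegrand hn (h.hγ'.trans hγ) hν hz hq r₀ f hφ)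
    hint ?_
  filter_upwards [ae_sphere_inner_ne_zero hν] with θ hθ h1 h2
  have hθ1 : ‖θ.1‖ = 1 := by simp
  set σ := contourSign κ ν θ.1 with hσ
  have hσ1 : σ ^ 2 = 1 := contourSign_sq κ ν θ.1
  have hκ2 : κ ^ 2 = 1 := by rw [← sq_abs, h.hκ, one_pow]
  have hσpos : 0 < σ * (inner ℝ θ.1 ν * p.1.im) := by
    have h3 := contourSign_mul κ ν θ.1
    have h4 : 0 < |κ * inner ℝ θ.1 ν| := abs_pos.2 (mul_ne_zero (fun h0 => by
      rw [h0] at hκ2; norm_num at hκ2) hθ)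
    have h5 : σ * (inner ℝ θ.1 ν * p.1.im) = |κ * inner ℝ θ.1 ν| * (κ * p.1.im) := by
      rw [← h3]
      linear_combination (-(σ * (inner ℝ θ.1 ν * p.1.im))) * hκ2
    rw [h5]
    positivity
  obtain ⟨K, R, hKR⟩ := exists_rayIntegrand_decay (ν := ν) (z := p.1) (σ := σ) (r₀ := r₀) hq hθ1
    hσ1 h.hcγ hfe hφ
  have e1 : EqOn (fun t : ℝ => t ^ (n - 1) • shiftedIntegrand p.1 (‖r₀‖ ^ 2) ν r₀ f φ (t • θ.1))
      (fun t : ℝ => rayIntegrand p.1 (‖r₀‖ ^ 2) ν r₀ θ f φ (t : ℂ)) (Ioi 0) :=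
    fun t ht => shiftedIntegrand_smul p.1 _ r₀ hθ1 f φ ht
  have e2 : EqOn (fun t : ℝ => t ^ (n - 1) • contourIntegrand c κ p f φ (t • θ.1))
      (fun t : ℝ => (1 + ((σ * (c / (1 + t) ^ 2) : ℝ) : ℂ) * Complex.I) *
        rayIntegrand p.1 (‖r₀‖ ^ 2) ν r₀ θ f φ (contourCurve c σ t)) (Ioi 0) :=
    fun t ht => contourIntegrand_smul hr₀ hθ1 f φ ht
  rw [setIntegral_congr_fun measurableSet_Ioi e1, setIntegral_congr_fun measurableSet_Ioi e2]
  exact integral_contourCurve_eq h.hc.le hσ1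
    (differentiableOn_rayIntegrand hq hθ1 hσ1 hσpos h.hcγ
      ((Lp.aestronglyMeasurable f).mono_ac (ac_expMeasure n (-γ))) hfe hφ) hKR
    (h1.congr_fun e1 measurableSet_Ioi) (h2.congr_fun e2 measurableSet_Ioi)

theorem exists_toC_eq {ρ : PerpC ν} (hρ : ρ ∈ realPerp ν) :
    ∃ r₀ : RSpace n, toC r₀ = (ρ : CSpace n) ∧ r₀ ≠ 0 ∧ inner ℝ r₀ ν = 0 := by
  obtain ⟨h1, h2⟩ := hρ
  have h3 : toC (WithLp.toLp 2 (fun i => ((ρ : CSpace n) i).re) : RSpace n) = (ρ : CSpace n) := by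
    ext i
    apply Complex.ext <;> simp [toC, h1 i]
  refine ⟨_, h3, fun h0 => h2 ?_, ?_⟩
  · rw [h0] at h3
    apply Subtype.ext
    rw [← h3]
    ext i
    simp [toC]
  · have h4 : cdot (ρ : CSpace n) (toC ν) = 0 := ρ.2
    rw [← h3, cdot_toC_toC] at h4
    exact_mod_cast h4

/-- Completing the square; the cross term `z r₀·ν` is absent because `ρ_⊥` is orthogonal to `ν`. -/
theorem freeSymbol_eq_shiftedSymbol {p : ℂ × PerpC ν} {r₀ : RSpace n}
    (hr₀ : toC r₀ = (p.2 : CSpace n)) (h0 : inner ℝ r₀ ν = 0) (ξ : RSpace n) :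
    freeSymbol (momentum p) ξ
      = shiftedSymbol p.1 (‖r₀‖ ^ 2) ν ((2 * Real.pi) • ξ + r₀) := by
  rw [freeSymbol, momentum, ← hr₀, cdot_add_left, cdot_smul_left, cdot_toC_toC, cdot_toC_toC,
    shiftedSymbol, norm_add_sq_real, inner_add_left, h0, add_zero, norm_smul,
    Real.norm_of_nonneg (by positivity), real_inner_comm ν, real_inner_comm r₀]
  push_cast
  ring

/-- The contour integral at real frequencies is the free resolvent. -/
theorem isFreeSolution_of_contour {γ γ' δ c κ : ℝ} (h : ContourParams n γ γ' δ c κ)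
    (hn : 2 ≤ n) (hν : ‖ν‖ = 1) {p : ℂ × PerpC ν} (hp : 0 < κ * p.1.im) (hp2 : p.2 ∈ realPerp ν)
    (f : ExpL2 n (-γ)) {u : RSpace n → ℂ}
    (hu : ∀ φ : RSpace n → ℂ, IsTest φ →
      Integrable (fun ξ : RSpace n => contourIntegrand c κ p f φ ((2 * Real.pi) • ξ)) volume ∧
      ∫ w, u w * φ w = ∫ ξ : RSpace n, contourIntegrand c κ p f φ ((2 * Real.pi) • ξ)) :
    IsFreeSolution (momentum p) (fun w => f w) u := by
  intro φ hφ
  obtain ⟨r₀, hr₀, hr, horth⟩ := exists_toC_eq hp2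
  obtain ⟨hu1, hu2⟩ := hu φ hφ
  have hγ : γ' < γ := by have := h.hγ; have := h.hδ; linarith
  have hq : 0 < ‖r₀‖ ^ 2 := by have := norm_pos_iff.2 hr; positivity
  have hz : p.1.im ≠ 0 := fun h0 => by rw [h0, mul_zero] at hp; exact lt_irrefl _ hp
  have h2π : (2 * Real.pi) ≠ 0 := by positivity
  have hint : Integrable (contourIntegrand c κ p f φ) volume :=
    (integrable_comp_smul_iff volume _ h2π).1 hu1
  have hS := integrable_shiftedIntegrand hn (h.hγ'.trans hγ) hν hz hq r₀ f hφ
  have heq : (fun ξ => (freeSymbol (momentum p) ξ)⁻¹ * 𝓕 (fun w => f w) ξ * 𝓕⁻ φ ξ)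
      = fun ξ => shiftedIntegrand p.1 (‖r₀‖ ^ 2) ν r₀ f φ ((2 * Real.pi) • ξ + r₀) := by
    funext ξ
    rw [shiftedIntegrand, freeSymbol_eq_shiftedSymbol hr₀ horth, add_sub_cancel_right,
      cFourier_toC, cFourier_neg_toC, mul_assoc]
  have hS2 := hS.comp_add_right r₀
  rw [heq]
  refine ⟨(integrable_comp_smul_iff volume
    (fun x => shiftedIntegrand p.1 (‖r₀‖ ^ 2) ν r₀ f φ (x + r₀)) h2π).2 hS2, ?_⟩
  rw [hu2, Measure.integral_comp_smul volume (contourIntegrand c κ p f φ),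
    Measure.integral_comp_smul volume
      (fun x => shiftedIntegrand p.1 (‖r₀‖ ^ 2) ν r₀ f φ (x + r₀)),
    integral_add_right_eq_self (shiftedIntegrand p.1 (‖r₀‖ ^ 2) ν r₀ f φ),
    integral_shiftedIntegrand_eq h hn hν hp hr₀ hr f hφ hint]

end RealFrequencies

/-! ### Existence of the analytic extension, and decay at infinity -/

section Decay

open Set Filter

variable {n : ℕ} {ν : RSpace n}

/-- The nonnegative contribution of `ρ_⊥·ρ_⊥` is dropped to obtain a bound free of the parameters,
which serves as the dominating function when these tend to infinity. -/
theorem norm_jac_div_symbol_le {c δ κ : ℝ} (hc : 0 < c) (hc1 : c ≤ 1) (hκ1 : |κ| = 1)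
    {p : ℂ × PerpC ν} (hp : p ∈ contourParam c δ κ ν) {x : RSpace n} (hx : x ≠ 0) :
    ‖contourJac c κ ν x / contourSymbol c κ p x‖ ≤
      2 ^ (n - 1) * 2 * 4 / c * ((1 + ‖x‖) / ‖x‖ ^ 2) := by
  have h1 := le_norm_contourSymbol hc hc1 hp.2 hp.1.le hκ1 x
  have h2 := norm_contourJac_le hc.le hc1 κ ν x
  have hx0 := norm_pos_iff.2 hx
  have h3 : c / (1 + ‖x‖) * ‖x‖ ^ 2 ≤ 4 * ‖contourSymbol c κ p x‖ := by
    refine le_trans ?_ h1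
    gcongr
    linarith [hp.2.1]
  have h4 : 0 < c / (1 + ‖x‖) * ‖x‖ ^ 2 := by positivity
  rw [norm_div]
  calc ‖contourJac c κ ν x‖ / ‖contourSymbol c κ p x‖
      ≤ (2 ^ (n - 1) * 2) / (c / (1 + ‖x‖) * ‖x‖ ^ 2 / 4) := by
        gcongr
        linarith
    _ = _ := by field_simp

theorem norm_contourScale_ge (c κ : ℝ) (ν x : RSpace n) : 1 ≤ ‖contourScale c κ ν x‖ := by
  have h : (contourScale c κ ν x).re = 1 := by
    rw [contourScale, Complex.add_re, Complex.re_ofReal_mul]; simp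
  have := Complex.abs_re_le_norm (contourScale c κ ν x)
  rwa [h, abs_one] at this

/-- The symbol is bounded below by a multiple of `‖ρ_⊥‖²`, and by `2|z||x·ν| - 4|x|² - ‖ρ_⊥‖²`. If
it stayed bounded, the first would bound `ρ_⊥` and then the second would bound `z`. -/
theorem tendsto_norm_contourSymbol {c δ κ : ℝ} (hc : 0 < c) (hc1 : c ≤ 1) (hκ1 : |κ| = 1)
    {x : RSpace n} (hx : inner ℝ x ν ≠ 0) :
    Tendsto (fun p : ℂ × PerpC ν => ‖contourSymbol c κ p x‖)
      (Bornology.cobounded _ ⊓ 𝓟 (contourParam c δ κ ν ∩ {p | p.2 ∈ realPerp ν})) atTop := by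
  set s := |inner ℝ x ν| with hs
  have hs0 : 0 < s := abs_pos.2 hx
  set a := c / (4 * (1 + ‖x‖)) with ha
  have ha0 : 0 < a := by positivity
  set m := min (2 * s) 2 with hm
  have hm0 : 0 < m := by positivity
  -- One `1 / a` pays for `‖ρ_⊥‖²` in the lower bound linear in `z`, the other for `2‖ρ_⊥‖ ≤ 1 +
  -- ‖ρ_⊥‖²`.
  set L := 1 + 1 / a + 1 / a with hL
  have hL0 : 0 < L := by positivity
  have hbound : ∀ p ∈ contourParam c δ κ ν ∩ {p : ℂ × PerpC ν | p.2 ∈ realPerp ν},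
      (m * ‖p‖ - (1 + 4 * ‖x‖ ^ 2)) / L ≤ ‖contourSymbol c κ p x‖ := by
    rintro p ⟨hp, hp2⟩
    have hq := cdot_self_of_real hp2.1
    have h1 := le_norm_contourSymbol hc hc1 hp.2 hp.1.le hκ1 x
    rw [hq, Complex.ofReal_re] at h1
    have h2 : a * ‖p.2‖ ^ 2 ≤ ‖contourSymbol c κ p x‖ := by
      have h3 : c / (1 + ‖x‖) * ‖p.2‖ ^ 2 ≤ 4 * ‖contourSymbol c κ p x‖ := by
        refine le_trans ?_ h1
        gcongr
        nlinarith [norm_nonneg x]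
      have h4 : a * ‖p.2‖ ^ 2 = (c / (1 + ‖x‖) * ‖p.2‖ ^ 2) / 4 := by
        rw [ha]; field_simp
      rw [h4]; linarith
    have h3 : 2 * ‖p.1‖ * s - 4 * ‖x‖ ^ 2 - ‖p.2‖ ^ 2 ≤ ‖contourSymbol c κ p x‖ := by
      have hl1 := norm_contourScale_ge c κ ν x
      have hl2 := norm_contourScale_le hc.le hc1 κ ν x
      have e1 : ‖2 * p.1 * ((inner ℝ x ν : ℝ) : ℂ) * contourScale c κ ν x‖
          = 2 * ‖p.1‖ * s * ‖contourScale c κ ν x‖ := by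
        rw [norm_mul, norm_mul, norm_mul, Complex.norm_real, Complex.norm_ofNat, Real.norm_eq_abs]
      have e2 : ‖((‖x‖ ^ 2 : ℝ) : ℂ) * contourScale c κ ν x ^ 2‖
          = ‖x‖ ^ 2 * ‖contourScale c κ ν x‖ ^ 2 := by
        rw [norm_mul, norm_pow, Complex.norm_real, Real.norm_of_nonneg (by positivity)]
      have e3 : ‖((‖p.2‖ ^ 2 : ℝ) : ℂ)‖ = ‖p.2‖ ^ 2 := by
        rw [Complex.norm_real, Real.norm_of_nonneg (by positivity)]
      have e4 : 2 * p.1 * ((inner ℝ x ν : ℝ) : ℂ) * contourScale c κ ν x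
          = contourSymbol c κ p x - ((‖x‖ ^ 2 : ℝ) : ℂ) * contourScale c κ ν x ^ 2
            + ((‖p.2‖ ^ 2 : ℝ) : ℂ) := by
        rw [contourSymbol, hq]; ring
      have e5 := norm_add_le (contourSymbol c κ p x - ((‖x‖ ^ 2 : ℝ) : ℂ) *
        contourScale c κ ν x ^ 2) ((‖p.2‖ ^ 2 : ℝ) : ℂ)
      have e6 := norm_sub_le (contourSymbol c κ p x) (((‖x‖ ^ 2 : ℝ) : ℂ) *
        contourScale c κ ν x ^ 2)
      rw [← e4, e1, e3] at e5
      rw [e2] at e6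
      have e7 : 2 * ‖p.1‖ * s ≤ 2 * ‖p.1‖ * s * ‖contourScale c κ ν x‖ :=
        le_mul_of_one_le_right (by positivity) hl1
      have e8 : ‖x‖ ^ 2 * ‖contourScale c κ ν x‖ ^ 2 ≤ ‖x‖ ^ 2 * 2 ^ 2 := by gcongr
      linarith
    have h4 : ‖p.2‖ ^ 2 ≤ ‖contourSymbol c κ p x‖ * (1 / a) := by
      rw [mul_one_div, le_div_iff₀ ha0]; linarith
    have h5 : m * ‖p‖ ≤ 2 * ‖p.1‖ * s + 2 * ‖p.2‖ := by
      have h6 : ‖p‖ ≤ ‖p.1‖ + ‖p.2‖ := by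
        rw [Prod.norm_def]
        exact max_le (le_add_of_nonneg_right (norm_nonneg _))
          (le_add_of_nonneg_left (norm_nonneg _))
      have h7 : m ≤ 2 * s := min_le_left _ _
      have h8 : m ≤ 2 := min_le_right _ _
      calc m * ‖p‖ ≤ m * (‖p.1‖ + ‖p.2‖) := by gcongr
        _ = m * ‖p.1‖ + m * ‖p.2‖ := by ring
        _ ≤ (2 * s) * ‖p.1‖ + 2 * ‖p.2‖ := by gcongr
        _ = _ := by ring
    rw [div_le_iff₀ hL0, hL]
    nlinarith [sq_nonneg (‖p.2‖ - 1)]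
  refine tendsto_atTop_mono' _ (f₁ := fun p : ℂ × PerpC ν =>
    (m * ‖p‖ - (1 + 4 * ‖x‖ ^ 2)) / L) ?_ ?_
  · exact mem_inf_of_right (mem_principal.2 hbound)
  · refine Tendsto.mono_left ?_ inf_le_left
    exact (tendsto_atTop_add_const_right _ _
      (tendsto_norm_cobounded_atTop.const_mul_atTop hm0)).atTop_div_const hL0

theorem ae_inner_ne_zero (hν : ‖ν‖ = 1) : ∀ᵐ x : RSpace n, inner ℝ x ν ≠ 0 := by
  let S : Submodule ℝ (RSpace n) := LinearMap.ker (innerₗ (RSpace n) ν)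
  have hS : S ≠ ⊤ := by
    intro h
    have h1 : ν ∈ S := h ▸ Submodule.mem_top
    have h2 : inner ℝ ν ν = 0 := h1
    rw [real_inner_self_eq_norm_sq, hν] at h2
    norm_num at h2
  rw [ae_iff]
  refine measure_mono_null ?_ (Measure.addHaar_submodule volume S hS)
  intro x hx
  rw [mem_ofPred_eq, not_not] at hx
  change inner ℝ ν x = 0
  rw [real_inner_comm, hx]

/-- Dominated convergence with the majorant `‖ξ‖^(-2)`, integrable near the origin precisely because
`n ≥ 3`. -/
theorem tendsto_setIntegral_jac_div_symbol {c δ κ : ℝ} (hn : 3 ≤ n) (hν : ‖ν‖ = 1) (hc : 0 < c)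
    (hc1 : c ≤ 1) (hκ1 : |κ| = 1) {M : ℝ} (hM : 0 < M) :
    (∀ p ∈ contourParam c δ κ ν, IntegrableOn (fun ξ : RSpace n =>
      contourJac c κ ν ((2 * Real.pi) • ξ) / contourSymbol c κ p ((2 * Real.pi) • ξ))
      (Metric.ball 0 M) volume) ∧
    Tendsto (fun p : ℂ × PerpC ν => ∫ ξ in Metric.ball (0 : RSpace n) M,
      ‖contourJac c κ ν ((2 * Real.pi) • ξ) / contourSymbol c κ p ((2 * Real.pi) • ξ)‖)
      (Bornology.cobounded _ ⊓ 𝓟 (contourParam c δ κ ν ∩ {p | p.2 ∈ realPerp ν})) (𝓝 0) := by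
  have : NeZero n := ⟨by omega⟩
  have h2π : 1 ≤ 2 * Real.pi := by linarith [Real.pi_gt_three]
  set D := 2 ^ (n - 1) * 2 * 4 / c * (1 + 2 * Real.pi * M) with hD
  have hmeas : ∀ p : ℂ × PerpC ν, Measurable fun ξ : RSpace n =>
      contourJac c κ ν ((2 * Real.pi) • ξ) / contourSymbol c κ p ((2 * Real.pi) • ξ) := fun p =>
    ((measurable_contourJac c κ ν).comp (measurable_const_smul _)).div
      ((measurable_contourSymbol c κ p).comp (measurable_const_smul _))
  have hae0 : ∀ᵐ ξ ∂(volume.restrict (Metric.ball (0 : RSpace n) M)), ξ ≠ 0 :=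
    ae_restrict_of_ae (by simp [ae_iff])
  have hbound : ∀ p ∈ contourParam c δ κ ν, ∀ᵐ ξ ∂(volume.restrict (Metric.ball (0 : RSpace n) M)),
      ‖contourJac c κ ν ((2 * Real.pi) • ξ) / contourSymbol c κ p ((2 * Real.pi) • ξ)‖
        ≤ D * ‖ξ‖ ^ (-2 : ℝ) := by
    intro p hp
    filter_upwards [hae0, ae_restrict_mem Metric.isOpen_ball.measurableSet] with ξ h0 hξ
    rw [mem_ball_zero_iff] at hξ
    have h1 := norm_jac_div_symbol_le hc hc1 hκ1 hp (x := (2 * Real.pi) • ξ)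
      (smul_ne_zero (by positivity) h0)
    refine h1.trans ?_
    have hξ0 := norm_pos_iff.2 h0
    have h2 : (1 + 2 * Real.pi * ‖ξ‖) / (2 * Real.pi * ‖ξ‖) ^ 2
        ≤ (1 + 2 * Real.pi * M) / ‖ξ‖ ^ 2 := by
      have h3 : ‖ξ‖ ≤ 2 * Real.pi * ‖ξ‖ := le_mul_of_one_le_left hξ0.le h2π
      gcongr
    rw [norm_smul, Real.norm_of_nonneg (by positivity), hD, Real.rpow_neg (norm_nonneg _),
      Real.rpow_two]
    have h4 : 0 ≤ (2 : ℝ) ^ (n - 1) * 2 * 4 / c := by positivity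
    exact (mul_le_mul_of_nonneg_left h2 h4).trans_eq (by ring)
  have hdim : (2 : ℝ) < Module.finrank ℝ (RSpace n) := by
    rw [finrank_euclideanSpace_fin]
    exact_mod_cast hn
  have hdim1 : 1 ≤ Module.finrank ℝ (RSpace n) := by
    rw [finrank_euclideanSpace_fin]; omega
  refine ⟨fun p hp => integrableOn_ball_of_norm_le_rpow hdim1 hdim (hbound p hp)
    (hmeas p).aestronglyMeasurable, ?_⟩
  -- Dominated convergence along a filter needs a countable basis.
  have : (Bornology.cobounded (ℂ × PerpC ν)).IsCountablyGenerated := by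
    rw [← comap_norm_atTop]; infer_instance
  have hbi : Integrable (fun ξ : RSpace n => D * ‖ξ‖ ^ (-2 : ℝ))
      (volume.restrict (Metric.ball 0 M)) := by
    refine (integrableOn_ball_of_norm_le_rpow (f := fun ξ : RSpace n => ‖ξ‖ ^ (-2 : ℝ)) hdim1 hdim
      (C := 1) (Eventually.of_forall fun ξ => ?_) ?_).const_mul D
    · rw [one_mul, Real.norm_of_nonneg (by positivity)]
    · exact (by fun_prop : Measurable fun ξ : RSpace n => ‖ξ‖ ^ (-2 : ℝ)).aestronglyMeasurable
  have h := tendsto_integral_filter_of_dominated_convergence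
    (μ := volume.restrict (Metric.ball (0 : RSpace n) M))
    (l := Bornology.cobounded _ ⊓ 𝓟 (contourParam c δ κ ν ∩ {p | p.2 ∈ realPerp ν}))
    (F := fun p ξ =>
      ‖contourJac c κ ν ((2 * Real.pi) • ξ) / contourSymbol c κ p ((2 * Real.pi) • ξ)‖)
    (f := fun _ => 0) (fun ξ => D * ‖ξ‖ ^ (-2 : ℝ))
    (Eventually.of_forall fun p => (hmeas p).norm.aestronglyMeasurable)
    (mem_inf_of_right (mem_principal.2 fun p hp => by
      have h1 := hbound p hp.1
      simp only [mem_ofPred_eq, norm_norm]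
      exact h1)) hbi ?_
  · simpa using h
  · refine ae_restrict_of_ae ?_
    filter_upwards [ae_inner_ne_zero hν] with ξ hξ
    have h1 : inner ℝ ((2 * Real.pi) • ξ) ν ≠ 0 := by
      rw [real_inner_smul_left]; exact mul_ne_zero (by positivity) hξ
    have h2 := tendsto_norm_contourSymbol (δ := δ) hc hc1 hκ1 h1
    simp only [norm_div]
    exact tendsto_const_nhds.div_atTop h2

/-- The multiplier is small outside a large ball uniformly in `p`, and its integral over this ball
tends to zero as `p` tends to infinity. -/
theorem exists_norm_le_of_large {c δ κ : ℝ} (hn : 3 ≤ n) (hν : ‖ν‖ = 1) (hc : 0 < c)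
    (hc1 : c ≤ 1) (hκ1 : |κ| = 1) {F : Type*} [NormedAddCommGroup F] {G : ℂ × PerpC ν → F}
    {C : ℝ} (hC0 : 0 ≤ C)
    (hC : ∀ p ∈ contourParam c δ κ ν, ∀ (S : Set (RSpace n)) (ε : ℝ), MeasurableSet S → 0 ≤ ε →
        IntegrableOn (fun ξ : RSpace n => contourJac c κ ν ((2 * Real.pi) • ξ) /
          contourSymbol c κ p ((2 * Real.pi) • ξ)) S volume →
        (∀ ξ, ξ ∉ S → ‖contourJac c κ ν ((2 * Real.pi) • ξ) /
          contourSymbol c κ p ((2 * Real.pi) • ξ)‖ ≤ ε) →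
        ‖G p‖ ≤ C * (ε + ∫ ξ in S,
          ‖contourJac c κ ν ((2 * Real.pi) • ξ) / contourSymbol c κ p ((2 * Real.pi) • ξ)‖))
    {ε : ℝ} (hε : 0 < ε) :
    ∃ R : ℝ, ∀ p ∈ contourParam c δ κ ν, p.2 ∈ realPerp ν → R ≤ ‖p‖ → ‖G p‖ ≤ ε := by
  set η := ε / (2 * (C + 1)) with hη
  have hη0 : 0 < η := by positivity
  set B := 2 ^ (n - 1) * 2 * 4 / c with hB
  have hB0 : 0 < B := by positivity
  -- For `‖x‖ ≥ M ≥ 1` the multiplier is at most `2B / ‖x‖ ≤ η`. With the integral over the ball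
  -- also below `η`, the norm is at most `2Cη ≤ ε`.
  set M := max 1 (2 * B / η) with hM
  have hM1 : 1 ≤ M := le_max_left _ _
  have hM2 : 2 * B ≤ η * M := by
    have h1 : 2 * B / η ≤ M := le_max_right _ _
    rw [div_le_iff₀ hη0] at h1; linarith
  obtain ⟨h1, h2⟩ := tendsto_setIntegral_jac_div_symbol (δ := δ) (κ := κ) hn hν hc hc1 hκ1
    (M := M) (by linarith)
  have h3 := h2.eventually (Iio_mem_nhds hη0)
  rw [eventually_inf_principal, ← comap_norm_atTop, eventually_comap] at h3
  obtain ⟨R, hR⟩ := eventually_atTop.1 h3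
  refine ⟨R, fun p hp hp2 hRp => ?_⟩
  have h4 := hR ‖p‖ hRp p rfl ⟨hp, hp2⟩
  have h5 := hC p hp (Metric.ball 0 M) η Metric.isOpen_ball.measurableSet hη0.le (h1 p hp) ?_
  · refine h5.trans ?_
    have h6 : η + ∫ ξ in Metric.ball (0 : RSpace n) M, ‖contourJac c κ ν ((2 * Real.pi) • ξ) /
        contourSymbol c κ p ((2 * Real.pi) • ξ)‖ ≤ 2 * η := by
      have : (∫ ξ in Metric.ball (0 : RSpace n) M, ‖contourJac c κ ν ((2 * Real.pi) • ξ) /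
        contourSymbol c κ p ((2 * Real.pi) • ξ)‖) < η := h4
      linarith
    calc _ ≤ C * (2 * η) := by gcongr
      _ ≤ (C + 1) * (2 * η) := by gcongr; linarith
      _ = ε := by rw [hη]; field_simp
  · intro ξ hξ
    rw [mem_ball_zero_iff, not_lt] at hξ
    have hξ1 : 1 ≤ ‖ξ‖ := hM1.trans hξ
    have hξ0 : ξ ≠ 0 := norm_pos_iff.1 (by linarith)
    set x := (2 * Real.pi) • ξ with hx
    have hxM : M ≤ ‖x‖ := by
      rw [hx, norm_smul, Real.norm_of_nonneg (by positivity)]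
      nlinarith [Real.pi_gt_three]
    refine (norm_jac_div_symbol_le hc hc1 hκ1 hp (x := x)
      (smul_ne_zero (by positivity) hξ0)).trans ?_
    have hx1 : 1 ≤ ‖x‖ := hM1.trans hxM
    rw [← hB, ← mul_div_assoc, div_le_iff₀ (by positivity)]
    calc B * (1 + ‖x‖) ≤ B * (2 * ‖x‖) := by gcongr; linarith
      _ = 2 * B * ‖x‖ := by ring
      _ ≤ η * M * ‖x‖ := by gcongr
      _ ≤ η * ‖x‖ * ‖x‖ := by gcongr
      _ = η * ‖x‖ ^ 2 := by ring

theorem eq_of_integral_test {γ : ℝ} {u u' : ExpL2 n γ}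
    (h : ∀ φ : RSpace n → ℂ, IsTest φ → ∫ w, u w * φ w = ∫ w, u' w * φ w) : u = u' := by
  have h1 := ae_eq_of_integral_contDiff_smul_eq (locallyIntegrable_coe u) (locallyIntegrable_coe u')
    (fun g hg hgs => by
      have h2 := h (fun w => ((g w : ℝ) : ℂ))
        ⟨Complex.ofRealCLM.contDiff.comp hg, hgs.comp_left Complex.ofReal_zero⟩
      simpa only [Complex.real_smul, mul_comm] using h2)
  exact Lp.ext ((expMeasure_ac n γ).ae_le h1)

theorem exists_contourParams {γ : ℝ} (hγ : 0 < γ) : ∃ c : ℝ, ∀ κ : ℝ, |κ| = 1 →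
    ContourParams n γ (γ / 2) (γ / 2) c κ := by
  refine ⟨min 1 (γ / (4 * (n + 1))), fun κ hκ => ⟨?_, ?_, ?_, ?_, ?_, ?_, ?_, hκ⟩⟩
  · positivity
  · exact min_le_left _ _
  · positivity
  · positivity
  · ring
  · have h1 : min 1 (γ / (4 * ((n : ℝ) + 1))) ≤ γ / (4 * (n + 1)) := min_le_right _ _
    calc (n : ℝ) * min 1 (γ / (4 * ((n : ℝ) + 1))) ≤ n * (γ / (4 * (n + 1))) := by gcongr
      _ = γ / 4 * (n / (n + 1)) := by field_simp
      _ ≤ γ / 4 * 1 := by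
          gcongr
          rw [div_le_one (by positivity)]; linarith
      _ < γ / 2 := by linarith
  · refine (min_le_right _ _).trans_lt ?_
    rw [div_lt_div_iff₀ (by positivity) (by positivity)]
    nlinarith [(Nat.cast_nonneg n : (0 : ℝ) ≤ n)]

/-- The analytic extension exists, and it is small at infinity for real frequencies. -/
theorem exists_isAnalyticExtension {γ : ℝ} (hn : 3 ≤ n) (hγ : 0 < γ) (hν : ‖ν‖ = 1) :
    ∃ (U : Set (PerpC ν)) (𝒢₀ : ℂ × PerpC ν → (ExpL2 n (-γ) →L[ℂ] ExpSobolev n γ 2)),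
      IsAnalyticExtension γ ν U 𝒢₀ ∧ ∀ ε : ℝ, 0 < ε → ∃ R : ℝ, ∀ p ∈ offReal (realPerp ν),
        R ≤ ‖p‖ → ‖(ExpSobolev.incl n γ 2).comp (𝒢₀ p)‖ ≤ ε := by
  obtain ⟨c, hc⟩ := exists_contourParams (n := n) hγ
  have hp := hc 1 (by simp)
  have hm := hc (-1) (by simp)
  obtain ⟨G, C, hC0, hGa, hGi, hGn⟩ := exists_contourExtension (ν := ν) hp hν
  obtain ⟨H, D, hD0, hHa, hHi, hHn⟩ := exists_contourExtension (ν := ν) hm hν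
  have hsub := realPerp_subset_contourDomain (ν := ν) hp.hc hp.hδ
  have hpos : ∀ p : ℂ × PerpC ν, 0 < p.1.im → p.2 ∈ contourDomain c (γ / 2) ν →
      p ∈ contourParam c (γ / 2) 1 ν := fun p h1 h2 => ⟨by rwa [one_mul], h2⟩
  have hneg : ∀ p : ℂ × PerpC ν, p.1.im < 0 → p.2 ∈ contourDomain c (γ / 2) ν →
      p ∈ contourParam c (γ / 2) (-1) ν := fun p h1 h2 => ⟨by linarith, h2⟩
  have himc : Continuous fun q : ℂ × PerpC ν => q.1.im := Complex.continuous_im.comp continuous_fst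
  -- The contour is moved to opposite sides in the two half planes of `z`. These are disjoint open
  -- sets, so no matching is needed.
  refine ⟨contourDomain c (γ / 2) ν, fun p => if 0 < p.1.im then G p else H p,
    ⟨isOpen_contourDomain _ _ _, hsub, ?_, ?_⟩, ?_⟩
  · rintro p ⟨h1, h2⟩
    rcases lt_or_gt_of_ne h1 with h3 | h3
    · refine (hHa p (hneg p h3 h2)).congr ?_
      filter_upwards [(isOpen_lt himc continuous_const).mem_nhds h3] with q hq
      have : q.1.im < 0 := hq
      rw [if_neg (not_lt.2 this.le)]
    · refine (hGa p (hpos p h3 h2)).congr ?_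
      filter_upwards [(isOpen_lt continuous_const himc).mem_nhds h3] with q hq
      have : 0 < q.1.im := hq
      rw [if_pos this]
  · rintro p ⟨h1, h2⟩ f
    rcases lt_or_gt_of_ne h1 with h3 | h3
    · rw [if_neg (not_lt.2 h3.le)]
      exact isFreeSolution_of_contour hm (by omega) hν (hneg p h3 (hsub h2)).1 h2 f
        (hHi p (hneg p h3 (hsub h2)) f)
    · rw [if_pos h3]
      exact isFreeSolution_of_contour hp (by omega) hν (hpos p h3 (hsub h2)).1 h2 f
        (hGi p (hpos p h3 (hsub h2)) f)
  · intro ε hε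
    obtain ⟨R₁, hR₁⟩ := exists_norm_le_of_large
      (G := fun p => (ExpSobolev.incl n γ 2).comp (G p)) hn hν hp.hc hp.hc1 hp.hκ hC0 hGn hε
    obtain ⟨R₂, hR₂⟩ := exists_norm_le_of_large
      (G := fun p => (ExpSobolev.incl n γ 2).comp (H p)) hn hν hm.hc hm.hc1 hm.hκ hD0 hHn hε
    refine ⟨max R₁ R₂, fun p ⟨h1, h2⟩ hpR => ?_⟩
    beta_reduce
    rcases lt_or_gt_of_ne h1 with h3 | h3
    · rw [if_neg (not_lt.2 h3.le)]
      exact hR₂ p (hneg p h3 (hsub h2)) h2 ((le_max_right _ _).trans hpR)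
    · rw [if_pos h3]
      exact hR₁ p (hpos p h3 (hsub h2)) h2 ((le_max_left _ _).trans hpR)

/-- Every analytic extension is small at infinity for real frequencies. -/
theorem IsAnalyticExtension.exists_norm_le {γ : ℝ} (hn : 3 ≤ n) (hγ : 0 < γ) (hν : ‖ν‖ = 1)
    {U : Set (PerpC ν)} {𝒢₀ : ℂ × PerpC ν → (ExpL2 n (-γ) →L[ℂ] ExpSobolev n γ 2)}
    (h : IsAnalyticExtension γ ν U 𝒢₀) {ε : ℝ} (hε : 0 < ε) : ∃ R : ℝ,
      ∀ p ∈ offReal (realPerp ν), R ≤ ‖p‖ → ‖(ExpSobolev.incl n γ 2).comp (𝒢₀ p)‖ ≤ ε := by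
  obtain ⟨U', G, hG, hdecay⟩ := exists_isAnalyticExtension hn hγ hν
  obtain ⟨R, hR⟩ := hdecay ε hε
  refine ⟨R, fun p hp hpR => ?_⟩
  -- At real `ρ_⊥` both families represent the same distribution, which determines the function.
  have h1 : (ExpSobolev.incl n γ 2).comp (𝒢₀ p) = (ExpSobolev.incl n γ 2).comp (G p) := by
    ext1 f
    refine eq_of_integral_test fun φ hφ => ?_
    exact ((h.restrict p hp f φ hφ).2).trans ((hG.restrict p hp f φ hφ).2).symm
  rw [h1]
  exact hR p hp hpR

end Decay

/-! ### Translations of weighted Sobolev functions -/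

section Translation

open Set

variable {n : ℕ}

theorem norm_integral_mul_le {γ : ℝ} (u : ExpL2 n γ) (f : ExpL2 n (-γ)) :
    ‖∫ w, u w * f w‖ ≤ ‖u‖ * ‖f‖ := by
  obtain ⟨h1, h2⟩ := integral_norm_mul_norm_le (weightEquiv n γ u) (weightEquiv n (-γ) f)
  rw [LinearIsometryEquiv.norm_map, LinearIsometryEquiv.norm_map] at h2
  refine (norm_integral_le_integral_norm _).trans (le_trans (le_of_eq ?_) h2)
  refine integral_congr_ae ?_
  filter_upwards [coeFn_weightEquiv u, coeFn_weightEquiv f] with w hu hf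
  rw [hu, hf, ← norm_mul]
  have := exp_neg_mul_exp γ ‖w‖ (u w * f w)
  rw [neg_mul, neg_neg]
  congr 1
  linear_combination -this

theorem IsTest.memLp {φ : RSpace n → ℂ} (hφ : IsTest φ) (γ : ℝ) :
    MemLp φ 2 (expMeasure n γ) := by
  have hc := hφ.1.continuous
  refine memLp_of_weight hc.aestronglyMeasurable ?_
  exact Continuous.memLp_of_hasCompactSupport (by fun_prop) hφ.2.mul_left

theorem IsTest.add {φ ψ : RSpace n → ℂ} (hφ : IsTest φ) (hψ : IsTest ψ) :
    IsTest (fun w => φ w + ψ w) := ⟨hφ.1.add hψ.1, hφ.2.add hψ.2⟩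

theorem IsTest.const_mul {φ : RSpace n → ℂ} (hφ : IsTest φ) (c : ℂ) :
    IsTest (fun w => c * φ w) := ⟨contDiff_const.mul hφ.1, hφ.2.mul_left⟩

theorem IsTest.conj {φ : RSpace n → ℂ} (hφ : IsTest φ) :
    IsTest (fun w => (starRingEnd ℂ) (φ w)) :=
  ⟨Complex.conjCLE.contDiff.comp hφ.1, hφ.2.comp_left (map_zero _)⟩

theorem IsTest.comp_sub {φ : RSpace n → ℂ} (hφ : IsTest φ) (x : RSpace n) :
    IsTest (fun w => φ (w - x)) :=
  ⟨hφ.1.comp (contDiff_id.sub contDiff_const), by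
    have := hφ.2.comp_homeomorph (Homeomorph.subRight x)
    exact this⟩

/-- Duality: after conjugation by the weights, test functions are dense in `L²`, so the bound
extends to all of `L²` and may be tested on `v` itself. -/
theorem norm_le_of_test_bound {γ : ℝ} {v : ExpL2 n γ} {K : ℝ} (hK : 0 ≤ K)
    (h : ∀ φ : RSpace n → ℂ, ∀ hφ : IsTest φ, ‖∫ w, v w * φ w‖ ≤
      K * ‖(hφ.memLp (-γ)).toLp φ‖) : ‖v‖ ≤ K := by
  let W : Submodule ℂ (L2 n) :=
    { carrier := {f | ∃ φ : RSpace n → ℂ, ∃ hφ : IsTest φ,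
        f = weightEquiv n (-γ) ((hφ.memLp (-γ)).toLp φ)}
      zero_mem' := ⟨fun _ => 0, ⟨contDiff_const, HasCompactSupport.zero⟩, by
        rw [eq_comm]
        exact (congrArg (weightEquiv n (-γ)) (MemLp.toLp_zero _)).trans (map_zero _)⟩
      add_mem' := by
        rintro _ _ ⟨φ, hφ, rfl⟩ ⟨ψ, hψ, rfl⟩
        refine ⟨_, hφ.add hψ, ?_⟩
        rw [← map_add, ← MemLp.toLp_add]
        rfl
      smul_mem' := by
        rintro c _ ⟨φ, hφ, rfl⟩
        refine ⟨_, hφ.const_mul c, ?_⟩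
        rw [← map_smul, ← MemLp.toLp_const_smul]
        rfl }
  have hinner : ∀ (φ : RSpace n → ℂ) (hφ : IsTest φ),
      inner ℂ (weightEquiv n (-γ) ((hφ.memLp (-γ)).toLp φ)) (weightEquiv n γ v)
        = ∫ w, v w * (starRingEnd ℂ) (φ w) := by
    intro φ hφ
    rw [L2.inner_def]
    refine integral_congr_ae ?_
    filter_upwards [coeFn_weightEquiv v, coeFn_weightEquiv ((hφ.memLp (-γ)).toLp φ),
      (ac_expMeasure n (-γ)).ae_le (hφ.memLp (-γ)).coeFn_toLp] with w h1 h2 h3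
    rw [h1, h2, h3, RCLike.inner_apply, map_mul, Complex.conj_ofReal, neg_mul, neg_neg]
    have := exp_neg_mul_exp γ ‖w‖ (v w * (starRingEnd ℂ) (φ w))
    linear_combination this
  have hW : ∀ f ∈ W, ‖inner ℂ f (weightEquiv n γ v)‖ ≤ K * ‖f‖ := by
    rintro _ ⟨φ, hφ, rfl⟩
    rw [hinner φ hφ, LinearIsometryEquiv.norm_map]
    refine (h _ hφ.conj).trans_eq ?_
    rw [Lp.norm_toLp, Lp.norm_toLp]
    congr 2
    exact eLpNorm_congr_norm_ae (Filter.Eventually.of_forall fun w => RCLike.norm_conj (φ w))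
  -- A vector orthogonal to all weighted test functions vanishes as a distribution.
  have hdense : W.topologicalClosure = ⊤ := by
    rw [Submodule.topologicalClosure_eq_top_iff, Submodule.eq_bot_iff]
    intro g hg
    have h1 : (weightEquiv n γ).symm g = 0 := by
      refine eq_of_integral_test fun φ hφ => ?_
      have h2 := (Submodule.mem_orthogonal W g).1 hg _ ⟨_, hφ.conj, rfl⟩
      have h0 : ∫ w, (0 : ExpL2 n γ) w * φ w = 0 := by
        rw [integral_eq_zero_of_ae]
        filter_upwards [(ac_expMeasure n γ).ae_le (Lp.coeFn_zero ℂ 2 (expMeasure n γ))] with w hw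
        rw [hw, Pi.zero_apply, zero_mul]
      rw [h0, ← h2, L2.inner_def]
      refine integral_congr_ae ?_
      filter_upwards [coeFn_weightEquiv_symm (γ := γ) g,
        coeFn_weightEquiv ((hφ.conj.memLp (-γ)).toLp _),
        (ac_expMeasure n (-γ)).ae_le (hφ.conj.memLp (-γ)).coeFn_toLp] with w h3 h4 h5
      rw [h3, h4, h5, RCLike.inner_apply, map_mul, Complex.conj_ofReal, neg_mul, neg_neg,
        Complex.conj_conj]
      ring
    rw [← (weightEquiv n γ).apply_symm_apply g, h1, map_zero]
  have hall : ∀ f : L2 n, ‖inner ℂ f (weightEquiv n γ v)‖ ≤ K * ‖f‖ := by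
    intro f
    have hcl : IsClosed {f : L2 n | ‖inner ℂ f (weightEquiv n γ v)‖ ≤ K * ‖f‖} :=
      isClosed_le (by fun_prop) (by fun_prop)
    have hf : f ∈ W.topologicalClosure := hdense ▸ Submodule.mem_top
    exact closure_minimal hW hcl hf
  have h1 := hall (weightEquiv n γ v)
  rw [inner_self_eq_norm_sq_to_K, LinearIsometryEquiv.norm_map] at h1
  rw [norm_pow, RCLike.norm_ofReal, abs_of_nonneg (norm_nonneg _), sq] at h1
  rcases (norm_nonneg v).eq_or_lt with h2 | h2
  · rwa [← h2]
  · exact le_of_mul_le_mul_right h1 h2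

theorem memLp_comp_add {γ : ℝ} (hγ : 0 ≤ γ) (u : ExpL2 n γ) (y : RSpace n) :
    MemLp (fun w => u (w + y)) 2 (expMeasure n γ) := by
  have hmp := measurePreserving_add_right (volume : Measure (RSpace n)) y
  have hm : AEStronglyMeasurable (fun w => u (w + y)) volume :=
    ((Lp.stronglyMeasurable u).comp_measurable (measurable_add_const y)).aestronglyMeasurable
  refine memLp_of_weight hm ?_
  have h1 := ((memLp_weight (Lp.memLp u)).comp_measurePreserving hmp).norm.const_mul
    (Real.exp (γ * ‖y‖))
  refine h1.mono' ((continuous_weight n γ).aestronglyMeasurable.mul hm)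
    (Filter.Eventually.of_forall fun w => ?_)
  simp only [Function.comp_apply]
  rw [norm_mul, norm_mul, Complex.norm_real, Complex.norm_real, Real.norm_of_nonneg
    (Real.exp_pos _).le, Real.norm_of_nonneg (Real.exp_pos _).le, ← mul_assoc, ← Real.exp_add]
  gcongr
  have h2 : γ * ‖w + y‖ ≤ γ * (‖w‖ + ‖y‖) := mul_le_mul_of_nonneg_left (norm_add_le w y) hγ
  linarith

theorem norm_toLp_comp_sub_le {γ : ℝ} (hγ : 0 ≤ γ) {φ : RSpace n → ℂ} (hφ : IsTest φ)
    (x : RSpace n) : ‖((hφ.comp_sub x).memLp (-γ)).toLp _‖ ≤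
      Real.exp (γ * ‖x‖) * ‖(hφ.memLp (-γ)).toLp φ‖ := by
  rw [Lp.norm_toLp, Lp.norm_toLp]
  have hmp := measurePreserving_sub_right (volume : Measure (RSpace n)) x
  have h1 : eLpNorm (fun w => φ (w - x)) 2 (expMeasure n (-γ)) ≤
      ENNReal.ofReal (Real.exp (γ * ‖x‖)) * eLpNorm φ 2 (expMeasure n (-γ)) := by
    rw [eLpNorm_expMeasure, eLpNorm_expMeasure, ← eLpNorm_comp_measurePreserving
      (g := fun w => (Real.exp (-(-γ * ‖w‖)) : ℂ) * φ w)
      ((continuous_weight n (-γ)).mul hφ.1.continuous).aestronglyMeasurable hmp]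
    refine eLpNorm_le_mul_eLpNorm_of_ae_le_mul (Filter.Eventually.of_forall fun w => ?_) 2
    simp only [Function.comp_apply]
    rw [norm_mul, norm_mul, Complex.norm_real, Complex.norm_real, Real.norm_of_nonneg
      (Real.exp_pos _).le, Real.norm_of_nonneg (Real.exp_pos _).le, ← mul_assoc, ← Real.exp_add]
    gcongr
    have h2 := norm_add_le (w - x) x
    rw [sub_add_cancel] at h2
    nlinarith
  have h2 := ENNReal.toReal_mono (ENNReal.mul_lt_top ENNReal.ofReal_lt_top
    (hφ.memLp (-γ)).2).ne h1
  rwa [ENNReal.toReal_mul, ENNReal.toReal_ofReal (Real.exp_pos _).le] at h2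

/-- The index of the derivative `∂_i`. -/
def DerivIndex.single (i : Fin n) : DerivIndex n 2 := ⟨1, fun _ => i⟩

theorem fderiv_eq_sum_partialDeriv (φ : RSpace n → ℂ) (w y : RSpace n) :
    fderiv ℝ φ w y = ∑ i, (y i : ℂ) * partialDeriv (fun _ : Fin 1 => i) φ w := by
  have h1 : y = ∑ i, y i • EuclideanSpace.single i (1 : ℝ) := by
    ext j
    simp [Pi.single_apply]
  conv_lhs => rw [h1]
  rw [map_sum]
  refine Finset.sum_congr rfl fun i _ => ?_
  rw [map_smul, Complex.real_smul, partialDeriv, iteratedFDeriv_one_apply]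

/-- As a function of the translation, `∫ u φ(· - x)` is the convolution of `u` with the reflected
test function, hence differentiable. The derivative falls on `φ` and is moved to `u` by the
definition of weak derivatives; the mean value inequality on the segment from `0` to `y` concludes.
-/
theorem norm_integral_mul_comp_sub_le {γ : ℝ} (hγ : 0 ≤ γ) (u : ExpSobolev n γ 2)
    {φ : RSpace n → ℂ} (hφ : IsTest φ) (y : RSpace n) :
    ‖(∫ w, ExpSobolev.incl n γ 2 u w * φ (w - y)) - ∫ w, ExpSobolev.incl n γ 2 u w * φ w‖ ≤
      n * ‖y‖ * Real.exp (γ * ‖y‖) * ‖u‖ * ‖(hφ.memLp (-γ)).toLp φ‖ := by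
  set u₀ := ExpSobolev.incl n γ 2 u with hu₀
  set g : RSpace n → ℂ := fun x => φ (-x) with hg
  have hgc : HasCompactSupport g := by
    have := hφ.2.comp_homeomorph (Homeomorph.neg (RSpace n))
    exact this
  have hgd : ContDiff ℝ ∞ g := hφ.1.comp contDiff_neg
  have hloc := locallyIntegrable_coe u₀
  set F : RSpace n → ℂ := fun x => ∫ w, u₀ w * φ (w - x) with hF
  have hFc : F = MeasureTheory.convolution (fun w => u₀ w) g (ContinuousLinearMap.mul ℝ ℂ)
      volume := by
    funext x
    simp only [hF, hg, MeasureTheory.convolution_def, ContinuousLinearMap.mul_apply', neg_sub]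
  have hder : ∀ x, HasFDerivAt F ((MeasureTheory.convolution (fun w => u₀ w) (fderiv ℝ g)
      ((ContinuousLinearMap.mul ℝ ℂ).precompR (RSpace n)) volume) x) x := by
    intro x
    rw [hFc]
    exact hgc.hasFDerivAt_convolution_right _ hloc (hgd.of_le (by simp)) x
  have hval : ∀ x y, (MeasureTheory.convolution (fun w => u₀ w) (fderiv ℝ g)
      ((ContinuousLinearMap.mul ℝ ℂ).precompR (RSpace n)) volume) x y =
        ∑ i, (y i : ℂ) * ∫ w, (u : DerivIndex n 2 → ExpL2 n γ) (DerivIndex.single i) w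
          * φ (w - x) := by
    intro x y
    rw [convolution_precompR_apply _ hloc (hgc.fderiv ℝ) (hgd.continuous_fderiv (by simp)),
      MeasureTheory.convolution_def]
    have h1 : ∀ w, (ContinuousLinearMap.mul ℝ ℂ) (u₀ w) (fderiv ℝ g (x - w) y) =
        ∑ i, -((y i : ℂ) * (u₀ w * partialDeriv (fun _ : Fin 1 => i) (fun w => φ (w - x)) w)) := by
      intro w
      have h2 : fderiv ℝ g (x - w) = -fderiv ℝ (fun w => φ (w - x)) w := by
        have h3 : (fun w => φ (w - x)) = fun w => g (x - w) := by
          funext w; simp only [hg, neg_sub]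
        have h4 : HasFDerivAt (fun w => g (x - w)) (fderiv ℝ g (x - w) ∘L
            (-ContinuousLinearMap.id ℝ (RSpace n))) w :=
          (hgd.differentiable (by simp) (x - w)).hasFDerivAt.comp w
            ((hasFDerivAt_id w).const_sub x)
        rw [h3, h4.fderiv]
        ext v
        simp
      rw [ContinuousLinearMap.mul_apply', h2, _root_.neg_apply,
        fderiv_eq_sum_partialDeriv, Finset.sum_neg_distrib, mul_neg, Finset.mul_sum]
      congr 1
      exact Finset.sum_congr rfl fun i _ => by ring
    simp only [h1]
    rw [integral_finsetSum]
    · refine Finset.sum_congr rfl fun i _ => ?_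
      rw [integral_neg, integral_const_mul]
      have h4 := u.2 (DerivIndex.single i) _ (hφ.comp_sub x)
      have h5 : ∫ w, u₀ w * partialDeriv (fun _ : Fin 1 => i) (fun w => φ (w - x)) w
          = (-1 : ℂ) ^ 1 * ∫ w, (u : DerivIndex n 2 → ExpL2 n γ) (DerivIndex.single i) w
            * φ (w - x) := h4
      rw [h5]
      ring
    · intro i _
      exact ((integrable_coe_mul u₀ ((hφ.comp_sub x).partialDeriv_continuous _)
        ((hφ.comp_sub x).partialDeriv_compact _)).const_mul _).neg
  have hbound : ∀ t ∈ Ico (0 : ℝ) 1, ‖∑ i, (y i : ℂ) *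
      ∫ w, (u : DerivIndex n 2 → ExpL2 n γ) (DerivIndex.single i) w * φ (w - t • y)‖ ≤
        n * ‖y‖ * Real.exp (γ * ‖y‖) * ‖u‖ * ‖(hφ.memLp (-γ)).toLp φ‖ := by
    intro t ht
    have hty : ‖t • y‖ ≤ ‖y‖ := by
      rw [norm_smul, Real.norm_of_nonneg ht.1]
      exact mul_le_of_le_one_left (norm_nonneg _) ht.2.le
    have hterm : ∀ i, ‖(y i : ℂ) * ∫ w, (u : DerivIndex n 2 → ExpL2 n γ) (DerivIndex.single i) w
        * φ (w - t • y)‖ ≤ ‖y‖ * (‖u‖ * (Real.exp (γ * ‖y‖) * ‖(hφ.memLp (-γ)).toLp φ‖)) := by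
      intro i
      have h1 := norm_integral_mul_le ((u : DerivIndex n 2 → ExpL2 n γ) (DerivIndex.single i))
        (((hφ.comp_sub (t • y)).memLp (-γ)).toLp _)
      have h2 : ∫ w, (u : DerivIndex n 2 → ExpL2 n γ) (DerivIndex.single i) w *
          (((hφ.comp_sub (t • y)).memLp (-γ)).toLp (fun w => φ (w - t • y)) : ExpL2 n (-γ)) w =
          ∫ w, (u : DerivIndex n 2 → ExpL2 n γ) (DerivIndex.single i) w * φ (w - t • y) := by
        refine integral_congr_ae ?_
        filter_upwards [(ac_expMeasure n (-γ)).ae_le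
          ((hφ.comp_sub (t • y)).memLp (-γ)).coeFn_toLp] with w hw
        rw [hw]
      rw [h2] at h1
      have h3 : ‖(u : DerivIndex n 2 → ExpL2 n γ) (DerivIndex.single i)‖ ≤ ‖u‖ :=
        norm_le_pi_norm (u : DerivIndex n 2 → ExpL2 n γ) _
      rw [norm_mul, Complex.norm_real]
      refine mul_le_mul (exists_coord_le y i) (h1.trans ?_) (norm_nonneg _) (norm_nonneg _)
      refine mul_le_mul h3 ((norm_toLp_comp_sub_le hγ hφ (t • y)).trans ?_) (norm_nonneg _)
        (norm_nonneg _)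
      gcongr
    refine (norm_sum_le_of_le _ fun i _ => hterm i).trans_eq ?_
    rw [Finset.sum_const, Finset.card_univ, Fintype.card_fin, nsmul_eq_mul]
    ring
  have hderiv : ∀ t ∈ Icc (0 : ℝ) 1, HasDerivWithinAt (fun t : ℝ => F (t • y)) (∑ i, (y i : ℂ) *
      ∫ w, (u : DerivIndex n 2 → ExpL2 n γ) (DerivIndex.single i) w * φ (w - t • y))
      (Icc 0 1) t := by
    intro t _
    have h1 := (hder (t • y)).comp_hasDerivAt t ((hasDerivAt_id t).smul_const y)
    rw [one_smul, hval] at h1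
    exact h1.hasDerivWithinAt
  have h := norm_image_sub_le_of_norm_deriv_le_segment_01' hderiv hbound
  simpa [hF] using h

/-- Translations act Lipschitz continuously on the weighted Sobolev space. -/
theorem exists_translate_sub {γ : ℝ} (hγ : 0 ≤ γ) (u : ExpSobolev n γ 2) (y : RSpace n) :
    ∃ v : ExpL2 n γ, (v : RSpace n → ℂ) =ᵐ[volume] (fun w => ExpSobolev.incl n γ 2 u (w + y) -
      ExpSobolev.incl n γ 2 u w) ∧ ‖v‖ ≤ n * ‖y‖ * Real.exp (γ * ‖y‖) * ‖u‖ := by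
  set u₀ := ExpSobolev.incl n γ 2 u with hu₀
  have hmem := (memLp_comp_add hγ u₀ y).sub (Lp.memLp u₀)
  refine ⟨hmem.toLp _, (ac_expMeasure n γ).ae_le hmem.coeFn_toLp, ?_⟩
  refine norm_le_of_test_bound (by positivity) fun φ hφ => ?_
  refine le_trans (le_of_eq ?_) (norm_integral_mul_comp_sub_le hγ u hφ y)
  congr 1
  have hi1 : Integrable (fun w => u₀ w * φ (w - y)) volume :=
    integrable_coe_mul u₀ (hφ.comp_sub y).1.continuous (hφ.comp_sub y).2
  have hi2 : Integrable (fun w => u₀ w * φ w) volume :=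
    integrable_coe_mul u₀ hφ.1.continuous hφ.2
  have hi3 : Integrable (fun w => u₀ (w + y) * φ w) volume := by
    have := hi1.comp_add_right y
    simpa only [add_sub_cancel_right] using this
  have h1 : ∫ w, u₀ w * φ (w - y) = ∫ w, u₀ (w + y) * φ w := by
    rw [← integral_add_right_eq_self _ y]
    simp only [add_sub_cancel_right]
  rw [h1, ← integral_sub hi3 hi2]
  refine integral_congr_ae ?_
  filter_upwards [(ac_expMeasure n γ).ae_le hmem.coeFn_toLp] with w hw
  rw [hw, Pi.sub_apply, sub_mul]

end Translation

/-! ### Averages over cubes -/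

section Cubes

open Set

variable {n : ℕ}

/-- The cube with the corner `h j` and the side `h`. -/
def cube (h : ℝ) (j : Fin n → ℤ) : Set (RSpace n) :=
  {w | ∀ i, (j i : ℝ) * h ≤ w i ∧ w i < ((j i : ℝ) + 1) * h}

/-- The cube around the origin with the side `2 h`. -/
def centralCube (n : ℕ) (h : ℝ) : Set (RSpace n) := {w | ∀ i, -h ≤ w i ∧ w i < h}

theorem measurableSet_coordBox (a b : Fin n → ℝ) :
    MeasurableSet {w : RSpace n | ∀ i, a i ≤ w i ∧ w i < b i} := by
  have : {w : RSpace n | ∀ i, a i ≤ w i ∧ w i < b i} =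
      ⋂ i, {w : RSpace n | a i ≤ w i ∧ w i < b i} := by ext; simp
  rw [this]
  refine MeasurableSet.iInter fun i => ?_
  have h1 : Measurable fun w : RSpace n => w i := by fun_prop
  exact (measurableSet_le measurable_const h1).inter (measurableSet_lt h1 measurable_const)

theorem volume_coordBox (a b : Fin n → ℝ) :
    volume {w : RSpace n | ∀ i, a i ≤ w i ∧ w i < b i} = ∏ i, ENNReal.ofReal (b i - a i) := by
  rw [← Real.volume_pi_Ico, ← (PiLp.volume_preserving_ofLp (Fin n)).measure_preimage
    (MeasurableSet.univ_pi fun i => measurableSet_Ico).nullMeasurableSet]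
  congr 1
  ext w
  simp [Set.mem_pi]

theorem measurableSet_cube (h : ℝ) (j : Fin n → ℤ) : MeasurableSet (cube h j) :=
  measurableSet_coordBox _ _

theorem measurableSet_centralCube (h : ℝ) : MeasurableSet (centralCube n h) :=
  measurableSet_coordBox _ _

theorem volume_cube (h : ℝ) (j : Fin n → ℤ) : volume (cube h j) = ENNReal.ofReal h ^ n := by
  rw [cube, volume_coordBox]
  have : ∀ i, ((j i : ℝ) + 1) * h - (j i : ℝ) * h = h := fun i => by ring
  simp [this]

theorem volume_centralCube (h : ℝ) :
    volume (centralCube n h) = 2 ^ n * ENNReal.ofReal h ^ n := by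
  rw [centralCube, volume_coordBox]
  have : h - -h = 2 * h := by ring
  simp only [this, Finset.prod_const, Finset.card_univ, Fintype.card_fin]
  rw [ENNReal.ofReal_mul (by norm_num), mul_pow]
  norm_num

theorem volume_cube_ne_zero {h : ℝ} (hh : 0 < h) (j : Fin n → ℤ) : volume (cube h j) ≠ 0 := by
  rw [volume_cube]
  exact pow_ne_zero _ (ENNReal.ofReal_pos.2 hh).ne'

theorem volume_cube_ne_top (h : ℝ) (j : Fin n → ℤ) : volume (cube h j) ≠ (⊤ : ℝ≥0∞) := by
  rw [volume_cube]
  exact ENNReal.pow_ne_top ENNReal.ofReal_ne_top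

theorem rnorm_le_sum (w : RSpace n) : ‖w‖ ≤ ∑ i, |w i| := by
  rw [EuclideanSpace.norm_eq]
  refine Real.sqrt_le_iff.2 ⟨Finset.sum_nonneg fun i _ => abs_nonneg _, ?_⟩
  exact Finset.sum_sq_le_sq_sum_of_nonneg fun i _ => abs_nonneg _

theorem norm_le_of_mem_centralCube {h : ℝ} {w : RSpace n} (hw : w ∈ centralCube n h) :
    ‖w‖ ≤ n * h := by
  refine (rnorm_le_sum w).trans ?_
  refine (Finset.sum_le_sum fun i _ => abs_le.2 ⟨(hw i).1, (hw i).2.le⟩).trans_eq ?_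
  simp

theorem cube_subset_closedBall (h : ℝ) (j : Fin n → ℤ) :
    ∃ R : ℝ, ∀ w ∈ cube h j, ‖w‖ ≤ R := by
  refine ⟨∑ i, (|(j i : ℝ) * h| + |((j i : ℝ) + 1) * h|), fun w hw => (rnorm_le_sum w).trans ?_⟩
  refine Finset.sum_le_sum fun i _ => ?_
  obtain ⟨h1, h2⟩ := hw i
  rw [abs_le]
  constructor
  · linarith [neg_abs_le ((j i : ℝ) * h), abs_nonneg (((j i : ℝ) + 1) * h)]
  · linarith [le_abs_self (((j i : ℝ) + 1) * h), abs_nonneg ((j i : ℝ) * h)]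

theorem expMeasure_cube_ne_top (γ h : ℝ) (j : Fin n → ℤ) :
    expMeasure n γ (cube h j) ≠ (⊤ : ℝ≥0∞) := by
  obtain ⟨R, hR⟩ := cube_subset_closedBall h j
  rw [expMeasure, withDensity_apply _ (measurableSet_cube h j)]
  have h1 : ∫⁻ w in cube h j, ENNReal.ofReal (Real.exp (-(2 * γ * ‖w‖))) ≤
      ∫⁻ w in cube h j, ENNReal.ofReal (Real.exp (2 * |γ| * R)) := by
    refine setLIntegral_mono' (measurableSet_cube h j) fun w hw => ?_
    refine ENNReal.ofReal_le_ofReal (Real.exp_le_exp.2 ?_)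
    have h2 := hR w hw
    have h3 := neg_abs_le γ
    have h4 := norm_nonneg w
    have h5 := abs_nonneg γ
    nlinarith
  refine (h1.trans_lt ?_).ne
  rw [setLIntegral_const]
  exact ENNReal.mul_lt_top ENNReal.ofReal_lt_top (volume_cube_ne_top h j).lt_top

theorem memLp_cube_indicator (γ h : ℝ) (j : Fin n → ℤ) :
    MemLp ((cube h j).indicator fun _ => (1 : ℂ)) 2 (expMeasure n γ) :=
  memLp_indicator_const 2 (measurableSet_cube h j) 1 (Or.inr (expMeasure_cube_ne_top γ h j))

theorem exists_pairing (γ : ℝ) (f : ExpL2 n (-γ)) :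
    ∃ Λ : ExpL2 n γ →L[ℂ] ℂ, ∀ u, Λ u = ∫ w, u w * f w := by
  refine ⟨((ContinuousLinearMap.mul ℂ ℂ).lpPairing (volume : Measure (RSpace n)) 2 2
    (weightEquiv n (-γ) f)).comp (weightEquiv n γ).toContinuousLinearEquiv.toContinuousLinearMap,
    fun u => ?_⟩
  have h3 := ContinuousLinearMap.lpPairing_eq_integral (μ := (volume : Measure (RSpace n)))
    (p := 2) (q := 2) (ContinuousLinearMap.mul ℂ ℂ) (weightEquiv n (-γ) f) (weightEquiv n γ u)
  refine h3.trans (integral_congr_ae ?_)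
  filter_upwards [coeFn_weightEquiv f, coeFn_weightEquiv u] with w h4 h5
  rw [h4, h5, ContinuousLinearMap.mul_apply', neg_mul, neg_neg]
  have := exp_mul_exp_neg γ ‖w‖ (u w * f w)
  linear_combination this

/-- The mean of `u` over a cube. -/
def cubeMean (h : ℝ) (u : RSpace n → ℂ) (j : Fin n → ℤ) : ℂ :=
  ∫ w, u w ∂((volume (cube h j))⁻¹ • volume.restrict (cube h j))

theorem exists_cubeMean_functional (γ h : ℝ) (j : Fin n → ℤ) :
    ∃ Λ : ExpL2 n γ →L[ℂ] ℂ, ∀ u, Λ u = cubeMean h u j := by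
  obtain ⟨Λ, hΛ⟩ := exists_pairing γ ((memLp_cube_indicator (-γ) h j).toLp _)
  refine ⟨((volume (cube h j))⁻¹.toReal : ℂ) • Λ, fun u => ?_⟩
  rw [_root_.smul_apply, hΛ, cubeMean, integral_smul_measure,
    ← integral_indicator (measurableSet_cube h j), Complex.coe_smul]
  congr 1
  refine integral_congr_ae ?_
  filter_upwards [(ac_expMeasure n (-γ)).ae_le (memLp_cube_indicator (-γ) h j).coeFn_toLp]
    with w hw
  rw [hw]
  by_cases h1 : w ∈ cube h j
  · rw [indicator_of_mem h1, indicator_of_mem h1, mul_one]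
  · rw [indicator_of_notMem h1, indicator_of_notMem h1, mul_zero]

theorem enorm_integral_sq_le {α : Type*} [MeasurableSpace α] {P : Measure α}
    [IsProbabilityMeasure P] {f : α → ℂ} (hf : AEStronglyMeasurable f P) :
    ‖∫ x, f x ∂P‖ₑ ^ 2 ≤ ∫⁻ x, ‖f x‖ₑ ^ 2 ∂P := by
  have h1 : ‖∫ x, f x ∂P‖ₑ ≤ eLpNorm f 2 P :=
    (enorm_integral_le_lintegral_enorm f).trans (by
      rw [← eLpNorm_one_eq_lintegral_enorm]
      exact eLpNorm_le_eLpNorm_of_exponent_le (by norm_num) hf)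
  calc ‖∫ x, f x ∂P‖ₑ ^ 2 ≤ eLpNorm f 2 P ^ 2 := by gcongr
    _ = _ := by
      have := eLpNorm_nnreal_pow_eq_lintegral (f := f) (μ := P) (p := 2) (by norm_num)
      simpa using this

/-- Jensen's inequality for the uniform probability on the cube, and the fact that differences of
points of a cube of side `h` lie in the central cube. -/
theorem enorm_sub_cubeMean_sq_le {h : ℝ} (hh : 0 < h) {j : Fin n → ℤ} {u : RSpace n → ℂ}
    (hu : Measurable u) (hloc : LocallyIntegrable u volume) {w : RSpace n} (hw : w ∈ cube h j) :
    ‖u w - cubeMean h u j‖ₑ ^ 2 ≤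
      (ENNReal.ofReal h ^ n)⁻¹ * ∫⁻ y in centralCube n h, ‖u (w + y) - u w‖ₑ ^ 2 := by
  have hP : IsProbabilityMeasure ((volume (cube h j))⁻¹ • volume.restrict (cube h j)) := by
    constructor
    rw [Measure.smul_apply, Measure.restrict_apply_univ, smul_eq_mul,
      ENNReal.inv_mul_cancel (volume_cube_ne_zero hh j) (volume_cube_ne_top h j)]
  have hint : Integrable u ((volume (cube h j))⁻¹ • volume.restrict (cube h j)) := by
    refine Integrable.smul_measure ?_ (ENNReal.inv_ne_top.2 (volume_cube_ne_zero hh j))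
    obtain ⟨R, hR⟩ := cube_subset_closedBall h j
    have := hloc.integrableOn_isCompact (isCompact_closedBall (0 : RSpace n) R)
    exact this.mono_set fun w hw => by simpa using hR w hw
  have h1 : u w - cubeMean h u j =
      ∫ w', (u w - u w') ∂((volume (cube h j))⁻¹ • volume.restrict (cube h j)) := by
    rw [integral_sub (integrable_const _) hint, integral_const]
    simp [cubeMean]
  rw [h1]
  refine (enorm_integral_sq_le (by fun_prop)).trans ?_
  rw [lintegral_smul_measure, smul_eq_mul, volume_cube]
  refine mul_le_mul' le_rfl ?_
  rw [← lintegral_indicator (measurableSet_cube h j),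
    ← lintegral_indicator (measurableSet_centralCube h),
    ← lintegral_add_left_eq_self _ w]
  refine lintegral_mono fun y => ?_
  by_cases h2 : w + y ∈ cube h j
  · have h3 : y ∈ centralCube n h := by
      intro i
      obtain ⟨a1, a2⟩ := hw i
      obtain ⟨b1, b2⟩ := h2 i
      rw [PiLp.add_apply] at b1 b2
      constructor <;> linarith
    rw [indicator_of_mem h2, indicator_of_mem h3, enorm_sub_rev]
  · rw [indicator_of_notMem h2]
    exact zero_le

theorem eLpNorm_two_sq {α : Type*} [MeasurableSpace α] (μ : Measure α) (f : α → ℂ) :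
    eLpNorm f 2 μ ^ 2 = ∫⁻ x, ‖f x‖ₑ ^ 2 ∂μ := by
  have := eLpNorm_nnreal_pow_eq_lintegral (f := f) (μ := μ) (p := 2) (by norm_num)
  simpa using this

theorem lintegral_enorm_translate_sub_le {γ : ℝ} (hγ : 0 ≤ γ) (u : ExpSobolev n γ 2)
    {h : ℝ} (hh : 0 < h) (hh1 : h ≤ 1) {y : RSpace n} (hy : y ∈ centralCube n h) :
    ∫⁻ w, ‖ExpSobolev.incl n γ 2 u (w + y) - ExpSobolev.incl n γ 2 u w‖ₑ ^ 2 ∂(expMeasure n γ)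
      ≤ ENNReal.ofReal (n * (n * h) * Real.exp (γ * n) * ‖u‖) ^ 2 := by
  obtain ⟨v, hv1, hv2⟩ := exists_translate_sub hγ u y
  have hyn := norm_le_of_mem_centralCube hy
  have hyn1 : ‖y‖ ≤ n := hyn.trans (mul_le_of_le_one_right (by positivity) hh1)
  rw [← eLpNorm_two_sq, ← eLpNorm_congr_ae ((expMeasure_ac n γ).ae_le hv1), ← Lp.enorm_def]
  gcongr
  rw [← ofReal_norm]
  refine ENNReal.ofReal_le_ofReal (hv2.trans ?_)
  gcongr

/-- The multiplicity free sum of the means over the cubes with index in `J`. -/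
theorem eLpNorm_sub_cubeMean_le {γ : ℝ} (hγ : 0 ≤ γ) (u : ExpSobolev n γ 2) {h : ℝ} (hh : 0 < h)
    (hh1 : h ≤ 1) {B : Set (RSpace n)} (e : RSpace n → ℂ)
    (he : ∀ w ∈ B, ∃ j, w ∈ cube h j ∧
      e w = ExpSobolev.incl n γ 2 u w - cubeMean h (ExpSobolev.incl n γ 2 u) j) :
    eLpNorm (B.indicator e) 2 (expMeasure n γ) ≤
      ENNReal.ofReal (2 ^ n * (n * (n * h) * Real.exp (γ * n) * ‖u‖)) := by
  set u₀ := ExpSobolev.incl n γ 2 u with hu₀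
  have hum : Measurable (fun w => u₀ w) := (Lp.stronglyMeasurable u₀).measurable
  have hq0 : ENNReal.ofReal h ^ n ≠ 0 := pow_ne_zero _ (ENNReal.ofReal_pos.2 hh).ne'
  have hqt : ENNReal.ofReal h ^ n ≠ (⊤ : ℝ≥0∞) := ENNReal.pow_ne_top ENNReal.ofReal_ne_top
  set M := ENNReal.ofReal (n * (n * h) * Real.exp (γ * n) * ‖u‖) with hM
  have h2 : eLpNorm (B.indicator e) 2 (expMeasure n γ) ^ 2 ≤ (2 ^ n * M) ^ 2 := by
    have hsf : SFinite (expMeasure n γ) := by unfold expMeasure; infer_instance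
    have hmeas : Measurable (Function.uncurry fun w y : RSpace n => ‖u₀ (w + y) - u₀ w‖ₑ ^ 2) := by
      have h1 : Measurable fun q : RSpace n × RSpace n => u₀ (q.1 + q.2) - u₀ q.1 :=
        (hum.comp (measurable_fst.add measurable_snd)).sub (hum.comp measurable_fst)
      exact h1.enorm.pow_const 2
    rw [eLpNorm_two_sq]
    calc ∫⁻ w, ‖B.indicator e w‖ₑ ^ 2 ∂(expMeasure n γ)
        ≤ ∫⁻ w, (ENNReal.ofReal h ^ n)⁻¹ *
            (∫⁻ y in centralCube n h, ‖u₀ (w + y) - u₀ w‖ₑ ^ 2) ∂(expMeasure n γ) := by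
          refine lintegral_mono fun w => ?_
          by_cases hw : w ∈ B
          · obtain ⟨j, hj, hej⟩ := he w hw
            rw [indicator_of_mem hw, hej]
            exact enorm_sub_cubeMean_sq_le hh hum (locallyIntegrable_coe u₀) hj
          · rw [indicator_of_notMem hw]
            simp
      -- Tonelli: for fixed `y` the inner integral is the norm of a translation difference, which is
      -- `O(h)` on the Sobolev space.
      _ = (ENNReal.ofReal h ^ n)⁻¹ * ∫⁻ y in centralCube n h, ∫⁻ w, ‖u₀ (w + y) - u₀ w‖ₑ ^ 2
            ∂(expMeasure n γ) := by
          rw [lintegral_const_mul' _ _ (ENNReal.inv_ne_top.2 hq0), lintegral_lintegral_swap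
            hmeas.aemeasurable]
      _ ≤ (ENNReal.ofReal h ^ n)⁻¹ * ∫⁻ y in centralCube n h, M ^ 2 := by
          refine mul_le_mul' le_rfl ?_
          exact setLIntegral_mono' (measurableSet_centralCube h) fun y hy =>
            lintegral_enorm_translate_sub_le hγ u hh hh1 hy
      _ = 2 ^ n * M ^ 2 := by
          rw [setLIntegral_const, volume_centralCube]
          calc (ENNReal.ofReal h ^ n)⁻¹ * (M ^ 2 * (2 ^ n * ENNReal.ofReal h ^ n))
              = ((ENNReal.ofReal h ^ n)⁻¹ * ENNReal.ofReal h ^ n) * (2 ^ n * M ^ 2) := by ring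
            _ = _ := by rw [ENNReal.inv_mul_cancel hq0 hqt, one_mul]
      -- The factor `2^n`, the ratio of the volumes of the central cube and a cube, is replaced by
      -- its square to allow a root without fractional powers.
      _ ≤ (2 ^ n * M) ^ 2 := by
          rw [mul_pow]
          exact mul_le_mul' (le_self_pow (one_le_pow₀ (by norm_num)) two_ne_zero) le_rfl
  have h3 : eLpNorm (B.indicator e) 2 (expMeasure n γ) ≤ 2 ^ n * M :=
    (ENNReal.pow_le_pow_left_iff two_ne_zero).1 h2
  rw [ENNReal.ofReal_mul (by positivity), ENNReal.ofReal_pow (by norm_num), ENNReal.ofReal_ofNat]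
  exact h3

end Cubes

/-! ### Approximation of the embedding by operators of finite rank -/

section Approximation

open Set

variable {n : ℕ}

theorem eLpNorm_expMeasure_le {γ γ₁ : ℝ} (h : γ ≤ γ₁) (f : RSpace n → ℂ) :
    eLpNorm f 2 (expMeasure n γ₁) ≤ eLpNorm f 2 (expMeasure n γ) := by
  rw [eLpNorm_expMeasure, eLpNorm_expMeasure]
  refine eLpNorm_mono fun w => ?_
  rw [norm_mul, norm_mul, Complex.norm_real, Complex.norm_real, Real.norm_of_nonneg
    (Real.exp_pos _).le, Real.norm_of_nonneg (Real.exp_pos _).le]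
  gcongr

theorem eLpNorm_indicator_far_le {γ γ₁ L : ℝ} (h : γ ≤ γ₁) {S : Set (RSpace n)}
    (hS : ∀ w ∈ S, L ≤ ‖w‖) (f : RSpace n → ℂ) :
    eLpNorm (S.indicator f) 2 (expMeasure n γ₁) ≤
      ENNReal.ofReal (Real.exp (-((γ₁ - γ) * L))) * eLpNorm f 2 (expMeasure n γ) := by
  rw [eLpNorm_expMeasure, eLpNorm_expMeasure]
  refine eLpNorm_le_mul_eLpNorm_of_ae_le_mul (Filter.Eventually.of_forall fun w => ?_) 2
  by_cases hw : w ∈ S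
  · rw [indicator_of_mem hw, norm_mul, norm_mul, Complex.norm_real, Complex.norm_real,
      Real.norm_of_nonneg (Real.exp_pos _).le, Real.norm_of_nonneg (Real.exp_pos _).le,
      ← mul_assoc, ← Real.exp_add]
    gcongr
    have := mul_le_mul_of_nonneg_left (hS w hw) (sub_nonneg.2 h)
    linarith
  · rw [indicator_of_notMem hw, mul_zero, norm_zero]
    positivity

/-- The potential decays fast enough for a weaker norm, with weight exponent `γ₀ / 2 > γ` in the
application, to control the product. This gain makes the tail at infinity small. -/
theorem norm_mulOp_le {γ γ₀ : ℝ} {V : RSpace n → ℂ} (hV : IsExpDecaying γ₀ V) (hγ : 2 * γ ≤ γ₀)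
    (e : ExpL2 n γ) :
    ‖mulOp hV hγ e‖ₑ ≤ ENNReal.ofReal (expDecayNorm γ₀ V) *
      eLpNorm e 2 (expMeasure n (γ₀ / 2)) := by
  change ‖(hV.memLp_mul hγ (Lp.memLp e)).toLp (fun w => V w * e w)‖ₑ ≤ _
  rw [Lp.enorm_toLp]
  exact (eLpNorm_expMeasure_le (by linarith) _).trans (eLpNorm_mul_le hV (by linarith) _)

theorem coeFn_expL2_sum {γ : ℝ} {ι : Type*} (s : Finset ι) (f : ι → ExpL2 n γ) :
    (↑(∑ i ∈ s, f i : ExpL2 n γ) : RSpace n → ℂ) =ᵐ[volume] fun w => ∑ i ∈ s, f i w := by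
  classical
  refine (ac_expMeasure n γ).ae_le ?_
  induction s using Finset.induction_on with
  | empty =>
    simp only [Finset.sum_empty]
    exact Lp.coeFn_zero ℂ 2 _
  | insert i s hi ih =>
    rw [Finset.sum_insert hi]
    filter_upwards [ih, Lp.coeFn_add (f i) (∑ i ∈ s, f i)] with w h1 h2
    rw [h2, Pi.add_apply, h1, Finset.sum_insert hi]

/-- The piecewise constant approximation of `u` on the cube of side `2 N h`. -/
theorem exists_projection_cubes (γ h : ℝ) (J : Finset (Fin n → ℤ)) :
    ∃ P : ExpL2 n γ →L[ℂ] ExpL2 n γ,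
      (∀ u, (P u : RSpace n → ℂ) =ᵐ[volume] fun w =>
        ∑ j ∈ J, cubeMean h u j * (cube h j).indicator (fun _ => 1) w) ∧
      ∃ s : Finset (ExpL2 n γ), s.card ≤ J.card ∧ ∀ u, P u ∈ Submodule.span ℂ (s : Set _) := by
  classical
  choose Λ hΛ using exists_cubeMean_functional (n := n) γ h
  set χ : (Fin n → ℤ) → ExpL2 n γ := fun j => (memLp_cube_indicator γ h j).toLp _ with hχ
  have hP : ∀ u, (∑ j ∈ J, (Λ j).smulRight (χ j)) u = ∑ j ∈ J, cubeMean h u j • χ j := by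
    intro u
    rw [_root_.sum_apply]
    refine Finset.sum_congr rfl fun j _ => ?_
    rw [ContinuousLinearMap.smulRight_apply, hΛ]
  refine ⟨∑ j ∈ J, (Λ j).smulRight (χ j), fun u => ?_, J.image χ, Finset.card_image_le, fun u => ?_⟩
  · rw [hP]
    have h1 : ∀ j ∈ J, ∀ᵐ w, (cubeMean h u j • χ j : ExpL2 n γ) w =
        cubeMean h u j * (cube h j).indicator (fun _ => 1) w := by
      intro j _
      filter_upwards [(ac_expMeasure n γ).ae_le (memLp_cube_indicator γ h j).coeFn_toLp,
        (ac_expMeasure n γ).ae_le (Lp.coeFn_smul (cubeMean h u j) (χ j))] with w h2 h3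
      rw [h3, Pi.smul_apply, hχ, h2, smul_eq_mul]
    have h4 : (↑(∑ j ∈ J, cubeMean h u j • χ j : ExpL2 n γ) : RSpace n → ℂ) =ᵐ[volume]
        fun w => ∑ j ∈ J, (cubeMean h u j • χ j : ExpL2 n γ) w :=
      coeFn_expL2_sum _ _
    filter_upwards [h4, (Filter.eventually_all_finset J).2 h1] with w h5 h6
    rw [h5]
    exact Finset.sum_congr rfl fun j hj => h6 j hj
  · rw [hP]
    exact Submodule.sum_mem _ fun j hj => Submodule.smul_mem _ _
      (Submodule.subset_span (Finset.mem_coe.2 (Finset.mem_image_of_mem χ hj)))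

theorem mem_cube_floor {h : ℝ} (hh : 0 < h) (w : RSpace n) : w ∈ cube h fun i => ⌊w i / h⌋ := by
  intro i
  have h1 := Int.floor_le (w i / h)
  have h2 := Int.lt_floor_add_one (w i / h)
  rw [le_div_iff₀ hh] at h1
  rw [div_lt_iff₀ hh] at h2
  exact ⟨h1, h2⟩

theorem eq_floor_of_mem_cube {h : ℝ} (hh : 0 < h) {w : RSpace n} {j : Fin n → ℤ}
    (hw : w ∈ cube h j) : j = fun i => ⌊w i / h⌋ := by
  funext i
  obtain ⟨h1, h2⟩ := hw i
  rw [← le_div_iff₀ hh] at h1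
  rw [← div_lt_iff₀ hh] at h2
  exact (Int.floor_eq_iff.2 ⟨h1, h2⟩).symm

/-- The cubes of side `h` in the central cube of side `2 N h`. -/
def cubeIndices (n N : ℕ) : Finset (Fin n → ℤ) :=
  Fintype.piFinset fun _ => Finset.Ico (-(N : ℤ)) N

theorem card_cubeIndices (n N : ℕ) : (cubeIndices n N).card = (2 * N) ^ n := by
  rw [cubeIndices, Fintype.card_piFinset]
  have : (N : ℤ) - -(N : ℤ) = ((2 * N : ℕ) : ℤ) := by push_cast; ring
  simp only [Int.card_Ico, this, Int.toNat_natCast, Finset.prod_const, Finset.card_univ,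
    Fintype.card_fin]

theorem floor_mem_cubeIndices {h : ℝ} (hh : 0 < h) (N : ℕ) (w : RSpace n) :
    (fun i => ⌊w i / h⌋) ∈ cubeIndices n N ↔ w ∈ centralCube n (N * h) := by
  simp only [cubeIndices, Fintype.mem_piFinset, Finset.mem_Ico, centralCube, mem_ofPred_eq]
  refine forall_congr' fun i => and_congr ?_ ?_
  · rw [Int.le_floor, le_div_iff₀ hh]
    push_cast
    rw [neg_mul]
  · rw [Int.floor_lt, div_lt_iff₀ hh]
    push_cast
    rfl

theorem le_norm_of_notMem_centralCube {h : ℝ} {w : RSpace n} (hw : w ∉ centralCube n h) :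
    h ≤ ‖w‖ := by
  by_contra hlt
  push Not at hlt
  refine hw fun i => ?_
  have h1 := (exists_coord_le w i).trans_lt hlt
  rw [Real.norm_eq_abs, abs_lt] at h1
  exact ⟨h1.1.le, h1.2⟩

/-- Inside the large cube the error is the deviation from the means, controlled by the Sobolev norm.
Outside, the approximation is zero, and the error is small through the difference of the weights. -/
theorem eLpNorm_sub_projection_le {γ γ₁ : ℝ} (hγ : 0 ≤ γ) (hγ₁ : γ ≤ γ₁) (u : ExpSobolev n γ 2)
    {h : ℝ} (hh : 0 < h) (hh1 : h ≤ 1) (N : ℕ) {e : RSpace n → ℂ}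
    (hem : AEStronglyMeasurable e volume)
    (he : e =ᵐ[volume] fun w => ExpSobolev.incl n γ 2 u w - ∑ j ∈ cubeIndices n N,
      cubeMean h (ExpSobolev.incl n γ 2 u) j * (cube h j).indicator (fun _ => 1) w) :
    eLpNorm e 2 (expMeasure n γ₁) ≤
      ENNReal.ofReal (2 ^ n * (n * (n * h) * Real.exp (γ * n) * ‖u‖) +
        Real.exp (-((γ₁ - γ) * (N * h))) * ‖u‖) := by
  set u₀ := ExpSobolev.incl n γ 2 u with hu₀
  set e' : RSpace n → ℂ := fun w => u₀ w - ∑ j ∈ cubeIndices n N,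
      cubeMean h u₀ j * (cube h j).indicator (fun _ => 1) w with he'
  set B := centralCube n (N * h) with hB
  have hBm : MeasurableSet B := measurableSet_centralCube _
  have hem' : AEStronglyMeasurable e' (expMeasure n γ₁) :=
    (hem.congr he).mono_ac (expMeasure_ac n γ₁)
  have hin : ∀ w ∈ B, ∃ j, w ∈ cube h j ∧ e' w = u₀ w - cubeMean h u₀ j := by
    intro w hw
    refine ⟨_, mem_cube_floor hh w, ?_⟩
    simp only [he']
    rw [Finset.sum_eq_single_of_mem _ ((floor_mem_cubeIndices hh N w).2 hw),
      indicator_of_mem (mem_cube_floor hh w), mul_one]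
    intro j _ hj
    rw [indicator_of_notMem, mul_zero]
    exact fun hjw => hj (eq_floor_of_mem_cube hh hjw)
  have hout : Bᶜ.indicator e' = Bᶜ.indicator fun w => u₀ w := by
    funext w
    by_cases hw : w ∈ B
    · rw [indicator_of_notMem (by simpa using hw), indicator_of_notMem (by simpa using hw)]
    · rw [indicator_of_mem hw, indicator_of_mem hw]
      simp only [he']
      rw [Finset.sum_eq_zero, sub_zero]
      intro j hj
      rw [indicator_of_notMem, mul_zero]
      intro hjw
      rw [eq_floor_of_mem_cube hh hjw] at hj
      exact hw ((floor_mem_cubeIndices hh N w).1 hj)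
  have hu : ENNReal.ofReal (‖u‖) ≥ eLpNorm u₀ 2 (expMeasure n γ) := by
    rw [← Lp.enorm_def, ← ofReal_norm]
    exact ENNReal.ofReal_le_ofReal (norm_le_pi_norm (u : DerivIndex n 2 → ExpL2 n γ) _)
  rw [eLpNorm_congr_ae ((expMeasure_ac n γ₁).ae_le he), ← indicator_self_add_compl B e',
    ENNReal.ofReal_add (by positivity) (by positivity)]
  refine (eLpNorm_add_le (hem'.indicator hBm) (hem'.indicator hBm.compl) (by norm_num)).trans
    (add_le_add ?_ ?_)
  · exact (eLpNorm_expMeasure_le hγ₁ _).trans (eLpNorm_sub_cubeMean_le hγ u hh hh1 e' hin)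
  · rw [hout, ENNReal.ofReal_mul (Real.exp_pos _).le]
    refine (eLpNorm_indicator_far_le hγ₁ (L := N * h)
      (fun w hw => le_norm_of_notMem_centralCube hw) _).trans ?_
    gcongr

/-- The multiplication by the potential, on the Sobolev space, is a rapidly convergent limit of
operators of finite rank. -/
theorem exists_finiteRank_approx {γ γ₀ : ℝ} (hγ : 0 < γ) (hγ₀ : 2 * γ < γ₀) {V : RSpace n → ℂ}
    (hV : IsExpDecaying γ₀ V) :
    ∃ (C : ℝ) (A : ℕ → (ExpSobolev n γ 2 →L[ℂ] ExpL2 n (-γ))),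
      (∀ k, ‖(mulOp hV hγ₀.le).comp (ExpSobolev.incl n γ 2) - A k‖ ≤ C * (1 / 2) ^ k) ∧
      (∀ k, FiniteDimensional ℂ (A k).range) ∧
      ∀ k, Module.finrank ℂ (A k).range ≤ 2 ^ n * 2 ^ (2 * n * k) := by
  -- Side `h = 2^{-k}` and `N = 4^k`, so that the large cube has half side `N h = 2^k`. Both errors
  -- are then `O(2^{-k})`, the tail even being `e^{-a 2^k}`, while the number of cubes is `(2 ·
  -- 4^k)^n`.
  have hP := fun k : ℕ => exists_projection_cubes (n := n) γ ((1 / 2) ^ k) (cubeIndices n (4 ^ k))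
  choose P hP1 s hs hPs using hP
  set M := expDecayNorm γ₀ V with hM
  have hM0 : 0 ≤ M := ENNReal.toReal_nonneg
  set a := γ₀ / 2 - γ with ha
  have ha0 : 0 < a := by rw [ha]; linarith
  refine ⟨M * (2 ^ n * (n * n * Real.exp (γ * n)) + 1 / a),
    fun k => (mulOp hV hγ₀.le).comp ((P k).comp (ExpSobolev.incl n γ 2)), fun k => ?_, ?_⟩
  · refine ContinuousLinearMap.opNorm_le_bound _ (by positivity) fun u => ?_
    set u₀ := ExpSobolev.incl n γ 2 u with hu₀
    have h1 : ((mulOp hV hγ₀.le).comp (ExpSobolev.incl n γ 2) -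
        (mulOp hV hγ₀.le).comp ((P k).comp (ExpSobolev.incl n γ 2))) u =
          mulOp hV hγ₀.le (u₀ - P k u₀) := by
      rw [map_sub]; rfl
    have h2 : ((u₀ - P k u₀ : ExpL2 n γ) : RSpace n → ℂ) =ᵐ[volume] fun w => u₀ w -
        ∑ j ∈ cubeIndices n (4 ^ k),
          cubeMean ((1 / 2) ^ k) u₀ j * (cube ((1 / 2) ^ k) j).indicator (fun _ => 1) w := by
      filter_upwards [(ac_expMeasure n γ).ae_le (Lp.coeFn_sub u₀ (P k u₀)), hP1 k u₀]
        with w h3 h4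
      rw [h3, Pi.sub_apply, h4]
    have h3 := eLpNorm_sub_projection_le hγ.le (show γ ≤ γ₀ / 2 by linarith) u
      (h := (1 / 2) ^ k) (by positivity) (pow_le_one₀ (by norm_num) (by norm_num)) (4 ^ k)
      ((Lp.aestronglyMeasurable _).mono_ac (ac_expMeasure n γ)) h2
    have h4 := (norm_mulOp_le hV hγ₀.le (u₀ - P k u₀)).trans (mul_le_mul' le_rfl h3)
    rw [← ENNReal.ofReal_mul hM0, ← ofReal_norm,
      ENNReal.ofReal_le_ofReal_iff (by positivity)] at h4
    rw [h1]
    refine h4.trans ?_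
    have h5 : (((4 ^ k : ℕ) : ℝ)) * (1 / 2) ^ k = 2 ^ k := by
      push_cast
      rw [← mul_pow]
      norm_num
    have h6 : Real.exp (-((γ₀ / 2 - γ) * (((4 ^ k : ℕ) : ℝ) * (1 / 2) ^ k))) ≤
        1 / a * (1 / 2) ^ k := by
      rw [h5, ← ha, Real.exp_neg, ← one_div, one_div_pow, div_mul_div_comm, one_mul]
      refine one_div_le_one_div_of_le (by positivity) ?_
      have := Real.add_one_le_exp (a * 2 ^ k)
      linarith
    calc M * (2 ^ n * (n * (n * (1 / 2) ^ k) * Real.exp (γ * n) * ‖u‖) +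
          Real.exp (-((γ₀ / 2 - γ) * (((4 ^ k : ℕ) : ℝ) * (1 / 2) ^ k))) * ‖u‖)
        ≤ M * (2 ^ n * (n * (n * (1 / 2) ^ k) * Real.exp (γ * n) * ‖u‖) +
          (1 / a * (1 / 2) ^ k) * ‖u‖) := by gcongr
      _ = _ := by ring
  · classical
    have hle : ∀ k, ((mulOp hV hγ₀.le).comp ((P k).comp (ExpSobolev.incl n γ 2))).range ≤
        Submodule.span ℂ (((s k).image (mulOp hV hγ₀.le) : Finset (ExpL2 n (-γ))) :
          Set (ExpL2 n (-γ))) := by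
      rintro k _ ⟨u, rfl⟩
      rw [Finset.coe_image]
      have h1 := Submodule.mem_map_of_mem (f := (mulOp hV hγ₀.le).toLinearMap)
        (hPs k (ExpSobolev.incl n γ 2 u))
      rw [Submodule.map_span] at h1
      exact h1
    have hfd : ∀ k, FiniteDimensional ℂ (Submodule.span ℂ
        (((s k).image (mulOp hV hγ₀.le) : Finset (ExpL2 n (-γ))) : Set (ExpL2 n (-γ)))) :=
      fun k => FiniteDimensional.span_finset ℂ _
    refine ⟨fun k => Submodule.finiteDimensional_of_le (hle k), fun k => ?_⟩
    calc _ ≤ _ := Submodule.finrank_mono (hle k)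
      _ ≤ ((s k).image (mulOp hV hγ₀.le)).card := finrank_span_finset_le_card _
      _ ≤ (s k).card := Finset.card_image_le
      _ ≤ (2 * 4 ^ k) ^ n := (hs k).trans_eq (card_cubeIndices n _)
      _ = 2 ^ n * 2 ^ (2 * n * k) := by
          rw [mul_pow, ← pow_mul, show 4 = 2 ^ 2 by norm_num, ← pow_mul]
          congr 2
          ring

theorem isCompactOperator_of_finiteDimensional_range {E F : Type*} [NormedAddCommGroup E]
    [NormedSpace ℂ E] [NormedAddCommGroup F] [NormedSpace ℂ F] (A : E →L[ℂ] F)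
    [FiniteDimensional ℂ A.range] : IsCompactOperator A := by
  have h1 : IsCompactOperator (id : A.range → A.range) :=
    (isCompactOperator_id_iff_finiteDimensional (𝕜 := ℂ)).2 inferInstance
  exact (h1.comp_clm (A.codRestrict A.range fun x => ⟨x, rfl⟩)).clm_comp A.range.subtypeL

theorem isCompactOperator_mulOp_incl {γ γ₀ : ℝ} (hγ : 0 < γ) (hγ₀ : 2 * γ < γ₀) {V : RSpace n → ℂ}
    (hV : IsExpDecaying γ₀ V) :
    IsCompactOperator ((mulOp hV hγ₀.le).comp (ExpSobolev.incl n γ 2)) := by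
  obtain ⟨C, A, hA, hfin, -⟩ := exists_finiteRank_approx hγ hγ₀ hV
  refine isCompactOperator_of_tendsto (l := Filter.atTop) (F := A) ?_
    (Filter.Eventually.of_forall fun k => isCompactOperator_of_finiteDimensional_range (A k))
  rw [tendsto_iff_norm_sub_tendsto_zero]
  refine squeeze_zero (g := fun k => C * (1 / 2) ^ k) (fun _ => norm_nonneg _)
    (fun k => by rw [norm_sub_rev]; exact hA k) ?_
  have := (tendsto_pow_atTop_nhds_zero_of_lt_one (r := (1 / 2 : ℝ)) (by norm_num)
    (by norm_num)).const_mul C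
  simpa using this

end Approximation

/-! ### Exponential solutions -/

section Solutions

open Set

variable {n : ℕ} {ν : RSpace n}

theorem contDiff_cdot_toC (ζ : CSpace n) : ContDiff ℝ ∞ fun w : RSpace n => cdot ζ (toC w) := by
  simp only [cdot_toC]
  refine ContDiff.sum fun i _ => contDiff_const.mul (Complex.ofRealCLM.contDiff.comp ?_)
  exact (EuclideanSpace.proj i : RSpace n →L[ℝ] ℝ).contDiff

theorem IsTest.exp_mul {φ : RSpace n → ℂ} (hφ : IsTest φ) (ζ : CSpace n) :
    IsTest fun w => Complex.exp (Complex.I * cdot ζ (toC w)) * φ w :=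
  ⟨((contDiff_const.mul (contDiff_cdot_toC ζ)).cexp).mul hφ.1, hφ.2.mul_left⟩

theorem cFourier_exp_mul (φ : RSpace n → ℂ) (ρ ζ : CSpace n) :
    cFourier (fun w => Complex.exp (Complex.I * cdot ρ (toC w)) * φ w) ζ = cFourier φ (ζ - ρ) := by
  refine integral_congr_ae (Filter.Eventually.of_forall fun w => ?_)
  simp only
  rw [← mul_assoc, ← Complex.exp_add, cdot_sub_left]
  congr 2
  ring

theorem laplacian_eq_sum_partialDeriv (φ : RSpace n → ℂ) (w : RSpace n) :
    (Δ φ) w = ∑ i, partialDeriv (fun _ : Fin 2 => i) φ w := by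
  rw [InnerProductSpace.laplacian_eq_iteratedFDeriv_orthonormalBasis φ
    (EuclideanSpace.basisFun (Fin n) ℝ)]
  refine Finset.sum_congr rfl fun i _ => ?_
  rw [partialDeriv]
  congr 1
  funext k
  fin_cases k <;> simp

theorem isTest_helmholtz {φ : RSpace n → ℂ} (hφ : IsTest φ) (μ : ℂ) :
    IsTest fun w => -(Δ φ) w - μ * φ w := by
  have h1 : IsTest fun w => (Δ φ) w := by
    simp only [laplacian_eq_sum_partialDeriv]
    have h2 : ∀ s : Finset (Fin n), IsTest fun w =>
        ∑ i ∈ s, partialDeriv (fun _ : Fin 2 => i) φ w := by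
      classical
      intro s
      induction s using Finset.induction_on with
      | empty =>
        simp only [Finset.sum_empty]
        exact ⟨contDiff_const, HasCompactSupport.zero⟩
      | insert i s hi ih =>
        simp only [Finset.sum_insert hi]
        exact (hφ.partialDeriv _).add ih
    exact h2 _
  have h3 := (h1.const_mul (-1)).add (hφ.const_mul (-μ))
  refine (congrArg IsTest (funext fun w => ?_)).mp h3
  ring

theorem cFourier_helmholtz {φ : RSpace n → ℂ} (hφ : IsTest φ) (μ : ℂ) (ζ : CSpace n) :
    cFourier (fun w => -(Δ φ) w - μ * φ w) ζ = (cdot ζ ζ - μ) * cFourier φ ζ := by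
  have h1 : ∀ i, Integrable (fun w => Complex.exp (-(Complex.I * cdot ζ (toC w))) *
      partialDeriv (fun _ : Fin 2 => i) φ w) volume := fun i =>
    integrable_exp_mul_test ζ (hφ.partialDeriv_continuous _) (hφ.partialDeriv_compact _)
  have h2 : ∀ i, ∫ w, Complex.exp (-(Complex.I * cdot ζ (toC w))) *
      partialDeriv (fun _ : Fin 2 => i) φ w = -(ζ i * ζ i) * cFourier φ ζ := by
    intro i
    have h3 := cFourier_partialDeriv hφ (fun _ : Fin 2 => i) ζ
    rw [cFourier] at h3
    rw [h3, Fin.prod_univ_two]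
    linear_combination (ζ i * ζ i * cFourier φ ζ) * Complex.I_sq
  have h3 : Integrable (fun w => Complex.exp (-(Complex.I * cdot ζ (toC w))) * φ w) volume :=
    integrable_exp_mul_test ζ hφ.1.continuous hφ.2
  have h4 : ∀ w, Complex.exp (-(Complex.I * cdot ζ (toC w))) * (-(Δ φ) w - μ * φ w) =
      -(∑ i, Complex.exp (-(Complex.I * cdot ζ (toC w))) * partialDeriv (fun _ : Fin 2 => i) φ w)
        - μ * (Complex.exp (-(Complex.I * cdot ζ (toC w))) * φ w) := by
    intro w
    rw [laplacian_eq_sum_partialDeriv, ← Finset.mul_sum]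
    ring
  have h5 : Integrable (fun w => ∑ i, Complex.exp (-(Complex.I * cdot ζ (toC w))) *
      partialDeriv (fun _ : Fin 2 => i) φ w) volume := integrable_finsetSum _ fun i _ => h1 i
  have h6 : Integrable (fun w => -∑ i, Complex.exp (-(Complex.I * cdot ζ (toC w))) *
      partialDeriv (fun _ : Fin 2 => i) φ w) volume := h5.neg
  rw [cFourier]
  simp only [h4]
  rw [integral_sub h6 (h3.const_mul μ), integral_neg, integral_const_mul,
    integral_finsetSum _ fun i _ => h1 i]
  simp only [h2]
  rw [← Finset.sum_mul, Finset.sum_neg_distrib, cdot, cFourier]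
  ring

/-- For real `ρ_⊥` the imaginary part of the symbol is a nonzero multiple of `ξ·ν`, so zeros lie in
a hyperplane. -/
theorem ae_freeSymbol_ne_zero (hν : ‖ν‖ = 1) {p : ℂ × PerpC ν} (hp : p ∈ offReal (realPerp ν)) :
    ∀ᵐ ξ : RSpace n, freeSymbol (momentum p) ξ ≠ 0 := by
  obtain ⟨r₀, hr₀, -, horth⟩ := exists_toC_eq hp.2
  filter_upwards [ae_inner_ne_zero hν] with ξ hξ h0
  rw [freeSymbol, momentum, ← hr₀, cdot_add_left, cdot_smul_left, cdot_toC_toC, cdot_toC_toC] at h0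
  have h1 := congrArg Complex.im h0
  rw [real_inner_smul_right, real_inner_comm ξ ν] at h1
  simp only [Complex.add_im, Complex.mul_im, Complex.ofReal_im, Complex.ofReal_re, Complex.re_ofNat,
    Complex.im_ofNat, Complex.zero_im] at h1
  have h2 : p.1.im * (2 * Real.pi * inner ℝ ξ ν) = 0 := by linarith
  rcases mul_eq_zero.1 h2 with h3 | h3
  · exact hp.1 h3
  · exact mul_ne_zero (by positivity) hξ h3

theorem integral_fourier_mul_fourierInv {f : RSpace n → ℂ} (hf : Integrable f volume)
    {ψ : RSpace n → ℂ} (hψ : IsTest ψ) : ∫ ξ, 𝓕 f ξ * 𝓕⁻ ψ ξ = ∫ w, f w * ψ w := by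
  set Ψ : SchwartzMap (RSpace n) ℂ := hψ.2.toSchwartzMap hψ.1 with hΨ
  have h1 : (𝓕⁻ ψ) = ((𝓕⁻ Ψ : SchwartzMap (RSpace n) ℂ) : RSpace n → ℂ) := by
    rw [SchwartzMap.fourierInv_coe]; rfl
  have h := VectorFourier.integral_fourierIntegral_smul_eq_flip
    (μ := (volume : Measure (RSpace n))) (ν := (volume : Measure (RSpace n)))
    (L := innerₗ (RSpace n)) (f := f) (g := 𝓕⁻ ψ)
    Real.continuous_fourierChar continuous_inner hf (by rw [h1]; exact SchwartzMap.integrable _)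
  have h2 : ∀ w, 𝓕 (𝓕⁻ ψ) w = ψ w := by
    intro w
    rw [h1, ← SchwartzMap.fourier_coe, FourierTransform.fourier_fourierInv_eq]
    rfl
  refine Eq.trans h ?_
  rw [flip_innerₗ]
  refine integral_congr_ae (Filter.Eventually.of_forall fun w => ?_)
  exact congrArg (f w * ·) (h2 w)

theorem cdot_sub_self (ζ ρ : CSpace n) :
    cdot (ζ - ρ) (ζ - ρ) - cdot ρ ρ = cdot ζ ζ - 2 * cdot ρ ζ := by
  rw [cdot_sub_left, cdot_comm ζ, cdot_comm ρ (ζ - ρ), cdot_sub_left, cdot_sub_left, cdot_comm ζ ρ]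
  ring

/-- Conjugation with `e^{iρ·w}` turns `Δ - ρ·ρ` into the operator with the symbol `|η|² + 2ρ·η`. On
the Fourier side this symbol cancels against its inverse in the definition of the free solution. -/
theorem integral_freeSolution_mul {γ : ℝ} (hγ : 0 < γ) (hν : ‖ν‖ = 1) {p : ℂ × PerpC ν}
    (hp : p ∈ offReal (realPerp ν)) (f : ExpL2 n (-γ)) {u : RSpace n → ℂ}
    (hu : IsFreeSolution (momentum p) (fun w => f w) u) {φ : RSpace n → ℂ} (hφ : IsTest φ) :
    ∫ w, u w * (Complex.exp (Complex.I * cdot (momentum p) (toC w)) *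
      (-(Δ φ) w - cdot (momentum p) (momentum p) * φ w)) =
    ∫ w, f w * (Complex.exp (Complex.I * cdot (momentum p) (toC w)) * φ w) := by
  set ρ := momentum p with hρ
  have hT := (isTest_helmholtz hφ (cdot ρ ρ)).exp_mul ρ
  rw [(hu _ hT).2, ← integral_fourier_mul_fourierInv (integrable_coe_expL2 hγ f) (hφ.exp_mul ρ)]
  refine integral_congr_ae ?_
  filter_upwards [ae_freeSymbol_ne_zero hν hp] with ξ hξ
  rw [← cFourier_neg_toC, ← cFourier_neg_toC, cFourier_exp_mul, cFourier_exp_mul,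
    cFourier_helmholtz hφ, cdot_sub_self]
  have h1 : cdot (-toC ((2 * Real.pi) • ξ)) (-toC ((2 * Real.pi) • ξ)) -
      2 * cdot ρ (-toC ((2 * Real.pi) • ξ)) = freeSymbol ρ ξ := by
    rw [freeSymbol, cdot_comm ρ, cdot_neg_left, cdot_neg_left, cdot_comm _ (-_), cdot_neg_left,
      cdot_toC_toC, real_inner_self_eq_norm_sq, norm_smul, Real.norm_of_nonneg (by positivity),
      cdot_comm ρ]
    ring
  rw [← hρ] at hξ
  rw [h1]
  field_simp

theorem coeFn_mulOp {γ γ₀ : ℝ} {V : RSpace n → ℂ} (hV : IsExpDecaying γ₀ V) (hγ : 2 * γ ≤ γ₀)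
    (u : ExpL2 n γ) : (mulOp hV hγ u : RSpace n → ℂ) =ᵐ[volume] fun w => V w * u w :=
  (ac_expMeasure n (-γ)).ae_le (hV.memLp_mul hγ (Lp.memLp u)).coeFn_toLp

theorem coeFn_potentialVec {γ γ₀ : ℝ} {V : RSpace n → ℂ} (hV : IsExpDecaying γ₀ V)
    (hγ : 2 * γ ≤ γ₀) (hpos : 0 < γ) :
    (potentialVec hV hγ hpos : RSpace n → ℂ) =ᵐ[volume] V := by
  filter_upwards [coeFn_mulOp hV hγ ((memLp_one hpos).toLp (fun _ => (1 : ℂ))),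
    (ac_expMeasure n γ).ae_le (memLp_one (n := n) hpos).coeFn_toLp] with w h1 h2
  rw [potentialVec, h1, h2, mul_one]

/-- With `f = (1 + V𝒢₀)⁻¹V` and `g = 𝒢₀f` one has `f = V(1 - g)`, and the solution is `e^{iρ·w}(1 -
g)`. The free operator annihilates `e^{iρ·w}` and takes `e^{iρ·w}g` to `e^{iρ·w}f`, which the
potential term cancels. -/
theorem isEigenfunction_expSolution {γ γ₀ : ℝ} (hγ : 0 < γ) (hν : ‖ν‖ = 1) {V : RSpace n → ℂ}
    (hV : IsExpDecaying γ₀ V) (hγ₀ : 2 * γ ≤ γ₀)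
    {𝒢₀ : ℂ × PerpC ν → (ExpL2 n (-γ) →L[ℂ] ExpSobolev n γ 2)} {p : ℂ × PerpC ν}
    (hp : p ∈ offReal (realPerp ν))
    (hfree : ∀ f : ExpL2 n (-γ),
      IsFreeSolution (momentum p) (fun w => f w) (fun w => ExpSobolev.incl n γ 2 (𝒢₀ p f) w))
    (hunit : IsUnit (1 + potentialOp hV hγ₀ 𝒢₀ p)) :
    IsEigenfunction V (cdot (momentum p) (momentum p))
      (expSolution p (fun w => correction hV hγ₀ hγ 𝒢₀ p w)) := by
  intro φ hφ
  set ρ := momentum p with hρ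
  set f := potentialInv hV hγ₀ 𝒢₀ p (potentialVec hV hγ₀ hγ) with hf
  set g := ExpSobolev.incl n γ 2 (𝒢₀ p f) with hg
  have h1 : f + mulOp hV hγ₀ g = potentialVec hV hγ₀ hγ := by
    have h2 := Ring.mul_inverse_cancel _ hunit
    have h3 := congrArg (fun A : ExpL2 n (-γ) →L[ℂ] ExpL2 n (-γ) =>
      A (potentialVec hV hγ₀ hγ)) h2
    exact h3
  have hfae : ∀ᵐ w, f w = V w * (1 - g w) := by
    have h2 : (f + mulOp hV hγ₀ g : ExpL2 n (-γ)) =ᵐ[volume] fun w => V w := by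
      rw [h1]; exact coeFn_potentialVec hV hγ₀ hγ
    filter_upwards [h2, (ac_expMeasure n (-γ)).ae_le (Lp.coeFn_add f (mulOp hV hγ₀ g)),
      coeFn_mulOp hV hγ₀ g] with w a1 a2 a3
    rw [a2, Pi.add_apply, a3] at a1
    linear_combination a1
  have hcorr : ∀ᵐ w, correction hV hγ₀ hγ 𝒢₀ p w = -g w := by
    filter_upwards [(ac_expMeasure n γ).ae_le (Lp.coeFn_neg g)] with w a1
    exact a1
  set χ : RSpace n → ℂ := fun w => Complex.exp (Complex.I * cdot ρ (toC w)) *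
    (-(Δ φ) w - cdot ρ ρ * φ w) with hχ
  set ψ : RSpace n → ℂ := fun w => Complex.exp (Complex.I * cdot ρ (toC w)) * φ w with hψ
  have hχT : IsTest χ := (isTest_helmholtz hφ (cdot ρ ρ)).exp_mul ρ
  have hψT : IsTest ψ := hφ.exp_mul ρ
  -- The integral is a transform at frequency `0`, that is, that of `(Δ - ρ·ρ)φ` at `-ρ`, where the
  -- factor `(-ρ)·(-ρ) - ρ·ρ` vanishes.
  have hχ0 : ∫ w, χ w = 0 := by
    have h2 := cFourier_exp_mul (fun w => -(Δ φ) w - cdot ρ ρ * φ w) ρ 0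
    rw [cFourier_helmholtz hφ, cdot_sub_self] at h2
    have h3 : cdot (0 : CSpace n) 0 - 2 * cdot ρ 0 = 0 := by simp [cdot]
    rw [h3, zero_mul, cFourier] at h2
    rw [← h2]
    refine integral_congr_ae (Filter.Eventually.of_forall fun w => ?_)
    have h4 : cdot (0 : CSpace n) (toC w) = 0 := by simp [cdot]
    simp only [h4, mul_zero, neg_zero, Complex.exp_zero, one_mul, hχ]
  have hfree2 : ∫ w, g w * χ w = ∫ w, f w * ψ w := integral_freeSolution_mul hγ hν hp f (hfree f) hφ
  have hi1 : Integrable χ volume := hχT.1.continuous.integrable_of_hasCompactSupport hχT.2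
  have hi2 : Integrable (fun w => g w * χ w) volume := integrable_coe_mul g hχT.1.continuous hχT.2
  have hi3 : Integrable (fun w => f w * ψ w) volume := integrable_coe_mul f hψT.1.continuous hψT.2
  have heq : ∫ w, expSolution p (fun w => correction hV hγ₀ hγ 𝒢₀ p w) w *
      (-(Δ φ) w + V w * φ w - cdot ρ ρ * φ w) = ∫ w, (χ w - g w * χ w + f w * ψ w) := by
    refine integral_congr_ae ?_
    filter_upwards [hfae, hcorr] with w a1 a2
    simp only [expSolution]
    rw [a2, a1, ← hρ]
    simp only [hχ, hψ]
    ring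
  have hi4 : Integrable (fun w => χ w - g w * χ w) volume := hi1.sub hi2
  rw [heq, integral_add hi4 hi3, integral_sub hi1 hi2, hχ0, hfree2]
  ring

end Solutions

/-! ### Analyticity of the exponential solutions -/

section Analyticity

open Set

variable {n : ℕ} {ν : RSpace n}

theorem isOpen_offReal {U : Set (PerpC ν)} (hU : IsOpen U) : IsOpen (offReal U) :=
  ((isOpen_ne (x := (0 : ℝ))).preimage (Complex.continuous_im.comp continuous_fst)).inter
    (hU.preimage continuous_snd)

theorem momentum_apply (p : ℂ × PerpC ν) (i : Fin n) :
    momentum p i = p.1 * (ν i : ℂ) + (p.2 : CSpace n) i := by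
  simp [momentum, toC]

theorem continuous_momentum : Continuous (momentum : ℂ × PerpC ν → CSpace n) := by
  unfold momentum
  fun_prop

theorem norm_cdot_le (ζ : CSpace n) (w : RSpace n) : ‖cdot ζ (toC w)‖ ≤ n * (‖ζ‖ * ‖w‖) := by
  rw [cdot_toC]
  refine (norm_sum_le_of_le _ (f := fun i => ζ i * (w i : ℂ)) (n := fun _ => ‖ζ‖ * ‖w‖)
    fun i _ => ?_).trans_eq (by simp)
  rw [norm_mul, Complex.norm_real]
  exact mul_le_mul (PiLp.norm_apply_le ζ i) (exists_coord_le w i) (norm_nonneg _) (norm_nonneg _)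

/-- On a ball the exponential is bounded locally uniformly in `p`. The additional factor `e^{γ|w|}`
undoes the weight in `weightEquiv`. -/
theorem exists_analytic_exp {U : Set (ℂ × PerpC ν)} (hU : IsOpen U) (γ R : ℝ) :
    ∃ E : ℂ × PerpC ν → Lp ℂ ∞ (volume.restrict (Metric.ball (0 : RSpace n) R)),
      AnalyticOnNhd ℂ E U ∧ ∀ p ∈ U, E p =ᵐ[volume.restrict (Metric.ball (0 : RSpace n) R)]
        fun w => Complex.exp (Complex.I * cdot (momentum p) (toC w)) *
          (Real.exp (γ * ‖w‖) : ℂ) := by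
  set B := Metric.ball (0 : RSpace n) R with hB
  have hBm : MeasurableSet B := Metric.isOpen_ball.measurableSet
  -- The indicator provides bounds for every `w`, as `exists_analytic_toLp_top` requires, and does
  -- not matter for the restricted measure.
  set g : ℂ × PerpC ν → RSpace n → ℂ := fun p => B.indicator fun w =>
    Complex.exp (Complex.I * cdot (momentum p) (toC w)) * (Real.exp (γ * ‖w‖) : ℂ) with hg
  suffices h : ∃ E : ℂ × PerpC ν → Lp ℂ ∞ (volume.restrict B),
      AnalyticOnNhd ℂ E U ∧ ∀ p ∈ U, E p =ᵐ[volume.restrict B] g p by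
    obtain ⟨E, hE1, hE2⟩ := h
    refine ⟨E, hE1, fun p hp => ?_⟩
    filter_upwards [hE2 p hp, ae_restrict_mem hBm] with w h1 h2
    rw [h1, hg]
    exact indicator_of_mem h2 _
  refine exists_analytic_toLp_top hU (fun p _ => ?_) (fun p hp => ?_) (fun w => ?_)
  · have := continuous_cdot_toC (momentum p)
    exact (Continuous.aestronglyMeasurable (by fun_prop)).indicator hBm
  · obtain ⟨M, hM⟩ := (isCompact_closedBall p 1).exists_bound_of_continuousOn
      (continuous_momentum (ν := ν)).continuousOn
    refine ⟨1, one_pos, Real.exp (n * (M * |R|)) * Real.exp (|γ| * |R|), fun q hq w => ?_⟩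
    have hqM := hM q (Metric.ball_subset_closedBall hq)
    have hM0 : 0 ≤ M := (norm_nonneg _).trans hqM
    by_cases hw : w ∈ B
    · have hwR : ‖w‖ ≤ |R| := (mem_ball_zero_iff.1 hw).le.trans (le_abs_self R)
      rw [hg]
      simp only
      rw [indicator_of_mem hw, norm_mul, Complex.norm_real, Real.norm_of_nonneg (Real.exp_pos _).le]
      refine mul_le_mul ?_ ?_ (Real.exp_pos _).le (Real.exp_pos _).le
      · refine (Complex.norm_exp_le_exp_norm _).trans (Real.exp_le_exp.2 ?_)
        rw [norm_mul, Complex.norm_I, one_mul]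
        refine (norm_cdot_le _ w).trans ?_
        gcongr
      · refine Real.exp_le_exp.2 ?_
        exact mul_le_mul (le_abs_self γ) hwR (norm_nonneg _) (abs_nonneg _)
    · rw [hg]
      simp only
      rw [indicator_of_notMem hw, norm_zero]
      positivity
  · refine lineHolomorphicOn_of_differentiableAt fun p hp => ?_
    by_cases hw : w ∈ B
    · have h1 : (fun p => g p w) = fun p : ℂ × PerpC ν =>
          Complex.exp (Complex.I * cdot (momentum p) (toC w)) * (Real.exp (γ * ‖w‖) : ℂ) := by
        funext p
        exact indicator_of_mem hw _
      have h2 := fun j => (differentiable_snd_apply (ν := ν) j) p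
      rw [h1]
      simp only [cdot_toC, momentum_apply]
      fun_prop
    · have h1 : (fun p => g p w) = fun _ => 0 := by
        funext p
        exact indicator_of_notMem hw _
      rw [h1]
      exact differentiableAt_const _

theorem analyticAt_clm_apply {E F G : Type*} [NormedAddCommGroup E] [NormedSpace ℂ E]
    [NormedAddCommGroup F] [NormedSpace ℂ F] [NormedAddCommGroup G] [NormedSpace ℂ G]
    {f : E → (F →L[ℂ] G)} {g : E → F} {p : E} (hf : AnalyticAt ℂ f p) (hg : AnalyticAt ℂ g p) :
    AnalyticAt ℂ (fun q => f q (g q)) p :=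
  ((ContinuousLinearMap.id ℂ (F →L[ℂ] G)).analyticAt_bilinear _).comp₂ hf hg

theorem exists_analytic_expSolution {γ : ℝ} (hγ : 0 < γ) {U S : Set (ℂ × PerpC ν)}
    (hU : IsOpen U) (hSU : S ⊆ U) {v : ℂ × PerpC ν → ExpL2 n γ} (hv : AnalyticOnNhd ℂ v S)
    (R : ℝ) :
    ∃ u : ℂ × PerpC ν → Lp ℂ 2 (volume.restrict (Metric.ball (0 : RSpace n) R)),
      AnalyticOnNhd ℂ u S ∧ ∀ p ∈ S, u p =ᵐ[volume.restrict (Metric.ball (0 : RSpace n) R)]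
        expSolution p (fun w => v p w) := by
  set B := Metric.ball (0 : RSpace n) R with hB
  obtain ⟨E, hE1, hE2⟩ : ∃ E : ℂ × PerpC ν → Lp ℂ ∞ (volume.restrict B),
      AnalyticOnNhd ℂ E U ∧ ∀ p ∈ U, E p =ᵐ[volume.restrict B]
        fun w => Complex.exp (Complex.I * cdot (momentum p) (toC w)) *
          (Real.exp (γ * ‖w‖) : ℂ) := exists_analytic_exp hU γ R
  set one : ExpL2 n γ := (memLp_one hγ).toLp (fun _ => (1 : ℂ)) with hone
  set W : ExpL2 n γ →L[ℂ] Lp ℂ 2 (volume.restrict B) :=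
    (LpToLpRestrictCLM (RSpace n) ℂ ℂ volume 2 B).comp
      (weightEquiv n γ).toContinuousLinearEquiv.toContinuousLinearMap with hW
  set mul := (ContinuousLinearMap.mul ℂ ℂ).holderL (volume.restrict B) ∞ 2 2 with hmul
  refine ⟨fun p => mul (E p) (W (one + v p)), fun p hp => ?_, fun p hp => ?_⟩
  · have h1 : AnalyticAt ℂ (fun p => mul (E p)) p :=
      (mul.analyticAt _).comp (hE1 p (hSU hp))
    have h2 : AnalyticAt ℂ (fun p => W (one + v p)) p :=
      (W.analyticAt _).comp (analyticAt_const.add (hv p hp))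
    exact analyticAt_clm_apply h1 h2
  · have h1 : (mul (E p) (W (one + v p)) : RSpace n → ℂ) =ᵐ[volume.restrict B]
        fun w => E p w * W (one + v p) w :=
      (ContinuousLinearMap.mul ℂ ℂ).coeFn_holder (E p) (W (one + v p))
    have h2 : (W (one + v p) : RSpace n → ℂ) =ᵐ[volume.restrict B]
        fun w => weightEquiv n γ (one + v p) w := LpToLpRestrictCLM_coeFn ℂ B _
    filter_upwards [h1, h2, hE2 p (hSU hp), ae_restrict_of_ae (coeFn_weightEquiv (one + v p)),
      ae_restrict_of_ae ((ac_expMeasure n γ).ae_le (Lp.coeFn_add one (v p))),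
      ae_restrict_of_ae ((ac_expMeasure n γ).ae_le (memLp_one (n := n) hγ).coeFn_toLp)]
      with w a1 a2 a3 a4 a5 a6
    rw [a1, a2, a3, a4, a5, Pi.add_apply, a6, expSolution, mul_assoc, exp_mul_exp_neg]

/-- Because `(1 + K)⁻¹ - 1 = -K (1 + K)⁻¹`. -/
theorem isCompactOperator_inverse_sub_one {H : Type*} [NormedAddCommGroup H] [NormedSpace ℂ H]
    {K : H →L[ℂ] H} (hK : IsCompactOperator K) (hu : IsUnit (1 + K)) :
    IsCompactOperator (Ring.inverse (1 + K) - 1 : H →L[ℂ] H) := by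
  have h1 := Ring.mul_inverse_cancel _ hu
  have h2 : (Ring.inverse (1 + K) - 1 : H →L[ℂ] H) = -(K.comp (Ring.inverse (1 + K))) := by
    rw [add_mul, one_mul] at h1
    have h3 : K.comp (Ring.inverse (1 + K)) = K * Ring.inverse (1 + K) := rfl
    rw [h3, sub_eq_iff_eq_add, neg_add_eq_sub]
    exact eq_sub_of_add_eq h1
  rw [h2]
  exact (hK.comp_clm (Ring.inverse (1 + K))).neg

theorem potentialOp_eq_comp {γ γ₀ : ℝ} {V : RSpace n → ℂ} (hV : IsExpDecaying γ₀ V)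
    (hγ : 2 * γ ≤ γ₀) (𝒢₀ : ℂ × PerpC ν → (ExpL2 n (-γ) →L[ℂ] ExpSobolev n γ 2))
    (p : ℂ × PerpC ν) :
    potentialOp hV hγ 𝒢₀ p = ((mulOp hV hγ).comp (ExpSobolev.incl n γ 2)).comp (𝒢₀ p) := rfl

theorem norm_comp_lt_one {E F G : Type*} [NormedAddCommGroup E] [NormedSpace ℂ E]
    [NormedAddCommGroup F] [NormedSpace ℂ F] [NormedAddCommGroup G] [NormedSpace ℂ G]
    {f : F →L[ℂ] G} {g : E →L[ℂ] F} (hg : ‖g‖ ≤ 1 / (2 * (‖f‖ + 1))) : ‖f.comp g‖ < 1 := by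
  have h0 := norm_nonneg f
  calc ‖f.comp g‖ ≤ ‖f‖ * ‖g‖ := f.opNorm_comp_le g
    _ ≤ (‖f‖ + 1) * (1 / (2 * (‖f‖ + 1))) :=
      mul_le_mul (by linarith) hg (norm_nonneg g) (by positivity)
    _ = 1 / 2 := by field_simp
    _ < 1 := by norm_num

theorem IsAnalyticExtension.exists_norm_potentialOp_lt (hn : 3 ≤ n) {γ γ₀ : ℝ} (hγ : 0 < γ)
    (hν : ‖ν‖ = 1) {U : Set (PerpC ν)}
    {𝒢₀ : ℂ × PerpC ν → (ExpL2 n (-γ) →L[ℂ] ExpSobolev n γ 2)}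
    (h : IsAnalyticExtension γ ν U 𝒢₀) {V : RSpace n → ℂ} (hV : IsExpDecaying γ₀ V)
    (hγ₀ : 2 * γ ≤ γ₀) :
    ∃ R : ℝ, ∀ p ∈ offReal (realPerp ν), R ≤ ‖p‖ → ‖potentialOp hV hγ₀ 𝒢₀ p‖ < 1 := by
  obtain ⟨R, hR⟩ := h.exists_norm_le hn hγ hν
    (ε := 1 / (2 * (‖mulOp (n := n) hV hγ₀‖ + 1))) (by positivity)
  exact ⟨R, fun p hp hpR => norm_comp_lt_one (hR p hp hpR)⟩

theorem IsAnalyticExtension.analyticOnNhd_potentialOp {γ γ₀ : ℝ} {U : Set (PerpC ν)}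
    {𝒢₀ : ℂ × PerpC ν → (ExpL2 n (-γ) →L[ℂ] ExpSobolev n γ 2)}
    (h : IsAnalyticExtension γ ν U 𝒢₀) {V : RSpace n → ℂ} (hV : IsExpDecaying γ₀ V)
    (hγ₀ : 2 * γ ≤ γ₀) : AnalyticOnNhd ℂ (potentialOp hV hγ₀ 𝒢₀) (offReal U) := fun p hp =>
  analyticAt_clm_comp analyticAt_const (analyticAt_clm_comp analyticAt_const (h.analytic p hp))

theorem IsAnalyticExtension.analyticAt_potentialInv {γ γ₀ : ℝ} {U : Set (PerpC ν)}
    {𝒢₀ : ℂ × PerpC ν → (ExpL2 n (-γ) →L[ℂ] ExpSobolev n γ 2)}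
    (h : IsAnalyticExtension γ ν U 𝒢₀) {V : RSpace n → ℂ} (hV : IsExpDecaying γ₀ V)
    (hγ₀ : 2 * γ ≤ γ₀) {p : ℂ × PerpC ν} (hp : p ∈ offReal U)
    (hu : IsUnit (1 + potentialOp hV hγ₀ 𝒢₀ p)) :
    AnalyticAt ℂ (potentialInv hV hγ₀ 𝒢₀) p := by
  obtain ⟨x, hx⟩ := hu
  have h1 : AnalyticAt ℂ (fun q => 1 + potentialOp hV hγ₀ 𝒢₀ q) p :=
    analyticAt_const.add (h.analyticOnNhd_potentialOp hV hγ₀ p hp)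
  have h2 := analyticAt_inverse (𝕜 := ℂ) x
  rw [hx] at h2
  exact AnalyticAt.comp (g := Ring.inverse) (f := fun q => 1 + potentialOp hV hγ₀ 𝒢₀ q) h2 h1

theorem IsAnalyticExtension.analyticAt_correction {γ γ₀ : ℝ} {U : Set (PerpC ν)}
    {𝒢₀ : ℂ × PerpC ν → (ExpL2 n (-γ) →L[ℂ] ExpSobolev n γ 2)}
    (h : IsAnalyticExtension γ ν U 𝒢₀) {V : RSpace n → ℂ} (hV : IsExpDecaying γ₀ V)
    (hγ₀ : 2 * γ ≤ γ₀) (hγ : 0 < γ) {p : ℂ × PerpC ν} (hp : p ∈ offReal U)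
    (hu : IsUnit (1 + potentialOp hV hγ₀ 𝒢₀ p)) :
    AnalyticAt ℂ (correction hV hγ₀ hγ 𝒢₀) p := by
  have h1 := analyticAt_clm_apply (h.analyticAt_potentialInv hV hγ₀ hp hu)
    (analyticAt_const (v := potentialVec hV hγ₀ hγ))
  exact (analyticAt_clm_apply (analyticAt_const (v := ExpSobolev.incl n γ 2))
    (analyticAt_clm_apply (h.analytic p hp) h1)).neg

end Analyticity

end ExpPotential

end

/-! ### The theorem -/

theorem corollary2p4 (n : ℕ) (hn : 3 ≤ n) (γ : ℝ) (hγ : 0 < γ) (ν : RSpace n) (hν : ‖ν‖ = 1) :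
    (∃ (U : Set (PerpC ν)) (𝒢₀ : ℂ × PerpC ν → (ExpL2 n (-γ) →L[ℂ] ExpSobolev n γ 2)),
      IsAnalyticExtension γ ν U 𝒢₀) ∧
    ∀ (U : Set (PerpC ν)) (𝒢₀ : ℂ × PerpC ν → (ExpL2 n (-γ) →L[ℂ] ExpSobolev n γ 2)),
      IsAnalyticExtension γ ν U 𝒢₀ →
      ∀ (γ₀ : ℝ) (hγ₀ : 2 * γ < γ₀) (V : RSpace n → ℂ) (hV : IsExpDecaying γ₀ V),
        ∃ ℰ : Set (ℂ × PerpC ν),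
          -- the exceptional set is the zero set of an analytic function on `(ℂ ∖ ℝ) × U`
          (∃ d : ℂ × PerpC ν → ℂ, AnalyticOnNhd ℂ d (offReal U) ∧
            ℰ = {p ∈ offReal U | d p = 0}) ∧
          -- its intersection with the real `ρ_⊥` is bounded
          Bornology.IsBounded (ℰ ∩ offReal (realPerp ν)) ∧
          -- the inverse exists off the exceptional set
          (∀ p ∈ offReal U \ ℰ, IsUnit (1 + potentialOp hV hγ₀.le 𝒢₀ p)) ∧
          -- near every point where it exists, the inverse is analytic, equal to `Id` + compact
          (∀ p ∈ offReal U, IsUnit (1 + potentialOp hV hγ₀.le 𝒢₀ p) →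
            ∀ᶠ q in 𝓝 p, IsUnit (1 + potentialOp hV hγ₀.le 𝒢₀ q) ∧
              AnalyticAt ℂ (potentialInv hV hγ₀.le 𝒢₀) q ∧
              IsCompactOperator
                (potentialInv hV hγ₀.le 𝒢₀ q - 1 : ExpL2 n (-γ) →L[ℂ] ExpL2 n (-γ))) ∧
          -- `v` is analytic off the exceptional set, with values in `e^{γ|w|}L²`
          AnalyticOnNhd ℂ (correction hV hγ₀.le hγ 𝒢₀) (offReal U \ ℰ) ∧
          -- `e^{iρ·w}(1 + v)` is analytic there, with values in `L²` of every ball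
          (∀ R : ℝ, ∃ u : ℂ × PerpC ν → Lp ℂ 2 (volume.restrict (Metric.ball (0 : RSpace n) R)),
            AnalyticOnNhd ℂ u (offReal U \ ℰ) ∧
            ∀ p ∈ offReal U \ ℰ, u p =ᵐ[volume.restrict (Metric.ball (0 : RSpace n) R)]
              expSolution p (fun w => correction hV hγ₀.le hγ 𝒢₀ p w)) ∧
          -- for real `ρ_⊥` it is an exponential solution: `(H - ρ·ρ) u = 0`
          (∀ p ∈ offReal (realPerp ν) \ ℰ,
            IsEigenfunction V (cdot (momentum p) (momentum p))
              (expSolution p (fun w => correction hV hγ₀.le hγ 𝒢₀ p w))) := by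
  refine ⟨?_, ?_⟩
  · obtain ⟨U, 𝒢₀, h, -⟩ := exists_isAnalyticExtension hn hγ hν
    exact ⟨U, 𝒢₀, h⟩
  intro U 𝒢₀ h γ₀ hγ₀ V hV
  have hopen : IsOpen (offReal U) := isOpen_offReal h.isOpen
  have hreal : offReal (realPerp ν) ⊆ offReal U := fun p hp => ⟨hp.1, h.real_subset hp.2⟩
  obtain ⟨C, A, hA, hfin, hrank⟩ := exists_finiteRank_approx (n := n) hγ hγ₀ hV
  -- The operator that is approximated is the inclusion followed by multiplication by `V`,
  -- independent of the parameters; the analytic family is `𝒢₀`. This yields one `d` on all of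
  -- `offReal U`.
  obtain ⟨d, hd, hdU⟩ := exists_det_of_approximable hopen h.analytic hA hfin hrank
  simp only [← potentialOp_eq_comp] at hdU
  set ℰ : Set (ℂ × PerpC ν) := {p ∈ offReal U | d p = 0} with hℰ
  have hunit : ∀ p ∈ offReal U \ ℰ, IsUnit (1 + potentialOp hV hγ₀.le 𝒢₀ p) := fun p hp =>
    (hdU p hp.1).1 fun h0 => hp.2 ⟨hp.1, h0⟩
  have hcorr : AnalyticOnNhd ℂ (correction hV hγ₀.le hγ 𝒢₀) (offReal U \ ℰ) := fun p hp =>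
    h.analyticAt_correction hV hγ₀.le hγ hp.1 (hunit p hp)
  refine ⟨ℰ, ⟨d, hd, rfl⟩, ?_, hunit, ?_, hcorr, ?_, ?_⟩
  -- Beyond the radius `R` the operator has norm below `1`, and there `d` does not vanish.
  · obtain ⟨R, hR⟩ := h.exists_norm_potentialOp_lt hn hγ hν hV hγ₀.le
    refine (Metric.isBounded_ball (x := (0 : ℂ × PerpC ν)) (r := R)).subset ?_
    rintro p ⟨⟨hpU, hp0⟩, hp⟩
    rw [mem_ball_zero_iff]
    by_contra hlt
    exact (hdU p hpU).2 (hR p hp (not_lt.1 hlt)) hp0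
  · intro p hp hu
    have h1 : ContinuousAt (fun q => 1 + potentialOp hV hγ₀.le 𝒢₀ q) p :=
      continuousAt_const.add (h.analyticOnNhd_potentialOp hV hγ₀.le p hp).continuousAt
    filter_upwards [h1.eventually (Units.isOpen.mem_nhds hu), hopen.mem_nhds hp] with q hq hqU
    exact ⟨hq, h.analyticAt_potentialInv hV hγ₀.le hqU hq, isCompactOperator_inverse_sub_one
      ((isCompactOperator_mulOp_incl hγ hγ₀ hV).comp_clm (𝒢₀ q)) hq⟩
  · exact fun R => exists_analytic_expSolution hγ hopen Set.sdiff_subset hcorr R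
  · intro p hp
    exact isEigenfunction_expSolution hγ hν hV hγ₀.le hp.1 (h.restrict p hp.1)
      (hunit p ⟨hreal hp.1, hp.2⟩)
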